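/- **Setting.** Let $T\ge 2$, $p\ge 1$, $k\in\{1,\dots,p\}$. For units $i=1,2,\dots$ let $X_i=(X_{i1}',\dots,X_{iT}')'\in\mathbb R^{pT}$, $\alpha_i\in\mathbb R$, $\varepsilon_i\in\mathbb R^T$, and $$Y_{it}=\mathbf 1\{X_{it}'\beta_0+\alpha_i+\varepsilon_{it}\ge 0\},\qquad S_i=\sum_{t=1}^T Y_{it},$$ where $\varepsilon_{i1},\dots,\varepsilon_{iT}$ are i.i.d. logistic and $\varepsilon_i$ is independent of $(\alpha_i,X_i)$. Let $(X,S)$ be distributed as $(X_1,S_1)$. **Notation.** Put $C_j(x,\beta)=\sum_{d\in\{0,1\}^T,\,\sum_t d_t=j}\exp(\sum_t d_t x_t'\beta)$ and $\ell_c(y|x;\beta)=\sum_t y_tx_t'\beta-\ln C_{\sum_t y_t}(x,\beta)$. Let $\lambda_t(x,\beta)$ be the coefficient of $u^t$ in $u(1-u)\prod_{t=1}^{T-1}\big(u(e^{(x_t-x_T)'\beta}-1)+1\big)$, and $$r(x,s,\beta)=\beta_k\sum_{t=0}^s\binom{T-t}{s-t}\frac{\lambda_t(x,\beta)e^{s x_T'\beta}}{C_s(x,\beta)}.$$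 Let $\gamma_{0j}(x)=P(S=j|X=x)$, $c_t(x)=E\big[\mathbf 1\{S\ge t\}\binom{T-t}{S-t}e^{Sx_T'\beta_0}/C_S(x,\beta_0)\,\big|\,X=x\big]$, and $m(x)=(c_t(x)/c_0(x))_{0\le t\le T}$. For a vector $(m_0,\dots,m_t)$ let $\underline q_t$ and $\overline q_t$ be the infimum and supremum of $\int u^{t+1}d\mu$ over positive measures $\mu$ on $[0,1]$ with $\int u^s d\mu=m_s$, $0\le s\le t$. For $t\ge1$ let $\underline H_t(m)$ and $\overline H_t(m)$ be the determinants of $(m_{i+j-2})_{1\le i,j\le t/2+1}$ and $(m_{i+j-1}-m_{i+j})_{1\le i,j\le t/2}$ if $t$ is even, and of $(m_{i+j-1})_{1\le i,j\le(t+1)/2}$ and $(m_{i+j-2}-m_{i+j-1})_{1\le i,j\le (t+1)/2}$ if $t$ is odd. **Bounds.** For a number $c$ and a vector $m$, let $$\underline g(x,s,\beta,c,m)=r(x,s,\beta)+\beta_k\,c\,\lambda_{T+1}(x,\beta)\big[\underline q_T(m)\mathbf 1\{\beta_k\lambda_{T+1}(x,\beta)\ge0\}+\overline q_T(m)\mathbf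 1\{\beta_k\lambda_{T+1}(x,\beta)<0\}\big],$$ and let $\overline g$ be the same expression with $\underline q_T$ and $\overline q_T$ exchanged. The bounds are $$\underline\Delta=E[\underline g(X,S,\beta_0,c_0(X),m(X))],\qquad \overline\Delta=E[\overline g(X,S,\beta_0,c_0(X),m(X))].$$ **Estimators** (from the first $n$ units). 1. $\widehat\beta$ is any maximiser of $\beta\mapsto\sum_{i\le n}\ell_c(Y_i|X_i;\beta)$ over $\Theta$. 2. $\widehat\gamma_j(x)$ is the intercept $a_0$ of any minimiser over $a$ of $\sum_{i\le n}K\big(\tfrac{X_i-x}{h_n}\big)\big(\mathbf 1\{S_i=j\}-\sum_{|b|\le\ell}a_b(X_i-x)^b\big)^2$. 3. $\widehat c_t(x)=\sum_{j=t}^T\binom{T-t}{j-t}\widehat\gamma_j(x)e^{jx_T'\widehat\beta}/C_j(x,\widehat\beta)$ and $\widetilde m(x)=(1,\widehat c_1(x)/\widehat c_0(x),\dots,\widehat c_T(x)/\widehat c_0(x))$. 4. $\widehat I(x)=\max\{t\in\{1,\dots,T\}:\underline H_t(\widetilde m(x))\overline H_t(\widetilde m(x))>c_n\}$, with $\max\emptyset=0$.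 Set $\widehat m_t(x)=\widetilde m_t(x)$ for $t\le\widehat I(x)$. If $I=\widehat I(x)<T$, set $\widehat m_{I+1}(x)=\underline q_I(\widetilde m_0(x),\dots,\widetilde m_I(x))$ if $\underline H_{I+1}(\widetilde m(x))<c_n^{1/2}$ and $\widehat m_{I+1}(x)=\overline q_I(\widetilde m_0(x),\dots,\widetilde m_I(x))$ otherwise. Then define $\widehat m_{I+2}(x),\dots,\widehat m_T(x)$ successively as the only values compatible with the previous moments, $\widehat m_{t+1}(x)=\underline q_t(\widehat m_0(x),\dots,\widehat m_t(x))$. 5. $\widehat{\underline\Delta}=\frac1n\sum_{i\le n}\underline g(X_i,S_i,\widehat\beta,\widehat c_0(X_i),\widehat m(X_i))$ and $\widehat{\overline\Delta}=\frac1n\sum_{i\le n}\overline g(X_i,S_i,\widehat\beta,\widehat c_0(X_i),\widehat m(X_i))$. (Where a quantity above is undefined, because a denominator is $0$ or no measure has the given moments, it is set to $0$.) **Theorem.** Suppose that * the vectors $(X_i,\alpha_i,\varepsilon_i)$ are i.i.d.; $\mathrm{Supp}(X)$ is compact; $\Theta$ is compact and $\beta_0\in\Theta$; * $X$ has a density with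 respect to the Lebesgue measure on $\mathbb R^{pT}$ that is $C^1$ and bounded away from $0$ on $\mathrm{Supp}(X)$; * for an integer $\ell\ge0$, $\gamma_0=(\gamma_{00},\dots,\gamma_{0T})$ is $C^{\ell+2}$ on $\mathrm{Supp}(X)$ (for some version of the conditional probabilities), where $C^q$ on a closed set means being the restriction of a $C^q$ function on $\mathbb R^{pT}$; * $K$ is a Lipschitz probability density on $\mathbb R^{pT}$ with compact support, positive on a neighbourhood of $0$; * $h_n>0$, $h_n\to0$ and $nh_n^{pT}/\ln n\to\infty$; * $c_n>0$, $c_n\to0$ and $\big[(\ln n/(nh_n^{pT}))^{1/2}+h_n^{\ell+1}\big]/c_n\to0$. Then the expectations defining $\underline\Delta$ and $\overline\Delta$ exist (the variables are integrable) and $$(\widehat{\underline\Delta},\widehat{\overline\Delta})\stackrel{P}{\longrightarrow}(\underline\Delta,\overline\Delta)\quad\text{as }n\to\infty.$$ -/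

import Mathlib

open MeasureTheory ProbabilityTheory Filter Topology

noncomputable section

namespace FELogit

/-- Covariate paths `x = (x_1', …, x_T')'` in `ℝ^{pT}`; `x t k` is the `k`-th covariate in
period `t`. -/
abbrev Cov (T p : ℕ) : Type := Fin T → Fin p → ℝ

/-- The index of the last period `T`. -/
def lastPeriod (T : ℕ) [NeZero T] : Fin T := ⟨T - 1, Nat.sub_one_lt (NeZero.ne T)⟩

/-! ### The model -/

/-- `Y_t = 1{x_t'β + a + e_t ≥ 0}`. -/
def outcome {T p : ℕ} (β : Fin p → ℝ) (x : Cov T p) (a : ℝ) (e : Fin T → ℝ) (t : Fin T) : ℕ :=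
  open Classical in if 0 ≤ x t ⬝ᵥ β + a + e t then 1 else 0

/-- The fixed effects logit model for one unit: the shocks `ε_1, …, ε_T` are i.i.d. with the
logistic distribution and (jointly) independent of `(α, X)`. -/
structure IsModel {Ω : Type*} [MeasurableSpace Ω] (P : Measure Ω) {T p : ℕ}
    (X : Ω → Cov T p) (α : Ω → ℝ) (ε : Ω → Fin T → ℝ) : Prop where
  measurable_X : Measurable X
  measurable_α : Measurable α
  measurable_ε : Measurable ε
  iIndep_ε : iIndepFun (fun (t : Fin T) (ω : Ω) => ε ω t) P
  cdf_ε : ∀ (t : Fin T) (a : ℝ), P.real {ω | ε ω t ≤ a} = 1 / (1 + Real.exp (-a))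
  indep_ε : IndepFun ε (fun ω => (α ω, X ω)) P

/-- The variables `(X_i, α_i, ε_i)` are i.i.d. across `i`. -/
structure IsIIDSample {Ω : Type*} [MeasurableSpace Ω] (P : Measure Ω) {T p : ℕ}
    (X : ℕ → Ω → Cov T p) (α : ℕ → Ω → ℝ) (ε : ℕ → Ω → Fin T → ℝ) : Prop where
  iIndep : iIndepFun (fun (i : ℕ) (ω : Ω) => (X i ω, α i ω, ε i ω)) P
  identDistrib : ∀ i : ℕ,
    IdentDistrib (fun ω => (X i ω, α i ω, ε i ω)) (fun ω => (X 0 ω, α 0 ω, ε 0 ω)) P P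

/-! ### The conditional likelihood -/

/-- `C_k(x, β) = ∑_{d ∈ {0,1}^T, ∑ d_t = k} exp (∑_t d_t x_t'β)`. -/
def C {T p : ℕ} (k : ℕ) (x : Cov T p) (β : Fin p → ℝ) : ℝ :=
  ∑ d : Fin T → Fin 2 with ∑ t, (d t : ℕ) = k, Real.exp (∑ t, ((d t : ℕ) : ℝ) * (x t ⬝ᵥ β))

/-- The conditional log-likelihood `ℓ_c(y | x; β)`. -/
def condLogLik {T p : ℕ} (y : Fin T → ℕ) (x : Cov T p) (β : Fin p → ℝ) : ℝ :=
  ∑ t, (y t : ℝ) * (x t ⬝ᵥ β) - Real.log (C (∑ t, y t) x β)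

/-- `β` is a conditional maximum likelihood estimate over `Θ` from the first `n` observations. -/
def IsCMLE {T p : ℕ} (Θ : Set (Fin p → ℝ)) (n : ℕ) (x : ℕ → Cov T p) (y : ℕ → Fin T → ℕ)
    (β : Fin p → ℝ) : Prop :=
  β ∈ Θ ∧ IsMaxOn (fun b => ∑ i ∈ Finset.range n, condLogLik (y i) (x i) b) Θ β

/-! ### Moment spaces

A vector `(m_0, …, m_t)` is represented by a sequence `m : ℕ → ℝ`, of which only the entries
of index at most `t` are used. -/

/-- `𝒟(m_0, …, m_t)`: the (finite) positive measures on `[0,1]` with raw moments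
`m_0, …, m_t`. -/
def momentMeasures (t : ℕ) (m : ℕ → ℝ) : Set (Measure unitInterval) :=
  {μ | IsFiniteMeasure μ ∧ ∀ s ≤ t, ∫ u, (u : ℝ) ^ s ∂μ = m s}

/-- The smallest possible next moment, given `m_0, …, m_t`. -/
def qLower (t : ℕ) (m : ℕ → ℝ) : ℝ :=
  sInf ((fun μ : Measure unitInterval => ∫ u, (u : ℝ) ^ (t + 1) ∂μ) '' momentMeasures t m)

/-- The largest possible next moment, given `m_0, …, m_t`. -/
def qUpper (t : ℕ) (m : ℕ → ℝ) : ℝ :=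
  sSup ((fun μ : Measure unitInterval => ∫ u, (u : ℝ) ^ (t + 1) ∂μ) '' momentMeasures t m)

/-- The lower Hankel determinant of order `t ≥ 1` (rows and columns are indexed from `0`). -/
def hankelLower (t : ℕ) (m : ℕ → ℝ) : ℝ :=
  if Even t then
    (Matrix.of fun i j : Fin (t / 2 + 1) => m (i + j)).det
  else
    (Matrix.of fun i j : Fin ((t + 1) / 2) => m (i + j + 1)).det

/-- The upper Hankel determinant of order `t ≥ 1` (rows and columns are indexed from `0`). -/
def hankelUpper (t : ℕ) (m : ℕ → ℝ) : ℝ :=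
  if Even t then
    (Matrix.of fun i j : Fin (t / 2) => m (i + j + 1) - m (i + j + 2)).det
  else
    (Matrix.of fun i j : Fin ((t + 1) / 2) => m (i + j) - m (i + j + 1)).det

/-! ### The sharp bounds -/

/-- `λ_t(x, β)`, the coefficient of `u^t` in
`u (1 - u) ∏_{t < T} (u (exp ((x_t - x_T)'β) - 1) + 1)`. -/
def lam {T p : ℕ} [NeZero T] (t : ℕ) (x : Cov T p) (β : Fin p → ℝ) : ℝ :=
  (Polynomial.X * (1 - Polynomial.X) *
    ∏ s ∈ Finset.univ.erase (lastPeriod T),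
      (Polynomial.X * Polynomial.C (Real.exp ((x s - x (lastPeriod T)) ⬝ᵥ β) - 1) + 1)
    : Polynomial ℝ).coeff t

/-- `r(x, s, β) = β_k ∑_{t ≤ s} binom(T-t, s-t) λ_t(x, β) exp(s x_T'β) / C_s(x, β)`. -/
def r {T p : ℕ} [NeZero T] (k : Fin p) (x : Cov T p) (s : ℕ) (β : Fin p → ℝ) : ℝ :=
  β k * ∑ t ∈ Finset.range (s + 1), ((T - t).choose (s - t) : ℝ) *
    (lam t x β * Real.exp (s * (x (lastPeriod T) ⬝ᵥ β)) / C s x β)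

/-- `γ_{0j}(x) = P(S = j | X = x)`, where `Q` is the joint law of `(X, S)`. -/
def gamma0 {T p : ℕ} (Q : Measure (Cov T p × ℕ)) [IsFiniteMeasure Q] (j : ℕ) (x : Cov T p) : ℝ :=
  (Q.condKernel x).real {j}

/-- `c_t(x) = E[1{S ≥ t} binom(T-t, S-t) exp(S x_T'β) / C_S(x, β) | X = x]`, where `Q` is the
joint law of `(X, S)`. -/
def cFun {T p : ℕ} [NeZero T] (Q : Measure (Cov T p × ℕ)) [IsFiniteMeasure Q] (β : Fin p → ℝ)
    (t : ℕ) (x : Cov T p) : ℝ :=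
  ∫ s, (if t ≤ s then
    ((T - t).choose (s - t) : ℝ) * Real.exp (s * (x (lastPeriod T) ⬝ᵥ β)) / C s x β else 0)
    ∂(Q.condKernel x)

/-- `m_t(x) = c_t(x) / c_0(x)`. -/
def mFun {T p : ℕ} [NeZero T] (Q : Measure (Cov T p × ℕ)) [IsFiniteMeasure Q] (β : Fin p → ℝ)
    (x : Cov T p) (t : ℕ) : ℝ :=
  cFun Q β t x / cFun Q β 0 x

/-- The quantity averaged in the lower bound, as a function of `x`, `s`, `β`, the value `c` of
`c_0(x)` and the moment vector `m`. -/
def lowerTerm {T p : ℕ} [NeZero T] (k : Fin p) (x : Cov T p) (s : ℕ) (β : Fin p → ℝ)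
    (c : ℝ) (m : ℕ → ℝ) : ℝ :=
  open Classical in
  r k x s β + β k * c * lam (T + 1) x β *
    (if 0 ≤ β k * lam (T + 1) x β then qLower T m else qUpper T m)

/-- The quantity averaged in the upper bound. -/
def upperTerm {T p : ℕ} [NeZero T] (k : Fin p) (x : Cov T p) (s : ℕ) (β : Fin p → ℝ)
    (c : ℝ) (m : ℕ → ℝ) : ℝ :=
  open Classical in
  r k x s β + β k * c * lam (T + 1) x β *
    (if 0 ≤ β k * lam (T + 1) x β then qUpper T m else qLower T m)

/-- The sharp lower bound, where `Q` is the joint law of `(X, S)`. -/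
def lowerBound {T p : ℕ} [NeZero T] (k : Fin p) (Q : Measure (Cov T p × ℕ)) [IsFiniteMeasure Q]
    (β : Fin p → ℝ) : ℝ :=
  ∫ z, lowerTerm k z.1 z.2 β (cFun Q β 0 z.1) (mFun Q β z.1) ∂Q

/-- The sharp upper bound, where `Q` is the joint law of `(X, S)`. -/
def upperBound {T p : ℕ} [NeZero T] (k : Fin p) (Q : Measure (Cov T p × ℕ)) [IsFiniteMeasure Q]
    (β : Fin p → ℝ) : ℝ :=
  ∫ z, upperTerm k z.1 z.2 β (cFun Q β 0 z.1) (mFun Q β z.1) ∂Q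

/-! ### The local polynomial estimator -/

/-- Multi-indices `b ∈ ℕ^{pT}` with `|b| ≤ ℓ` (so each component is at most `ℓ`). -/
abbrev MultiIndex (T p ℓ : ℕ) : Type :=
  {b : Fin T → Fin p → Fin (ℓ + 1) // ∑ t, ∑ k, (b t k : ℕ) ≤ ℓ}

/-- The multi-index `0`. -/
def MultiIndex.zero (T p ℓ : ℕ) : MultiIndex T p ℓ := ⟨fun _ _ => 0, by simp⟩

/-- The monomial `x^b`. -/
def monomial {T p ℓ : ℕ} (x : Cov T p) (b : MultiIndex T p ℓ) : ℝ :=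
  ∏ t, ∏ k, x t k ^ (b.1 t k : ℕ)

/-- The local polynomial criterion at the point `x₀`, with kernel `K`, bandwidth `h` and sample
`(x_i, s_i)`, `i < n`, for the regression of `1{S = j}` on `X`. -/
def localCriterion {T p : ℕ} (K : Cov T p → ℝ) (h : ℝ) (ℓ n : ℕ) (x : ℕ → Cov T p) (s : ℕ → ℕ)
    (j : ℕ) (x₀ : Cov T p) (a : MultiIndex T p ℓ → ℝ) : ℝ :=
  ∑ i ∈ Finset.range n, K (h⁻¹ • (x i - x₀)) *
    ((if s i = j then 1 else 0) - ∑ b, a b * monomial (x i - x₀) b) ^ 2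

/-- `g` is a local polynomial estimate of order `ℓ` of `P(S = j | X = x₀)`: the intercept of a
minimiser of the local polynomial criterion. -/
def IsLocalPolyEstimate {T p : ℕ} (K : Cov T p → ℝ) (h : ℝ) (ℓ n : ℕ) (x : ℕ → Cov T p)
    (s : ℕ → ℕ) (j : ℕ) (x₀ : Cov T p) (g : ℝ) : Prop :=
  ∃ a : MultiIndex T p ℓ → ℝ,
    (∀ a' : MultiIndex T p ℓ → ℝ,
      localCriterion K h ℓ n x s j x₀ a ≤ localCriterion K h ℓ n x s j x₀ a') ∧
    g = a (MultiIndex.zero T p ℓ)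

/-! ### The estimators of `c`, of `m` and of the bounds -/

/-- `c_t(γ, x, β) = ∑_{j=t}^T binom(T-t, j-t) γ_j(x) exp(j x_T'β) / C_j(x, β)`. -/
def cPlug {T p : ℕ} [NeZero T] (γ : ℕ → Cov T p → ℝ) (β : Fin p → ℝ) (t : ℕ) (x : Cov T p) : ℝ :=
  ∑ j ∈ Finset.Icc t T, ((T - t).choose (j - t) : ℝ) *
    (γ j x * Real.exp (j * (x (lastPeriod T) ⬝ᵥ β)) / C j x β)

/-- The unconstrained estimate `(1, ĉ_1/ĉ_0, …, ĉ_T/ĉ_0)`. -/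
def mTilde {T p : ℕ} [NeZero T] (γ : ℕ → Cov T p → ℝ) (β : Fin p → ℝ) (x : Cov T p) (t : ℕ) : ℝ :=
  if t = 0 then 1 else cPlug γ β t x / cPlug γ β 0 x

/-- The largest `t ∈ {1, …, T}` at which the product of the two Hankel determinants exceeds `c`,
and `0` if there is none. -/
def iHat (T : ℕ) (c : ℝ) (m : ℕ → ℝ) : ℕ :=
  open Classical in
  ((Finset.Icc 1 T).filter fun t => c < hankelLower t m * hankelUpper t m).sup id

/-- Starting from `(m_0, …, m_s)` on the boundary of the moment space, append `j` further
moments; each of them is the only one compatible with the previous ones, so that it is the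
value of `qLower` (and of `qUpper`) there. -/
def complete (s : ℕ) (m : ℕ → ℝ) : ℕ → (ℕ → ℝ)
  | 0 => m
  | j + 1 => Function.update (complete s m j) (s + j + 1) (qLower (s + j) (complete s m j))

/-- The corrected moment vector obtained from `m` with threshold `c`. -/
def correct (T : ℕ) (c : ℝ) (m : ℕ → ℝ) : ℕ → ℝ :=
  open Classical in
  if iHat T c m = T then m
  else
    complete (iHat T c m + 1)
      (Function.update m (iHat T c m + 1)
        (if hankelLower (iHat T c m + 1) m < √c then qLower (iHat T c m) m
          else qUpper (iHat T c m) m))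
      (T - (iHat T c m + 1))

/-- The estimator `m̂(x)`. -/
def mHat {T p : ℕ} [NeZero T] (c : ℝ) (γ : ℕ → Cov T p → ℝ) (β : Fin p → ℝ) (x : Cov T p) :
    ℕ → ℝ :=
  correct T c (mTilde γ β x)

/-- The estimator of the lower bound from the sample `(x_i, s_i)`, `i < n`. -/
def lowerEst {T p : ℕ} [NeZero T] (k : Fin p) (n : ℕ) (x : ℕ → Cov T p) (s : ℕ → ℕ) (c : ℝ)
    (γ : ℕ → Cov T p → ℝ) (β : Fin p → ℝ) : ℝ :=
  (n : ℝ)⁻¹ * ∑ i ∈ Finset.range n,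
    lowerTerm k (x i) (s i) β (cPlug γ β 0 (x i)) (mHat c γ β (x i))

/-- The estimator of the upper bound from the sample `(x_i, s_i)`, `i < n`. -/
def upperEst {T p : ℕ} [NeZero T] (k : Fin p) (n : ℕ) (x : ℕ → Cov T p) (s : ℕ → ℕ) (c : ℝ)
    (γ : ℕ → Cov T p → ℝ) (β : Fin p → ℝ) : ℝ :=
  (n : ℝ)⁻¹ * ∑ i ∈ Finset.range n,
    upperTerm k (x i) (s i) β (cPlug γ β 0 (x i)) (mHat c γ β (x i))

/-! ### Regularity conditions -/

/-- The law `ν` has a density with respect to Lebesgue measure which is `C^1` and bounded away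
from `0` on the support of `ν`. A function is `C^k` on a closed set if it agrees there with a
`C^k` function on the whole space. -/
def HasRegularDensity {T p : ℕ} (ν : Measure (Cov T p)) : Prop :=
  ∃ f : Cov T p → ℝ, ContDiff ℝ 1 f ∧ (∃ b > 0, ∀ x ∈ ν.support, b ≤ f x) ∧
    ν = volume.withDensity (fun x => ENNReal.ofReal (ν.support.indicator f x))

/-- `γ_0` is `C^k` on the support of `X` (conditional probabilities being defined almost
everywhere, this means that they have a version with this property). -/
def HasSmoothGamma {T p : ℕ} (Q : Measure (Cov T p × ℕ)) [IsFiniteMeasure Q] (k : ℕ) : Prop :=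
  ∀ j ≤ T, ∃ g : Cov T p → ℝ, ContDiff ℝ k g ∧ ∀ᵐ x ∂Q.fst, gamma0 Q j x = g x

/-- `K` is a Lipschitz probability density with compact support, positive around `0`. -/
structure IsKernel {T p : ℕ} (K : Cov T p → ℝ) : Prop where
  lipschitz : ∃ L, LipschitzWith L K
  nonneg : ∀ u, 0 ≤ K u
  integral_eq_one : ∫ u, K u = 1
  hasCompactSupport : HasCompactSupport K
  pos_near_zero : ∀ᶠ u in 𝓝 0, 0 < K u

/-- `(ln n / (n h^{pT}))^{1/2} + h^{ℓ+1}`. -/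
def rate (T p ℓ n : ℕ) (h : ℝ) : ℝ :=
  √(Real.log n / (n * h ^ (p * T))) + h ^ (ℓ + 1)

end FELogit

end

open FELogit

/-! Given `X = x`, let u = e^v / (1 + e^v) with v = x_T'β₀ + α. Averaging the weights that define
`c_t(x)` over the law of `S` given (x, α) yields u^t W, where W does not depend on t
(`sum_sumProb_wgt`). So `c_t(x) / c_0(x)` is the t-th moment of u under a tilted law of α, and m(x)
is the moment vector of a probability measure on [0,1] (`isMom_of_mixture`). The bounds are averages
of functions of β₀, γ₀(x) and the extremal next moments of m(x). The latter are delicate at the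
boundary of the moment space, where a perturbed vector need not be a moment vector at all.

The deterministic core is `correct_uniform`. If a Hankel determinant of order t vanishes, the
measure is carried by the roots of a polynomial and its first t moments determine all the others. If
neither vanishes, the vector is interior (`mem_interior_momSet`), and the extremal next moments are
Lipschitz nearby (`q_close`). Consider vectors whose determinants are zero or at least η (`Strat T
η`), known up to an error o(c). A vanishing determinant is then estimated by o(c), while a
nonvanishing one stays away from zero. The threshold c therefore recovers the last interior order,
and √c recovers which determinant vanishes at the next order. Weak compactness of the probability
measures on [0,1], used along an ultrafilter, makes this uniform over the stratum. The strata
exhaust the moment space, so m(X) misses `Strat T η` with small probability when η is small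
(`exists_strat_measure_le`).

On the statistical side the errors must be at most δ c_n. For the conditional likelihood this
follows from a quantitative strict concavity inequality and a centred score
(`IsModel.exists_beta_bad`). For γ̂ no uniformity in x is needed, since only the values at the
sample points enter. At each X_i the error is at most δ c_n outside an event whose probability tends
to zero uniformly in i (`IsIID.exists_gamma_bad`). Chebyshev's inequality suffices for this, and
Lebesgue differentiation deals with the edge of the support.

By Markov's inequality only a small fraction of the indices is bad. Their contribution is bounded by
Cauchy–Schwarz, because the local polynomial intercepts at the sample points are bounded in
quadratic mean for every sample, degenerate designs included (`exists_sum_sq_localPoly_le`). This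
rests on the fact that leverages sum to at most the dimension of the space of polynomials.
`IsIID.tendsto_average` joins these facts to a law of large numbers. -/

noncomputable section
namespace FELogit

/-! ### Moments of measures on the unit interval -/

/-- The raw moments of a measure on `[0,1]`. -/
def mom (μ : Measure unitInterval) (s : ℕ) : ℝ := ∫ u, (u : ℝ) ^ s ∂μ

/-- `(m_0, …, m_t)` is the beginning of the moment sequence of a probability measure. -/
def IsMom (t : ℕ) (m : ℕ → ℝ) : Prop :=
  ∃ μ : Measure unitInterval, IsProbabilityMeasure μ ∧ ∀ s ≤ t, mom μ s = m s

/-- The Riesz functional of a sequence. -/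
def momEval (m : ℕ → ℝ) (q : Polynomial ℝ) : ℝ := q.sum fun i a => a * m i

lemma momEval_eq_sum {m : ℕ → ℝ} {q : Polynomial ℝ} {t : ℕ} (h : q.natDegree ≤ t) :
    momEval m q = ∑ i ∈ Finset.range (t + 1), q.coeff i * m i := by
  unfold momEval
  exact Polynomial.sum_over_range' q (by simp) (t + 1) (by omega)

lemma momEval_congr {m m' : ℕ → ℝ} {q : Polynomial ℝ} {t : ℕ} (h : q.natDegree ≤ t)
    (hm : ∀ s ≤ t, m s = m' s) : momEval m q = momEval m' q := by
  rw [momEval_eq_sum h, momEval_eq_sum h]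
  refine Finset.sum_congr rfl fun i hi => ?_
  rw [hm i (by simpa [Nat.lt_succ_iff] using hi)]

lemma integrable_continuous_unitInterval (μ : Measure unitInterval) [IsFiniteMeasure μ]
    {f : unitInterval → ℝ} (hf : Continuous f) : Integrable f μ := by
  obtain ⟨C, hC⟩ := (isCompact_range hf).isBounded.exists_norm_le
  exact Integrable.of_bound hf.aestronglyMeasurable C (ae_of_all _ fun u => hC _ ⟨u, rfl⟩)

lemma continuous_eval_unitInterval (q : Polynomial ℝ) :
    Continuous fun u : unitInterval => q.eval (u : ℝ) :=
  q.continuous.comp continuous_subtype_val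

lemma integrable_eval_unitInterval (μ : Measure unitInterval) [IsFiniteMeasure μ]
    (q : Polynomial ℝ) : Integrable (fun u : unitInterval => q.eval (u : ℝ)) μ :=
  integrable_continuous_unitInterval μ (continuous_eval_unitInterval q)

lemma momEval_mom (μ : Measure unitInterval) [IsFiniteMeasure μ] (q : Polynomial ℝ) :
    momEval (mom μ) q = ∫ u, q.eval (u : ℝ) ∂μ := by
  rw [momEval_eq_sum le_rfl]
  simp_rw [Polynomial.eval_eq_sum_range, mom]
  rw [integral_finsetSum]
  · simp_rw [integral_const_mul]
  · intro i _
    exact integrable_continuous_unitInterval μ (by fun_prop)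

lemma mom_nonneg (μ : Measure unitInterval) (s : ℕ) : 0 ≤ mom μ s :=
  integral_nonneg fun u => pow_nonneg u.2.1 s

lemma mom_zero (μ : Measure unitInterval) [IsProbabilityMeasure μ] : mom μ 0 = 1 := by
  simp [mom]

lemma mom_le_one (μ : Measure unitInterval) [IsProbabilityMeasure μ] (s : ℕ) : mom μ s ≤ 1 := by
  calc mom μ s ≤ ∫ _, (1 : ℝ) ∂μ :=
        integral_mono (integrable_continuous_unitInterval μ (by fun_prop)) (integrable_const _)
          fun u => pow_le_one₀ u.2.1 u.2.2
    _ = 1 := by simp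

lemma isMom_mom (t : ℕ) (μ : Measure unitInterval) [h : IsProbabilityMeasure μ] :
    IsMom t (mom μ) := ⟨μ, h, fun _ _ => rfl⟩

lemma IsMom.congr {t : ℕ} {m m' : ℕ → ℝ} (h : IsMom t m) (hm : ∀ s ≤ t, m s = m' s) :
    IsMom t m' := by
  obtain ⟨μ, hμ, h⟩ := h
  exact ⟨μ, hμ, fun s hs => (h s hs).trans (hm s hs)⟩

/-- Probability measures on `[0,1]` converge, moment by moment, along an ultrafilter. -/
lemma exists_tendsto_mom {ι : Type*} (U : Ultrafilter ι) (μ : ι → Measure unitInterval)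
    (hμ : ∀ i, IsProbabilityMeasure (μ i)) :
    ∃ ν : Measure unitInterval, IsProbabilityMeasure ν ∧
      ∀ s, Tendsto (fun i => mom (μ i) s) U (𝓝 (mom ν s)) := by
  let f : ι → ProbabilityMeasure unitInterval := fun i => ⟨μ i, hμ i⟩
  -- The probability measures on the compact interval form a weakly compact space, and moments are
  -- integrals of bounded continuous functions.
  obtain ⟨ν, -, hν⟩ := isCompact_univ.ultrafilter_le_nhds (U.map f) (by simp)
  refine ⟨ν, inferInstance, fun s => ?_⟩
  have h1 : Tendsto f U (𝓝 ν) := hν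
  rw [ProbabilityMeasure.tendsto_iff_forall_integral_tendsto] at h1
  exact h1 (BoundedContinuousFunction.mkOfCompact ⟨fun u : unitInterval => (u : ℝ) ^ s, by fun_prop⟩)

/-! ### Extremal next moments -/

lemma momentMeasures_congr {t : ℕ} {m m' : ℕ → ℝ} (hm : ∀ s ≤ t, m s = m' s) :
    momentMeasures t m = momentMeasures t m' := by
  ext μ
  simp only [momentMeasures, Set.mem_ofPred_eq]
  exact and_congr_right fun _ => forall₂_congr fun s hs => by rw [hm s hs]

lemma qLower_congr {t : ℕ} {m m' : ℕ → ℝ} (hm : ∀ s ≤ t, m s = m' s) :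
    qLower t m = qLower t m' := by rw [qLower, qLower, momentMeasures_congr hm]

lemma qUpper_congr {t : ℕ} {m m' : ℕ → ℝ} (hm : ∀ s ≤ t, m s = m' s) :
    qUpper t m = qUpper t m' := by rw [qUpper, qUpper, momentMeasures_congr hm]

lemma mem_momentMeasures_iff {t : ℕ} {m : ℕ → ℝ} (h0 : m 0 = 1) {μ : Measure unitInterval} :
    μ ∈ momentMeasures t m ↔ IsProbabilityMeasure μ ∧ ∀ s ≤ t, mom μ s = m s := by
  refine ⟨fun h => ?_, fun h => ?_⟩
  · obtain ⟨hf, h⟩ := h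
    refine ⟨⟨?_⟩, h⟩
    have := h 0 (Nat.zero_le _)
    simp only [pow_zero, integral_const, smul_eq_mul, mul_one, h0] at this
    rw [measureReal_def, ENNReal.toReal_eq_one_iff] at this
    exact this
  · obtain ⟨hp, h⟩ := h
    exact ⟨inferInstance, h⟩

lemma bddBelow_next (t : ℕ) (m : ℕ → ℝ) :
    BddBelow ((fun μ : Measure unitInterval => ∫ u, (u : ℝ) ^ (t + 1) ∂μ) ''
      momentMeasures t m) :=
  ⟨0, by rintro _ ⟨μ, -, rfl⟩; exact mom_nonneg μ (t + 1)⟩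

lemma bddAbove_next (t : ℕ) {m : ℕ → ℝ} (h0 : m 0 = 1) :
    BddAbove ((fun μ : Measure unitInterval => ∫ u, (u : ℝ) ^ (t + 1) ∂μ) ''
      momentMeasures t m) :=
  ⟨1, by
    rintro _ ⟨μ, hμ, rfl⟩
    have := ((mem_momentMeasures_iff h0).1 hμ).1
    exact mom_le_one μ (t + 1)⟩

/-- No representing measure is assumed: when there is none, the infimum is that of the empty set,
which is 0. The crude bounds on the estimated terms therefore hold whatever vector is plugged in. -/
lemma qLower_mem_Icc (t : ℕ) {m : ℕ → ℝ} (h0 : m 0 = 1) : qLower t m ∈ Set.Icc (0 : ℝ) 1 := by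
  refine ⟨Real.sInf_nonneg ?_, ?_⟩
  · rintro _ ⟨μ, -, rfl⟩; exact mom_nonneg μ (t + 1)
  · rcases (momentMeasures t m).eq_empty_or_nonempty with h | ⟨μ, hμ⟩
    · simp [qLower, h]
    · have := ((mem_momentMeasures_iff h0).1 hμ).1
      exact (csInf_le (bddBelow_next t m) ⟨μ, hμ, rfl⟩).trans (mom_le_one μ (t + 1))

lemma qUpper_mem_Icc (t : ℕ) {m : ℕ → ℝ} (h0 : m 0 = 1) : qUpper t m ∈ Set.Icc (0 : ℝ) 1 := by
  refine ⟨Real.sSup_nonneg ?_, Real.sSup_le ?_ zero_le_one⟩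
  · rintro _ ⟨μ, -, rfl⟩; exact mom_nonneg μ (t + 1)
  · rintro _ ⟨μ, hμ, rfl⟩
    have := ((mem_momentMeasures_iff h0).1 hμ).1
    exact mom_le_one μ (t + 1)

lemma qLower_le_mom (t : ℕ) {m : ℕ → ℝ} (h0 : m 0 = 1) {μ : Measure unitInterval}
    [h : IsProbabilityMeasure μ] (hμ : ∀ s ≤ t, mom μ s = m s) : qLower t m ≤ mom μ (t + 1) :=
  csInf_le (bddBelow_next t m) ⟨μ, (mem_momentMeasures_iff h0).2 ⟨h, hμ⟩, rfl⟩

lemma mom_le_qUpper (t : ℕ) {m : ℕ → ℝ} (h0 : m 0 = 1) {μ : Measure unitInterval}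
    [h : IsProbabilityMeasure μ] (hμ : ∀ s ≤ t, mom μ s = m s) : mom μ (t + 1) ≤ qUpper t m :=
  le_csSup (bddAbove_next t h0) ⟨μ, (mem_momentMeasures_iff h0).2 ⟨h, hμ⟩, rfl⟩

/-- A limit of approximate representing measures is representing. -/
lemma exists_measure_of_approx {t : ℕ} {m : ℕ → ℝ} {y : ℝ}
    (h : ∀ n : ℕ, ∃ μ : Measure unitInterval, IsProbabilityMeasure μ ∧ (∀ s ≤ t, mom μ s = m s) ∧
      |mom μ (t + 1) - y| ≤ 1 / ((n : ℝ) + 1)) :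
    ∃ μ : Measure unitInterval, IsProbabilityMeasure μ ∧ (∀ s ≤ t, mom μ s = m s) ∧
      mom μ (t + 1) = y := by
  choose μ hp hm hy using h
  obtain ⟨ν, hν, hlim⟩ := exists_tendsto_mom (hyperfilter ℕ) μ hp
  refine ⟨ν, hν, fun s hs => ?_, ?_⟩
  · refine tendsto_nhds_unique (hlim s) ?_
    simp_rw [fun n => hm n s hs]
    exact tendsto_const_nhds
  · refine tendsto_nhds_unique (hlim (t + 1)) ?_
    rw [tendsto_iff_dist_tendsto_zero]
    refine squeeze_zero (fun _ => dist_nonneg) (fun n => ?_)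
      ((tendsto_one_div_add_atTop_nhds_zero_nat (𝕜 := ℝ)).mono_left Nat.hyperfilter_le_atTop)
    rw [Real.dist_eq]
    exact hy n

lemma IsMom.zero_eq_one {t : ℕ} {m : ℕ → ℝ} (h : IsMom t m) : m 0 = 1 := by
  obtain ⟨μ, hμ, h⟩ := h
  rw [← h 0 (Nat.zero_le _), mom_zero]

/-- The infimum is attained, by weak compactness applied to near-minimisers. -/
lemma IsMom.exists_qLower {t : ℕ} {m : ℕ → ℝ} (h : IsMom t m) :
    ∃ μ : Measure unitInterval, IsProbabilityMeasure μ ∧ (∀ s ≤ t, mom μ s = m s) ∧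
      mom μ (t + 1) = qLower t m := by
  have h0 := h.zero_eq_one
  obtain ⟨μ, hμ, hm⟩ := h
  refine exists_measure_of_approx fun n => ?_
  obtain ⟨_, ⟨ν, hν, rfl⟩, hlt⟩ := Real.lt_sInf_add_pos
    (s := (fun μ : Measure unitInterval => ∫ u, (u : ℝ) ^ (t + 1) ∂μ) '' momentMeasures t m)
    ⟨_, μ, (mem_momentMeasures_iff h0).2 ⟨hμ, hm⟩, rfl⟩
    (ε := 1 / ((n : ℝ) + 1)) (by positivity)
  obtain ⟨hp, hν⟩ := (mem_momentMeasures_iff h0).1 hν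
  refine ⟨ν, hp, hν, ?_⟩
  have h1 := qLower_le_mom t h0 hν
  rw [abs_of_nonneg (sub_nonneg.2 h1)]
  change mom ν (t + 1) < qLower t m + _ at hlt
  linarith

lemma IsMom.exists_qUpper {t : ℕ} {m : ℕ → ℝ} (h : IsMom t m) :
    ∃ μ : Measure unitInterval, IsProbabilityMeasure μ ∧ (∀ s ≤ t, mom μ s = m s) ∧
      mom μ (t + 1) = qUpper t m := by
  have h0 := h.zero_eq_one
  obtain ⟨μ, hμ, hm⟩ := h
  refine exists_measure_of_approx fun n => ?_
  obtain ⟨_, ⟨ν, hν, rfl⟩, hlt⟩ := Real.add_neg_lt_sSup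
    (s := (fun μ : Measure unitInterval => ∫ u, (u : ℝ) ^ (t + 1) ∂μ) '' momentMeasures t m)
    ⟨_, μ, (mem_momentMeasures_iff h0).2 ⟨hμ, hm⟩, rfl⟩
    (ε := -(1 / ((n : ℝ) + 1))) (neg_lt_zero.2 (by positivity))
  obtain ⟨hp, hν⟩ := (mem_momentMeasures_iff h0).1 hν
  refine ⟨ν, hp, hν, ?_⟩
  have h1 := mom_le_qUpper t h0 hν
  rw [abs_of_nonpos (sub_nonpos.2 h1)]
  change qUpper t m + _ < mom ν (t + 1) at hlt
  linarith

/-! ### Hankel determinants -/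

/-- The Hankel determinant of size `n` localised by the polynomial `w`. -/
def hankelDet (w : Polynomial ℝ) (n : ℕ) (m : ℕ → ℝ) : ℝ :=
  (Matrix.of fun i j : Fin n => momEval m (w * Polynomial.X ^ ((i : ℕ) + j))).det

open Polynomial in
lemma momEval_X_pow (m : ℕ → ℝ) (n : ℕ) : momEval m (X ^ n) = m n := by
  rw [momEval_eq_sum (t := n) (natDegree_X_pow_le n)]
  simp [coeff_X_pow]

lemma momEval_sub (m : ℕ → ℝ) (q q' : Polynomial ℝ) :
    momEval m (q - q') = momEval m q - momEval m q' := by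
  have h1 := momEval_eq_sum (m := m) (Polynomial.natDegree_sub_le q q')
  rw [h1, momEval_eq_sum (le_max_left q.natDegree q'.natDegree),
    momEval_eq_sum (le_max_right q.natDegree q'.natDegree), ← Finset.sum_sub_distrib]
  simp [sub_mul]

lemma det_of_congr {n n' : ℕ} (hn : n = n') (f g : ℕ → ℕ → ℝ) (h : ∀ i j, f i j = g i j) :
    (Matrix.of fun i j : Fin n => f i j).det = (Matrix.of fun i j : Fin n' => g i j).det := by
  subst hn
  rw [show f = g from funext fun i => funext fun j => h i j]

/-- The weight of the lower Hankel determinant. -/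
def wLower (t : ℕ) : Polynomial ℝ := if Even t then 1 else Polynomial.X
/-- The weight of the upper Hankel determinant. -/
def wUpper (t : ℕ) : Polynomial ℝ :=
  if Even t then Polynomial.X - Polynomial.X ^ 2 else 1 - Polynomial.X
/-- The size of the upper Hankel determinant. -/
def sUpper (t : ℕ) : ℕ := if Even t then t / 2 else (t + 1) / 2
/-- The size of the lower Hankel determinant. -/
def sLower (t : ℕ) : ℕ := if Even t then t / 2 + 1 else (t + 1) / 2

open Polynomial in
-- All Hankel matrices here are of the form L(w X^(i+j)), with L the Riesz functional and w one of
-- 1, X, X - X², 1 - X, each nonnegative on [0,1]. This allows a single treatment of both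
-- determinants and both parities.
lemma hankelLower_eq (t : ℕ) (m : ℕ → ℝ) :
    hankelLower t m = hankelDet (wLower t) (sLower t) m := by
  unfold hankelLower hankelDet
  by_cases h : Even t
  · simp only [h, if_true]
    refine det_of_congr (by simp [sLower, h]) (fun i j => m (i + j))
      (fun i j => momEval m (wLower t * X ^ (i + j))) fun i j => ?_
    simp only [wLower, h, if_true]
    rw [one_mul, momEval_X_pow]
  · simp only [h, if_false]
    refine det_of_congr (by simp [sLower, h]) (fun i j => m (i + j + 1))
      (fun i j => momEval m (wLower t * X ^ (i + j))) fun i j => ?_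
    simp only [wLower, h, if_false]
    rw [← pow_succ', momEval_X_pow]

open Polynomial in
lemma hankelUpper_eq (t : ℕ) (m : ℕ → ℝ) :
    hankelUpper t m = hankelDet (wUpper t) (sUpper t) m := by
  unfold hankelUpper hankelDet
  by_cases h : Even t
  · simp only [h, if_true]
    refine det_of_congr (by simp [sUpper, h]) (fun i j => m (i + j + 1) - m (i + j + 2))
      (fun i j => momEval m (wUpper t * X ^ (i + j))) fun i j => ?_
    simp only [wUpper, h, if_true]
    rw [sub_mul, ← pow_succ', ← pow_add, momEval_sub, momEval_X_pow, momEval_X_pow, add_comm 2]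
  · simp only [h, if_false]
    refine det_of_congr (by simp [sUpper, h]) (fun i j => m (i + j) - m (i + j + 1))
      (fun i j => momEval m (wUpper t * X ^ (i + j))) fun i j => ?_
    simp only [wUpper, h, if_false]
    rw [sub_mul, one_mul, ← pow_succ', momEval_sub, momEval_X_pow, momEval_X_pow]

/-- `w` is a localising polynomial for Hankel determinants of size `n` and order `t`. -/
structure IsWeight (w : Polynomial ℝ) (n t : ℕ) : Prop where
  ne_zero : w ≠ 0
  nonneg : ∀ u : unitInterval, 0 ≤ w.eval (u : ℝ)
  size_pos : 0 < n
  -- For `P` of degree at most `n - 1`, the integral of `w * P ^ 2` is thus a combination of moments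
  -- up to order `t`. The product `w * P`, whose roots carry the measure in the degenerate case,
  -- also has degree at most `t`.
  degree : w.natDegree + 2 * (n - 1) = t
  degree_le : w.natDegree + (n - 1) ≤ t

open Polynomial in
lemma natDegree_X_sub_X_sq : (X - X ^ 2 : ℝ[X]).natDegree = 2 := by
  compute_degree!

open Polynomial in
lemma natDegree_one_sub_X : (1 - X : ℝ[X]).natDegree = 1 := by
  compute_degree!

open Polynomial in
lemma isWeight_lower {t : ℕ} (ht : 1 ≤ t) : IsWeight (wLower t) (sLower t) t := by
  unfold wLower sLower
  split_ifs with h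
  · obtain ⟨r, rfl⟩ := h
    exact ⟨one_ne_zero, fun u => by simp, by omega, by simp; omega, by simp; omega⟩
  · rw [Nat.not_even_iff_odd] at h
    obtain ⟨r, rfl⟩ := h
    exact ⟨X_ne_zero, fun u => by simpa using u.2.1, by omega, by simp; omega, by simp; omega⟩

open Polynomial in
lemma isWeight_upper {t : ℕ} (ht : 1 ≤ t) : IsWeight (wUpper t) (sUpper t) t := by
  unfold wUpper sUpper
  split_ifs with h
  · obtain ⟨r, rfl⟩ := h
    refine ⟨fun h0 => ?_, fun u => ?_, by omega, ?_, ?_⟩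
    · have := natDegree_X_sub_X_sq; simp [h0] at this
    · have := u.2.1; have := u.2.2; simp; nlinarith
    · rw [natDegree_X_sub_X_sq]; omega
    · rw [natDegree_X_sub_X_sq]; omega
  · rw [Nat.not_even_iff_odd] at h
    obtain ⟨r, rfl⟩ := h
    refine ⟨fun h0 => ?_, fun u => ?_, by omega, ?_, ?_⟩
    · have := natDegree_one_sub_X; simp [h0] at this
    · have := u.2.2; simp; linarith
    · rw [natDegree_one_sub_X]; omega
    · rw [natDegree_one_sub_X]; omega

open Polynomial in
/-- The polynomial with prescribed coefficients. -/
def polyOf {n : ℕ} (v : Fin n → ℝ) : ℝ[X] := ∑ i : Fin n, Polynomial.C (v i) * X ^ (i : ℕ)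

lemma polyOf_coeff {n : ℕ} (v : Fin n → ℝ) (i : Fin n) : (polyOf v).coeff i = v i := by
  simp [polyOf, Polynomial.finsetSum_coeff, Polynomial.coeff_X_pow, Fin.val_inj]

lemma natDegree_polyOf_le {n : ℕ} (v : Fin n → ℝ) : (polyOf v).natDegree ≤ n - 1 := by
  refine Polynomial.natDegree_sum_le_of_forall_le _ _ fun i _ => ?_
  refine (Polynomial.natDegree_C_mul_X_pow_le _ _).trans ?_
  omega

lemma exists_polyOf {n : ℕ} (P : Polynomial ℝ) (hn : 0 < n) (h : P.natDegree ≤ n - 1) :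
    P = polyOf fun i : Fin n => P.coeff i := by
  conv_lhs => rw [P.as_sum_range_C_mul_X_pow' (n := n) (by omega)]
  rw [polyOf, Finset.sum_range]

lemma polyOf_eval {n : ℕ} (v : Fin n → ℝ) (x : ℝ) :
    (polyOf v).eval x = ∑ i : Fin n, v i * x ^ (i : ℕ) := by
  simp [polyOf, Polynomial.eval_finsetSum]

lemma hankel_entry (w : Polynomial ℝ) (μ : Measure unitInterval) [IsFiniteMeasure μ] (a : ℕ) :
    momEval (mom μ) (w * Polynomial.X ^ a) = ∫ u, w.eval (u : ℝ) * (u : ℝ) ^ a ∂μ := by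
  rw [momEval_mom]; simp

lemma hankel_mulVec (w : Polynomial ℝ) {n : ℕ} (μ : Measure unitInterval) [IsFiniteMeasure μ]
    (v : Fin n → ℝ) (i : Fin n) :
    (Matrix.of fun i j : Fin n => momEval (mom μ) (w * Polynomial.X ^ ((i : ℕ) + j))).mulVec v i =
      ∫ u, w.eval (u : ℝ) * (polyOf v).eval (u : ℝ) * (u : ℝ) ^ (i : ℕ) ∂μ := by
  simp only [Matrix.mulVec, dotProduct, Matrix.of_apply, hankel_entry, polyOf_eval]
  simp_rw [← integral_mul_const]
  rw [← integral_finsetSum]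
  · congr 1; ext u
    rw [Finset.mul_sum, Finset.sum_mul]
    exact Finset.sum_congr rfl fun j _ => by ring
  · intro j _
    have := continuous_eval_unitInterval w
    exact integrable_continuous_unitInterval μ (by fun_prop)

/-- This identity makes the Hankel matrices of a measure positive semidefinite, and identifies their
kernel vectors with the polynomials `P` for which `w * P` vanishes almost everywhere. -/
lemma hankel_quadForm (w : Polynomial ℝ) {n : ℕ} (μ : Measure unitInterval) [IsFiniteMeasure μ]
    (v : Fin n → ℝ) :
    v ⬝ᵥ (Matrix.of fun i j : Fin n =>
      momEval (mom μ) (w * Polynomial.X ^ ((i : ℕ) + j))).mulVec v =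
      ∫ u, (w * polyOf v ^ 2).eval (u : ℝ) ∂μ := by
  simp only [dotProduct, hankel_mulVec]
  simp_rw [← integral_const_mul]
  rw [← integral_finsetSum]
  · congr 1; ext u
    simp only [Polynomial.eval_mul, polyOf_eval, sq, Finset.mul_sum,
      Finset.sum_mul]
    rw [Finset.sum_comm]
    refine Finset.sum_congr rfl fun i _ => Finset.sum_congr rfl fun j _ => by ring
  · intro j _
    have := continuous_eval_unitInterval w
    have := continuous_eval_unitInterval (polyOf v)
    exact integrable_continuous_unitInterval μ (by fun_prop)

lemma hankel_posSemidef {w : Polynomial ℝ} (hw : ∀ u : unitInterval, 0 ≤ w.eval (u : ℝ)) (n : ℕ)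
    (μ : Measure unitInterval) [IsFiniteMeasure μ] :
    (Matrix.of fun i j : Fin n =>
      momEval (mom μ) (w * Polynomial.X ^ ((i : ℕ) + j))).PosSemidef := by
  refine Matrix.PosSemidef.of_dotProduct_mulVec_nonneg ?_ fun v => ?_
  · ext i j; simp [add_comm]
  · rw [star_trivial, hankel_quadForm]
    refine integral_nonneg fun u => ?_
    simp only [Polynomial.eval_mul, Polynomial.eval_pow]
    exact mul_nonneg (hw u) (sq_nonneg _)

lemma hankelDet_nonneg {w : Polynomial ℝ} (hw : ∀ u : unitInterval, 0 ≤ w.eval (u : ℝ)) (n : ℕ)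
    (μ : Measure unitInterval) [IsFiniteMeasure μ] : 0 ≤ hankelDet w n (mom μ) :=
  (hankel_posSemidef hw n μ).det_nonneg

lemma exists_of_hankelDet_eq_zero {w : Polynomial ℝ} {n : ℕ}
    {μ : Measure unitInterval} [IsFiniteMeasure μ] (h : hankelDet w n (mom μ) = 0) :
    ∃ P : Polynomial ℝ, P ≠ 0 ∧ P.natDegree ≤ n - 1 ∧
      ∫ u, (w * P ^ 2).eval (u : ℝ) ∂μ = 0 := by
  obtain ⟨v, hv, h⟩ := Matrix.exists_mulVec_eq_zero_iff.2 h
  refine ⟨polyOf v, fun h0 => hv ?_, natDegree_polyOf_le v, ?_⟩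
  · ext i; rw [← polyOf_coeff v i, h0]; simp
  · rw [← hankel_quadForm, h]; simp

lemma hankelDet_eq_zero {w : Polynomial ℝ} {n : ℕ} (hn : 0 < n)
    {μ : Measure unitInterval} [IsFiniteMeasure μ] {P : Polynomial ℝ} (hP : P ≠ 0)
    (hd : P.natDegree ≤ n - 1) (h : ∀ᵐ u : unitInterval ∂μ, (w * P).eval (u : ℝ) = 0) :
    hankelDet w n (mom μ) = 0 := by
  refine Matrix.exists_mulVec_eq_zero_iff.1 ⟨fun i : Fin n => P.coeff i, fun h0 => hP ?_, ?_⟩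
  · rw [exists_polyOf P hn hd]
    simp only [polyOf]
    refine Finset.sum_eq_zero fun i _ => ?_
    have := congrFun h0 i
    simp only [Pi.zero_apply] at this
    simp [this]
  · ext i
    rw [hankel_mulVec, ← exists_polyOf P hn hd, Pi.zero_apply]
    refine integral_eq_zero_of_ae ?_
    filter_upwards [h] with u hu
    rw [Polynomial.eval_mul] at hu
    simp [hu]

lemma ae_eq_zero_of_integral_weight {w P : Polynomial ℝ}
    (hw : ∀ u : unitInterval, 0 ≤ w.eval (u : ℝ))
    {μ : Measure unitInterval} [IsFiniteMeasure μ]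
    (h : ∫ u, (w * P ^ 2).eval (u : ℝ) ∂μ = 0) :
    ∀ᵐ u : unitInterval ∂μ, (w * P).eval (u : ℝ) = 0 := by
  rw [integral_eq_zero_iff_of_nonneg] at h
  · filter_upwards [h] with u hu
    simpa using hu
  · intro u
    simp only [Polynomial.eval_mul, Polynomial.eval_pow, Pi.zero_apply]
    exact mul_nonneg (hw u) (sq_nonneg _)
  · exact integrable_eval_unitInterval μ _

/-- A measure carried by the roots of a polynomial of degree at most `t + 1` is determined by its
moments up to order `t`. -/
lemma mom_eq_of_roots {G : Polynomial ℝ} (hG : G ≠ 0) {t : ℕ} (hd : G.natDegree ≤ t + 1)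
    {μ ν : Measure unitInterval} [IsFiniteMeasure μ] [IsFiniteMeasure ν]
    (hμ : ∀ᵐ u : unitInterval ∂μ, G.eval (u : ℝ) = 0)
    (hν : ∀ᵐ u : unitInterval ∂ν, G.eval (u : ℝ) = 0)
    (h : ∀ s ≤ t, mom μ s = mom ν s) (s : ℕ) : mom μ s = mom ν s := by
  -- On the roots of `G` the monomial `X ^ s` equals its remainder modulo `G`, whose degree is at
  -- most `t`.
  have key : ∀ (ρ : Measure unitInterval) [IsFiniteMeasure ρ],
      (∀ᵐ u : unitInterval ∂ρ, G.eval (u : ℝ) = 0) →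
      mom ρ s = momEval (mom ρ) (Polynomial.X ^ s % G) := by
    intro ρ _ hρ
    rw [momEval_mom, mom]
    refine integral_congr_ae ?_
    filter_upwards [hρ] with u hu
    have h1 := congrArg (Polynomial.eval (u : ℝ)) (EuclideanDomain.div_add_mod (Polynomial.X ^ s) G)
    simp only [Polynomial.eval_add, Polynomial.eval_mul, hu, zero_mul, zero_add,
      Polynomial.eval_pow, Polynomial.eval_X] at h1
    exact h1.symm
  rw [key μ hμ, key ν hν]
  refine momEval_congr (t := t) ?_ h
  -- The remainder has strictly smaller degree than `G` only when `G` is not constant; for a unit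
  -- the remainder is 0.
  by_cases hz : G.natDegree = 0
  · obtain ⟨a, ha⟩ := Polynomial.natDegree_eq_zero.1 hz
    have hu : IsUnit G := by
      rw [← ha, Polynomial.isUnit_C]
      exact isUnit_iff_ne_zero.2 fun h0 => hG (by rw [← ha, h0, Polynomial.C_0])
    rw [EuclideanDomain.mod_eq_zero.2 hu.dvd]; simp
  · have := Polynomial.natDegree_mod_lt (Polynomial.X ^ s) hz
    omega

/-- Moments up to order `t` with a vanishing Hankel determinant of order `t` determine all
moments. -/
lemma mom_eq_of_weight {w : Polynomial ℝ} {n t : ℕ} (hw : IsWeight w n t)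
    {μ ν : Measure unitInterval} [IsFiniteMeasure μ] [IsFiniteMeasure ν]
    (h0 : hankelDet w n (mom μ) = 0)
    (h : ∀ s ≤ t, mom μ s = mom ν s) (s : ℕ) : mom μ s = mom ν s := by
  obtain ⟨P, hP, hd, hi⟩ := exists_of_hankelDet_eq_zero h0
  have hdeg : (w * P ^ 2).natDegree ≤ t := by
    refine Polynomial.natDegree_mul_le.trans ?_
    have := Polynomial.natDegree_pow_le (p := P) (n := 2)
    have := hw.degree
    omega
  -- This integral depends only on moments up to order `t`, hence vanishes for both measures. Both
  -- are then carried by the roots of the same polynomial `w * P`.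
  have hi' : ∫ u, (w * P ^ 2).eval (u : ℝ) ∂ν = 0 := by
    rw [← hi, ← momEval_mom, ← momEval_mom]
    exact (momEval_congr hdeg h).symm
  refine mom_eq_of_roots (mul_ne_zero hw.ne_zero hP) (t := t) ?_
    (ae_eq_zero_of_integral_weight hw.nonneg hi) (ae_eq_zero_of_integral_weight hw.nonneg hi') h s
  refine Polynomial.natDegree_mul_le.trans ?_
  have := hw.degree_le
  omega

/-- The next moment is extremal when a Hankel determinant vanishes. -/
lemma mom_extremal_of_weight {w : Polynomial ℝ} {n t : ℕ} (hw : IsWeight w n (t + 1))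
    {μ ν : Measure unitInterval} [IsFiniteMeasure μ] [IsFiniteMeasure ν]
    (h0 : hankelDet w n (mom μ) = 0)
    (h : ∀ s ≤ t, mom μ s = mom ν s) :
    0 ≤ w.leadingCoeff * (mom ν (t + 1) - mom μ (t + 1)) := by
  obtain ⟨P, hP, hd, hi⟩ := exists_of_hankelDet_eq_zero h0
  have hdeg : (w * P ^ 2).natDegree = w.natDegree + 2 * P.natDegree := by
    rw [Polynomial.natDegree_mul hw.ne_zero (pow_ne_zero _ hP), Polynomial.natDegree_pow]
  have h1 := hw.degree
  have hν : 0 ≤ ∫ u, (w * P ^ 2).eval (u : ℝ) ∂ν := by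
    refine integral_nonneg fun u => ?_
    simp only [Polynomial.eval_mul, Polynomial.eval_pow]
    exact mul_nonneg (hw.nonneg u) (sq_nonneg _)
  -- If `P` has full degree, the integrals of `w * P ^ 2` under `μ` (zero) and `ν` (nonnegative)
  -- differ only through the moment of order `t + 1`, whose coefficient has the sign of the leading
  -- coefficient of `w`. Otherwise `w * P ^ 2` has degree at most `t`, so that the lower moments
  -- already determine the next one.
  by_cases hPd : P.natDegree = n - 1
  · have hc : (w * P ^ 2).coeff (t + 1) = w.leadingCoeff * P.leadingCoeff ^ 2 := by
      rw [← Polynomial.leadingCoeff_pow, ← Polynomial.leadingCoeff_mul, Polynomial.leadingCoeff,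
        hdeg]
      congr 1; omega
    have hle : (w * P ^ 2).natDegree ≤ t + 1 := by omega
    rw [← momEval_mom, momEval_eq_sum hle, Finset.sum_range_succ] at hi hν
    have hs : ∑ i ∈ Finset.range (t + 1), (w * P ^ 2).coeff i * mom μ i =
        ∑ i ∈ Finset.range (t + 1), (w * P ^ 2).coeff i * mom ν i :=
      Finset.sum_congr rfl fun i hi => by rw [h i (by simpa [Nat.lt_succ_iff] using hi)]
    rw [hc] at hi hν
    have hp : 0 < P.leadingCoeff ^ 2 := by
      have := Polynomial.leadingCoeff_ne_zero.2 hP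
      positivity
    refine nonneg_of_mul_nonneg_right (?_ : 0 ≤ P.leadingCoeff ^ 2 * _) hp
    nlinarith
  · have hle : (w * P ^ 2).natDegree ≤ t := by omega
    have hi' : ∫ u, (w * P ^ 2).eval (u : ℝ) ∂ν = 0 := by
      rw [← hi, ← momEval_mom, ← momEval_mom]
      exact (momEval_congr hle h).symm
    have := mom_eq_of_roots (mul_ne_zero hw.ne_zero hP) (t := t) (by
      rw [Polynomial.natDegree_mul hw.ne_zero hP]; have := hw.degree_le; omega)
      (ae_eq_zero_of_integral_weight hw.nonneg hi)
      (ae_eq_zero_of_integral_weight hw.nonneg hi') h (t + 1)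
    rw [this]; simp

/-- The leading coefficient of the weight decides between the two extremes. It is 1 for the lower
weights 1 and X, so the moment is minimal; it is -1 for the upper weights X - X² and 1 - X, so in
the next lemma it is maximal. -/
lemma qLower_eq_of_hankelLower {t : ℕ} {μ : Measure unitInterval} [IsProbabilityMeasure μ]
    (h : hankelLower (t + 1) (mom μ) = 0) : qLower t (mom μ) = mom μ (t + 1) := by
  refine le_antisymm (qLower_le_mom t (mom_zero μ) fun _ _ => rfl) ?_
  obtain ⟨ν, hν, h1, h2⟩ := (isMom_mom t μ).exists_qLower
  rw [← h2]
  rw [hankelLower_eq] at h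
  have := mom_extremal_of_weight (isWeight_lower (by omega)) h (ν := ν) fun s hs => (h1 s hs).symm
  have hl : (wLower (t + 1)).leadingCoeff = 1 := by unfold wLower; split_ifs <;> simp
  rw [hl] at this
  linarith

open Polynomial in
lemma qUpper_eq_of_hankelUpper {t : ℕ} {μ : Measure unitInterval} [IsProbabilityMeasure μ]
    (h : hankelUpper (t + 1) (mom μ) = 0) : qUpper t (mom μ) = mom μ (t + 1) := by
  refine le_antisymm ?_ (mom_le_qUpper t (mom_zero μ) fun _ _ => rfl)
  obtain ⟨ν, hν, h1, h2⟩ := (isMom_mom t μ).exists_qUpper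
  rw [← h2]
  rw [hankelUpper_eq] at h
  have := mom_extremal_of_weight (isWeight_upper (by omega)) h (ν := ν) fun s hs => (h1 s hs).symm
  have hl : (wUpper (t + 1)).leadingCoeff = -1 := by
    unfold wUpper
    split_ifs
    · rw [Polynomial.leadingCoeff, natDegree_X_sub_X_sq]; simp [coeff_X]
    · rw [Polynomial.leadingCoeff, natDegree_one_sub_X]; simp [coeff_one]
  rw [hl] at this
  linarith

end FELogit
end

noncomputable section
namespace FELogit

/-! ### The interior of the moment space -/

lemma exists_mix (μ ν : Measure unitInterval) [IsProbabilityMeasure μ] [IsProbabilityMeasure ν]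
    {s : ℝ} (h0 : 0 ≤ s) (h1 : s ≤ 1) :
    ∃ ρ : Measure unitInterval, IsProbabilityMeasure ρ ∧
      ∀ k, mom ρ k = (1 - s) * mom μ k + s * mom ν k := by
  refine ⟨ENNReal.ofReal (1 - s) • μ + ENNReal.ofReal s • ν, ⟨?_⟩, fun k => ?_⟩
  · simp only [Measure.add_apply, Measure.smul_apply, measure_univ, smul_eq_mul, mul_one]
    rw [← ENNReal.ofReal_add (by linarith) h0]; simp
  · have hi : ∀ ρ : Measure unitInterval, IsFiniteMeasure ρ →
        Integrable (fun u : unitInterval => (u : ℝ) ^ k) ρ := fun ρ _ =>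
      integrable_continuous_unitInterval ρ (by fun_prop)
    unfold mom
    rw [integral_add_measure ((hi μ inferInstance).smul_measure ENNReal.ofReal_ne_top)
      ((hi ν inferInstance).smul_measure ENNReal.ofReal_ne_top), integral_smul_measure,
      integral_smul_measure, ENNReal.toReal_ofReal (by linarith), ENNReal.toReal_ofReal h0]
    simp

/-- The space of moment vectors `(m_1, …, m_t)` of probability measures on `[0,1]`. -/
def momSet (t : ℕ) : Set (Fin t → ℝ) :=
  {v | ∃ μ : Measure unitInterval, IsProbabilityMeasure μ ∧ ∀ i : Fin t, mom μ (i + 1) = v i}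

lemma convex_momSet (t : ℕ) : Convex ℝ (momSet t) := by
  rintro _ ⟨μ, hμ, h1⟩ _ ⟨ν, hν, h2⟩ a b ha hb hab
  obtain ⟨ρ, hρ, h⟩ := exists_mix μ ν hb (by linarith)
  refine ⟨ρ, hρ, fun i => ?_⟩
  rw [h, ← hab]
  simp [h1, h2]

/-- A supporting hyperplane at a noninterior point. If the interior is empty, the set spans a proper
affine subspace, and a functional vanishing on its direction works. Otherwise Hahn–Banach separates
the point from the interior, whose closure contains the set. -/
lemma exists_supporting {E : Type*} [NormedAddCommGroup E] [NormedSpace ℝ E]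
    [FiniteDimensional ℝ E] {C : Set E} (hC : Convex ℝ C) {x : E} (hx : x ∈ C)
    (hi : x ∉ interior C) : ∃ f : E →ₗ[ℝ] ℝ, f ≠ 0 ∧ ∀ z ∈ C, f z ≤ f x := by
  rcases (interior C).eq_empty_or_nonempty with he | hne
  · have h1 : affineSpan ℝ C ≠ ⊤ := fun h => by
      have := (hC.interior_nonempty_iff_affineSpan_eq_top).2 h
      simp [he] at this
    have h2 : vectorSpan ℝ C < ⊤ := by
      rw [lt_top_iff_ne_top]
      intro h
      exact h1 ((AffineSubspace.affineSpan_eq_top_iff_vectorSpan_eq_top_of_nonempty ℝ E E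
        ⟨x, hx⟩).2 h)
    obtain ⟨f, hf, hle⟩ := Submodule.exists_le_ker_of_lt_top _ h2
    refine ⟨f, hf, fun z hz => ?_⟩
    have := hle (vsub_mem_vectorSpan ℝ hz hx)
    simp only [vsub_eq_sub, LinearMap.mem_ker, map_sub] at this
    linarith
  · obtain ⟨f, hf⟩ := geometric_hahn_banach_open_point hC.interior isOpen_interior hi
    refine ⟨f, fun h => ?_, fun z hz => ?_⟩
    · obtain ⟨y, hy⟩ := hne
      have h1 := hf y hy
      have h2 := fun y => LinearMap.congr_fun h y
      simp only [ContinuousLinearMap.coe_coe, LinearMap.zero_apply] at h2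
      rw [h2, h2] at h1; exact lt_irrefl _ h1
    · have h1 : z ∈ closure (interior C) := by
        rw [hC.closure_interior_eq_closure_of_nonempty_interior hne]
        exact subset_closure hz
      exact closure_minimal (fun y hy => (hf y hy).le)
        (isClosed_le f.continuous continuous_const) h1

open Polynomial in
/-- The monic polynomial with simple roots at the points of `S`. -/
def rootPoly (S : Finset ℝ) : ℝ[X] := ∏ z ∈ S, (X - Polynomial.C z)

lemma rootPoly_ne_zero (S : Finset ℝ) : rootPoly S ≠ 0 :=
  (Polynomial.monic_prod_of_monic _ _ fun z _ => Polynomial.monic_X_sub_C z).ne_zero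

lemma natDegree_rootPoly (S : Finset ℝ) : (rootPoly S).natDegree = S.card := by
  rw [rootPoly, Polynomial.natDegree_prod _ _ fun z _ => Polynomial.X_sub_C_ne_zero z]
  simp

lemma rootPoly_eval {S : Finset ℝ} {x : ℝ} (h : x ∈ S) : (rootPoly S).eval x = 0 := by
  rw [rootPoly, Polynomial.eval_prod]
  exact Finset.prod_eq_zero h (by simp)

/-- An interior zero of a function that is nonnegative on [0,1] is a local minimum, so the
derivative vanishes there too. -/
lemma two_le_count_roots {Q : Polynomial ℝ} (hQ : Q ≠ 0)
    (hpos : ∀ u : unitInterval, 0 ≤ Q.eval (u : ℝ)) {z : ℝ} (h0 : 0 < z) (h1 : z < 1)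
    (hz : Q.eval z = 0) : 2 ≤ Q.roots.count z := by
  rw [Polynomial.count_roots]
  refine (Polynomial.one_lt_rootMultiplicity_iff_isRoot hQ).2 ⟨hz, ?_⟩
  have hmin : IsLocalMin (fun x => Q.eval x) z := by
    filter_upwards [Ioo_mem_nhds h0 h1] with x hx
    rw [hz]
    exact hpos ⟨x, hx.1.le, hx.2.le⟩
  have := hmin.deriv_eq_zero
  rwa [Polynomial.deriv] at this

/-- A nonnegative polynomial of degree at most `t` with vanishing integral forces a Hankel
determinant of order `t` to vanish. -/
lemma hankel_eq_zero_of_nonneg_poly {t : ℕ} (ht : 1 ≤ t) {μ : Measure unitInterval}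
    [IsFiniteMeasure μ] {Q : Polynomial ℝ} (hQ : Q ≠ 0) (hd : Q.natDegree ≤ t)
    (hpos : ∀ u : unitInterval, 0 ≤ Q.eval (u : ℝ)) (hint : ∫ u, Q.eval (u : ℝ) ∂μ = 0) :
    hankelLower t (mom μ) = 0 ∨ hankelUpper t (mom μ) = 0 := by
  rw [integral_eq_zero_iff_of_nonneg hpos (integrable_eval_unitInterval μ Q)] at hint
  -- The measure is carried by the zeros of `Q` in [0,1]. Zeros in the open interval (the set `R`
  -- below) count twice and endpoint zeros once, for a total of at most `t`. This bounds the number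
  -- of points available to the measure.
  set Z : Finset ℝ := Q.roots.toFinset.filter (fun z => 0 ≤ z ∧ z ≤ 1) with hZ
  have hroot : ∀ z ∈ Z, Q.eval z = 0 := fun z hz => by
    simp only [hZ, Finset.mem_filter, Multiset.mem_toFinset, Polynomial.mem_roots hQ] at hz
    exact hz.1
  have hZae : ∀ᵐ u : unitInterval ∂μ, (u : ℝ) ∈ Z := by
    filter_upwards [hint] with u hu
    simp only [hZ, Finset.mem_filter, Multiset.mem_toFinset, Polynomial.mem_roots hQ]
    exact ⟨hu, u.2⟩
  set R : Finset ℝ := (Z.erase 0).erase 1 with hR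
  have hcount : ∑ z ∈ Z, Q.roots.count z ≤ t := by
    calc ∑ z ∈ Z, Q.roots.count z ≤ ∑ z ∈ Q.roots.toFinset, Q.roots.count z :=
          Finset.sum_le_sum_of_subset (Finset.filter_subset _ _)
      _ = Q.roots.card := Multiset.toFinset_sum_count_eq _
      _ ≤ Q.natDegree := Polynomial.card_roots' Q
      _ ≤ t := hd
  have hone : ∀ z ∈ Z, 1 ≤ Q.roots.count z := fun z hz => by
    rw [Multiset.one_le_count_iff_mem, Polynomial.mem_roots hQ]
    exact hroot z hz
  have htwo : 2 * R.card ≤ ∑ z ∈ R, Q.roots.count z := by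
    rw [mul_comm, ← smul_eq_mul]
    refine Finset.card_nsmul_le_sum _ _ _ fun z hz => ?_
    simp only [hR, Finset.mem_erase] at hz
    have hz' := hz.2.2
    simp only [hZ, Finset.mem_filter] at hz'
    exact two_le_count_roots hQ hpos (lt_of_le_of_ne hz'.2.1 (Ne.symm hz.2.1))
      (lt_of_le_of_ne hz'.2.2 hz.1) (hroot z hz.2.2)
  have e0 : (if (0 : ℝ) ∈ Z then 1 else 0) + ∑ z ∈ Z.erase 0, Q.roots.count z ≤
      ∑ z ∈ Z, Q.roots.count z := by
    split_ifs with h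
    · rw [← Finset.add_sum_erase _ _ h]; have := hone 0 h; omega
    · rw [Finset.erase_eq_of_notMem h, zero_add]
  have e1 : (if (1 : ℝ) ∈ Z then 1 else 0) + ∑ z ∈ R, Q.roots.count z ≤
      ∑ z ∈ Z.erase 0, Q.roots.count z := by
    split_ifs with h
    · have h' : (1 : ℝ) ∈ Z.erase 0 := Finset.mem_erase.2 ⟨one_ne_zero, h⟩
      rw [hR, ← Finset.add_sum_erase _ _ h']; have := hone 1 h; omega
    · have h' : (1 : ℝ) ∉ Z.erase 0 := fun h' => h (Finset.mem_of_mem_erase h')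
      rw [hR, Finset.erase_eq_of_notMem h', zero_add]
  have c1 : (Z.erase 0).card = R.card + (if (1 : ℝ) ∈ Z then 1 else 0) := by
    split_ifs with h
    · have h' : (1 : ℝ) ∈ Z.erase 0 := Finset.mem_erase.2 ⟨one_ne_zero, h⟩
      rw [hR, Finset.card_erase_add_one h']
    · have h' : (1 : ℝ) ∉ Z.erase 0 := fun h' => h (Finset.mem_of_mem_erase h')
      rw [hR, Finset.erase_eq_of_notMem h', add_zero]
  have c0 : Z.card = (Z.erase 0).card + (if (0 : ℝ) ∈ Z then 1 else 0) := by
    split_ifs with h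
    · rw [Finset.card_erase_add_one h]
    · rw [Finset.erase_eq_of_notMem h, add_zero]
  rw [hankelLower_eq, hankelUpper_eq]
  have w1 := (isWeight_lower ht).size_pos
  have w2 := (isWeight_upper ht).size_pos
  have memcase : ∀ x ∈ Z, x = 0 ∨ x = 1 ∨ x ∈ R := fun x hx => by
    by_cases h0 : x = 0
    · exact Or.inl h0
    by_cases h1 : x = 1
    · exact Or.inr (Or.inl h1)
    · exact Or.inr (Or.inr (Finset.mem_erase.2 ⟨h1, Finset.mem_erase.2 ⟨h0, hx⟩⟩))
  -- The weight absorbs endpoint zeros, and the rest must be the roots of a polynomial of degree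
  -- below the size of the matrix. For even `t`: if both endpoints are zeros, X - X² absorbs them
  -- and `R` has at most t/2 - 1 points; otherwise `Z` has at most t/2 points and the weight 1
  -- suffices. For odd `t`: the weight X absorbs 0 when 0 is a zero, and 1 - X absorbs 1 when it is
  -- not.
  by_cases he : Even t
  · have hpar := Nat.even_iff.1 he
    have hs : sLower t = t / 2 + 1 := by simp [sLower, he]
    have hs' : sUpper t = t / 2 := by simp [sUpper, he]
    by_cases hb : (0 : ℝ) ∈ Z ∧ (1 : ℝ) ∈ Z
    · rw [if_pos hb.1] at e0
      rw [if_pos hb.2] at e1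
      right
      refine hankelDet_eq_zero w2 (rootPoly_ne_zero R) ?_ ?_
      · rw [natDegree_rootPoly]; omega
      · filter_upwards [hZae] with u hu
        rw [Polynomial.eval_mul]
        rcases memcase _ hu with h | h | h
        · simp [wUpper, he, h]
        · simp [wUpper, he, h]
        · rw [rootPoly_eval h, mul_zero]
    · left
      refine hankelDet_eq_zero w1 (rootPoly_ne_zero Z) ?_ ?_
      · rw [natDegree_rootPoly]
        have hab : (if (0 : ℝ) ∈ Z then 1 else 0) + (if (1 : ℝ) ∈ Z then 1 else 0) ≤ 1 := by
          rcases not_and_or.1 hb with h | h <;> rw [if_neg h] <;> split_ifs <;> omega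
        generalize (if (0 : ℝ) ∈ Z then 1 else 0) = a at *
        generalize (if (1 : ℝ) ∈ Z then 1 else 0) = b at *
        omega
      · filter_upwards [hZae] with u hu
        rw [Polynomial.eval_mul, rootPoly_eval hu, mul_zero]
  · have hpar := Nat.not_even_iff.1 he
    have hs : sLower t = (t + 1) / 2 := by simp [sLower, he]
    have hs' : sUpper t = (t + 1) / 2 := by simp [sUpper, he]
    by_cases hb : (0 : ℝ) ∈ Z
    · left
      rw [if_pos hb] at e0
      refine hankelDet_eq_zero w1 (rootPoly_ne_zero (Z.erase 0)) ?_ ?_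
      · rw [natDegree_rootPoly]
        have hb1 : (if (1 : ℝ) ∈ Z then 1 else 0) ≤ 1 := by split_ifs <;> omega
        generalize (if (1 : ℝ) ∈ Z then 1 else 0) = b at *
        omega
      · filter_upwards [hZae] with u hu
        rw [Polynomial.eval_mul]
        by_cases h : (u : ℝ) = 0
        · simp [wLower, he, h]
        · rw [rootPoly_eval (Finset.mem_erase.2 ⟨h, hu⟩), mul_zero]
    · right
      refine hankelDet_eq_zero w2 (rootPoly_ne_zero R) ?_ ?_
      · rw [natDegree_rootPoly]
        omega
      · filter_upwards [hZae] with u hu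
        rw [Polynomial.eval_mul]
        rcases memcase _ hu with h | h | h
        · rw [h] at hu; exact absurd hu hb
        · simp [wUpper, he, h]
        · rw [rootPoly_eval h, mul_zero]

open Polynomial in
-- At a noninterior point, a supporting functional is a nonzero polynomial of degree at most `t`
-- that is nonnegative on [0,1] and has integral zero under `μ`. Such a polynomial forces one of the
-- two determinants to vanish.
lemma mem_interior_momSet {t : ℕ} (ht : 1 ≤ t) {μ : Measure unitInterval} [IsProbabilityMeasure μ]
    (hL : hankelLower t (mom μ) ≠ 0) (hU : hankelUpper t (mom μ) ≠ 0) :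
    (fun i : Fin t => mom μ (i + 1)) ∈ interior (momSet t) := by
  by_contra hi
  obtain ⟨f, hf, hle⟩ := exists_supporting (convex_momSet t) ⟨μ, inferInstance, fun i => rfl⟩ hi
  set x : Fin t → ℝ := fun i : Fin t => mom μ (i + 1) with hx
  let e : Fin t → (Fin t → ℝ) := fun i => Pi.single i 1
  have hfe : ∀ v, f v = ∑ i, v i * f (e i) := fun v => by
    have h1 : v = ∑ i, v i • e i := by
      ext j; simp [e, Finset.sum_apply, Pi.single_apply]
    conv_lhs => rw [h1]
    simp only [map_sum, map_smul, smul_eq_mul]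
  let Q : ℝ[X] := Polynomial.C (f x) - ∑ i : Fin t, Polynomial.C (f (e i)) * X ^ ((i : ℕ) + 1)
  have hQe : ∀ u : ℝ, Q.eval u = f x - ∑ i : Fin t, u ^ ((i : ℕ) + 1) * f (e i) := fun u => by
    simp only [Q, eval_sub, eval_C, eval_finsetSum, eval_mul, eval_pow, eval_X]
    exact congrArg _ (Finset.sum_congr rfl fun i _ => mul_comm _ _)
  have hQ0 : Q ≠ 0 := by
    intro h0
    apply hf
    have hz : ∀ i, f (e i) = 0 := fun i => by
      have h1 := congrArg (fun q : ℝ[X] => q.coeff (i + 1)) h0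
      simpa [Q, finsetSum_coeff, coeff_X_pow, coeff_C, Fin.val_inj] using h1
    refine LinearMap.ext fun v => ?_
    rw [hfe]
    simp [hz]
  -- The supporting inequality is tested on the moment vectors of Dirac masses.
  have hpos : ∀ u : unitInterval, 0 ≤ Q.eval (u : ℝ) := fun u => by
    have := hle (fun i => (u : ℝ) ^ ((i : ℕ) + 1))
      ⟨Measure.dirac u, inferInstance, fun i => by simp [mom]⟩
    rw [hfe (fun i => (u : ℝ) ^ ((i : ℕ) + 1))] at this
    rw [hQe]; linarith
  have hdeg : Q.natDegree ≤ t := by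
    refine (natDegree_sub_le _ _).trans (max_le (by simp) ?_)
    refine natDegree_sum_le_of_forall_le _ _ fun i _ => ?_
    refine (natDegree_C_mul_X_pow_le _ _).trans ?_
    omega
  have hint : ∫ u, Q.eval (u : ℝ) ∂μ = 0 := by
    simp_rw [hQe]
    rw [integral_sub (integrable_const _), integral_finsetSum]
    · simp_rw [integral_mul_const]
      rw [hfe x]; simp [hx, mom]
    · exact fun i _ => integrable_continuous_unitInterval μ (by fun_prop)
    · exact integrable_continuous_unitInterval μ (by fun_prop)
  rcases hankel_eq_zero_of_nonneg_poly ht hQ0 hdeg hpos hint with h | h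
  · exact hL h
  · exact hU h

/-! ### Continuity of the extremal next moments -/

/-- Mixing an extremal measure for `m0` with a proportion `s` of any measure representing `z`
produces a competitor for `m`. Its next moment moves by at most `s`, because moments lie in [0,1].
-/
lemma q_mix {t : ℕ} {m m0 z : ℕ → ℝ} {s : ℝ} (hs0 : 0 ≤ s) (hs1 : s ≤ 1) (h0 : IsMom t m0)
    (hz : IsMom t z) (hm : ∀ k ≤ t, m k = (1 - s) * m0 k + s * z k) :
    qLower t m ≤ qLower t m0 + s ∧ qUpper t m0 - s ≤ qUpper t m := by
  have hm0 : m 0 = 1 := by rw [hm 0 (by omega), h0.zero_eq_one, hz.zero_eq_one]; ring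
  obtain ⟨ζ, hζ, hζm⟩ := hz
  constructor
  · obtain ⟨μ, hμ, h1, h2⟩ := h0.exists_qLower
    obtain ⟨ρ, hρ, h⟩ := exists_mix μ ζ hs0 hs1
    have := qLower_le_mom t hm0 (μ := ρ) fun k hk => by rw [h, hm k hk, h1 k hk, hζm k hk]
    rw [h, h2] at this
    have h3 := mom_le_one ζ (t + 1)
    have h4 := (qLower_mem_Icc t h0.zero_eq_one).1
    nlinarith
  · obtain ⟨μ, hμ, h1, h2⟩ := h0.exists_qUpper
    obtain ⟨ρ, hρ, h⟩ := exists_mix μ ζ hs0 hs1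
    have := mom_le_qUpper t hm0 (μ := ρ) fun k hk => by rw [h, hm k hk, h1 k hk, hζm k hk]
    rw [h, h2] at this
    have h3 := mom_nonneg ζ (t + 1)
    have h4 := (qUpper_mem_Icc t h0.zero_eq_one).2
    nlinarith

lemma isMom_of_mem_momSet {t : ℕ} {m : ℕ → ℝ} (h0 : m 0 = 1)
    (h : (fun i : Fin t => m (i + 1)) ∈ momSet t) : IsMom t m := by
  obtain ⟨μ, hμ, h⟩ := h
  refine ⟨μ, hμ, fun s hs => ?_⟩
  rcases s with _ | s
  · rw [mom_zero, h0]
  · exact h ⟨s, by omega⟩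

/-- The sequence with `m_0 = 1` and prescribed following entries. -/
def consSeq {t : ℕ} (v : Fin t → ℝ) (k : ℕ) : ℝ :=
  if k = 0 then 1 else if h : k - 1 < t then v ⟨k - 1, h⟩ else 0

lemma consSeq_succ {t : ℕ} (v : Fin t → ℝ) (i : Fin t) : consSeq v (i + 1) = v i := by
  simp [consSeq]

lemma isMom_consSeq {t : ℕ} {v : Fin t → ℝ} (h : v ∈ momSet t) : IsMom t (consSeq v) := by
  refine isMom_of_mem_momSet (by simp [consSeq]) ?_
  convert h using 2 with i
  exact consSeq_succ v i

/-- Near an interior point of the moment space, the extremal next moments are Lipschitz. -/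
lemma q_close {t : ℕ} {m0 : ℕ → ℝ} (h00 : m0 0 = 1) {ρ : ℝ} (hρ : 0 < ρ)
    (hball : Metric.closedBall (fun i : Fin t => m0 (i + 1)) ρ ⊆ momSet t) {m : ℕ → ℝ}
    (hm0 : m 0 = 1) {δ : ℝ} (hδ : δ ≤ ρ) (hm : ∀ s ≤ t, |m s - m0 s| ≤ δ) :
    IsMom t m ∧ |qLower t m - qLower t m0| ≤ δ / ρ ∧ |qUpper t m - qUpper t m0| ≤ δ / ρ := by
  have hδ0 : 0 ≤ δ := (abs_nonneg _).trans (hm 0 (by omega))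
  set x0 : Fin t → ℝ := fun i : Fin t => m0 (i + 1)
  set x : Fin t → ℝ := fun i : Fin t => m (i + 1) with hx
  have hxx : ‖x - x0‖ ≤ δ := (pi_norm_le_iff_of_nonneg hδ0).2 fun i => hm _ (by omega)
  have hxm : IsMom t m := isMom_of_mem_momSet hm0
    (hball (by rw [Metric.mem_closedBall, dist_eq_norm]; exact hxx.trans hδ))
  have hm0m : IsMom t m0 := isMom_of_mem_momSet h00 (hball (Metric.mem_closedBall_self hρ.le))
  refine ⟨hxm, ?_⟩
  rcases hδ0.eq_or_lt with rfl | hδp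
  · have : ∀ s ≤ t, m s = m0 s := fun s hs => by
      have := hm s hs
      rwa [abs_nonpos_iff, sub_eq_zero] at this
    rw [qLower_congr this, qUpper_congr this]; simp
  set s := δ / ρ with hs
  have hs0 : 0 < s := by positivity
  have hs1 : s ≤ 1 := (div_le_one hρ).2 hδ
  have hsρ : s * ρ = δ := by rw [hs]; field_simp
  -- The choice `s = δ / ρ` keeps this point in the ball, and `x` is the mixture of `x0` and this
  -- point with weights 1 - s and s.
  have hz1 : x0 + s⁻¹ • (x - x0) ∈ momSet t := hball (by
    rw [Metric.mem_closedBall, dist_eq_norm, add_sub_cancel_left, norm_smul, Real.norm_eq_abs,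
      abs_of_pos (inv_pos.2 hs0), inv_mul_le_iff₀ hs0, hsρ]
    exact hxx)
  -- Conversely, `x0` is the mixture of `x` and this point with the same weights, which gives the
  -- reverse inequalities.
  have hz2 : x0 - ((1 - s) * s⁻¹) • (x - x0) ∈ momSet t := hball (by
    rw [Metric.mem_closedBall, dist_eq_norm, sub_sub_cancel_left, norm_neg, norm_smul,
      Real.norm_eq_abs, abs_of_nonneg (mul_nonneg (by linarith) (inv_pos.2 hs0).le), mul_comm,
      ← mul_assoc, mul_inv_le_iff₀ hs0, mul_comm ρ, hsρ]
    nlinarith [norm_nonneg (x - x0)])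
  have a1 := q_mix (m := m) hs0.le hs1 hm0m (isMom_consSeq hz1) fun k hk => by
    rcases k with _ | k
    · simp [hm0, h00, consSeq]
    · have := consSeq_succ (x0 + s⁻¹ • (x - x0)) ⟨k, by omega⟩
      simp only at this
      rw [this]
      simp only [Pi.add_apply, Pi.smul_apply, Pi.sub_apply, smul_eq_mul, x0, x]
      field_simp; ring
  have a2 := q_mix (m := m0) hs0.le hs1 hxm (isMom_consSeq hz2) fun k hk => by
    rcases k with _ | k
    · simp [hm0, h00, consSeq]
    · have := consSeq_succ (x0 - ((1 - s) * s⁻¹) • (x - x0)) ⟨k, by omega⟩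
      simp only at this
      rw [this]
      simp only [Pi.sub_apply, Pi.smul_apply, smul_eq_mul, x0, x]
      field_simp; ring
  exact ⟨abs_le.2 ⟨by linarith [a2.1], by linarith [a1.1]⟩,
    abs_le.2 ⟨by linarith [a1.2], by linarith [a2.2]⟩⟩

/-- Continuity of the extremal next moments at interior points. -/
lemma tendsto_q_of_interior {ι : Type*} {l : Filter ι} {t : ℕ} {μ : Measure unitInterval}
    [IsProbabilityMeasure μ]
    (hI : t = 0 ∨ hankelLower t (mom μ) ≠ 0 ∧ hankelUpper t (mom μ) ≠ 0)
    {m : ι → ℕ → ℝ} (hm0 : ∀ i, m i 0 = 1)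
    (hm : ∀ s ≤ t, Tendsto (fun i => m i s) l (𝓝 (mom μ s))) :
    (∀ᶠ i in l, IsMom t (m i)) ∧
    Tendsto (fun i => qLower t (m i)) l (𝓝 (qLower t (mom μ))) ∧
    Tendsto (fun i => qUpper t (m i)) l (𝓝 (qUpper t (mom μ))) := by
  rcases Nat.eq_zero_or_pos t with rfl | ht
  · have h : ∀ i, ∀ s ≤ 0, mom μ s = m i s := fun i s hs => by
      obtain rfl : s = 0 := by omega
      rw [hm0, mom_zero]
    refine ⟨Eventually.of_forall fun i => (isMom_mom 0 μ).congr (h i), ?_, ?_⟩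
    · simp_rw [← fun i => qLower_congr (h i)]; exact tendsto_const_nhds
    · simp_rw [← fun i => qUpper_congr (h i)]; exact tendsto_const_nhds
  · have hI' := hI.resolve_left (by omega)
    have hint := mem_interior_momSet ht hI'.1 hI'.2
    obtain ⟨ρ, hρ, hball⟩ := Metric.nhds_basis_closedBall.mem_iff.1
      (mem_interior_iff_mem_nhds.1 hint)
    have key : ∀ δ, 0 < δ → ∀ᶠ i in l, ∀ s ≤ t, |m i s - mom μ s| ≤ δ := fun δ hδ => by
      have : ∀ s ∈ Finset.range (t + 1), ∀ᶠ i in l, |m i s - mom μ s| ≤ δ := fun s hs => by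
        have := (hm s (by simpa [Nat.lt_succ_iff] using hs)).eventually
          (Metric.closedBall_mem_nhds _ hδ)
        filter_upwards [this] with i hi
        rwa [← Real.dist_eq]
      filter_upwards [(Filter.eventually_all_finset _).2 this] with i hi s hs
      exact hi s (by simpa [Nat.lt_succ_iff] using hs)
    refine ⟨?_, ?_, ?_⟩
    · filter_upwards [key ρ hρ] with i hi
      exact (q_close (mom_zero μ) hρ hball (hm0 i) le_rfl hi).1
    all_goals
      refine Metric.tendsto_nhds.2 fun ε hε => ?_
      filter_upwards [key (min ρ (ε / 2 * ρ)) (by positivity)] with i hi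
      have h1 := (q_close (mom_zero μ) hρ hball (hm0 i) (min_le_left _ _) hi).2
      have h2 : min ρ (ε / 2 * ρ) / ρ ≤ ε / 2 := (div_le_iff₀ hρ).2 (min_le_right _ _)
      rw [Real.dist_eq]
    · linarith [h1.1]
    · linarith [h1.2]

end FELogit
end

noncomputable section
namespace FELogit

/-! ### Regularity of Hankel determinants -/

/-- The determinant is a polynomial in the finitely many moments involved. This gives its continuity
and the local Lipschitz bound that converts moment errors into determinant errors. -/
lemma exists_contDiff_hankelDet {w : Polynomial ℝ} {n t : ℕ} (hw : IsWeight w n t) :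
    ∃ F : (Fin (t + 1) → ℝ) → ℝ, ContDiff ℝ 1 F ∧
      ∀ m : ℕ → ℝ, hankelDet w n m = F fun i => m i := by
  refine ⟨fun v => (Matrix.of fun i j : Fin n => ∑ a : Fin (t + 1),
    (w * Polynomial.X ^ ((i : ℕ) + j)).coeff a * v a).det, ?_, fun m => ?_⟩
  · simp only [Matrix.det_apply, Matrix.of_apply]
    refine ContDiff.sum fun σ _ => ?_
    refine ContDiff.const_smul _ (contDiff_prod fun i _ => ContDiff.sum fun a _ => ?_)
    fun_prop
  · unfold hankelDet
    congr 1
    ext i j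
    simp only [Matrix.of_apply]
    rw [momEval_eq_sum (t := t), Finset.sum_range]
    refine Polynomial.natDegree_mul_le.trans ?_
    rw [Polynomial.natDegree_X_pow]
    have := hw.degree; have := i.2; have := j.2
    omega

lemma tendsto_hankelDet {ι : Type*} {l : Filter ι} {w : Polynomial ℝ} {n t : ℕ}
    (hw : IsWeight w n t) {m : ι → ℕ → ℝ} {x : ℕ → ℝ}
    (hm : ∀ s ≤ t, Tendsto (fun i => m i s) l (𝓝 (x s))) :
    Tendsto (fun i => hankelDet w n (m i)) l (𝓝 (hankelDet w n x)) := by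
  obtain ⟨F, hF, h⟩ := exists_contDiff_hankelDet hw
  simp_rw [h]
  exact (hF.continuous.tendsto _).comp
    (tendsto_pi_nhds.2 fun a => hm a (Nat.lt_succ_iff.1 a.2))

lemma hankelDet_sub_le {ι : Type*} {l : Filter ι} {w : Polynomial ℝ} {n t : ℕ}
    (hw : IsWeight w n t) {m m' : ι → ℕ → ℝ} {x : ℕ → ℝ}
    (hm : ∀ s ≤ t, Tendsto (fun i => m i s) l (𝓝 (x s)))
    (hm' : ∀ s ≤ t, Tendsto (fun i => m' i s) l (𝓝 (x s))) :
    ∃ L : ℝ, 0 ≤ L ∧ ∀ᶠ i in l, ∀ δ : ℝ, (∀ s ≤ t, |m i s - m' i s| ≤ δ) →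
      |hankelDet w n (m i) - hankelDet w n (m' i)| ≤ L * δ := by
  obtain ⟨F, hF, h⟩ := exists_contDiff_hankelDet hw
  obtain ⟨L, s, hs, hL⟩ := hF.locallyLipschitz fun a => x a
  refine ⟨L, L.2, ?_⟩
  have h1 := (tendsto_pi_nhds.2 fun a : Fin (t + 1) => hm a (Nat.lt_succ_iff.1 a.2)).eventually hs
  have h2 := (tendsto_pi_nhds.2 fun a : Fin (t + 1) => hm' a (Nat.lt_succ_iff.1 a.2)).eventually hs
  filter_upwards [h1, h2] with i h1 h2 δ hδ
  rw [h, h, ← Real.dist_eq]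
  refine (hL.dist_le_mul _ h1 _ h2).trans (mul_le_mul_of_nonneg_left ?_ L.2)
  refine (dist_pi_le_iff ((abs_nonneg _).trans (hδ 0 (by omega)))).2 fun a => ?_
  rw [Real.dist_eq]
  exact hδ a (Nat.lt_succ_iff.1 a.2)

/-! ### The corrected moment vector -/

lemma complete_of_le (s : ℕ) (m : ℕ → ℝ) (j : ℕ) {i : ℕ} (hi : i ≤ s) :
    complete s m j i = m i := by
  induction j with
  | zero => rfl
  | succ j ih => rw [complete, Function.update_of_ne (by omega), ih]

/-- Each appended value is attained by a measure representing the previous ones, so the completed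
vector stays in the moment space; uniqueness of the extension plays no role here. -/
lemma IsMom.complete {s : ℕ} {m : ℕ → ℝ} (h : IsMom s m) (j : ℕ) :
    IsMom (s + j) (complete s m j) := by
  induction j with
  | zero => exact h
  | succ j ih =>
    obtain ⟨μ, hμ, h1, h2⟩ := ih.exists_qLower
    refine ⟨μ, hμ, fun i hi => ?_⟩
    rw [FELogit.complete]
    rcases eq_or_ne i (s + j + 1) with rfl | hne
    · rw [h2, Function.update_self]
    · rw [Function.update_of_ne hne, h1 i (by omega)]

lemma correct_zero (T : ℕ) (c : ℝ) {m : ℕ → ℝ} (h : m 0 = 1) : correct T c m 0 = 1 := by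
  unfold correct
  split_ifs
  · exact h
  · rw [complete_of_le _ _ _ (by omega), Function.update_of_ne (by omega), h]
  · rw [complete_of_le _ _ _ (by omega), Function.update_of_ne (by omega), h]

/-- Moment vectors whose Hankel determinants are either zero or at least `η`. -/
def Strat (T : ℕ) (η : ℝ) : Set (ℕ → ℝ) :=
  {m | IsMom T m ∧ ∀ t ∈ Finset.Icc 1 T, (hankelLower t m = 0 ∨ η ≤ hankelLower t m) ∧
    (hankelUpper t m = 0 ∨ η ≤ hankelUpper t m)}

/-- On the boundary nothing has to be known about the orders between `t` and `T`. Measures realising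
the extremal moment of `x i` converge along the ultrafilter to a measure sharing with `ν` the
moments up to `t`, hence all moments, since a determinant of order `t` vanishes. -/
lemma tendsto_q_of_boundary {ι : Type*} (U : Ultrafilter ι) {t T : ℕ} (ht : 1 ≤ t) (htT : t ≤ T)
    {ν : Measure unitInterval} [IsProbabilityMeasure ν]
    (hν : hankelLower t (mom ν) = 0 ∨ hankelUpper t (mom ν) = 0) {x : ι → ℕ → ℝ}
    (hx : ∀ᶠ i in (U : Filter ι), IsMom T (x i))
    (hlim : ∀ s ≤ t, Tendsto (fun i => x i s) U (𝓝 (mom ν s))) :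
    Tendsto (fun i => qLower T (x i)) U (𝓝 (mom ν (T + 1))) ∧
    Tendsto (fun i => qUpper T (x i)) U (𝓝 (mom ν (T + 1))) := by
  have key : ∀ q : ι → ℝ, (∀ᶠ i in (U : Filter ι), ∃ μ : Measure unitInterval,
      IsProbabilityMeasure μ ∧ (∀ s ≤ T, mom μ s = x i s) ∧ mom μ (T + 1) = q i) →
      Tendsto q U (𝓝 (mom ν (T + 1))) := by
    intro q hq
    classical
    let μ : ι → Measure unitInterval := fun i =>
      if h : ∃ μ : Measure unitInterval, IsProbabilityMeasure μ ∧ (∀ s ≤ T, mom μ s = x i s) ∧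
        mom μ (T + 1) = q i then h.choose else Measure.dirac 0
    have hμ : ∀ i, IsProbabilityMeasure (μ i) := fun i => by
      by_cases h : ∃ μ : Measure unitInterval, IsProbabilityMeasure μ ∧
        (∀ s ≤ T, mom μ s = x i s) ∧ mom μ (T + 1) = q i
      · simp only [μ, dif_pos h]; exact h.choose_spec.1
      · simp only [μ, dif_neg h]; infer_instance
    have hμ' : ∀ᶠ i in (U : Filter ι), (∀ s ≤ T, mom (μ i) s = x i s) ∧
        mom (μ i) (T + 1) = q i := by
      filter_upwards [hq] with i h
      simp only [μ, dif_pos h]; exact h.choose_spec.2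
    obtain ⟨ρ, hρ, hl⟩ := exists_tendsto_mom U μ hμ
    have heq : ∀ s ≤ t, mom ν s = mom ρ s := fun s hs => by
      refine tendsto_nhds_unique ((hlim s hs).congr' ?_) (hl s)
      filter_upwards [hμ'] with i hi
      exact (hi.1 s (by omega)).symm
    have hall : mom ν (T + 1) = mom ρ (T + 1) := by
      rcases hν with h | h
      · rw [hankelLower_eq] at h
        exact mom_eq_of_weight (isWeight_lower ht) h heq _
      · rw [hankelUpper_eq] at h
        exact mom_eq_of_weight (isWeight_upper ht) h heq _
    rw [hall]
    refine (hl (T + 1)).congr' ?_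
    filter_upwards [hμ'] with i hi
    exact hi.2
  refine ⟨key _ ?_, key _ ?_⟩
  · filter_upwards [hx] with i hi using hi.exists_qLower
  · filter_upwards [hx] with i hi using hi.exists_qUpper

/-- Along an ultrafilter the measures representing the true vectors converge to some `ν`. If `ν` is
interior up to order `T`, both sides converge by continuity. Otherwise the correction detects the
last interior order of `ν` and appends the right boundary moment, after which both sides are
governed by `tendsto_q_of_boundary`. -/
lemma exists_limit_correct {ι : Type*} (U : Ultrafilter ι) {T : ℕ} {η : ℝ} (hη : 0 < η)
    {m : ι → ℕ → ℝ} (hm : ∀ i, m i ∈ Strat T η) {c d : ι → ℝ} (hc : ∀ i, 0 < c i)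
    (hc0 : Tendsto c U (𝓝 0)) (hd0 : Tendsto d U (𝓝 0))
    {mt : ι → ℕ → ℝ} (hmt0 : ∀ i, mt i 0 = 1)
    (hmt : ∀ i, ∀ s ≤ T, |mt i s - m i s| ≤ d i * c i) :
    (∃ a, Tendsto (fun i => qLower T (correct T (c i) (mt i))) U (𝓝 a) ∧
      Tendsto (fun i => qLower T (m i)) U (𝓝 a)) ∧
    (∃ a, Tendsto (fun i => qUpper T (correct T (c i) (mt i))) U (𝓝 a) ∧
      Tendsto (fun i => qUpper T (m i)) U (𝓝 a)) := by
  choose μ hμ hμm using fun i => (hm i).1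
  obtain ⟨ν, hν, hlim⟩ := exists_tendsto_mom U μ hμ
  have hml : ∀ s ≤ T, Tendsto (fun i => m i s) U (𝓝 (mom ν s)) := fun s hs =>
    (hlim s).congr fun i => hμm i s hs
  have hdc : Tendsto (fun i => d i * c i) U (𝓝 0) := by simpa using hd0.mul hc0
  have hmtl : ∀ s ≤ T, Tendsto (fun i => mt i s) U (𝓝 (mom ν s)) := fun s hs => by
    have h1 : Tendsto (fun i => mt i s - m i s) U (𝓝 0) :=
      squeeze_zero_norm (fun i => by rw [Real.norm_eq_abs]; exact hmt i s hs) hdc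
    simpa using h1.add (hml s hs)
  have hm0 : ∀ i, m i 0 = 1 := fun i => (hm i).1.zero_eq_one
  -- vanishing determinants are estimated by quantities that are small with respect to `c`
  have hsmall : ∀ {w : Polynomial ℝ} {n t : ℕ}, IsWeight w n t → t ≤ T →
      (∀ i, hankelDet w n (m i) = 0 ∨ η ≤ hankelDet w n (m i)) → hankelDet w n (mom ν) = 0 →
      ∃ e : ι → ℝ, Tendsto e U (𝓝 0) ∧
        ∀ᶠ i in (U : Filter ι), |hankelDet w n (mt i)| ≤ e i * c i := by
    intro w n t hw htT hor h0
    have h1 := tendsto_hankelDet hw fun s hs => hml s (hs.trans htT)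
    rw [h0] at h1
    obtain ⟨L, hL, hLe⟩ := hankelDet_sub_le hw (fun s hs => hmtl s (hs.trans htT))
      fun s hs => hml s (hs.trans htT)
    refine ⟨fun i => L * d i, by simpa using hd0.const_mul L, ?_⟩
    -- The gap `η` is decisive: a true determinant that tends to 0 along the stratum is eventually
    -- equal to 0, so its estimate is pure error, of size o(c).
    filter_upwards [h1.eventually (gt_mem_nhds hη), hLe] with i hi hi'
    have h2 : hankelDet w n (m i) = 0 := (hor i).resolve_right (not_le.2 hi)
    have := hi' (d i * c i) fun s hs => hmt i s (hs.trans htT)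
    rw [h2, sub_zero] at this
    linarith
  have hsmallL : ∀ t ∈ Finset.Icc 1 T, hankelLower t (mom ν) = 0 →
      ∃ e : ι → ℝ, Tendsto e U (𝓝 0) ∧
        ∀ᶠ i in (U : Filter ι), |hankelLower t (mt i)| ≤ e i * c i := by
    intro t ht h0
    have ht' := Finset.mem_Icc.1 ht
    simp only [hankelLower_eq] at h0 ⊢
    refine hsmall (isWeight_lower ht'.1) ht'.2 (fun i => ?_) h0
    simpa only [hankelLower_eq] using ((hm i).2 t ht).1
  have hsmallU : ∀ t ∈ Finset.Icc 1 T, hankelUpper t (mom ν) = 0 →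
      ∃ e : ι → ℝ, Tendsto e U (𝓝 0) ∧
        ∀ᶠ i in (U : Filter ι), |hankelUpper t (mt i)| ≤ e i * c i := by
    intro t ht h0
    have ht' := Finset.mem_Icc.1 ht
    simp only [hankelUpper_eq] at h0 ⊢
    refine hsmall (isWeight_upper ht'.1) ht'.2 (fun i => ?_) h0
    simpa only [hankelUpper_eq] using ((hm i).2 t ht).2
  have hLlim : ∀ t ∈ Finset.Icc 1 T,
      Tendsto (fun i => hankelLower t (mt i)) U (𝓝 (hankelLower t (mom ν))) := fun t ht => by
    have ht' := Finset.mem_Icc.1 ht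
    simp only [hankelLower_eq]
    exact tendsto_hankelDet (isWeight_lower ht'.1) fun s hs => hmtl s (hs.trans ht'.2)
  have hUlim : ∀ t ∈ Finset.Icc 1 T,
      Tendsto (fun i => hankelUpper t (mt i)) U (𝓝 (hankelUpper t (mom ν))) := fun t ht => by
    have ht' := Finset.mem_Icc.1 ht
    simp only [hankelUpper_eq]
    exact tendsto_hankelDet (isWeight_upper ht'.1) fun s hs => hmtl s (hs.trans ht'.2)
  have hLpos : ∀ t ∈ Finset.Icc 1 T, 0 ≤ hankelLower t (mom ν) := fun t ht => by
    rw [hankelLower_eq]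
    exact hankelDet_nonneg (isWeight_lower (Finset.mem_Icc.1 ht).1).nonneg _ ν
  have hUpos : ∀ t ∈ Finset.Icc 1 T, 0 ≤ hankelUpper t (mom ν) := fun t ht => by
    rw [hankelUpper_eq]
    exact hankelDet_nonneg (isWeight_upper (Finset.mem_Icc.1 ht).1).nonneg _ ν
  -- A factor o(c) times a convergent factor eventually fails to exceed c.
  have hprod : ∀ f g e : ι → ℝ, ∀ b : ℝ, Tendsto e U (𝓝 0) → Tendsto g U (𝓝 b) →
      (∀ᶠ i in (U : Filter ι), |f i| ≤ e i * c i) → ∀ᶠ i in (U : Filter ι),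
      f i * g i ≤ c i := by
    intro f g e b he hg hf
    have h1 : Tendsto (fun i => e i * |g i|) U (𝓝 0) := by simpa using he.mul hg.abs
    filter_upwards [hf, h1.eventually (gt_mem_nhds one_pos)] with i hi hi1
    calc f i * g i ≤ |f i| * |g i| := by rw [← abs_mul]; exact le_abs_self _
      _ ≤ e i * c i * |g i| := mul_le_mul_of_nonneg_right hi (abs_nonneg _)
      _ = c i * (e i * |g i|) := by ring
      _ ≤ c i * 1 := mul_le_mul_of_nonneg_left hi1.le (hc i).le
      _ = c i := mul_one _
  -- Hence the threshold test eventually gives the same answer as the test of nonvanishing at the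
  -- limit `ν`.
  have hkey : ∀ t ∈ Finset.Icc 1 T, ∀ᶠ i in (U : Filter ι),
      (c i < hankelLower t (mt i) * hankelUpper t (mt i) ↔
        hankelLower t (mom ν) ≠ 0 ∧ hankelUpper t (mom ν) ≠ 0) := by
    intro t ht
    by_cases hL : hankelLower t (mom ν) = 0
    · obtain ⟨e, he, hle⟩ := hsmallL t ht hL
      filter_upwards [hprod _ _ e _ he (hUlim t ht) hle] with i hi
      simp [hL, hi]
    by_cases hU : hankelUpper t (mom ν) = 0
    · obtain ⟨e, he, hle⟩ := hsmallU t ht hU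
      filter_upwards [hprod _ _ e _ he (hLlim t ht) hle] with i hi
      rw [mul_comm] at hi
      simp [hU, hi]
    · have hp : 0 < hankelLower t (mom ν) * hankelUpper t (mom ν) :=
        mul_pos (lt_of_le_of_ne (hLpos t ht) (Ne.symm hL))
          (lt_of_le_of_ne (hUpos t ht) (Ne.symm hU))
      filter_upwards [hc0.eventually_lt ((hLlim t ht).mul (hUlim t ht)) hp] with i hi
      simp [hL, hU, hi]
  classical
  set J : ℕ := ((Finset.Icc 1 T).filter fun t =>
    hankelLower t (mom ν) ≠ 0 ∧ hankelUpper t (mom ν) ≠ 0).sup id with hJ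
  have hiHat : ∀ᶠ i in (U : Filter ι), iHat T (c i) (mt i) = J := by
    filter_upwards [(Filter.eventually_all_finset _).2 hkey] with i hi
    unfold iHat
    rw [hJ]
    congr 1
    exact Finset.filter_congr hi
  have hJT : J ≤ T := Finset.sup_le fun t ht =>
    (Finset.mem_Icc.1 (Finset.mem_filter.1 ht).1).2
  have hJcond : J = 0 ∨ hankelLower J (mom ν) ≠ 0 ∧ hankelUpper J (mom ν) ≠ 0 := by
    rcases Finset.eq_empty_or_nonempty ((Finset.Icc 1 T).filter fun t =>
      hankelLower t (mom ν) ≠ 0 ∧ hankelUpper t (mom ν) ≠ 0) with h | h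
    · left; rw [hJ, h]; rfl
    · right
      obtain ⟨t, ht, hte⟩ := Finset.exists_mem_eq_sup _ h id
      have := (Finset.mem_filter.1 ht).2
      rwa [hJ, hte]
  rcases hJT.eq_or_lt with hJeq | hJlt
  · have h1 := tendsto_q_of_interior (t := T) (by rwa [hJeq] at hJcond) hmt0 hmtl
    have h2 := tendsto_q_of_interior (t := T) (by rwa [hJeq] at hJcond) hm0 hml
    have hce : ∀ᶠ i in (U : Filter ι), correct T (c i) (mt i) = mt i := by
      filter_upwards [hiHat] with i hi
      unfold correct
      rw [if_pos (hi.trans hJeq)]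
    refine ⟨⟨_, h1.2.1.congr' ?_, h2.2.1⟩, ⟨_, h1.2.2.congr' ?_, h2.2.2⟩⟩ <;>
    · filter_upwards [hce] with i hi
      rw [hi]
  · have hJ1 : J + 1 ∈ Finset.Icc 1 T := Finset.mem_Icc.2 ⟨by omega, hJlt⟩
    -- By maximality of `J`, order `J + 1` is on the boundary, while order `J` is interior (or `J =
    -- 0`).
    have hzero : hankelLower (J + 1) (mom ν) = 0 ∨ hankelUpper (J + 1) (mom ν) = 0 := by
      by_contra hcon
      rw [not_or] at hcon
      have : J + 1 ≤ J := Finset.le_sup (f := id) (Finset.mem_filter.2 ⟨hJ1, hcon⟩)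
      omega
    obtain ⟨hI1, hI2, hI3⟩ := tendsto_q_of_interior (t := J) hJcond hmt0
      fun s hs => hmtl s (by omega)
    set val : ι → ℝ := fun i => if hankelLower (J + 1) (mt i) < √(c i) then qLower J (mt i)
      else qUpper J (mt i) with hval
    have hsq : Tendsto (fun i => √(c i)) U (𝓝 0) := by
      have := (Real.continuous_sqrt.tendsto 0).comp hc0
      rwa [Real.sqrt_zero] at this
    -- If the lower determinant of `ν` vanishes, its estimate is o(c), hence below √c (recall c ≤ √c
    -- for c < 1), and the smallest moment is appended. If not, its estimate stays away from 0 and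
    -- exceeds √c; the upper determinant then vanishes, and the largest moment is the right one.
    have hvall : Tendsto val U (𝓝 (mom ν (J + 1))) := by
      by_cases hL : hankelLower (J + 1) (mom ν) = 0
      · rw [← qLower_eq_of_hankelLower hL]
        obtain ⟨e, he, hle⟩ := hsmallL _ hJ1 hL
        refine hI2.congr' ?_
        filter_upwards [hle, he.eventually (gt_mem_nhds one_pos),
          hc0.eventually (gt_mem_nhds one_pos)] with i hi h1 h2
        simp only [hval]
        rw [if_pos]
        have h3 : e i * c i < c i := by nlinarith [hc i]
        have h4 : c i ≤ √(c i) := Real.le_sqrt_of_sq_le (by nlinarith [hc i])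
        exact ((le_abs_self _).trans hi).trans_lt (h3.trans_le h4)
      · rw [← qUpper_eq_of_hankelUpper (hzero.resolve_left hL)]
        refine hI3.congr' ?_
        filter_upwards [hsq.eventually_lt (hLlim _ hJ1)
          (lt_of_le_of_ne (hLpos _ hJ1) (Ne.symm hL))] with i hi
        simp only [hval]
        rw [if_neg (not_lt.2 hi.le)]
    set v : ι → ℕ → ℝ := fun i => Function.update (mt i) (J + 1) (val i) with hv
    have hvmom : ∀ᶠ i in (U : Filter ι), IsMom (J + 1) (v i) := by
      filter_upwards [hI1] with i hi
      have : ∃ μ : Measure unitInterval, IsProbabilityMeasure μ ∧ (∀ s ≤ J, mom μ s = mt i s) ∧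
          mom μ (J + 1) = val i := by
        by_cases h : hankelLower (J + 1) (mt i) < √(c i)
        · simp only [hval, if_pos h]; exact hi.exists_qLower
        · simp only [hval, if_neg h]; exact hi.exists_qUpper
      obtain ⟨ρ, hρ, h1, h2⟩ := this
      refine ⟨ρ, hρ, fun s hs => ?_⟩
      simp only [hv]
      rcases eq_or_ne s (J + 1) with rfl | hne
      · rw [h2, Function.update_self]
      · rw [Function.update_of_ne hne, h1 s (by omega)]
    have hce : ∀ᶠ i in (U : Filter ι),
        correct T (c i) (mt i) = complete (J + 1) (v i) (T - (J + 1)) := by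
      filter_upwards [hiHat] with i hi
      unfold correct
      rw [if_neg (by omega), hi]
    have hxm : ∀ᶠ i in (U : Filter ι), IsMom T (correct T (c i) (mt i)) := by
      filter_upwards [hvmom, hce] with i h1 h2
      rw [h2]
      have := h1.complete (T - (J + 1))
      rwa [Nat.add_sub_cancel' (by omega)] at this
    have hxl : ∀ s ≤ J + 1, Tendsto (fun i => correct T (c i) (mt i) s) U (𝓝 (mom ν s)) := by
      intro s hs
      have h1 : Tendsto (fun i => v i s) U (𝓝 (mom ν s)) := by
        simp only [hv]
        rcases eq_or_ne s (J + 1) with rfl | hne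
        · simpa using hvall
        · simp only [Function.update_of_ne hne]
          exact hmtl s (by omega)
      refine h1.congr' ?_
      filter_upwards [hce] with i hi
      rw [hi, complete_of_le _ _ _ hs]
    have h1 := tendsto_q_of_boundary U (by omega : 1 ≤ J + 1) hJlt hzero hxm hxl
    have h2 := tendsto_q_of_boundary U (by omega : 1 ≤ J + 1) hJlt hzero
      (Eventually.of_forall fun i => (hm i).1) fun s hs => hml s (hs.trans hJlt)
    exact ⟨⟨_, h1.1, h2.1⟩, ⟨_, h1.2, h2.2⟩⟩

/-- Uniform consistency of the corrected moment vectors over a stratum of the moment space. -/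
lemma correct_uniform (T : ℕ) {η : ℝ} (hη : 0 < η) {ε : ℝ} (hε : 0 < ε) :
    ∃ δ > 0, ∀ m ∈ Strat T η, ∀ c, 0 < c → c < δ → ∀ mt : ℕ → ℝ, mt 0 = 1 →
      (∀ s ≤ T, |mt s - m s| ≤ δ * c) →
      |qLower T (correct T c mt) - qLower T m| ≤ ε ∧
      |qUpper T (correct T c mt) - qUpper T m| ≤ ε := by
  -- Counterexamples for the tolerances 1 / (n + 1) form sequences to which the limit statement
  -- applies along a nonprincipal ultrafilter, with `d` equal to that tolerance.
  by_contra hcon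
  push Not at hcon
  choose m hm c hc hcδ mt hmt0 hmt hbad using fun n : ℕ =>
    hcon (1 / ((n : ℝ) + 1)) (by positivity)
  have hd : Tendsto (fun n : ℕ => 1 / ((n : ℝ) + 1)) (hyperfilter ℕ) (𝓝 0) :=
    tendsto_one_div_add_atTop_nhds_zero_nat.mono_left Nat.hyperfilter_le_atTop
  have hc0 : Tendsto c (hyperfilter ℕ) (𝓝 0) :=
    squeeze_zero (fun n => (hc n).le) (fun n => (hcδ n).le) hd
  obtain ⟨⟨a, h1, h2⟩, b, h3, h4⟩ :=
    exists_limit_correct (hyperfilter ℕ) hη hm hc hc0 hd hmt0 hmt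
  have hl := (h1.sub h2).abs
  have hu := (h3.sub h4).abs
  simp only [sub_self, abs_zero] at hl hu
  obtain ⟨n, hn1, hn2⟩ := ((hl.eventually (gt_mem_nhds hε)).and
    (hu.eventually (gt_mem_nhds hε))).exists
  exact absurd (hbad n hn1.le) (not_lt.2 hn2.le)

/-! ### Measurability -/

/-- Needed for measurability only: since the infimum is attained, this set is the sublevel set of
`qLower T` within the moment space. It is closed because representing measures have limits along
ultrafilters. -/
lemma isClosed_isMom_le (T : ℕ) (a : ℝ) : IsClosed {m : ℕ → ℝ | ∃ μ : Measure unitInterval,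
    IsProbabilityMeasure μ ∧ (∀ s ≤ T, mom μ s = m s) ∧ mom μ (T + 1) ≤ a} := by
  rw [isClosed_iff_ultrafilter]
  intro m U hUm hmem
  classical
  have hmem' : ∀ᶠ x in (U : Filter (ℕ → ℝ)), ∃ μ : Measure unitInterval,
    IsProbabilityMeasure μ ∧ (∀ s ≤ T, mom μ s = x s) ∧ mom μ (T + 1) ≤ a := hmem
  let μ : (ℕ → ℝ) → Measure unitInterval := fun x =>
    if h : ∃ μ : Measure unitInterval, IsProbabilityMeasure μ ∧ (∀ s ≤ T, mom μ s = x s) ∧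
      mom μ (T + 1) ≤ a then h.choose else Measure.dirac 0
  have hμ : ∀ x, IsProbabilityMeasure (μ x) := fun x => by
    by_cases h : ∃ μ : Measure unitInterval, IsProbabilityMeasure μ ∧
      (∀ s ≤ T, mom μ s = x s) ∧ mom μ (T + 1) ≤ a
    · simp only [μ, dif_pos h]; exact h.choose_spec.1
    · simp only [μ, dif_neg h]; infer_instance
  have hμ' : ∀ᶠ x in (U : Filter (ℕ → ℝ)), (∀ s ≤ T, mom (μ x) s = x s) ∧
      mom (μ x) (T + 1) ≤ a := by
    filter_upwards [hmem'] with x h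
    simp only [μ, dif_pos h]; exact h.choose_spec.2
  obtain ⟨ρ, hρ, hl⟩ := exists_tendsto_mom U μ hμ
  refine ⟨ρ, hρ, fun s hs => ?_, ?_⟩
  · have h1 : Tendsto (fun x : ℕ → ℝ => x s) U (𝓝 (m s)) :=
      ((continuous_apply s).tendsto m).mono_left hUm
    refine tendsto_nhds_unique ((hl s).congr' ?_) h1
    filter_upwards [hμ'] with x hx
    exact hx.1 s hs
  · refine le_of_tendsto (hl (T + 1)) ?_
    filter_upwards [hμ'] with x hx using hx.2

lemma isClosed_isMom_ge (T : ℕ) (a : ℝ) : IsClosed {m : ℕ → ℝ | ∃ μ : Measure unitInterval,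
    IsProbabilityMeasure μ ∧ (∀ s ≤ T, mom μ s = m s) ∧ a ≤ mom μ (T + 1)} := by
  rw [isClosed_iff_ultrafilter]
  intro m U hUm hmem
  classical
  have hmem' : ∀ᶠ x in (U : Filter (ℕ → ℝ)), ∃ μ : Measure unitInterval,
    IsProbabilityMeasure μ ∧ (∀ s ≤ T, mom μ s = x s) ∧ a ≤ mom μ (T + 1) := hmem
  let μ : (ℕ → ℝ) → Measure unitInterval := fun x =>
    if h : ∃ μ : Measure unitInterval, IsProbabilityMeasure μ ∧ (∀ s ≤ T, mom μ s = x s) ∧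
      a ≤ mom μ (T + 1) then h.choose else Measure.dirac 0
  have hμ : ∀ x, IsProbabilityMeasure (μ x) := fun x => by
    by_cases h : ∃ μ : Measure unitInterval, IsProbabilityMeasure μ ∧
      (∀ s ≤ T, mom μ s = x s) ∧ a ≤ mom μ (T + 1)
    · simp only [μ, dif_pos h]; exact h.choose_spec.1
    · simp only [μ, dif_neg h]; infer_instance
  have hμ' : ∀ᶠ x in (U : Filter (ℕ → ℝ)), (∀ s ≤ T, mom (μ x) s = x s) ∧
      a ≤ mom (μ x) (T + 1) := by
    filter_upwards [hmem'] with x h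
    simp only [μ, dif_pos h]; exact h.choose_spec.2
  obtain ⟨ρ, hρ, hl⟩ := exists_tendsto_mom U μ hμ
  refine ⟨ρ, hρ, fun s hs => ?_, ?_⟩
  · have h1 : Tendsto (fun x : ℕ → ℝ => x s) U (𝓝 (m s)) :=
      ((continuous_apply s).tendsto m).mono_left hUm
    refine tendsto_nhds_unique ((hl s).congr' ?_) h1
    filter_upwards [hμ'] with x hx
    exact hx.1 s hs
  · refine ge_of_tendsto (hl (T + 1)) ?_
    filter_upwards [hμ'] with x hx using hx.2

lemma measurableSet_isMom (T : ℕ) : MeasurableSet {m : ℕ → ℝ | IsMom T m} := by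
  convert (isClosed_isMom_le T 1).measurableSet using 1
  ext m
  constructor
  · rintro ⟨μ, hμ, h⟩; exact ⟨μ, hμ, h, mom_le_one μ _⟩
  · rintro ⟨μ, hμ, h, -⟩; exact ⟨μ, hμ, h⟩

/-- The indicator discards the vectors that have no representing measure, where nothing is claimed;
almost every true vector is representable. -/
lemma measurable_qLower (T : ℕ) :
    Measurable ({m : ℕ → ℝ | IsMom T m}.indicator (qLower T)) := by
  refine measurable_of_Iic fun a => ?_
  convert (isClosed_isMom_le T a).measurableSet.union
    ((measurableSet_isMom T).compl.inter (MeasurableSet.const (0 ≤ a))) using 1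
  ext m
  by_cases hm : IsMom T m
  · simp only [Set.mem_preimage, Set.mem_Iic, Set.mem_union, Set.mem_ofPred_eq, Set.mem_inter_iff,
      Set.mem_compl_iff, hm, not_true_eq_false, false_and, or_false, Set.indicator, if_true]
    constructor
    · intro h
      obtain ⟨μ, hμ, h1, h2⟩ := IsMom.exists_qLower hm
      exact ⟨μ, hμ, h1, h2.trans_le h⟩
    · rintro ⟨μ, hμ, h1, h2⟩
      exact (qLower_le_mom T (IsMom.zero_eq_one hm) h1).trans h2
  · simp only [Set.mem_preimage, Set.mem_Iic, Set.mem_union, Set.mem_ofPred_eq, Set.mem_inter_iff,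
      Set.mem_compl_iff, hm, not_false_eq_true, true_and, Set.indicator, if_false]
    refine ⟨Or.inr, fun h => h.resolve_left ?_⟩
    rintro ⟨μ, hμ, h1, -⟩
    exact hm ⟨μ, hμ, h1⟩

lemma measurable_qUpper (T : ℕ) :
    Measurable ({m : ℕ → ℝ | IsMom T m}.indicator (qUpper T)) := by
  refine measurable_of_Ici fun a => ?_
  convert (isClosed_isMom_ge T a).measurableSet.union
    ((measurableSet_isMom T).compl.inter (MeasurableSet.const (a ≤ 0))) using 1
  ext m
  by_cases hm : IsMom T m
  · simp only [Set.mem_preimage, Set.mem_Ici, Set.mem_union, Set.mem_ofPred_eq, Set.mem_inter_iff,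
      Set.mem_compl_iff, hm, not_true_eq_false, false_and, or_false, Set.indicator, if_true]
    constructor
    · intro h
      obtain ⟨μ, hμ, h1, h2⟩ := IsMom.exists_qUpper hm
      exact ⟨μ, hμ, h1, h.trans_eq h2.symm⟩
    · rintro ⟨μ, hμ, h1, h2⟩
      exact h2.trans (mom_le_qUpper T (IsMom.zero_eq_one hm) h1)
  · simp only [Set.mem_preimage, Set.mem_Ici, Set.mem_union, Set.mem_ofPred_eq, Set.mem_inter_iff,
      Set.mem_compl_iff, hm, not_false_eq_true, true_and, Set.indicator, if_false]
    refine ⟨Or.inr, fun h => h.resolve_left ?_⟩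
    rintro ⟨μ, hμ, h1, -⟩
    exact hm ⟨μ, hμ, h1⟩

lemma continuous_hankelDet {w : Polynomial ℝ} {n t : ℕ} (hw : IsWeight w n t) :
    Continuous (hankelDet w n) := by
  obtain ⟨F, hF, h⟩ := exists_contDiff_hankelDet hw
  rw [show hankelDet w n = fun m => F fun i => m i from funext h]
  exact hF.continuous.comp (continuous_pi fun i => continuous_apply _)

lemma measurableSet_strat (T : ℕ) (η : ℝ) : MeasurableSet (Strat T η) := by
  have hL : ∀ t ∈ Finset.Icc 1 T, Measurable (hankelLower t) := fun t ht => by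
    rw [show hankelLower t = hankelDet _ _ from funext (hankelLower_eq t)]
    exact (continuous_hankelDet (isWeight_lower (Finset.mem_Icc.1 ht).1)).measurable
  have hU : ∀ t ∈ Finset.Icc 1 T, Measurable (hankelUpper t) := fun t ht => by
    rw [show hankelUpper t = hankelDet _ _ from funext (hankelUpper_eq t)]
    exact (continuous_hankelDet (isWeight_upper (Finset.mem_Icc.1 ht).1)).measurable
  have h : Strat T η = {m | IsMom T m} ∩ ⋂ t ∈ Finset.Icc 1 T,
      (({m | hankelLower t m = 0} ∪ {m | η ≤ hankelLower t m}) ∩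
        ({m | hankelUpper t m = 0} ∪ {m | η ≤ hankelUpper t m})) := by
    ext m; simp [Strat]
  rw [h]
  refine (measurableSet_isMom T).inter (Finset.measurableSet_biInter _ fun t ht => ?_)
  exact ((measurableSet_eq_fun (hL t ht) measurable_const).union
    (measurableSet_le measurable_const (hL t ht))).inter
    ((measurableSet_eq_fun (hU t ht) measurable_const).union
    (measurableSet_le measurable_const (hU t ht)))

/-- The strata exhaust the moment space. -/
lemma IsMom.exists_strat {T : ℕ} {m : ℕ → ℝ} (h : IsMom T m) :
    ∃ η > 0, ∀ η' ≤ η, m ∈ Strat T η' := by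
  have hpos : ∀ t ∈ Finset.Icc 1 T, 0 ≤ hankelLower t m ∧ 0 ≤ hankelUpper t m := by
    intro t ht
    obtain ⟨μ, hμ, hm⟩ := h
    have ht' := Finset.mem_Icc.1 ht
    have e : ∀ {w : Polynomial ℝ} {n : ℕ}, IsWeight w n t →
        hankelDet w n m = hankelDet w n (mom μ) := fun hw => by
      obtain ⟨F, -, hF⟩ := exists_contDiff_hankelDet hw
      rw [hF, hF]
      congr 1; ext i
      exact (hm i ((Nat.lt_succ_iff.1 i.2).trans ht'.2)).symm
    rw [hankelLower_eq, hankelUpper_eq, e (isWeight_lower ht'.1), e (isWeight_upper ht'.1)]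
    exact ⟨hankelDet_nonneg (isWeight_lower ht'.1).nonneg _ μ,
      hankelDet_nonneg (isWeight_upper ht'.1).nonneg _ μ⟩
  have key : ∀ a : ℝ, 0 ≤ a → ∃ η > 0, ∀ η' ≤ η, a = 0 ∨ η' ≤ a := fun a ha => by
    rcases ha.eq_or_lt with h | h
    · exact ⟨1, one_pos, fun _ _ => Or.inl h.symm⟩
    · exact ⟨a, h, fun _ h' => Or.inr h'⟩
  have key2 : ∀ t ∈ Finset.Icc 1 T, ∀ᶠ η' in 𝓝[>] (0 : ℝ),
      (hankelLower t m = 0 ∨ η' ≤ hankelLower t m) ∧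
      (hankelUpper t m = 0 ∨ η' ≤ hankelUpper t m) := fun t ht => by
    obtain ⟨a, ha, h1⟩ := key _ (hpos t ht).1
    obtain ⟨b, hb, h2⟩ := key _ (hpos t ht).2
    filter_upwards [Ioo_mem_nhdsGT (lt_min ha hb)] with x hx
    exact ⟨h1 x (hx.2.le.trans (min_le_left _ _)), h2 x (hx.2.le.trans (min_le_right _ _))⟩
  obtain ⟨η, hη1, hη2⟩ := (((Filter.eventually_all_finset _).2 key2).and
    (self_mem_nhdsWithin : ∀ᶠ x in 𝓝[>] (0 : ℝ), 0 < x)).exists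
  exact ⟨η, hη2, fun η' hη' => ⟨h, fun t ht =>
    ⟨(hη1 t ht).1.imp_right hη'.trans, (hη1 t ht).2.imp_right hη'.trans⟩⟩⟩

end FELogit
end

noncomputable section
namespace FELogit

/-! ### Polynomials in several variables -/

/-- The polynomial function with coefficients `a`. -/
def polyVal {T p ℓ : ℕ} (a : MultiIndex T p ℓ → ℝ) (z : Cov T p) : ℝ := ∑ b, a b * monomial z b

/-- The exponent vector of a multi-index. -/
def MultiIndex.toFinsupp {T p ℓ : ℕ} (b : MultiIndex T p ℓ) : Fin T × Fin p →₀ ℕ :=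
  Finsupp.equivFunOnFinite.symm fun i => (b.1 i.1 i.2 : ℕ)

lemma MultiIndex.toFinsupp_injective {T p ℓ : ℕ} :
    Function.Injective (MultiIndex.toFinsupp (T := T) (p := p) (ℓ := ℓ)) := by
  intro b b' h
  refine Subtype.ext (funext fun t => funext fun k => Fin.ext ?_)
  exact DFunLike.congr_fun h (t, k)

lemma MultiIndex.exists_toFinsupp {T p ℓ : ℕ} (d : Fin T × Fin p →₀ ℕ)
    (h : (d.sum fun _ e => e) ≤ ℓ) : ∃ b : MultiIndex T p ℓ, b.toFinsupp = d := by
  rw [Finsupp.sum_fintype _ _ fun _ => rfl] at h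
  refine ⟨⟨fun t k => ⟨d (t, k), Nat.lt_succ_iff.2 ?_⟩, ?_⟩, ?_⟩
  · exact (Finset.single_le_sum (f := fun i => d i) (fun _ _ => Nat.zero_le _)
      (Finset.mem_univ (t, k))).trans h
  · rw [← Fintype.sum_prod_type' (f := fun t k => d (t, k))]
    exact h
  · ext i; rfl

/-- The polynomial with coefficients `a`. -/
def mvPoly {T p ℓ : ℕ} (a : MultiIndex T p ℓ → ℝ) : MvPolynomial (Fin T × Fin p) ℝ :=
  ∑ b, MvPolynomial.monomial b.toFinsupp (a b)

lemma eval_mvPoly {T p ℓ : ℕ} (a : MultiIndex T p ℓ → ℝ) (z : Cov T p) :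
    MvPolynomial.eval (fun i => z i.1 i.2) (mvPoly a) = polyVal a z := by
  simp only [mvPoly, map_sum, MvPolynomial.eval_monomial, polyVal, monomial]
  refine Finset.sum_congr rfl fun b _ => ?_
  rw [Finsupp.prod_fintype _ _ fun _ => pow_zero _, Fintype.prod_prod_type]
  rfl

lemma exists_polyVal {T p ℓ : ℕ} (q : MvPolynomial (Fin T × Fin p) ℝ) (h : q.totalDegree ≤ ℓ) :
    ∃ a : MultiIndex T p ℓ → ℝ, ∀ z : Cov T p,
      MvPolynomial.eval (fun i => z i.1 i.2) q = polyVal a z := by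
  refine ⟨fun b => q.coeff b.toFinsupp, fun z => ?_⟩
  rw [← eval_mvPoly]
  congr 1
  classical
  ext d
  simp only [mvPoly, MvPolynomial.coeff_sum, MvPolynomial.coeff_monomial]
  by_cases hd : d ∈ q.support
  · obtain ⟨b, rfl⟩ := MultiIndex.exists_toFinsupp d ((MvPolynomial.le_totalDegree hd).trans h)
    rw [Finset.sum_eq_single b]
    · simp
    · intro b' _ hne
      rw [if_neg fun h => hne (MultiIndex.toFinsupp_injective h)]
    · simp
  · rw [MvPolynomial.notMem_support_iff.1 hd]
    refine (Finset.sum_eq_zero fun b _ => ?_).symm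
    split_ifs with hb
    · rw [hb, MvPolynomial.notMem_support_iff.1 hd]
    · rfl

lemma monomial_zero {T p ℓ : ℕ} (b : MultiIndex T p ℓ) :
    monomial 0 b = if b = MultiIndex.zero T p ℓ then 1 else 0 := by
  split_ifs with h
  · subst h; simp [monomial, MultiIndex.zero]
  · have : ∃ t k, (b.1 t k : ℕ) ≠ 0 := by
      by_contra hcon
      push Not at hcon
      exact h (Subtype.ext (funext fun t => funext fun k => Fin.ext (hcon t k)))
    obtain ⟨t, k, htk⟩ := this
    refine Finset.prod_eq_zero (Finset.mem_univ t) (Finset.prod_eq_zero (Finset.mem_univ k) ?_)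
    simp [htk]

lemma polyVal_zero {T p ℓ : ℕ} (a : MultiIndex T p ℓ → ℝ) :
    polyVal a 0 = a (MultiIndex.zero T p ℓ) := by
  simp [polyVal, monomial_zero]

lemma monomial_mi_zero {T p ℓ : ℕ} (z : Cov T p) : monomial z (MultiIndex.zero T p ℓ) = 1 := by
  simp [monomial, MultiIndex.zero]

lemma polyVal_sub {T p ℓ : ℕ} (a a' : MultiIndex T p ℓ → ℝ) (z : Cov T p) :
    polyVal (a - a') z = polyVal a z - polyVal a' z := by
  simp [polyVal, sub_mul]

lemma continuous_monomial {T p ℓ : ℕ} (b : MultiIndex T p ℓ) :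
    Continuous fun z : Cov T p => monomial z b := by
  unfold monomial; fun_prop

lemma continuous_polyVal {T p ℓ : ℕ} (a : MultiIndex T p ℓ → ℝ) : Continuous (polyVal a) := by
  unfold polyVal
  exact continuous_finsetSum _ fun b _ => continuous_const.mul (continuous_monomial b)

lemma monomial_smul {T p ℓ : ℕ} (h : ℝ) (z : Cov T p) (b : MultiIndex T p ℓ) :
    monomial (h • z) b = h ^ (∑ t, ∑ k, (b.1 t k : ℕ)) * monomial z b := by
  simp only [monomial, Pi.smul_apply, smul_eq_mul, mul_pow, Finset.prod_mul_distrib,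
    Finset.prod_pow_eq_pow_sum]

lemma abs_monomial_le {T p ℓ : ℕ} {R : ℝ} (hR : 1 ≤ R) {z : Cov T p} (hz : ‖z‖ ≤ R)
    (b : MultiIndex T p ℓ) : |monomial z b| ≤ R ^ ℓ := by
  have h1 : |monomial z b| ≤ R ^ (∑ t, ∑ k, (b.1 t k : ℕ)) := by
    simp only [monomial, Finset.abs_prod, abs_pow]
    rw [← Finset.prod_pow_eq_pow_sum]
    refine Finset.prod_le_prod (fun _ _ => Finset.prod_nonneg fun _ _ => by positivity)
      fun t _ => ?_
    rw [← Finset.prod_pow_eq_pow_sum]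
    refine Finset.prod_le_prod (fun _ _ => by positivity) fun k _ => ?_
    refine pow_le_pow_left₀ (abs_nonneg _) ?_ _
    exact ((norm_le_pi_norm (z t) k).trans (norm_le_pi_norm z t)).trans hz
  exact h1.trans (pow_le_pow_right₀ hR b.2)

/-- Polynomials of bounded degree are invariant under translations. -/
lemma exists_polyVal_translate {T p ℓ : ℕ} (a : MultiIndex T p ℓ → ℝ) (x : Cov T p) :
    ∃ a' : MultiIndex T p ℓ → ℝ, ∀ z, polyVal a (z - x) = polyVal a' z := by
  let q : MvPolynomial (Fin T × Fin p) ℝ := ∑ b, MvPolynomial.C (a b) *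
    ∏ i : Fin T × Fin p, (MvPolynomial.X i - MvPolynomial.C (x i.1 i.2)) ^ (b.1 i.1 i.2 : ℕ)
  have hq : q.totalDegree ≤ ℓ := by
    refine MvPolynomial.totalDegree_finsetSum_le fun b _ => ?_
    refine (MvPolynomial.totalDegree_mul _ _).trans ?_
    rw [MvPolynomial.totalDegree_C, zero_add]
    refine (MvPolynomial.totalDegree_finsetProd _ _).trans ?_
    have : ∀ i : Fin T × Fin p, ((MvPolynomial.X i - MvPolynomial.C (x i.1 i.2)) ^
        (b.1 i.1 i.2 : ℕ) : MvPolynomial (Fin T × Fin p) ℝ).totalDegree ≤ (b.1 i.1 i.2 : ℕ) := by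
      intro i
      refine (MvPolynomial.totalDegree_pow _ _).trans ?_
      have h1 : (MvPolynomial.X i - MvPolynomial.C (x i.1 i.2) :
          MvPolynomial (Fin T × Fin p) ℝ).totalDegree ≤ 1 :=
        (MvPolynomial.totalDegree_sub _ _).trans (by simp)
      nlinarith
    refine (Finset.sum_le_sum fun i _ => this i).trans ?_
    rw [Fintype.sum_prod_type]
    exact b.2
  obtain ⟨a', ha'⟩ := exists_polyVal q hq
  refine ⟨a', fun z => ?_⟩
  rw [← ha']
  simp only [q, map_sum, map_mul, map_prod, map_pow, map_sub, MvPolynomial.eval_C,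
    MvPolynomial.eval_X, polyVal, monomial, Fintype.prod_prod_type, Pi.sub_apply]

lemma polyVal_eq_zero_of_nhds {T p ℓ : ℕ} {a : MultiIndex T p ℓ → ℝ}
    (h : ∀ᶠ z in 𝓝 (0 : Cov T p), polyVal a z = 0) : a = 0 := by
  obtain ⟨r, hr, hball⟩ := Metric.nhds_basis_closedBall.mem_iff.1 h
  have h0 : mvPoly a = 0 := by
    refine MvPolynomial.funext_set (fun _ => Set.Icc (-r) r)
      (fun _ => Set.Icc_infinite (by linarith)) fun v hv => ?_
    rw [map_zero]
    have : polyVal a (fun t k => v (t, k)) = 0 := hball (by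
      rw [mem_closedBall_zero_iff]
      refine (pi_norm_le_iff_of_nonneg hr.le).2 fun t => (pi_norm_le_iff_of_nonneg hr.le).2
        fun k => ?_
      have := hv (t, k) (Set.mem_univ _)
      rw [Real.norm_eq_abs]
      exact abs_le.2 this)
    rwa [← eval_mvPoly] at this
  ext b
  have h1 := congrArg (MvPolynomial.coeff b.toFinsupp) h0
  classical
  simp only [mvPoly, MvPolynomial.coeff_sum, MvPolynomial.coeff_monomial,
    MultiIndex.toFinsupp_injective.eq_iff] at h1
  simpa using h1

/-! ### Taylor expansions -/

lemma iteratedDeriv_line {E : Type*} [NormedAddCommGroup E] [NormedSpace ℝ E] {g : E → ℝ} {n : ℕ}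
    (hg : ContDiff ℝ n g) (x v : E) (t : ℝ) :
    iteratedDeriv n (fun t : ℝ => g (x + t • v)) t = iteratedFDeriv ℝ n g (x + t • v) fun _ => v := by
  have h1 : (fun t : ℝ => g (x + t • v)) =
      (fun z => g (x + z)) ∘ (ContinuousLinearMap.toSpanSingleton ℝ v) := by
    ext t; simp [ContinuousLinearMap.toSpanSingleton_apply]
  have h2 : ContDiff ℝ n fun z => g (x + z) := hg.comp (contDiff_const.add contDiff_id)
  rw [iteratedDeriv_eq_iteratedFDeriv, h1,
    ContinuousLinearMap.iteratedFDeriv_comp_right _ h2 _ le_rfl,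
    ContinuousMultilinearMap.compContinuousLinearMap_apply, iteratedFDeriv_comp_add_left]
  simp [ContinuousLinearMap.toSpanSingleton_apply]

/-- One-dimensional Taylor expansion along the segment from `x` to `x + v`; the factor 1/ℓ! of the
remainder is dropped. -/
lemma taylor_line {E : Type*} [NormedAddCommGroup E] [NormedSpace ℝ E] {g : E → ℝ} {ℓ : ℕ}
    (hg : ContDiff ℝ (ℓ + 1 : ℕ) g) (x v : E) {C : ℝ}
    (hC : ∀ t ∈ Set.Icc (0 : ℝ) 1, ‖iteratedFDeriv ℝ (ℓ + 1) g (x + t • v)‖ ≤ C) :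
    |g (x + v) - ∑ m ∈ Finset.range (ℓ + 1),
      ((m.factorial : ℝ))⁻¹ * iteratedFDeriv ℝ m g x fun _ => v| ≤ C * ‖v‖ ^ (ℓ + 1) := by
  set f : ℝ → ℝ := fun t => g (x + t • v) with hf
  have hfc : ContDiff ℝ (ℓ + 1 : ℕ) f :=
    hg.comp (contDiff_const.add (contDiff_id.smul contDiff_const))
  have hD : ∀ m ≤ ℓ + 1, ∀ t ∈ Set.Icc (0 : ℝ) 1, iteratedDerivWithin m f (Set.Icc 0 1) t =
      iteratedFDeriv ℝ m g (x + t • v) fun _ => v := fun m hm t ht => by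
    rw [iteratedDerivWithin_eq_iteratedDeriv (uniqueDiffOn_Icc zero_lt_one)
      ((hfc.of_le (by exact_mod_cast hm)).contDiffAt) ht]
    exact iteratedDeriv_line (hg.of_le (by exact_mod_cast hm)) x v t
  have hb : ∀ y ∈ Set.Icc (0 : ℝ) 1, ‖iteratedDerivWithin (ℓ + 1) f (Set.Icc 0 1) y‖ ≤
      C * ‖v‖ ^ (ℓ + 1) := fun y hy => by
    rw [hD _ le_rfl y hy]
    refine (ContinuousMultilinearMap.le_opNorm _ _).trans ?_
    rw [Finset.prod_const, Finset.card_univ, Fintype.card_fin]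
    exact mul_le_mul_of_nonneg_right (hC y hy) (by positivity)
  have h1 := taylor_mean_remainder_bound zero_le_one (by exact_mod_cast hfc.contDiffOn)
    (Set.right_mem_Icc.2 zero_le_one) hb
  rw [taylor_within_apply, Real.norm_eq_abs] at h1
  have h2 : ∑ k ∈ Finset.range (ℓ + 1), ((k.factorial : ℝ)⁻¹ * (1 - 0) ^ k) •
      iteratedDerivWithin k f (Set.Icc 0 1) 0 = ∑ m ∈ Finset.range (ℓ + 1),
      ((m.factorial : ℝ))⁻¹ * iteratedFDeriv ℝ m g x fun _ => v :=
    Finset.sum_congr rfl fun m hm => by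
      rw [hD m (by have := Finset.mem_range.1 hm; omega) 0 (Set.left_mem_Icc.2 zero_le_one)]
      simp
  rw [h2] at h1
  have h3 : f 1 = g (x + v) := by simp [hf]
  rw [h3] at h1
  refine h1.trans ?_
  have h4 : 0 ≤ C * ‖v‖ ^ (ℓ + 1) := (norm_nonneg _).trans (hb 0 (Set.left_mem_Icc.2 zero_le_one))
  rw [sub_zero, one_pow, mul_one]
  exact div_le_self h4 (by exact_mod_cast Nat.one_le_iff_ne_zero.2 (Nat.factorial_ne_zero ℓ))

/-- Expanding every argument on the coordinate basis writes the diagonal of a multilinear map as a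
sum of products of `m` coordinates. -/
lemma exists_polyVal_multilinear {T p ℓ m : ℕ} (hm : m ≤ ℓ)
    (D : ContinuousMultilinearMap ℝ (fun _ : Fin m => Cov T p) ℝ) :
    ∃ a : MultiIndex T p ℓ → ℝ, ∀ v, (D fun _ => v) = polyVal a v := by
  let e : Fin T × Fin p → Cov T p := fun i => Pi.single i.1 (Pi.single i.2 1)
  have hv : ∀ v : Cov T p, v = ∑ i : Fin T × Fin p, v i.1 i.2 • e i := fun v => by
    ext t k
    simp only [Finset.sum_apply, Pi.smul_apply, smul_eq_mul, e, Fintype.sum_prod_type]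
    rw [Finset.sum_eq_single t, Finset.sum_eq_single k]
    · simp
    · intro k' _ hne; simp [Ne.symm hne]
    · simp
    · intro t' _ hne
      refine Finset.sum_eq_zero fun k' _ => ?_
      simp [Ne.symm hne]
    · simp
  let q : MvPolynomial (Fin T × Fin p) ℝ := ∑ r : Fin m → Fin T × Fin p,
    MvPolynomial.C (D fun i => e (r i)) * ∏ i, MvPolynomial.X (r i)
  have hq : q.totalDegree ≤ ℓ := by
    refine MvPolynomial.totalDegree_finsetSum_le fun r _ => ?_
    refine (MvPolynomial.totalDegree_mul _ _).trans ?_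
    rw [MvPolynomial.totalDegree_C, zero_add]
    refine (MvPolynomial.totalDegree_finsetProd _ _).trans ?_
    simpa using hm
  obtain ⟨a, ha⟩ := exists_polyVal q hq
  refine ⟨a, fun v => ?_⟩
  rw [← ha]
  conv_lhs => rw [hv v]
  classical
  rw [D.map_sum]
  simp only [q, map_sum, map_mul, map_prod, MvPolynomial.eval_C, MvPolynomial.eval_X]
  refine Finset.sum_congr rfl fun r _ => ?_
  rw [D.map_smul_univ (fun i => v (r i).1 (r i).2) fun i => e (r i), smul_eq_mul, mul_comm]

lemma exists_polyVal_sum {T p ℓ : ℕ} {ι : Type*} (s : Finset ι) (c : ι → ℝ)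
    (F : ι → Cov T p → ℝ)
    (h : ∀ i ∈ s, ∃ a : MultiIndex T p ℓ → ℝ, ∀ v, F i v = polyVal a v) :
    ∃ a : MultiIndex T p ℓ → ℝ, ∀ v, ∑ i ∈ s, c i * F i v = polyVal a v := by
  choose! a ha using h
  refine ⟨fun b => ∑ i ∈ s, c i * a i b, fun v => ?_⟩
  simp only [polyVal, Finset.sum_mul]
  rw [Finset.sum_comm]
  refine Finset.sum_congr rfl fun i hi => ?_
  rw [ha i hi, polyVal, Finset.mul_sum]
  exact Finset.sum_congr rfl fun b _ => by ring

/-- Taylor's theorem with a remainder that is uniform over balls. -/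
lemma exists_taylor {T p ℓ : ℕ} {g : Cov T p → ℝ} (hg : ContDiff ℝ (ℓ + 1 : ℕ) g) (R : ℝ) :
    ∃ C, 0 ≤ C ∧ ∀ x ∈ Metric.closedBall (0 : Cov T p) R, ∃ a : MultiIndex T p ℓ → ℝ,
      a (MultiIndex.zero T p ℓ) = g x ∧ ∀ z ∈ Metric.closedBall (0 : Cov T p) R,
        |g z - polyVal a (z - x)| ≤ C * ‖z - x‖ ^ (ℓ + 1) := by
  obtain ⟨C, hC⟩ := (isCompact_closedBall (0 : Cov T p) R).exists_bound_of_continuousOn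
    (hg.continuous_iteratedFDeriv (m := ℓ + 1) (by exact_mod_cast le_rfl)).continuousOn
  refine ⟨|C|, abs_nonneg C, fun x hx => ?_⟩
  obtain ⟨a, ha⟩ := exists_polyVal_sum (ℓ := ℓ) (Finset.range (ℓ + 1))
    (fun m => ((m.factorial : ℝ))⁻¹) (fun m v => iteratedFDeriv ℝ m g x fun _ => v)
    fun m hm => exists_polyVal_multilinear (by have := Finset.mem_range.1 hm; omega) _
  have key : ∀ z ∈ Metric.closedBall (0 : Cov T p) R,
      |g z - polyVal a (z - x)| ≤ |C| * ‖z - x‖ ^ (ℓ + 1) := fun z hz => by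
    have h1 := taylor_line hg x (z - x) (C := |C|) fun t ht => by
      refine (hC _ ?_).trans (le_abs_self C)
      have := (convex_closedBall (0 : Cov T p) R).add_smul_sub_mem hx hz ht
      exact this
    rwa [add_sub_cancel, ha] at h1
  refine ⟨a, ?_, key⟩
  -- At z = x the remainder bound is 0, because its exponent is positive; this identifies the
  -- intercept.
  have h1 := key x hx
  rw [sub_self, polyVal_zero, norm_zero, zero_pow (by omega), mul_zero, abs_nonpos_iff] at h1
  linarith

/-! ### Quadratic forms -/

/-- Homogeneity reduces the claim to the Euclidean unit sphere, where a continuous positive function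
has a positive minimum. -/
lemma exists_pos_quadForm {ι : Type*} [Fintype ι] (M : ι → ι → ℝ)
    (h : ∀ e : ι → ℝ, e ≠ 0 → 0 < ∑ i, ∑ j, e i * e j * M i j) :
    ∃ κ > 0, ∀ e : ι → ℝ, κ * ∑ i, e i ^ 2 ≤ ∑ i, ∑ j, e i * e j * M i j := by
  have hcont : Continuous fun e : ι → ℝ => ∑ i, ∑ j, e i * e j * M i j := by fun_prop
  set S : Set (ι → ℝ) := {e | ∑ i, e i ^ 2 = 1} with hS
  have hcomp : IsCompact S := by
    refine Metric.isCompact_of_isClosed_isBounded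
      (isClosed_eq (by fun_prop) continuous_const) ?_
    refine (Metric.isBounded_closedBall (x := (0 : ι → ℝ)) (r := 1)).subset fun e he => ?_
    rw [mem_closedBall_zero_iff]
    refine (pi_norm_le_iff_of_nonneg zero_le_one).2 fun i => ?_
    have h1 : e i ^ 2 ≤ 1 := by
      rw [← (he : ∑ i, e i ^ 2 = 1)]
      exact Finset.single_le_sum (f := fun i => e i ^ 2) (fun _ _ => sq_nonneg _)
        (Finset.mem_univ i)
    rw [Real.norm_eq_abs]
    exact abs_le_one_iff_mul_self_le_one.2 (by nlinarith)
  have hmin : ∃ κ > 0, ∀ e ∈ S, κ ≤ ∑ i, ∑ j, e i * e j * M i j := by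
    -- The sphere is empty when the index type is, for instance with no regressors; any constant
    -- works then.
    rcases S.eq_empty_or_nonempty with hE | hE
    · exact ⟨1, one_pos, by simp [hE]⟩
    · obtain ⟨e0, he0, hmin⟩ := hcomp.exists_isMinOn hE hcont.continuousOn
      refine ⟨_, h e0 ?_, fun e he => hmin he⟩
      rintro rfl
      simp [hS] at he0
  obtain ⟨κ, hκ, hmin⟩ := hmin
  refine ⟨κ, hκ, fun e => ?_⟩
  rcases (Finset.sum_nonneg fun i _ => sq_nonneg (e i) : 0 ≤ ∑ i, e i ^ 2).eq_or_lt with h0 | h0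
  · have : ∀ i, e i = 0 := fun i => by
      have := (Finset.sum_eq_zero_iff_of_nonneg fun i _ => sq_nonneg (e i)).1 h0.symm i
        (Finset.mem_univ i)
      simpa using this
    simp [this]
  · set s := √(∑ i, e i ^ 2) with hs
    have hs0 : 0 < s := Real.sqrt_pos.2 h0
    have hs2 : s ^ 2 = ∑ i, e i ^ 2 := Real.sq_sqrt h0.le
    have h1 := hmin (fun i => e i / s) (by
      simp only [hS, Set.mem_ofPred_eq, div_pow]
      rw [← Finset.sum_div, hs2, div_self h0.ne'])
    have h2 : ∑ i, ∑ j, e i / s * (e j / s) * M i j =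
        (∑ i, ∑ j, e i * e j * M i j) / s ^ 2 := by
      rw [Finset.sum_div]
      refine Finset.sum_congr rfl fun i _ => ?_
      rw [Finset.sum_div]
      refine Finset.sum_congr rfl fun j _ => ?_
      field_simp
    rw [h2, hs2, le_div_iff₀ h0] at h1
    exact h1

lemma sq_sum_abs_le {ι : Type*} [Fintype ι] (e : ι → ℝ) :
    (∑ i, |e i|) ^ 2 ≤ Fintype.card ι * ∑ i, e i ^ 2 := by
  have := sq_sum_le_card_mul_sum_sq (s := (Finset.univ : Finset ι)) (f := fun i => |e i|)
  simpa using this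

/-- An entrywise error `η` changes the form by at most η (∑ |e_i|)², and Cauchy–Schwarz turns this
into η times the dimension times ∑ e_i². -/
lemma quadForm_perturb {ι : Type*} [Fintype ι] {M A : ι → ι → ℝ} {κ η : ℝ}
    (h : ∀ e : ι → ℝ, κ * ∑ i, e i ^ 2 ≤ ∑ i, ∑ j, e i * e j * M i j)
    (hA : ∀ i j, |A i j - M i j| ≤ η) (e : ι → ℝ) :
    (κ - η * Fintype.card ι) * ∑ i, e i ^ 2 ≤ ∑ i, ∑ j, e i * e j * A i j := by
  rcases isEmpty_or_nonempty ι with hι | ⟨⟨i0⟩⟩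
  · simp
  have hη : 0 ≤ η := (abs_nonneg _).trans (hA i0 i0)
  have h1 : ∑ i, ∑ j, e i * e j * M i j - ∑ i, ∑ j, e i * e j * A i j ≤
      η * (∑ i, |e i|) ^ 2 := by
    rw [sq, Finset.sum_mul_sum, Finset.mul_sum, ← Finset.sum_sub_distrib]
    refine Finset.sum_le_sum fun i _ => ?_
    rw [Finset.mul_sum, ← Finset.sum_sub_distrib]
    refine Finset.sum_le_sum fun j _ => ?_
    rw [← mul_sub]
    refine (le_abs_self _).trans ?_
    rw [abs_mul, abs_mul, mul_comm, abs_sub_comm]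
    exact mul_le_mul_of_nonneg_right (hA i j) (by positivity)
  have h2 := mul_le_mul_of_nonneg_left (sq_sum_abs_le e) hη
  have h3 := h e
  nlinarith

end FELogit
end

noncomputable section
namespace FELogit

/-! ### Local least squares -/

lemma eq_zero_of_quadratic_nonneg {A B : ℝ} (h : ∀ t : ℝ, 0 ≤ t ^ 2 * B - 2 * t * A) : A = 0 := by
  by_contra hA
  have hB : 0 < |B| + 1 := by positivity
  have h1 := h (A / (|B| + 1))
  have h2 : (A / (|B| + 1)) ^ 2 * B ≤ (A / (|B| + 1)) ^ 2 * (|B| + 1) :=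
    mul_le_mul_of_nonneg_left ((le_abs_self B).trans (by linarith)) (sq_nonneg _)
  have h3 : (A / (|B| + 1)) ^ 2 * (|B| + 1) = A ^ 2 / (|B| + 1) := by field_simp
  have h4 : 2 * (A / (|B| + 1)) * A = 2 * (A ^ 2 / (|B| + 1)) := by ring
  have h5 : 0 < A ^ 2 / (|B| + 1) := by positivity
  linarith

/-- The normal equations of local polynomial regression. -/
lemma normal_equations {T p ℓ n j : ℕ} {K : Cov T p → ℝ} {h : ℝ} {x : ℕ → Cov T p} {s : ℕ → ℕ}
    {x₀ : Cov T p} {a : MultiIndex T p ℓ → ℝ}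
    (hmin : ∀ a', localCriterion K h ℓ n x s j x₀ a ≤ localCriterion K h ℓ n x s j x₀ a')
    (v : MultiIndex T p ℓ → ℝ) :
    ∑ i ∈ Finset.range n, K (h⁻¹ • (x i - x₀)) *
      (((if s i = j then 1 else 0) - polyVal a (x i - x₀)) * polyVal v (x i - x₀)) = 0 := by
  refine eq_zero_of_quadratic_nonneg
    (B := ∑ i ∈ Finset.range n, K (h⁻¹ • (x i - x₀)) * polyVal v (x i - x₀) ^ 2) fun t => ?_
  have h1 := hmin (a + t • v)
  unfold localCriterion at h1
  have h2 : ∀ z, ∑ b, (a + t • v) b * monomial z b = polyVal a z + t * polyVal v z := fun z => by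
    simp only [polyVal, Pi.add_apply, Pi.smul_apply, smul_eq_mul, add_mul, Finset.sum_add_distrib,
      Finset.mul_sum, mul_assoc]
  have h3 : ∀ z, ∑ b, a b * monomial z b = polyVal a z := fun z => rfl
  simp only [h2, h3] at h1
  rw [← sub_nonneg, ← Finset.sum_sub_distrib] at h1
  rw [Finset.mul_sum, Finset.mul_sum, ← Finset.sum_sub_distrib]
  refine h1.trans_eq (Finset.sum_congr rfl fun i _ => ?_)
  ring

/-- Testing the normal equations with the fit itself shows that the residual is orthogonal to it. By
Pythagoras, the weighted norm of the fit is at most that of the responses, which are bounded by 1.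
-/
lemma sum_sq_fitted_le {T p ℓ n j : ℕ} {K : Cov T p → ℝ} (hK : ∀ u, 0 ≤ K u) {h : ℝ}
    {x : ℕ → Cov T p} {s : ℕ → ℕ} {x₀ : Cov T p} {a : MultiIndex T p ℓ → ℝ}
    (hmin : ∀ a', localCriterion K h ℓ n x s j x₀ a ≤ localCriterion K h ℓ n x s j x₀ a') :
    ∑ i ∈ Finset.range n, K (h⁻¹ • (x i - x₀)) * polyVal a (x i - x₀) ^ 2 ≤
      ∑ i ∈ Finset.range n, K (h⁻¹ • (x i - x₀)) := by
  have h1 := normal_equations hmin a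
  have h2 : 0 ≤ ∑ i ∈ Finset.range n, K (h⁻¹ • (x i - x₀)) *
      ((if s i = j then 1 else 0) - polyVal a (x i - x₀)) ^ 2 :=
    Finset.sum_nonneg fun i _ => mul_nonneg (hK _) (sq_nonneg _)
  have h3 : ∑ i ∈ Finset.range n, K (h⁻¹ • (x i - x₀)) *
      ((if s i = j then 1 else 0) - polyVal a (x i - x₀)) ^ 2 =
      ∑ i ∈ Finset.range n, K (h⁻¹ • (x i - x₀)) * (if s i = j then 1 else 0) ^ 2 -
      2 * ∑ i ∈ Finset.range n, K (h⁻¹ • (x i - x₀)) *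
      (((if s i = j then 1 else 0) - polyVal a (x i - x₀)) * polyVal a (x i - x₀)) -
      ∑ i ∈ Finset.range n, K (h⁻¹ • (x i - x₀)) * polyVal a (x i - x₀) ^ 2 := by
    rw [Finset.mul_sum, ← Finset.sum_sub_distrib, ← Finset.sum_sub_distrib]
    exact Finset.sum_congr rfl fun i _ => by ring
  rw [h3, h1] at h2
  have h4 : ∑ i ∈ Finset.range n, K (h⁻¹ • (x i - x₀)) * (if s i = j then (1 : ℝ) else 0) ^ 2 ≤
      ∑ i ∈ Finset.range n, K (h⁻¹ • (x i - x₀)) := by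
    refine Finset.sum_le_sum fun i _ => ?_
    refine (mul_le_mul_of_nonneg_left ?_ (hK _)).trans_eq (mul_one _)
    split_ifs <;> norm_num
  linarith

/-- The sum of the leverages is at most the dimension. -/
lemma sum_sq_diag_le {ι : Type*} [Fintype ι] (W : Submodule ℝ (EuclideanSpace ℝ ι))
    (f : ι → EuclideanSpace ℝ ι) (hf : ∀ i, f i ∈ W) {M : ℝ} (hM : ∀ i, ‖f i‖ ^ 2 ≤ M) :
    ∑ i, (f i i) ^ 2 ≤ Module.finrank ℝ W * M := by
  let b := stdOrthonormalBasis ℝ W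
  -- Cauchy–Schwarz in an orthonormal basis of `W`. The factor ∑_k b_k(i)² is the leverage of `i`;
  -- summed over `i`, it gives the dimension.
  have h1 : ∀ i, (f i i) ^ 2 ≤ M * ∑ k, ((b k : EuclideanSpace ℝ ι) i) ^ 2 := fun i => by
    have e1 : f i i = ∑ k, inner ℝ (b k) (⟨f i, hf i⟩ : W) * (b k : EuclideanSpace ℝ ι) i := by
      have := congrArg (fun w : W => (w : EuclideanSpace ℝ ι) i) (b.sum_repr' ⟨f i, hf i⟩)
      simpa using this.symm
    rw [e1]
    refine (Finset.sum_mul_sq_le_sq_mul_sq _ _ _).trans ?_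
    refine mul_le_mul_of_nonneg_right ?_ (Finset.sum_nonneg fun _ _ => sq_nonneg _)
    refine le_trans (le_of_eq ?_) (hM i)
    have := b.sum_sq_norm_inner_right (⟨f i, hf i⟩ : W)
    simpa using this
  refine (Finset.sum_le_sum fun i _ => h1 i).trans ?_
  rw [← Finset.mul_sum, Finset.sum_comm]
  have h2 : ∀ k, ∑ i, ((b k : EuclideanSpace ℝ ι) i) ^ 2 = 1 := fun k => by
    have := b.norm_eq_one k
    rw [Submodule.coe_norm] at this
    have h3 := EuclideanSpace.norm_sq_eq (b k : EuclideanSpace ℝ ι)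
    rw [this] at h3
    simpa using h3.symm
  simp only [h2]
  simp [mul_comm]

/-- Polynomials centred at different points of the cell all restrict to one space of functions on
the cell, because degree is translation invariant. The intercept at x_i is the fitted function
evaluated at x_i, a diagonal value, so the leverage bound applies. -/
lemma sum_sq_fitted_cell {T p ℓ : ℕ} (S : Finset ℕ) (x : ℕ → Cov T p)
    (a : ℕ → MultiIndex T p ℓ → ℝ) {M : ℝ} (hM0 : 0 ≤ M)
    (hM : ∀ i ∈ S, ∑ k ∈ S, polyVal (a i) (x k - x i) ^ 2 ≤ M) :
    ∑ i ∈ S, a i (MultiIndex.zero T p ℓ) ^ 2 ≤ Fintype.card (MultiIndex T p ℓ) * M := by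
  let φ : MultiIndex T p ℓ → EuclideanSpace ℝ S := fun b =>
    WithLp.toLp 2 fun k : S => monomial (x k) b
  let W := Submodule.span ℝ (Set.range φ)
  let f : S → EuclideanSpace ℝ S := fun i =>
    WithLp.toLp 2 fun k : S => polyVal (a i) (x k - x i)
  have hf : ∀ i, f i ∈ W := fun i => by
    obtain ⟨a', ha'⟩ := exists_polyVal_translate (a i) (x i)
    have : f i = ∑ b, a' b • φ b := by
      ext k
      simp only [f, ha']
      simp [polyVal, φ]
    rw [this]
    exact Submodule.sum_mem _ fun b _ => Submodule.smul_mem _ _ (Submodule.subset_span ⟨b, rfl⟩)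
  have h1 := sum_sq_diag_le W f hf (M := M) fun i => by
    rw [EuclideanSpace.norm_sq_eq]
    simp only [f, Real.norm_eq_abs, sq_abs]
    have := hM i i.2
    rwa [← Finset.sum_coe_sort S fun k => polyVal (a i) (x k - x i) ^ 2] at this
  have h2 : ∀ i : S, f i i = a i (MultiIndex.zero T p ℓ) := fun i => by
    simp [f, polyVal_zero]
  simp only [h2] at h1
  rw [Finset.sum_coe_sort S fun i => a i (MultiIndex.zero T p ℓ) ^ 2] at h1
  refine h1.trans (mul_le_mul_of_nonneg_right ?_ hM0)
  exact_mod_cast finrank_range_le_card φ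

lemma IsKernel.continuous {T p : ℕ} {K : Cov T p → ℝ} (hK : IsKernel K) : Continuous K := by
  obtain ⟨L, hL⟩ := hK.lipschitz
  exact hL.continuous

lemma IsKernel.exists_bounds {T p : ℕ} {K : Cov T p → ℝ} (hK : IsKernel K) :
    ∃ B R r κ : ℝ, 0 < B ∧ 1 ≤ R ∧ 0 < r ∧ 0 < κ ∧ (∀ u, K u ≤ B) ∧ (∀ u, R < ‖u‖ → K u = 0) ∧
      (∀ u, ‖u‖ ≤ r → κ ≤ K u) := by
  obtain ⟨B, hB⟩ := hK.hasCompactSupport.exists_bound_of_continuous hK.continuous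
  obtain ⟨R, hR⟩ := hK.hasCompactSupport.isCompact.isBounded.exists_norm_le
  have h0 : 0 < K 0 := hK.pos_near_zero.self_of_nhds
  have h1 : ∀ᶠ u in 𝓝 (0 : Cov T p), K 0 / 2 < K u :=
    hK.continuous.continuousAt.eventually (lt_mem_nhds (half_lt_self h0))
  obtain ⟨r, hr, hball⟩ := Metric.nhds_basis_closedBall.mem_iff.1 h1
  refine ⟨|B| + 1, max R 1, r, K 0 / 2, by positivity, le_max_right _ _, hr, half_pos h0,
    fun u => ?_, fun u hu => ?_, fun u hu => ?_⟩
  · have := hB u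
    rw [Real.norm_eq_abs] at this
    linarith [le_abs_self (K u), le_abs_self B]
  · by_contra hne
    have := hR u (subset_tsupport _ hne)
    exact absurd ((le_max_left R 1).trans_lt hu) (not_lt.2 this)
  · exact (hball (mem_closedBall_zero_iff.2 hu) : K 0 / 2 < K u).le

/-- The cell of side `w` containing `x`. -/
def cell {T p : ℕ} (w : ℝ) (x : Cov T p) : Fin T → Fin p → ℤ := fun t k => ⌊x t k / w⌋

lemma norm_sub_le_of_cell_eq {T p : ℕ} {w : ℝ} (hw : 0 < w) {x y : Cov T p}
    (h : cell w x = cell w y) : ‖x - y‖ ≤ w := by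
  refine (pi_norm_le_iff_of_nonneg hw.le).2 fun t => (pi_norm_le_iff_of_nonneg hw.le).2 fun k => ?_
  have h1 : ⌊x t k / w⌋ = ⌊y t k / w⌋ := congrFun (congrFun h t) k
  have h2 := Int.abs_sub_lt_one_of_floor_eq_floor h1
  rw [← sub_div, abs_div, abs_of_pos hw, div_lt_one hw] at h2
  exact h2.le

lemma cell_mem_Icc {T p : ℕ} {w ρ : ℝ} (hw : 0 < w) {m : ℕ} (hm : ρ / w + 1 ≤ m) {x y : Cov T p}
    (h : ‖x - y‖ ≤ ρ) : cell w y ∈ Finset.Icc (cell w x - fun _ _ => (m : ℤ))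
      (cell w x + fun _ _ => (m : ℤ)) := by
  have h1 : ∀ t k, |x t k / w - y t k / w| ≤ ρ / w := fun t k => by
    rw [← sub_div, abs_div, abs_of_pos hw]
    refine div_le_div_of_nonneg_right ?_ hw.le
    exact ((norm_le_pi_norm ((x - y) t) k).trans (norm_le_pi_norm (x - y) t)).trans h
  rw [Finset.mem_Icc]
  constructor <;> intro t k
  · simp only [Pi.sub_apply, cell]
    have := (abs_le.1 (h1 t k)).2
    have a1 := Int.floor_le (x t k / w)
    have a2 := Int.lt_floor_add_one (y t k / w)
    have : ((⌊x t k / w⌋ - m : ℤ) : ℝ) < (⌊y t k / w⌋ : ℤ) + 1 := by push_cast; linarith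
    have : ⌊x t k / w⌋ - (m : ℤ) < ⌊y t k / w⌋ + 1 := by exact_mod_cast this
    omega
  · simp only [Pi.add_apply, cell]
    have := (abs_le.1 (h1 t k)).1
    have a1 := Int.floor_le (y t k / w)
    have a2 := Int.lt_floor_add_one (x t k / w)
    have : ((⌊y t k / w⌋ : ℤ) : ℝ) < (⌊x t k / w⌋ + m + 1 : ℤ) := by push_cast; linarith
    have : ⌊y t k / w⌋ < ⌊x t k / w⌋ + (m : ℤ) + 1 := by exact_mod_cast this
    omega

lemma card_Icc_cell {T p : ℕ} (q : Fin T → Fin p → ℤ) (m : ℕ) :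
    (Finset.Icc (q - fun _ _ => (m : ℤ)) (q + fun _ _ => (m : ℤ))).card = (2 * m + 1) ^ (p * T) := by
  rw [Pi.card_Icc]
  simp only [Pi.card_Icc, Int.card_Icc, Pi.add_apply, Pi.sub_apply]
  have : ∀ t k, (q t k + (m : ℤ) + 1 - (q t k - m)).toNat = 2 * m + 1 := fun t k => by omega
  simp [this, pow_mul]

/-- The local polynomial estimates at the sample points are bounded in quadratic mean, whatever
the sample. -/
theorem exists_sum_sq_localPoly_le {T p : ℕ} {K : Cov T p → ℝ} (hK : IsKernel K) (ℓ : ℕ) :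
    ∃ A : ℝ, 0 ≤ A ∧ ∀ (n : ℕ) (x : ℕ → Cov T p) (s : ℕ → ℕ) (j : ℕ) (h : ℝ), 0 < h →
      ∀ g : ℕ → ℝ, (∀ i < n, IsLocalPolyEstimate K h ℓ n x s j (x i) (g i)) →
      ∑ i ∈ Finset.range n, g i ^ 2 ≤ A * n := by
  obtain ⟨B, R, r, κ, hB, hR, hr, hκ, hKB, hKR, hKr⟩ := hK.exists_bounds
  obtain ⟨m, hm⟩ := exists_nat_ge (R / r + 1)
  -- The three factors are the dimension of the polynomial space, the ratio between the upper bound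
  -- of the kernel and its lower bound near 0, and the number of cells that the window of one
  -- observation can meet.
  refine ⟨Fintype.card (MultiIndex T p ℓ) * (B / κ * (2 * m + 1) ^ (p * T)), by positivity,
    fun n x s j h hh g hg => ?_⟩
  have hg' : ∀ i, ∃ a : MultiIndex T p ℓ → ℝ, i < n → (∀ a', localCriterion K h ℓ n x s j (x i) a ≤
      localCriterion K h ℓ n x s j (x i) a') ∧ g i = a (MultiIndex.zero T p ℓ) := fun i => by
    by_cases hi : i < n
    · obtain ⟨a, ha⟩ := hg i hi
      exact ⟨a, fun _ => ha⟩
    · exact ⟨0, fun h => absurd h hi⟩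
  choose a ha using hg'
  have hw : 0 < h * r := by positivity
  set q : ℕ → Fin T → Fin p → ℤ := fun i => cell (h * r) (x i) with hq
  classical
  -- `N c` counts the observations whose cell is within `m` of `c`; these include every observation
  -- receiving positive weight at some sample point of `c`.
  let N : (Fin T → Fin p → ℤ) → ℕ := fun c => ((Finset.range n).filter fun k =>
    c ∈ Finset.Icc (q k - fun _ _ => (m : ℤ)) (q k + fun _ _ => (m : ℤ))).card
  have hcell : ∀ c ∈ (Finset.range n).image q,
      ∑ i ∈ (Finset.range n).filter (fun i => q i = c), g i ^ 2 ≤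
        Fintype.card (MultiIndex T p ℓ) * (B / κ * N c) := by
    intro c _
    -- Two points in a cell of side h r have rescaled distance at most r, where K is at least κ. On
    -- the cell, the unweighted sum of squares is thus at most 1/κ times the weighted one, which is
    -- at most the total kernel weight, itself at most B N(c). The design need not be invertible.
    have h1 : ∀ i ∈ (Finset.range n).filter (fun i => q i = c),
        ∑ k ∈ (Finset.range n).filter (fun i => q i = c), polyVal (a i) (x k - x i) ^ 2 ≤
          B / κ * N c := by
      intro i hi
      obtain ⟨hin, hic⟩ := Finset.mem_filter.1 hi
      have hmin := (ha i (Finset.mem_range.1 hin)).1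
      have h2 := sum_sq_fitted_le hK.nonneg hmin
      have h3 : κ * ∑ k ∈ (Finset.range n).filter (fun i => q i = c),
          polyVal (a i) (x k - x i) ^ 2 ≤
          ∑ k ∈ Finset.range n, K (h⁻¹ • (x k - x i)) * polyVal (a i) (x k - x i) ^ 2 := by
        rw [Finset.mul_sum]
        refine (Finset.sum_le_sum fun k hk => ?_).trans (Finset.sum_le_sum_of_subset_of_nonneg
          (Finset.filter_subset (fun i => q i = c) _)
          fun k _ _ => mul_nonneg (hK.nonneg _) (sq_nonneg _))
        refine mul_le_mul_of_nonneg_right (hKr _ ?_) (sq_nonneg _)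
        have h4 := norm_sub_le_of_cell_eq hw ((Finset.mem_filter.1 hk).2.trans hic.symm)
        rw [norm_smul, norm_inv, Real.norm_eq_abs, abs_of_pos hh, inv_mul_le_iff₀ hh]
        exact h4
      have h5 : ∑ k ∈ Finset.range n, K (h⁻¹ • (x k - x i)) ≤ B * N c := by
        rw [← Finset.sum_filter_add_sum_filter_not (Finset.range n) fun k =>
          c ∈ Finset.Icc (q k - fun _ _ => (m : ℤ)) (q k + fun _ _ => (m : ℤ))]
        have h6 : ∑ k ∈ (Finset.range n).filter (fun k =>
            ¬ c ∈ Finset.Icc (q k - fun _ _ => (m : ℤ)) (q k + fun _ _ => (m : ℤ))),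
            K (h⁻¹ • (x k - x i)) = 0 := by
          refine Finset.sum_eq_zero fun k hk => hKR _ ?_
          by_contra hle
          rw [not_lt, norm_smul, norm_inv, Real.norm_eq_abs, abs_of_pos hh,
            inv_mul_le_iff₀ hh] at hle
          refine (Finset.mem_filter.1 hk).2 ?_
          rw [← hic]
          refine cell_mem_Icc hw ?_ hle
          rwa [mul_div_mul_left _ _ hh.ne']
        rw [h6, add_zero]
        refine (Finset.sum_le_card_nsmul _ _ B fun k _ => hKB _).trans_eq ?_
        rw [nsmul_eq_mul, mul_comm]
      rw [div_mul_eq_mul_div, le_div_iff₀ hκ, mul_comm]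
      exact h3.trans (h2.trans h5)
    have h2 := sum_sq_fitted_cell _ x a (by positivity) h1
    refine le_trans (le_of_eq (Finset.sum_congr rfl fun i hi => ?_)) h2
    rw [(ha i (Finset.mem_range.1 (Finset.mem_filter.1 hi).1)).2]
  rw [← Finset.sum_fiberwise_of_maps_to (g := q) (t := (Finset.range n).image q)
    fun i hi => Finset.mem_image_of_mem q hi]
  refine (Finset.sum_le_sum hcell).trans ?_
  rw [← Finset.mul_sum, ← Finset.mul_sum, mul_assoc, mul_assoc]
  refine mul_le_mul_of_nonneg_left (mul_le_mul_of_nonneg_left ?_ (by positivity)) (by positivity)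
  -- Exchanging the sums, each observation is counted for at most (2m+1)^(pT) cells.
  have h7 : ∑ c ∈ (Finset.range n).image q, N c ≤ n * (2 * m + 1) ^ (p * T) := by
    simp only [N, Finset.card_filter]
    rw [Finset.sum_comm]
    refine (Finset.sum_le_card_nsmul _ _ ((2 * m + 1) ^ (p * T)) fun k _ => ?_).trans_eq (by simp)
    rw [← Finset.card_filter, ← card_Icc_cell (q k) m]
    refine Finset.card_le_card fun c hc => (Finset.mem_filter.1 hc).2
  have h8 : ((∑ c ∈ (Finset.range n).image q, N c : ℕ) : ℝ) ≤
      ((n * (2 * m + 1) ^ (p * T) : ℕ) : ℝ) := by exact_mod_cast h7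
  push_cast at h8
  linarith

/-- The error of a local polynomial estimate at a point with a well-conditioned design. -/
theorem abs_localPoly_sub_le {T p ℓ n j : ℕ} {K : Cov T p → ℝ} {h : ℝ} (hh : 0 < h)
    {x : ℕ → Cov T p} {s : ℕ → ℕ} {x₀ : Cov T p} {g : ℝ}
    (hg : IsLocalPolyEstimate K h ℓ n x s j x₀ g) {N κ τ : ℝ} (hκ : 0 < κ)
    {G : Cov T p → ℝ} {a₀ : MultiIndex T p ℓ → ℝ}
    (hdesign : ∀ e : MultiIndex T p ℓ → ℝ, κ * ∑ b, e b ^ 2 ≤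
      N⁻¹ * ∑ i ∈ Finset.range n, K (h⁻¹ • (x i - x₀)) * polyVal e (h⁻¹ • (x i - x₀)) ^ 2)
    (hnoise : ∀ b : MultiIndex T p ℓ, |N⁻¹ * ∑ i ∈ Finset.range n, K (h⁻¹ • (x i - x₀)) *
      (monomial (h⁻¹ • (x i - x₀)) b * ((if s i = j then 1 else 0) - G (x i)))| ≤ τ)
    (hbias : ∀ b : MultiIndex T p ℓ, |N⁻¹ * ∑ i ∈ Finset.range n, K (h⁻¹ • (x i - x₀)) *
      (monomial (h⁻¹ • (x i - x₀)) b * (G (x i) - polyVal a₀ (x i - x₀)))| ≤ τ) :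
    |g - a₀ (MultiIndex.zero T p ℓ)| ≤ 2 * Fintype.card (MultiIndex T p ℓ) * τ / κ := by
  obtain ⟨a, hmin, rfl⟩ := hg
  -- Coefficient errors are rescaled by h^|b|, so that they multiply monomials in (x_i - x₀)/h; the
  -- intercept is unaffected.
  set e : MultiIndex T p ℓ → ℝ := fun b => h ^ (∑ t, ∑ k, (b.1 t k : ℕ)) * (a b - a₀ b) with he
  have hev : ∀ z, polyVal e (h⁻¹ • z) = polyVal (a - a₀) z := fun z => by
    simp only [polyVal, monomial_smul, he, Pi.sub_apply]
    refine Finset.sum_congr rfl fun b _ => ?_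
    rw [inv_pow]
    have : h ^ (∑ t, ∑ k, (b.1 t k : ℕ)) ≠ 0 := by positivity
    field_simp
  -- Testing with the error polynomial itself expresses its weighted sum of squares as a linear form
  -- in `e` with a noise part and a bias part.
  have h1 := normal_equations hmin (a - a₀)
  have h2 : ∑ i ∈ Finset.range n, K (h⁻¹ • (x i - x₀)) * polyVal e (h⁻¹ • (x i - x₀)) ^ 2 =
      ∑ b, e b * (∑ i ∈ Finset.range n, K (h⁻¹ • (x i - x₀)) *
        (monomial (h⁻¹ • (x i - x₀)) b * ((if s i = j then 1 else 0) - G (x i))) +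
        ∑ i ∈ Finset.range n, K (h⁻¹ • (x i - x₀)) *
        (monomial (h⁻¹ • (x i - x₀)) b * (G (x i) - polyVal a₀ (x i - x₀)))) := by
    rw [← add_zero (∑ i ∈ Finset.range n, K (h⁻¹ • (x i - x₀)) * polyVal e _ ^ 2)]
    refine (congrArg _ h1).symm.trans ?_
    simp only [← Finset.sum_add_distrib, Finset.mul_sum]
    rw [Finset.sum_comm]
    refine Finset.sum_congr rfl fun i _ => ?_
    have h3 : ∑ b, e b * (K (h⁻¹ • (x i - x₀)) *
        (monomial (h⁻¹ • (x i - x₀)) b * ((if s i = j then 1 else 0) - G (x i))) +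
        K (h⁻¹ • (x i - x₀)) *
        (monomial (h⁻¹ • (x i - x₀)) b * (G (x i) - polyVal a₀ (x i - x₀)))) =
        K (h⁻¹ • (x i - x₀)) * ((if s i = j then 1 else 0) - polyVal a₀ (x i - x₀)) *
          polyVal e (h⁻¹ • (x i - x₀)) := by
      rw [show polyVal e (h⁻¹ • (x i - x₀)) = ∑ b, e b * monomial (h⁻¹ • (x i - x₀)) b from rfl,
        Finset.mul_sum]
      exact Finset.sum_congr rfl fun b _ => by ring
    rw [h3, hev, polyVal_sub]
    ring
  have h3 := hdesign e
  rw [h2, Finset.mul_sum (a := N⁻¹)] at h3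
  have h4 : ∑ b, N⁻¹ * (e b * (∑ i ∈ Finset.range n, K (h⁻¹ • (x i - x₀)) *
        (monomial (h⁻¹ • (x i - x₀)) b * ((if s i = j then 1 else 0) - G (x i))) +
        ∑ i ∈ Finset.range n, K (h⁻¹ • (x i - x₀)) *
        (monomial (h⁻¹ • (x i - x₀)) b * (G (x i) - polyVal a₀ (x i - x₀))))) ≤
      2 * τ * ∑ b, |e b| := by
    rw [Finset.mul_sum]
    refine Finset.sum_le_sum fun b _ => ?_
    refine (le_abs_self _).trans ?_
    rw [mul_left_comm, mul_add, abs_mul, mul_comm]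
    refine mul_le_mul_of_nonneg_right ?_ (abs_nonneg _)
    refine (abs_add_le _ _).trans ?_
    linarith [hnoise b, hbias b]
  set E := ∑ b, |e b| with hE
  have hE0 : 0 ≤ E := Finset.sum_nonneg fun _ _ => abs_nonneg _
  have h5 := sq_sum_abs_le e
  set D : ℝ := (Fintype.card (MultiIndex T p ℓ) : ℝ) with hD
  have hD0 : 0 ≤ D := Nat.cast_nonneg _
  have hτ : 0 ≤ τ := (abs_nonneg _).trans (hnoise (MultiIndex.zero T p ℓ))
  -- The form is quadratic in `e` from below and linear from above, so one factor `E` can be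
  -- cancelled.
  have h6 : κ * E ^ 2 ≤ D * (2 * τ * E) :=
    calc κ * E ^ 2 ≤ κ * (D * ∑ b, e b ^ 2) := mul_le_mul_of_nonneg_left h5 hκ.le
      _ = D * (κ * ∑ b, e b ^ 2) := by ring
      _ ≤ D * (2 * τ * E) := mul_le_mul_of_nonneg_left (h3.trans h4) hD0
  have h7 : E ≤ 2 * D * τ / κ := by
    rw [le_div_iff₀ hκ]
    rcases hE0.eq_or_lt with h0 | h0
    · rw [← h0, zero_mul]; positivity
    · refine le_of_mul_le_mul_right (?_ : E * κ * E ≤ 2 * D * τ * E) h0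
      linarith
  have h8 : a (MultiIndex.zero T p ℓ) - a₀ (MultiIndex.zero T p ℓ) = e (MultiIndex.zero T p ℓ) := by
    simp [he, MultiIndex.zero]
  rw [h8]
  exact (Finset.single_le_sum (f := fun b => |e b|) (fun _ _ => abs_nonneg _)
    (Finset.mem_univ _)).trans h7

/-- The matrix of kernel moments. -/
def kernelMoment {T p ℓ : ℕ} (K : Cov T p → ℝ) (b b' : MultiIndex T p ℓ) : ℝ :=
  ∫ u, K u * (monomial u b * monomial u b')

lemma IsKernel.integrable_mul {T p : ℕ} {K : Cov T p → ℝ} (hK : IsKernel K) {φ : Cov T p → ℝ}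
    (hφ : Continuous φ) : Integrable fun u => K u * φ u :=
  (hK.continuous.mul hφ).integrable_of_hasCompactSupport hK.hasCompactSupport.mul_right

/-- The form is the integral of K P². If it vanishes, then P is zero near the origin, where K is
positive, and hence is the zero polynomial. -/
lemma IsKernel.exists_kernelMoment_pos {T p : ℕ} {K : Cov T p → ℝ} (hK : IsKernel K) (ℓ : ℕ) :
    ∃ κ > 0, ∀ e : MultiIndex T p ℓ → ℝ, κ * ∑ b, e b ^ 2 ≤
      ∑ b, ∑ b', e b * e b' * kernelMoment K b b' := by
  refine exists_pos_quadForm _ fun e he => ?_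
  have h1 : ∑ b, ∑ b', e b * e b' * kernelMoment K b b' = ∫ u, K u * polyVal e u ^ 2 := by
    simp only [kernelMoment, ← integral_const_mul]
    have hint : ∀ b b' : MultiIndex T p ℓ, Integrable fun u : Cov T p =>
        e b * e b' * (K u * (monomial u b * monomial u b')) := fun b b' =>
      (hK.integrable_mul ((continuous_monomial b).mul (continuous_monomial b'))).const_mul _
    simp_rw [← integral_finsetSum _ fun b' _ => hint _ b']
    rw [← integral_finsetSum _ fun b _ => integrable_finsetSum _ fun b' _ => hint b b']
    congr 1; ext u
    rw [polyVal, sq, Finset.sum_mul_sum, Finset.mul_sum]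
    refine Finset.sum_congr rfl fun b _ => ?_
    rw [Finset.mul_sum]
    exact Finset.sum_congr rfl fun b' _ => by ring
  rw [h1]
  have hnn : 0 ≤ fun u => K u * polyVal e u ^ 2 := fun u => mul_nonneg (hK.nonneg u) (sq_nonneg _)
  have hcont : Continuous fun u => K u * polyVal e u ^ 2 :=
    hK.continuous.mul ((continuous_polyVal e).pow 2)
  refine (integral_nonneg hnn).lt_of_ne fun h0 => he ?_
  have h2 := (integral_eq_zero_iff_of_nonneg hnn
    (hK.integrable_mul ((continuous_polyVal e).pow 2))).1 h0.symm
  have h3 := (hcont.ae_eq_iff_eq volume continuous_const).1 h2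
  refine polyVal_eq_zero_of_nhds ?_
  filter_upwards [hK.pos_near_zero] with u hu
  have h4 := congrFun h3 u
  have := (mul_eq_zero.1 h4).resolve_left hu.ne'
  exact pow_eq_zero_iff (two_ne_zero) |>.1 this

end FELogit
end

noncomputable section
namespace FELogit

/-! ### A quantitative Jensen inequality -/

/-- For u ≥ 0 the coefficient 1/2 would do. For u in [-b, 0], the difference of the two sides is
antitone and vanishes at 0, since e^z ≤ 1/(1 - z) ≤ 1 + 2kz for k = 1/(2(1+b)). -/
lemma exp_lower_quadratic {b u : ℝ} (hb : 0 ≤ b) (hu : |u| ≤ b) :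
    1 + u + (2 * (1 + b))⁻¹ * u ^ 2 ≤ Real.exp u := by
  have hk : (2 * (1 + b))⁻¹ ≤ 2⁻¹ := inv_anti₀ (by norm_num) (by linarith)
  rcases le_total 0 u with h0 | h0
  · have := Real.quadratic_le_exp_of_nonneg h0
    nlinarith [sq_nonneg u]
  · set k := (2 * (1 + b))⁻¹ with hkd
    set g : ℝ → ℝ := fun u => Real.exp u - (1 + u + k * u ^ 2) with hg
    have hderiv : ∀ z, HasDerivAt g (Real.exp z - (1 + k * (2 * z))) z := fun z => by
      have h1 : HasDerivAt (fun u : ℝ => 1 + u + k * u ^ 2) (1 + k * (2 * z)) z := by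
        refine (((hasDerivAt_id z).const_add 1).add
          (((hasDerivAt_id z).pow 2).const_mul k)).congr_deriv ?_
        simp
      exact (Real.hasDerivAt_exp z).sub h1
    have hanti : AntitoneOn g (Set.Icc (-b) 0) := by
      refine antitoneOn_of_deriv_nonpos (convex_Icc _ _)
        (fun z _ => (hderiv z).continuousAt.continuousWithinAt)
        (fun z _ => (hderiv z).differentiableAt.differentiableWithinAt) fun z hz => ?_
      rw [interior_Icc] at hz
      rw [(hderiv z).deriv]
      have h1 : Real.exp z * (1 - z) ≤ 1 := by
        have := Real.add_one_le_exp (-z)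
        have h2 : Real.exp z * Real.exp (-z) = 1 := by rw [← Real.exp_add]; simp
        nlinarith [Real.exp_pos z]
      have h2 : k * 2 * (1 + b) = 1 := by rw [hkd]; field_simp
      have h3 : 0 < k := by positivity
      have h4 : Real.exp z ≤ 1 / (1 - z) := by
        rw [le_div_iff₀ (by linarith [hz.2])]; exact h1
      have h5 : 1 / (1 - z) ≤ 1 + k * (2 * z) := by
        rw [div_le_iff₀ (by linarith [hz.2])]
        have h6 : k * 2 * (1 - z) ≤ 1 := by
          rw [← h2]; exact mul_le_mul_of_nonneg_left (by linarith [hz.1]) (by positivity)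
        nlinarith [hz.2]
      linarith
    have h1 := hanti ⟨(abs_le.1 hu).1, h0⟩ (Set.right_mem_Icc.2 (by linarith)) h0
    simp only [hg] at h1
    norm_num at h1
    linarith

/-- Jensen's inequality with a variance gain. After centring, the mean of exp is at least 1 + kV
with V the variance. Then log(1 + y) ≥ y/(1 + y) and V ≤ b² give the constant k/(1 + kb²), which
depends on neither the weights nor the index set. -/
lemma exists_log_sum_exp_ge {B : ℝ} (hB : 0 ≤ B) : ∃ κ > 0, ∀ {ι : Type} (s : Finset ι)
    (w v : ι → ℝ), (∀ i ∈ s, 0 ≤ w i) → ∑ i ∈ s, w i = 1 → (∀ i ∈ s, |v i| ≤ B) →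
    ∑ i ∈ s, w i * v i + κ * ∑ i ∈ s, w i * (v i - ∑ j ∈ s, w j * v j) ^ 2 ≤
      Real.log (∑ i ∈ s, w i * Real.exp (v i)) := by
  set b := 2 * B with hb
  set k := (2 * (1 + b))⁻¹ with hk
  have hk0 : 0 < k := by positivity
  refine ⟨k / (1 + k * b ^ 2), by positivity, fun s w v hw hsum hv => ?_⟩
  set m := ∑ j ∈ s, w j * v j with hm
  set V := ∑ i ∈ s, w i * (v i - m) ^ 2 with hV
  have hmB : |m| ≤ B := by
    refine (Finset.abs_sum_le_sum_abs _ _).trans ?_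
    calc ∑ i ∈ s, |w i * v i| ≤ ∑ i ∈ s, w i * B := Finset.sum_le_sum fun i hi => by
          rw [abs_mul, abs_of_nonneg (hw i hi)]
          exact mul_le_mul_of_nonneg_left (hv i hi) (hw i hi)
      _ = B := by rw [← Finset.sum_mul, hsum, one_mul]
  have hu : ∀ i ∈ s, |v i - m| ≤ b := fun i hi => by
    have := abs_sub (v i) m
    have := hv i hi
    linarith
  have hV0 : 0 ≤ V := Finset.sum_nonneg fun i hi => mul_nonneg (hw i hi) (sq_nonneg _)
  have hVb : V ≤ b ^ 2 := by
    calc V ≤ ∑ i ∈ s, w i * b ^ 2 := Finset.sum_le_sum fun i hi =>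
          mul_le_mul_of_nonneg_left (by rw [← sq_abs]; exact pow_le_pow_left₀ (abs_nonneg _) (hu i hi) 2) (hw i hi)
      _ = b ^ 2 := by rw [← Finset.sum_mul, hsum, one_mul]
  have h1 : 1 + k * V ≤ ∑ i ∈ s, w i * Real.exp (v i - m) := by
    have h2 : ∑ i ∈ s, w i * (1 + (v i - m) + k * (v i - m) ^ 2) = 1 + k * V := by
      have : ∀ i, w i * (1 + (v i - m) + k * (v i - m) ^ 2) =
        w i + w i * v i - w i * m + k * (w i * (v i - m) ^ 2) := fun i => by ring
      simp only [this, Finset.sum_add_distrib, Finset.sum_sub_distrib, ← Finset.sum_mul,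
        ← Finset.mul_sum, hsum, ← hm, ← hV]
      ring
    rw [← h2]
    exact Finset.sum_le_sum fun i hi =>
      mul_le_mul_of_nonneg_left (exp_lower_quadratic (by positivity) (hu i hi)) (hw i hi)
  have h2 : ∑ i ∈ s, w i * Real.exp (v i) = Real.exp m * ∑ i ∈ s, w i * Real.exp (v i - m) := by
    rw [Finset.mul_sum]
    refine Finset.sum_congr rfl fun i _ => ?_
    rw [mul_left_comm, ← Real.exp_add]; congr 2; ring
  have hpos : 0 < 1 + k * V := by positivity
  rw [h2, Real.log_mul (Real.exp_pos _).ne' (hpos.trans_le h1).ne', Real.log_exp]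
  have h3 := Real.log_le_log hpos h1
  have h4 := Real.one_sub_inv_le_log_of_pos hpos
  have h5 : k / (1 + k * b ^ 2) * V ≤ 1 - (1 + k * V)⁻¹ := by
    have e : 1 - (1 + k * V)⁻¹ = k * V / (1 + k * V) := by field_simp; ring
    rw [e, div_mul_eq_mul_div]
    exact div_le_div_of_nonneg_left (by positivity) hpos (by nlinarith)
  linarith

/-! ### The conditional likelihood -/

/-- The exponent `∑_t d_t x_t'β`. -/
def lin {T p : ℕ} (d : Fin T → Fin 2) (x : Cov T p) (β : Fin p → ℝ) : ℝ :=
  ∑ t, ((d t : ℕ) : ℝ) * (x t ⬝ᵥ β)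

/-- The sequences in `{0,1}^T` with sum `s`. -/
def level (T s : ℕ) : Finset (Fin T → Fin 2) := Finset.univ.filter fun d => ∑ t, (d t : ℕ) = s

lemma C_eq {T p : ℕ} (s : ℕ) (x : Cov T p) (β : Fin p → ℝ) :
    C s x β = ∑ d ∈ level T s, Real.exp (lin d x β) := rfl

lemma mem_level {T s : ℕ} {d : Fin T → Fin 2} : d ∈ level T s ↔ ∑ t, (d t : ℕ) = s := by
  simp [level]

lemma sum_le_of_fin2 {T : ℕ} (d : Fin T → Fin 2) : ∑ t, (d t : ℕ) ≤ T := by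
  refine (Finset.sum_le_card_nsmul _ _ 1 fun t _ => ?_).trans_eq (by simp)
  have := (d t).2; omega

lemma level_nonempty {T s : ℕ} (h : s ≤ T) : (level T s).Nonempty := by
  refine ⟨fun t => if (t : ℕ) < s then 1 else 0, mem_level.2 ?_⟩
  have h1 : ∀ t : Fin T, (((if (t : ℕ) < s then 1 else 0 : Fin 2)) : ℕ) =
      if (t : ℕ) < s then 1 else 0 := fun t => by split_ifs <;> rfl
  simp only [h1]
  rw [Fin.sum_univ_eq_sum_range (fun t => if t < s then 1 else 0) T, Finset.sum_ite]
  simp only [Finset.sum_const, smul_eq_mul, mul_one, mul_zero, add_zero]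
  rw [show (Finset.range T).filter (fun t => t < s) = Finset.range s by
    ext t; simp; omega]
  simp

lemma C_pos {T p s : ℕ} (h : s ≤ T) (x : Cov T p) (β : Fin p → ℝ) : 0 < C s x β :=
  Finset.sum_pos (fun _ _ => Real.exp_pos _) (level_nonempty h)

lemma abs_dotProduct_le {p : ℕ} (v w : Fin p → ℝ) : |v ⬝ᵥ w| ≤ p * (‖v‖ * ‖w‖) := by
  refine (Finset.abs_sum_le_sum_abs _ _).trans ?_
  refine (Finset.sum_le_card_nsmul _ _ (‖v‖ * ‖w‖) fun k _ => ?_).trans_eq (by simp)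
  rw [abs_mul]
  exact mul_le_mul (norm_le_pi_norm v k) (norm_le_pi_norm w k) (abs_nonneg _) (norm_nonneg _)

lemma abs_lin_le {T p : ℕ} (d : Fin T → Fin 2) (x : Cov T p) (β : Fin p → ℝ) :
    |lin d x β| ≤ T * (p * (‖x‖ * ‖β‖)) := by
  refine (Finset.abs_sum_le_sum_abs _ _).trans ?_
  refine (Finset.sum_le_card_nsmul _ _ (p * (‖x‖ * ‖β‖)) fun t _ => ?_).trans_eq (by simp)
  rw [abs_mul]
  have h1 : |((d t : ℕ) : ℝ)| ≤ 1 := by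
    have : (d t : ℕ) ≤ 1 := by have := (d t).2; omega
    rw [abs_of_nonneg (Nat.cast_nonneg _)]
    exact_mod_cast this
  calc |((d t : ℕ) : ℝ)| * |x t ⬝ᵥ β| ≤ 1 * (p * (‖x t‖ * ‖β‖)) :=
        mul_le_mul h1 (abs_dotProduct_le _ _) (abs_nonneg _) zero_le_one
    _ ≤ p * (‖x‖ * ‖β‖) := by
        rw [one_mul]
        exact mul_le_mul_of_nonneg_left
          (mul_le_mul_of_nonneg_right (norm_le_pi_norm x t) (norm_nonneg _)) (Nat.cast_nonneg _)

lemma lin_add {T p : ℕ} (d : Fin T → Fin 2) (x : Cov T p) (β δ : Fin p → ℝ) :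
    lin d x (β + δ) = lin d x β + lin d x δ := by
  simp [lin, dotProduct_add, mul_add, Finset.sum_add_distrib]

lemma lin_eq_sum {T p : ℕ} (d : Fin T → Fin 2) (x : Cov T p) (δ : Fin p → ℝ) :
    lin d x δ = ∑ k, δ k * ∑ t, ((d t : ℕ) : ℝ) * x t k := by
  simp only [lin, dotProduct, Finset.mul_sum]
  rw [Finset.sum_comm]
  exact Finset.sum_congr rfl fun k _ => Finset.sum_congr rfl fun t _ => by ring

/-- The conditional mean of `∑_t d_t x_t` given `∑_t d_t = s`. -/
def condMean {T p : ℕ} (s : ℕ) (x : Cov T p) (β : Fin p → ℝ) (k : Fin p) : ℝ :=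
  (∑ d ∈ level T s, Real.exp (lin d x β) * ∑ t, ((d t : ℕ) : ℝ) * x t k) / C s x β

/-- The conditional score. -/
def score {T p : ℕ} (d : Fin T → Fin 2) (x : Cov T p) (β : Fin p → ℝ) (k : Fin p) : ℝ :=
  ∑ t, ((d t : ℕ) : ℝ) * x t k - condMean (∑ t, (d t : ℕ)) x β k

lemma condLogLik_eq {T p : ℕ} (d : Fin T → Fin 2) (x : Cov T p) (β : Fin p → ℝ) :
    condLogLik (fun t => (d t : ℕ)) x β = lin d x β - Real.log (C (∑ t, (d t : ℕ)) x β) := rfl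

/-- A strict concavity inequality for the conditional log-likelihood. -/
lemma exists_condLogLik_sub_le {T p : ℕ} {t₀ t₁ : Fin T} (ht : t₀ ≠ t₁) (R : ℝ) :
    ∃ κ > 0, ∀ (d : Fin T → Fin 2) (x : Cov T p) (β₀ β : Fin p → ℝ), ‖x‖ ≤ R → ‖β₀‖ ≤ R → ‖β‖ ≤ R →
      condLogLik (fun t => (d t : ℕ)) x β - condLogLik (fun t => (d t : ℕ)) x β₀ ≤
        ∑ k, (β - β₀) k * score d x β₀ k -
        κ * if ∑ t, (d t : ℕ) = 1 then ((x t₀ - x t₁) ⬝ᵥ (β - β₀)) ^ 2 else 0 := by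
  set B : ℝ := T * (p * (|R| * (2 * |R|))) with hB
  have hB0 : 0 ≤ B := by positivity
  obtain ⟨κ, hκ, hlog⟩ := exists_log_sum_exp_ge hB0
  -- A lower bound for the conditional probability of any sequence with a single 1, valid for all
  -- covariates and parameters in the ball.
  set wm : ℝ := Real.exp (-B) / ((level T 1).card * Real.exp B) with hwm
  have hT : 1 ≤ T := by have := t₀.2; omega
  have hcard : 0 < ((level T 1).card : ℝ) := by
    exact_mod_cast Finset.card_pos.2 (level_nonempty hT)
  have hwm0 : 0 < wm := by positivity
  refine ⟨κ * (wm / 2), by positivity, fun d x β₀ β hx hβ₀ hβ => ?_⟩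
  have hR : R ≤ |R| := le_abs_self R
  have hlinb : ∀ (d : Fin T → Fin 2) (δ : Fin p → ℝ), ‖δ‖ ≤ 2 * |R| → |lin d x δ| ≤ B :=
    fun d δ hδ => (abs_lin_le d x δ).trans (by
      rw [hB]; gcongr; exact hx.trans hR)
  set δ := β - β₀ with hδ
  have hδR : ‖δ‖ ≤ 2 * |R| := (norm_sub_le _ _).trans (by linarith)
  set s := ∑ t, (d t : ℕ) with hs
  have hC := C_pos (sum_le_of_fin2 d) x β₀
  have hC' := C_pos (sum_le_of_fin2 d) x β
  rw [← hs] at hC hC'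
  let w : (Fin T → Fin 2) → ℝ := fun d => Real.exp (lin d x β₀) / C s x β₀
  have hw0 : ∀ d ∈ level T s, 0 ≤ w d := fun d _ => by positivity
  have hwsum : ∑ d ∈ level T s, w d = 1 := by
    rw [← Finset.sum_div, ← C_eq, div_self hC.ne']
  -- The ratio of normalising sums at `β` and `β₀` is the mean of exp(lin d x δ) under the
  -- conditional law at `β₀`. Its logarithm therefore exceeds the mean, which enters the score, by a
  -- multiple of the conditional variance.
  have h1 := hlog (level T s) w (fun d => lin d x δ) hw0 hwsum fun d _ => hlinb d δ hδR
  have h2 : ∑ d ∈ level T s, w d * Real.exp (lin d x δ) = C s x β / C s x β₀ := by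
    rw [C_eq s x β, Finset.sum_div]
    refine Finset.sum_congr rfl fun d _ => ?_
    rw [div_mul_eq_mul_div, ← Real.exp_add, ← lin_add, hδ, add_sub_cancel]
  rw [h2, Real.log_div hC'.ne' hC.ne'] at h1
  set m := ∑ d ∈ level T s, w d * lin d x δ with hm
  have hm' : m = ∑ k, δ k * condMean s x β₀ k := by
    rw [hm]
    simp only [w, condMean, lin_eq_sum _ _ δ, Finset.mul_sum, Finset.sum_div]
    rw [Finset.sum_comm]
    exact Finset.sum_congr rfl fun k _ => Finset.sum_congr rfl fun d _ =>
      Finset.sum_congr rfl fun t _ => by ring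
  have h3 : ∑ k, δ k * score d x β₀ k = lin d x δ - m := by
    rw [hm', lin_eq_sum, ← Finset.sum_sub_distrib]
    exact Finset.sum_congr rfl fun k _ => by rw [score]; ring
  have hlin : lin d x β = lin d x β₀ + lin d x δ := by rw [← lin_add, hδ, add_sub_cancel]
  rw [condLogLik_eq, condLogLik_eq, ← hs, h3, hlin]
  have h4 : κ * (wm / 2) * (if s = 1 then ((x t₀ - x t₁) ⬝ᵥ δ) ^ 2 else 0) ≤
      κ * ∑ d ∈ level T s, w d * (lin d x δ - m) ^ 2 := by
    rw [mul_assoc]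
    refine mul_le_mul_of_nonneg_left ?_ hκ.le
    split_ifs with hs1
    · have hwge : ∀ d, wm ≤ w d := fun d => by
        have hb : ∀ d : Fin T → Fin 2, |lin d x β₀| ≤ B := fun d =>
          hlinb d β₀ (by linarith [abs_nonneg R])
        refine div_le_div₀ (Real.exp_pos _).le
          (Real.exp_le_exp.2 (by linarith [(abs_le.1 (hb d)).1])) hC ?_
        rw [hs1, C_eq]
        refine (Finset.sum_le_card_nsmul _ _ (Real.exp B) fun d _ =>
          Real.exp_le_exp.2 (abs_le.1 (hb d)).2).trans_eq (by rw [nsmul_eq_mul])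
      -- At level 1 the sequences with their only 1 in period t₀ or t₁ suffice: (a - m)² + (b - m)²
      -- ≥ (a - b)²/2, whence the factor wm/2.
      let e : Fin T → Fin T → Fin 2 := fun t₀ t => if t = t₀ then 1 else 0
      have hecast : ∀ t₀ t : Fin T, ((e t₀ t : Fin 2) : ℕ) = if t = t₀ then 1 else 0 :=
        fun t₀ t => by simp only [e]; split_ifs <;> rfl
      have hel : ∀ t₀, e t₀ ∈ level T s := fun t₀ => by
        rw [mem_level, hs1]; simp [hecast]
      have hev : ∀ t₀, lin (e t₀) x δ = x t₀ ⬝ᵥ δ := fun t₀ => by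
        simp [lin, hecast]
      have hne : e t₀ ≠ e t₁ := fun h => by
        have := congrArg (fun f => ((f t₀ : Fin 2) : ℕ)) h
        simp [hecast, ht] at this
      have hsub : ({e t₀, e t₁} : Finset (Fin T → Fin 2)) ⊆ level T s := by
        intro d hd
        rcases Finset.mem_insert.1 hd with rfl | hd
        · exact hel _
        · rw [Finset.mem_singleton.1 hd]; exact hel _
      refine le_trans ?_ (Finset.sum_le_sum_of_subset_of_nonneg hsub fun d hd _ =>
        mul_nonneg (hw0 d hd) (sq_nonneg _))
      rw [Finset.sum_pair hne, hev, hev, sub_dotProduct]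
      have a0 := mul_le_mul_of_nonneg_right (hwge (e t₀)) (sq_nonneg (x t₀ ⬝ᵥ δ - m))
      have a1 := mul_le_mul_of_nonneg_right (hwge (e t₁)) (sq_nonneg (x t₁ ⬝ᵥ δ - m))
      nlinarith [mul_nonneg hwm0.le (sq_nonneg ((x t₀ ⬝ᵥ δ - m) + (x t₁ ⬝ᵥ δ - m)))]
    · rw [mul_zero]
      exact Finset.sum_nonneg fun d hd => mul_nonneg (hw0 d hd) (sq_nonneg _)
  linarith

/-- A bound on the error of a conditional maximum likelihood estimate. -/
lemma exists_cmle_bound {T p : ℕ} {t₀ t₁ : Fin T} (ht : t₀ ≠ t₁) (R : ℝ) {κ₂ : ℝ} (hκ₂ : 0 < κ₂) :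
    ∃ A : ℝ, 0 ≤ A ∧ ∀ (Θ : Set (Fin p → ℝ)) (n : ℕ) (x : ℕ → Cov T p) (d : ℕ → Fin T → Fin 2)
      (β₀ β : Fin p → ℝ), (∀ b ∈ Θ, ‖b‖ ≤ R) → β₀ ∈ Θ → (∀ i < n, ‖x i‖ ≤ R) →
      IsCMLE Θ n x (fun i t => (d i t : ℕ)) β →
      (∀ e : Fin p → ℝ, κ₂ * ∑ k, e k ^ 2 ≤ ∑ k, ∑ l, e k * e l *
        ((n : ℝ)⁻¹ * ∑ i ∈ Finset.range n, if ∑ t, (d i t : ℕ) = 1 then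
          (x i t₀ - x i t₁) k * (x i t₀ - x i t₁) l else 0)) →
      ∀ τ, (∀ k, |(n : ℝ)⁻¹ * ∑ i ∈ Finset.range n, score (d i) (x i) β₀ k| ≤ τ) →
      ‖β - β₀‖ ≤ A * τ := by
  obtain ⟨κ, hκ, hmain⟩ := exists_condLogLik_sub_le (p := p) ht R
  refine ⟨p / (κ * κ₂), by positivity, fun Θ n x d β₀ β hΘ hβ₀ hx hβ hM τ hτ => ?_⟩
  set δ := β - β₀ with hδ
  -- The maximiser does at least as well as `β₀`, so the linear score term must outweigh the
  -- quadratic loss. With the curvature assumed in the statement, this bounds `δ` linearly by the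
  -- mean score.
  have h1 : 0 ≤ ∑ i ∈ Finset.range n, (∑ k, δ k * score (d i) (x i) β₀ k -
      κ * if ∑ t, (d i t : ℕ) = 1 then ((x i t₀ - x i t₁) ⬝ᵥ δ) ^ 2 else 0) := by
    have h2 := hβ.2 hβ₀
    simp only [Set.mem_ofPred_eq] at h2
    rw [← sub_nonneg, ← Finset.sum_sub_distrib] at h2
    refine h2.trans (Finset.sum_le_sum fun i hi => ?_)
    exact hmain _ _ _ _ (hx i (Finset.mem_range.1 hi)) (hΘ _ hβ₀) (hΘ _ hβ.1)
  rw [Finset.sum_sub_distrib, ← Finset.mul_sum, sub_nonneg] at h1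
  have h2 : ∑ k, ∑ l, δ k * δ l *
        ((n : ℝ)⁻¹ * ∑ i ∈ Finset.range n, if ∑ t, (d i t : ℕ) = 1 then
          (x i t₀ - x i t₁) k * (x i t₀ - x i t₁) l else 0) =
      (n : ℝ)⁻¹ * ∑ i ∈ Finset.range n,
        if ∑ t, (d i t : ℕ) = 1 then ((x i t₀ - x i t₁) ⬝ᵥ δ) ^ 2 else 0 := by
    simp only [Finset.mul_sum]
    rw [Finset.sum_congr rfl fun k _ => Finset.sum_comm, Finset.sum_comm]
    refine Finset.sum_congr rfl fun i _ => ?_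
    split_ifs with h
    · rw [sq, dotProduct, Finset.sum_mul_sum, Finset.mul_sum]
      refine Finset.sum_congr rfl fun k _ => ?_
      rw [Finset.mul_sum]
      exact Finset.sum_congr rfl fun l _ => by ring
    · simp
  have h3 := hM δ
  rw [h2] at h3
  have hn : (0 : ℝ) ≤ (n : ℝ)⁻¹ := by positivity
  have h4 : (n : ℝ)⁻¹ * ∑ i ∈ Finset.range n, ∑ k, δ k * score (d i) (x i) β₀ k ≤
      τ * ∑ k, |δ k| := by
    rw [Finset.sum_comm, Finset.mul_sum, Finset.mul_sum]
    refine Finset.sum_le_sum fun k _ => ?_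
    rw [← Finset.mul_sum, mul_left_comm, mul_comm τ]
    refine (le_abs_self _).trans ?_
    rw [abs_mul]
    exact mul_le_mul_of_nonneg_left (hτ k) (abs_nonneg _)
  have h5 := mul_le_mul_of_nonneg_left h1 hn
  set E := ∑ k, |δ k| with hE
  have hE0 : 0 ≤ E := Finset.sum_nonneg fun _ _ => abs_nonneg _
  have h6 := sq_sum_abs_le δ
  rw [Fintype.card_fin] at h6
  have h7 : κ * κ₂ * E ^ 2 ≤ p * (τ * E) := by
    calc κ * κ₂ * E ^ 2 ≤ κ * κ₂ * (p * ∑ k, δ k ^ 2) :=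
          mul_le_mul_of_nonneg_left h6 (by positivity)
      _ = p * (κ * (κ₂ * ∑ k, δ k ^ 2)) := by ring
      _ ≤ p * (τ * E) := by
          refine mul_le_mul_of_nonneg_left ?_ (Nat.cast_nonneg _)
          refine (mul_le_mul_of_nonneg_left h3 hκ.le).trans ?_
          rw [mul_left_comm]
          exact h5.trans h4
  have hnorm : ‖δ‖ ≤ E := (pi_norm_le_iff_of_nonneg hE0).2 fun k =>
    Finset.single_le_sum (f := fun k => |δ k|) (fun _ _ => abs_nonneg _) (Finset.mem_univ k)
  refine hnorm.trans ?_
  rw [div_mul_eq_mul_div, le_div_iff₀ (by positivity)]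
  rcases hE0.eq_or_lt with h0 | h0
  · rcases Nat.eq_zero_or_pos p with rfl | hp
    · rw [← h0]; simp
    · have hτ0 := (abs_nonneg _).trans (hτ ⟨0, hp⟩)
      rw [← h0, zero_mul]; positivity
  · refine le_of_mul_le_mul_right (?_ : E * (κ * κ₂) * E ≤ p * τ * E) h0
    linarith

end FELogit
end

noncomputable section
namespace FELogit

/-! ### The law of the outcomes -/

/-- The outcomes, as elements of `{0,1}`. -/
def dvec {T p : ℕ} (β : Fin p → ℝ) (x : Cov T p) (a : ℝ) (e : Fin T → ℝ) (t : Fin T) : Fin 2 :=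
  open Classical in if 0 ≤ x t ⬝ᵥ β + a + e t then 1 else 0

lemma outcome_eq_dvec {T p : ℕ} (β : Fin p → ℝ) (x : Cov T p) (a : ℝ) (e : Fin T → ℝ)
    (t : Fin T) : outcome β x a e t = (dvec β x a e t : ℕ) := by
  unfold outcome dvec
  split_ifs <;> rfl

/-- The logit probabilities. -/
def logitProb (v : ℝ) (b : Fin 2) : ℝ := Real.exp ((b : ℕ) * v) / (1 + Real.exp v)

/-- The conditional probability of the outcomes `d`, given the covariates and the effect. -/
def seqProb {T p : ℕ} (β : Fin p → ℝ) (d : Fin T → Fin 2) (x : Cov T p) (a : ℝ) : ℝ :=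
  ∏ t, logitProb (x t ⬝ᵥ β + a) (d t)

/-- The normalising factor of the outcome probabilities. -/
def normFactor {T p : ℕ} (β : Fin p → ℝ) (x : Cov T p) (a : ℝ) : ℝ :=
  ∏ t, (1 + Real.exp (x t ⬝ᵥ β + a))

/-- The conditional probability of `S = s`, given the covariates and the effect. -/
def sumProb {T p : ℕ} (β : Fin p → ℝ) (s : ℕ) (x : Cov T p) (a : ℝ) : ℝ :=
  ∑ d ∈ level T s, seqProb β d x a

lemma logitProb_nonneg (v : ℝ) (b : Fin 2) : 0 ≤ logitProb v b := by
  unfold logitProb; positivity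

lemma logitProb_le_one (v : ℝ) (b : Fin 2) : logitProb v b ≤ 1 := by
  unfold logitProb
  rw [div_le_one (by positivity)]
  fin_cases b
  · simp; positivity
  · simp

lemma seqProb_nonneg {T p : ℕ} (β : Fin p → ℝ) (d : Fin T → Fin 2) (x : Cov T p) (a : ℝ) :
    0 ≤ seqProb β d x a := Finset.prod_nonneg fun _ _ => logitProb_nonneg _ _

lemma seqProb_le_one {T p : ℕ} (β : Fin p → ℝ) (d : Fin T → Fin 2) (x : Cov T p) (a : ℝ) :
    seqProb β d x a ≤ 1 :=
  Finset.prod_le_one (fun _ _ => logitProb_nonneg _ _) fun _ _ => logitProb_le_one _ _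

lemma normFactor_pos {T p : ℕ} (β : Fin p → ℝ) (x : Cov T p) (a : ℝ) : 0 < normFactor β x a :=
  Finset.prod_pos fun _ _ => by positivity

lemma seqProb_eq {T p : ℕ} (β : Fin p → ℝ) (d : Fin T → Fin 2) (x : Cov T p) (a : ℝ) :
    seqProb β d x a =
      Real.exp (((∑ t, (d t : ℕ) : ℕ) : ℝ) * a) * Real.exp (lin d x β) / normFactor β x a := by
  unfold seqProb logitProb normFactor lin
  rw [Finset.prod_div_distrib, ← Real.exp_sum, ← Real.exp_add]
  congr 2
  push_cast
  rw [Finset.sum_mul, ← Finset.sum_add_distrib]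
  exact Finset.sum_congr rfl fun t _ => by ring

lemma sumProb_eq {T p : ℕ} (β : Fin p → ℝ) (s : ℕ) (x : Cov T p) (a : ℝ) :
    sumProb β s x a = Real.exp (s * a) * C s x β / normFactor β x a := by
  unfold sumProb
  rw [C_eq, Finset.mul_sum, Finset.sum_div]
  refine Finset.sum_congr rfl fun d hd => ?_
  rw [seqProb_eq, mem_level.1 hd]

lemma sumProb_pos {T p s : ℕ} (hs : s ≤ T) (β : Fin p → ℝ) (x : Cov T p) (a : ℝ) :
    0 < sumProb β s x a := by
  rw [sumProb_eq]
  exact div_pos (mul_pos (Real.exp_pos _) (C_pos hs x β)) (normFactor_pos β x a)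

lemma measurable_dotProduct_cov {T p : ℕ} (t : Fin T) (β : Fin p → ℝ) :
    Measurable fun z : Cov T p => z t ⬝ᵥ β := by
  unfold dotProduct; fun_prop

lemma measurable_seqProb {T p : ℕ} (β : Fin p → ℝ) (d : Fin T → Fin 2) :
    Measurable fun z : ℝ × Cov T p => seqProb β d z.2 z.1 := by
  unfold seqProb logitProb
  refine Finset.measurable_prod _ fun t _ => ?_
  have h1 : Measurable fun z : ℝ × Cov T p => z.2 t ⬝ᵥ β :=
    (measurable_dotProduct_cov t β).comp measurable_snd
  have h2 : Measurable fun z : ℝ × Cov T p => z.2 t ⬝ᵥ β + z.1 := h1.add measurable_fst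
  exact (h2.const_mul _).exp.div (h2.exp.const_add 1)

lemma measurable_dvec {T p : ℕ} (β : Fin p → ℝ) :
    Measurable fun z : (Fin T → ℝ) × (ℝ × Cov T p) => dvec β z.2.2 z.2.1 z.1 := by
  refine measurable_pi_lambda _ fun t => ?_
  unfold dvec
  refine Measurable.ite ?_ measurable_const measurable_const
  refine measurableSet_le measurable_const ?_
  have h1 : Measurable fun z : (Fin T → ℝ) × (ℝ × Cov T p) => z.2.2 t ⬝ᵥ β :=
    (measurable_dotProduct_cov t β).comp (measurable_snd.comp measurable_snd)
  exact (h1.add (measurable_fst.comp measurable_snd)).add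
    ((measurable_pi_apply t).comp measurable_fst)

section Model

variable {Ω : Type*} [MeasurableSpace Ω] {P : Measure Ω} [IsProbabilityMeasure P] {T p : ℕ}
  {X : Ω → Cov T p} {α : Ω → ℝ} {ε : Ω → Fin T → ℝ}

/-- The outcome is 0 on a strict inequality, whereas the distribution function is given with a weak
one; continuity of the logistic function closes the gap. -/
lemma IsModel.prob_lt (h : IsModel P X α ε) (t : Fin T) (a : ℝ) :
    P.real {ω | ε ω t < a} = 1 / (1 + Real.exp (-a)) := by
  refine le_antisymm ?_ ?_
  · rw [← h.cdf_ε t a]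
    exact measureReal_mono fun ω (hω : ε ω t < a) => (show ε ω t ≤ a from hω.le)
  · have hc : Tendsto (fun b : ℝ => 1 / (1 + Real.exp (-b))) (𝓝[<] a)
        (𝓝 (1 / (1 + Real.exp (-a)))) := by
      refine ContinuousAt.continuousWithinAt ?_
      refine ContinuousAt.div (by fun_prop) (by fun_prop) (by positivity)
    refine le_of_tendsto hc ?_
    filter_upwards [self_mem_nhdsWithin] with b hb
    rw [← h.cdf_ε t b]
    exact measureReal_mono fun ω (hω : ε ω t ≤ b) => (show ε ω t < a from hω.trans_lt hb)

lemma IsModel.prob_dvec_apply (h : IsModel P X α ε) (β : Fin p → ℝ) (x : Cov T p) (a : ℝ)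
    (t : Fin T) (b : Fin 2) :
    P.real {ω | dvec β x a (ε ω) t = b} = logitProb (x t ⬝ᵥ β + a) b := by
  set v := x t ⬝ᵥ β + a with hv
  have hlt : P.real {ω | ε ω t < -v} = 1 / (1 + Real.exp v) := by
    rw [h.prob_lt]; simp
  have hm : MeasurableSet {ω | ε ω t < -v} :=
    measurableSet_lt ((measurable_pi_apply t).comp h.measurable_ε) measurable_const
  have h0 : {ω | dvec β x a (ε ω) t = 0} = {ω | ε ω t < -v} := by
    ext ω
    simp only [dvec, Set.mem_ofPred_eq, ← hv]
    split_ifs with hc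
    · simp; linarith
    · simp; linarith
  have h1 : {ω | dvec β x a (ε ω) t = 1} = {ω | ε ω t < -v}ᶜ := by
    rw [← h0]
    ext ω
    simp only [Set.mem_ofPred_eq, Set.mem_compl_iff]
    omega
  fin_cases b
  · simp only [Fin.zero_eta, h0, hlt]
    simp [logitProb]
  · simp only [Fin.mk_one, h1]
    rw [probReal_compl_eq_one_sub hm, hlt]
    simp only [logitProb, Fin.val_one, Nat.cast_one, one_mul]
    have : 1 + Real.exp v ≠ 0 := by positivity
    field_simp; ring

lemma IsModel.prob_dvec (h : IsModel P X α ε) (β : Fin p → ℝ) (d : Fin T → Fin 2) (x : Cov T p)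
    (a : ℝ) : P.real {ω | dvec β x a (ε ω) = d} = seqProb β d x a := by
  let A : Fin T → Set ℝ := fun t => {e | (open Classical in if 0 ≤ x t ⬝ᵥ β + a + e then (1 : Fin 2) else 0) = d t}
  have hA : ∀ t, MeasurableSet (A t) := fun t => by
    have : Measurable fun e : ℝ =>
        (open Classical in if 0 ≤ x t ⬝ᵥ β + a + e then (1 : Fin 2) else 0) := by
      refine Measurable.ite ?_ measurable_const measurable_const
      exact measurableSet_le measurable_const (by fun_prop)
    exact this (measurableSet_singleton _)
  have h1 : {ω | dvec β x a (ε ω) = d} = ⋂ t ∈ Finset.univ, {ω | dvec β x a (ε ω) t = d t} := by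
    ext ω; simp [funext_iff]
  have h2 := h.iIndep_ε.meas_biInter (S := Finset.univ)
    (s := fun t => {ω | dvec β x a (ε ω) t = d t}) fun t _ => ⟨A t, hA t, rfl⟩
  rw [h1, measureReal_def, h2, ENNReal.toReal_prod]
  exact Finset.prod_congr rfl fun t _ => h.prob_dvec_apply β x a t (d t)

/-- Averaging over the outcomes, given the covariates and the effect. -/
theorem IsModel.integral_outcome (h : IsModel P X α ε) (β : Fin p → ℝ)
    (F : (Fin T → Fin 2) → ℝ × Cov T p → ℝ) (hF : ∀ d, Measurable (F d)) {B : ℝ}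
    (hB : ∀ d z, |F d z| ≤ B) :
    ∫ ω, F (dvec β (X ω) (α ω) (ε ω)) (α ω, X ω) ∂P =
      ∫ ω, ∑ d, seqProb β d (X ω) (α ω) * F d (α ω, X ω) ∂P := by
  have hαX : Measurable fun ω => (α ω, X ω) := h.measurable_α.prodMk h.measurable_X
  have hd : Measurable fun ω => dvec β (X ω) (α ω) (ε ω) :=
    (measurable_dvec β).comp (h.measurable_ε.prodMk hαX)
  have hind : ∀ d, MeasurableSet {z : (Fin T → ℝ) × (ℝ × Cov T p) | dvec β z.2.2 z.2.1 z.1 = d} :=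
    fun d => measurable_dvec β (measurableSet_singleton d)
  have hi1 : ∀ d, Integrable (fun ω =>
      (if dvec β (X ω) (α ω) (ε ω) = d then F d (α ω, X ω) else 0)) P := fun d => by
    refine Integrable.of_bound (Measurable.ite (hd (measurableSet_singleton d))
      ((hF d).comp hαX) measurable_const).aestronglyMeasurable |B| (ae_of_all _ fun ω => ?_)
    rw [Real.norm_eq_abs]
    split_ifs
    · exact (hB _ _).trans (le_abs_self B)
    · simp
  have hi2 : ∀ d, Integrable (fun ω => seqProb β d (X ω) (α ω) * F d (α ω, X ω)) P := fun d => by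
    refine Integrable.of_bound
      (((measurable_seqProb β d).comp hαX).mul ((hF d).comp hαX)).aestronglyMeasurable |B|
      (ae_of_all _ fun ω => ?_)
    rw [Real.norm_eq_abs, abs_mul, abs_of_nonneg (seqProb_nonneg _ _ _ _)]
    calc seqProb β d (X ω) (α ω) * |F d (α ω, X ω)| ≤ 1 * |B| :=
          mul_le_mul (seqProb_le_one _ _ _ _) ((hB _ _).trans (le_abs_self B)) (abs_nonneg _)
            zero_le_one
      _ = |B| := one_mul _
  -- Splitting over the finitely many outcomes reduces the claim to one `d` at a time; Fubini then
  -- integrates out `ε`, which is independent of (α, X).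
  have e1 : ∀ ω, F (dvec β (X ω) (α ω) (ε ω)) (α ω, X ω) =
      ∑ d, if dvec β (X ω) (α ω) (ε ω) = d then F d (α ω, X ω) else 0 := fun ω => by simp
  simp_rw [e1]
  rw [integral_finsetSum _ fun d _ => hi1 d, integral_finsetSum _ fun d _ => hi2 d]
  refine Finset.sum_congr rfl fun d _ => ?_
  have hprod := (indepFun_iff_map_prod_eq_prod_map_map h.measurable_ε.aemeasurable
    hαX.aemeasurable).1 h.indep_ε
  set G : (Fin T → ℝ) × (ℝ × Cov T p) → ℝ :=
    fun z => if dvec β z.2.2 z.2.1 z.1 = d then F d z.2 else 0 with hG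
  have hGm : Measurable G := Measurable.ite (hind d) ((hF d).comp measurable_snd) measurable_const
  have hpm : IsProbabilityMeasure (P.map ε) :=
    Measure.isProbabilityMeasure_map h.measurable_ε.aemeasurable
  have hpm' : IsProbabilityMeasure (P.map fun ω => (α ω, X ω)) :=
    Measure.isProbabilityMeasure_map hαX.aemeasurable
  have hGi : Integrable G ((P.map ε).prod (P.map fun ω => (α ω, X ω))) := by
    refine Integrable.of_bound hGm.aestronglyMeasurable |B| (ae_of_all _ fun z => ?_)
    rw [Real.norm_eq_abs]
    simp only [hG]
    split_ifs
    · exact (hB _ _).trans (le_abs_self B)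
    · simp
  calc ∫ ω, (if dvec β (X ω) (α ω) (ε ω) = d then F d (α ω, X ω) else 0) ∂P
      = ∫ z, G z ∂(P.map fun ω => (ε ω, (α ω, X ω))) :=
        (integral_map (h.measurable_ε.prodMk hαX).aemeasurable hGm.aestronglyMeasurable).symm
    _ = ∫ y, ∫ e, G (e, y) ∂(P.map ε) ∂(P.map fun ω => (α ω, X ω)) := by
        rw [hprod, integral_prod_symm _ hGi]
    _ = ∫ y, seqProb β d y.2 y.1 * F d y ∂(P.map fun ω => (α ω, X ω)) := by
        congr 1; ext y
        simp only [hG]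
        have hm : MeasurableSet {e : Fin T → ℝ | dvec β y.2 y.1 e = d} :=
          ((measurable_dvec β).comp (measurable_id.prodMk measurable_const))
            (measurableSet_singleton d)
        have e2 : ∀ e, (if dvec β y.2 y.1 e = d then F d y else 0) =
            {e : Fin T → ℝ | dvec β y.2 y.1 e = d}.indicator (fun _ => F d y) e := fun e => by
          simp [Set.indicator]
        simp_rw [e2]
        rw [integral_indicator_const _ hm, smul_eq_mul, map_measureReal_apply h.measurable_ε hm]
        congr 1
        exact h.prob_dvec β d y.2 y.1
    _ = ∫ ω, seqProb β d (X ω) (α ω) * F d (α ω, X ω) ∂P :=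
        integral_map hαX.aemeasurable
          ((measurable_seqProb β d).mul (hF d)).aestronglyMeasurable

/-- The score has conditional mean zero. -/
lemma sum_seqProb_score (β : Fin p → ℝ) (x : Cov T p) (a : ℝ) (k : Fin p) :
    ∑ d, seqProb β d x a * score d x β k = 0 := by
  have hmaps : ∀ d ∈ (Finset.univ : Finset (Fin T → Fin 2)),
      ∑ t, (d t : ℕ) ∈ Finset.range (T + 1) := fun d _ =>
    Finset.mem_range.2 (Nat.lt_succ_iff.2 (sum_le_of_fin2 d))
  rw [← Finset.sum_fiberwise_of_maps_to hmaps]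
  refine Finset.sum_eq_zero fun s hs => ?_
  have hC := C_pos (Nat.lt_succ_iff.1 (Finset.mem_range.1 hs)) x β
  -- Sufficiency of the sum: within a level the effect enters only through a factor common to all
  -- sequences, so the mean of the score is proportional to the one under the conditional law, which
  -- is zero.
  have h1 : ∀ d ∈ level T s, seqProb β d x a * score d x β k =
      Real.exp (s * a) / normFactor β x a * (Real.exp (lin d x β) * ∑ t, ((d t : ℕ) : ℝ) * x t k) -
      Real.exp (s * a) / normFactor β x a * condMean s x β k * Real.exp (lin d x β) := by
    intro d hd
    rw [seqProb_eq, score, mem_level.1 hd]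
    ring
  change ∑ d ∈ level T s, _ = _
  rw [Finset.sum_congr rfl h1, Finset.sum_sub_distrib, ← Finset.mul_sum, ← Finset.mul_sum, ← C_eq,
    condMean]
  field_simp
  ring

end Model

end FELogit
end

noncomputable section
namespace FELogit

/-! ### Uniform continuity of the plug-in terms -/

/-- A `C^1` function of the covariates and of the parameter is bounded, and Lipschitz in the
parameter, uniformly on bounded sets. -/
lemma exists_bound_lipschitz {T p : ℕ} {F : Cov T p × (Fin p → ℝ) → ℝ} (hF : ContDiff ℝ 1 F)
    (R : ℝ) : ∃ L, 0 ≤ L ∧ ∀ x β, ‖x‖ ≤ R → ‖β‖ ≤ R →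
      |F (x, β)| ≤ L ∧ ∀ β', ‖β'‖ ≤ R → |F (x, β) - F (x, β')| ≤ L * ‖β - β'‖ := by
  have hc : IsCompact (Metric.closedBall (0 : Cov T p × (Fin p → ℝ)) R) := isCompact_closedBall _ _
  obtain ⟨L, hL⟩ := LocallyLipschitzOn.exists_lipschitzOnWith_of_compact hc
    hF.locallyLipschitz.locallyLipschitzOn
  obtain ⟨B, hB⟩ := hc.exists_bound_of_continuousOn hF.continuous.continuousOn
  have hmem : ∀ x β, ‖x‖ ≤ R → ‖β‖ ≤ R →
      (x, β) ∈ Metric.closedBall (0 : Cov T p × (Fin p → ℝ)) R := fun x β hx hβ => by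
    rw [mem_closedBall_zero_iff, Prod.norm_def]; exact max_le hx hβ
  refine ⟨max L |B|, le_max_of_le_left L.2, fun x β hx hβ => ⟨?_, fun β' hβ' => ?_⟩⟩
  · exact ((hB _ (hmem x β hx hβ)).trans (le_abs_self B)).trans (le_max_right _ _)
  · have h := hL.dist_le_mul _ (hmem x β hx hβ) _ (hmem x β' hx hβ')
    rw [Real.dist_eq, Prod.dist_eq, dist_self, dist_eq_norm, max_eq_right (norm_nonneg _)] at h
    exact h.trans (mul_le_mul_of_nonneg_right (le_max_left _ _) (norm_nonneg _))

lemma contDiff_dotProduct {E : Type*} [NormedAddCommGroup E] [NormedSpace ℝ E] {p : ℕ}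
    {u v : E → Fin p → ℝ} (hu : ContDiff ℝ 1 u) (hv : ContDiff ℝ 1 v) :
    ContDiff ℝ 1 fun z => u z ⬝ᵥ v z := by
  unfold dotProduct
  exact ContDiff.sum fun i _ => (contDiff_pi.1 hu i).mul (contDiff_pi.1 hv i)

lemma contDiff_cov_dotProduct {T p : ℕ} (t : Fin T) :
    ContDiff ℝ 1 fun z : Cov T p × (Fin p → ℝ) => z.1 t ⬝ᵥ z.2 :=
  contDiff_dotProduct ((contDiff_apply ℝ (Fin p → ℝ) t).comp contDiff_fst) contDiff_snd

lemma contDiff_C {T p : ℕ} (s : ℕ) : ContDiff ℝ 1 fun z : Cov T p × (Fin p → ℝ) => C s z.1 z.2 := by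
  unfold C
  exact ContDiff.sum fun d _ =>
    (ContDiff.sum fun t _ => contDiff_const.mul (contDiff_cov_dotProduct t)).exp

lemma contDiff_coeff_prod {E : Type*} [NormedAddCommGroup E] [NormedSpace ℝ E] {ι : Type*}
    (s : Finset ι) {f : ι → E → Polynomial ℝ} (hf : ∀ i n, ContDiff ℝ 1 fun z => (f i z).coeff n)
    (n : ℕ) : ContDiff ℝ 1 fun z => (∏ i ∈ s, f i z).coeff n := by
  classical
  induction s using Finset.induction_on generalizing n with
  | empty => simpa using contDiff_const
  | insert i s hi ih =>
    simp only [Finset.prod_insert hi, Polynomial.coeff_mul]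
    exact ContDiff.sum fun z _ => (hf i z.1).mul (ih z.2)

lemma contDiff_lam {T p : ℕ} [NeZero T] (t : ℕ) :
    ContDiff ℝ 1 fun z : Cov T p × (Fin p → ℝ) => lam t z.1 z.2 := by
  unfold lam
  simp only [Polynomial.coeff_mul]
  refine ContDiff.sum fun n _ => contDiff_const.mul (contDiff_coeff_prod _ (fun s m => ?_) _)
  have h1 : ContDiff ℝ 1 fun z : Cov T p × (Fin p → ℝ) =>
      Real.exp ((z.1 s - z.1 (lastPeriod T)) ⬝ᵥ z.2) - 1 := by
    simp only [sub_dotProduct]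
    exact ((contDiff_cov_dotProduct s).sub (contDiff_cov_dotProduct _)).exp.sub contDiff_const
  simp only [Polynomial.coeff_add, Polynomial.coeff_mul_C]
  exact (contDiff_const.mul h1).add contDiff_const

/-- The weights `exp (j x_T'β) / C_j(x, β)`. -/
def wgt {T p : ℕ} [NeZero T] (j : ℕ) (x : Cov T p) (β : Fin p → ℝ) : ℝ :=
  Real.exp (j * (x (lastPeriod T) ⬝ᵥ β)) / C j x β

lemma contDiff_wgt {T p j : ℕ} [NeZero T] (hj : j ≤ T) :
    ContDiff ℝ 1 fun z : Cov T p × (Fin p → ℝ) => wgt j z.1 z.2 :=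
  (contDiff_const.mul (contDiff_cov_dotProduct _)).exp.div (contDiff_C j)
    fun z => (C_pos hj z.1 z.2).ne'

lemma wgt_pos {T p j : ℕ} [NeZero T] (hj : j ≤ T) (x : Cov T p) (β : Fin p → ℝ) : 0 < wgt j x β :=
  div_pos (Real.exp_pos _) (C_pos hj x β)

lemma r_eq {T p : ℕ} [NeZero T] (k : Fin p) (x : Cov T p) (s : ℕ) (β : Fin p → ℝ) :
    r k x s β = β k * ∑ t ∈ Finset.range (s + 1), ((T - t).choose (s - t) : ℝ) *
      (lam t x β * wgt s x β) := by
  simp only [r, wgt, mul_div_assoc]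

lemma contDiff_r {T p s : ℕ} [NeZero T] (hs : s ≤ T) (k : Fin p) :
    ContDiff ℝ 1 fun z : Cov T p × (Fin p → ℝ) => r k z.1 s z.2 := by
  simp only [r_eq]
  exact ((contDiff_apply ℝ ℝ k).comp contDiff_snd).mul
    (ContDiff.sum fun t _ => contDiff_const.mul ((contDiff_lam t).mul (contDiff_wgt hs)))

/-- The coefficient `β_k λ_{T+1}(x, β)` of the extremal moment. -/
def slope {T p : ℕ} [NeZero T] (k : Fin p) (x : Cov T p) (β : Fin p → ℝ) : ℝ :=
  β k * lam (T + 1) x β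

lemma contDiff_slope {T p : ℕ} [NeZero T] (k : Fin p) :
    ContDiff ℝ 1 fun z : Cov T p × (Fin p → ℝ) => slope k z.1 z.2 :=
  ((contDiff_apply ℝ ℝ k).comp contDiff_snd).mul (contDiff_lam _)

/-- The common form of the two bounds. -/
def boundTerm (ρ c v q₁ q₂ : ℝ) : ℝ := ρ + c * (max v 0 * q₁ - max (-v) 0 * q₂)

/-- Replacing the test on the sign of the slope by its positive and negative parts makes the term
visibly Lipschitz in the slope, also where the sign changes. -/
lemma lowerTerm_eq {T p : ℕ} [NeZero T] (k : Fin p) (x : Cov T p) (s : ℕ) (β : Fin p → ℝ)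
    (c : ℝ) (m : ℕ → ℝ) :
    lowerTerm k x s β c m = boundTerm (r k x s β) c (slope k x β) (qLower T m) (qUpper T m) := by
  unfold lowerTerm boundTerm slope
  split_ifs with h
  · rw [max_eq_left h, max_eq_right (by linarith)]; ring
  · rw [max_eq_right (not_le.1 h).le, max_eq_left (by linarith)]; ring

lemma upperTerm_eq {T p : ℕ} [NeZero T] (k : Fin p) (x : Cov T p) (s : ℕ) (β : Fin p → ℝ)
    (c : ℝ) (m : ℕ → ℝ) :
    upperTerm k x s β c m = boundTerm (r k x s β) c (slope k x β) (qUpper T m) (qLower T m) := by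
  unfold upperTerm boundTerm slope
  split_ifs with h
  · rw [max_eq_left h, max_eq_right (by linarith)]; ring
  · rw [max_eq_right (not_le.1 h).le, max_eq_left (by linarith)]; ring

lemma abs_boundTerm_le {ρ c v q₁ q₂ : ℝ} (h₁ : q₁ ∈ Set.Icc (0 : ℝ) 1)
    (h₂ : q₂ ∈ Set.Icc (0 : ℝ) 1) : |boundTerm ρ c v q₁ q₂| ≤ |ρ| + |c| * |v| := by
  unfold boundTerm
  refine (abs_add_le _ _).trans (add_le_add_right ?_ _)
  rw [abs_mul]
  refine mul_le_mul_of_nonneg_left ?_ (abs_nonneg _)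
  rw [abs_le]
  rcases le_total 0 v with h | h
  · rw [max_eq_left h, max_eq_right (by linarith : -v ≤ 0), abs_of_nonneg h]
    constructor <;> nlinarith [h₁.1, h₁.2]
  · rw [max_eq_right h, max_eq_left (by linarith : 0 ≤ -v), abs_of_nonpos h]
    constructor <;> nlinarith [h₂.1, h₂.2]

lemma abs_boundTerm_sub_le {ρ ρ' c c' v v' q₁ q₁' q₂ q₂' : ℝ} (h₁ : q₁' ∈ Set.Icc (0 : ℝ) 1)
    (h₂ : q₂' ∈ Set.Icc (0 : ℝ) 1) :
    |boundTerm ρ c v q₁ q₂ - boundTerm ρ' c' v' q₁' q₂'| ≤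
      |ρ - ρ'| + |c - c'| * |v'| + |c| * (|v| * (|q₁ - q₁'| + |q₂ - q₂'|) + 2 * |v - v'|) := by
  have e : boundTerm ρ c v q₁ q₂ - boundTerm ρ' c' v' q₁' q₂' = (ρ - ρ') +
      (c - c') * (max v' 0 * q₁' - max (-v') 0 * q₂') +
      c * (max v 0 * (q₁ - q₁') - max (-v) 0 * (q₂ - q₂') +
        ((max v 0 - max v' 0) * q₁' - (max (-v) 0 - max (-v') 0) * q₂')) := by
    unfold boundTerm; ring
  have hv := (abs_boundTerm_le (ρ := 0) (c := 1) (v := v') h₁ h₂)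
  simp only [boundTerm, zero_add, one_mul, abs_zero, abs_one] at hv
  have hm1 : |max v 0| ≤ |v| := by
    rw [abs_of_nonneg (le_max_right _ _)]; exact max_le (le_abs_self _) (abs_nonneg _)
  have hm2 : |max (-v) 0| ≤ |v| := by
    rw [abs_of_nonneg (le_max_right _ _)]; exact max_le (neg_le_abs _) (abs_nonneg _)
  have hd1 : |max v 0 - max v' 0| ≤ |v - v'| := abs_max_sub_max_le_abs _ _ _
  have hd2 : |max (-v) 0 - max (-v') 0| ≤ |v - v'| := by
    refine (abs_max_sub_max_le_abs _ _ _).trans (le_of_eq ?_)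
    rw [← abs_neg]; congr 1; ring
  have hq1 : |q₁'| ≤ 1 := abs_le.2 ⟨by linarith [h₁.1], h₁.2⟩
  have hq2 : |q₂'| ≤ 1 := abs_le.2 ⟨by linarith [h₂.1], h₂.2⟩
  rw [e]
  refine (abs_add_le _ _).trans (add_le_add ((abs_add_le _ _).trans (add_le_add le_rfl ?_)) ?_)
  · rw [abs_mul]; exact mul_le_mul_of_nonneg_left hv (abs_nonneg _)
  · rw [abs_mul]
    refine mul_le_mul_of_nonneg_left ((abs_add_le _ _).trans (add_le_add ?_ ?_)) (abs_nonneg _)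
    · refine (abs_sub _ _).trans ?_
      rw [abs_mul, abs_mul, mul_add]
      exact add_le_add (mul_le_mul_of_nonneg_right hm1 (abs_nonneg _))
        (mul_le_mul_of_nonneg_right hm2 (abs_nonneg _))
    · refine (abs_sub _ _).trans ?_
      rw [abs_mul, abs_mul, two_mul]
      exact add_le_add
        ((mul_le_mul hd1 hq1 (abs_nonneg _) (abs_nonneg _)).trans_eq (mul_one _))
        ((mul_le_mul hd2 hq2 (abs_nonneg _) (abs_nonneg _)).trans_eq (mul_one _))

lemma abs_boundTerm_sub_le_of_le {ρ ρ' c c' v v' q₁ q₁' q₂ q₂' L₁ L₂ δ d e : ℝ} (hL₁ : 0 ≤ L₁)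
    (hL₂ : 0 ≤ L₂) (hd : 0 ≤ d)
    (h₁ : q₁' ∈ Set.Icc (0 : ℝ) 1) (h₂ : q₂' ∈ Set.Icc (0 : ℝ) 1) (hρ : |ρ - ρ'| ≤ L₂ * δ)
    (hc : |c - c'| ≤ d) (hc₁ : |c| ≤ L₁ + 1) (hv : |v| ≤ L₂) (hv' : |v'| ≤ L₂)
    (hvv : |v - v'| ≤ L₂ * δ) (hq₁ : |q₁ - q₁'| ≤ e) (hq₂ : |q₂ - q₂'| ≤ e) :
    |boundTerm ρ c v q₁ q₂ - boundTerm ρ' c' v' q₁' q₂'| ≤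
      L₂ * δ + d * L₂ + (L₁ + 1) * ((L₂ + 1) * (2 * e) + 2 * (L₂ * δ)) := by
  have t2 : |c - c'| * |v'| ≤ d * L₂ := mul_le_mul hc hv' (abs_nonneg _) hd
  have t3 : |v| * (|q₁ - q₁'| + |q₂ - q₂'|) ≤ (L₂ + 1) * (2 * e) :=
    mul_le_mul (by linarith) (by linarith) (by positivity) (by positivity)
  exact (abs_boundTerm_sub_le h₁ h₂).trans (add_le_add (add_le_add hρ t2)
    (mul_le_mul hc₁ (add_le_add t3 (mul_le_mul_of_nonneg_left hvv zero_le_two)) (by positivity)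
      (by positivity)))

lemma cPlug_eq {T p : ℕ} [NeZero T] (γ : ℕ → Cov T p → ℝ) (β : Fin p → ℝ) (t : ℕ)
    (x : Cov T p) : cPlug γ β t x =
      ∑ j ∈ Finset.Icc t T, γ j x * (((T - t).choose (j - t) : ℝ) * wgt j x β) := by
  unfold cPlug wgt
  exact Finset.sum_congr rfl fun j _ => by ring

/-- Uniform bounds for the weights. -/
lemma exists_wgt_bounds (T p : ℕ) [NeZero T] (R : ℝ) : ∃ L κ, 0 ≤ L ∧ 0 < κ ∧
    ∀ j ≤ T, ∀ (x : Cov T p) (β : Fin p → ℝ), ‖x‖ ≤ R → ‖β‖ ≤ R → κ ≤ wgt j x β ∧ wgt j x β ≤ L ∧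
      ∀ β', ‖β'‖ ≤ R → |wgt j x β - wgt j x β'| ≤ L * ‖β - β'‖ := by
  choose! A hA0 hA using fun (j : ℕ) (hj : j ≤ T) =>
    exists_bound_lipschitz (contDiff_wgt (p := p) hj) R
  choose! A' hA0' hA' using fun (j : ℕ) (hj : j ≤ T) =>
    exists_bound_lipschitz ((contDiff_wgt (p := p) hj).inv fun z => (wgt_pos hj _ _).ne') R
  have hle : ∀ {f : ℕ → ℝ}, (∀ j ≤ T, 0 ≤ f j) → ∀ j ≤ T, f j ≤ ∑ j ∈ Finset.range (T + 1), f j :=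
    fun hf j hj => Finset.single_le_sum (fun i hi => hf i (Finset.mem_range_succ_iff.1 hi))
      (Finset.mem_range_succ_iff.2 hj)
  refine ⟨∑ j ∈ Finset.range (T + 1), A j, (1 + ∑ j ∈ Finset.range (T + 1), A' j)⁻¹,
    Finset.sum_nonneg fun j hj => hA0 j (Finset.mem_range_succ_iff.1 hj), inv_pos.2 ?_, ?_⟩
  · linarith [Finset.sum_nonneg fun j hj => hA0' j (Finset.mem_range_succ_iff.1 hj)]
  · intro j hj x β hx hβ
    refine ⟨?_, ?_, fun β' hβ' => ?_⟩
    · have h1 : (wgt j x β)⁻¹ ≤ ∑ j ∈ Finset.range (T + 1), A' j :=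
        ((le_abs_self _).trans (hA' j hj x β hx hβ).1).trans (hle hA0' j hj)
      have h2 : (wgt j x β)⁻¹ ≤ 1 + ∑ j ∈ Finset.range (T + 1), A' j := by linarith
      exact (inv_anti₀ (inv_pos.2 (wgt_pos hj x β)) h2).trans_eq (inv_inv _)
    · exact ((le_abs_self _).trans (hA j hj x β hx hβ).1).trans (hle hA0 j hj)
    · exact ((hA j hj x β hx hβ).2 β' hβ').trans
        (mul_le_mul_of_nonneg_right (hle hA0 j hj) (norm_nonneg _))

/-- Uniform bounds for the plug-in estimates of `c_t`. -/
lemma exists_cPlug_bounds (T p : ℕ) [NeZero T] (R : ℝ) : ∃ L κ, 0 ≤ L ∧ 0 < κ ∧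
    ∀ (x : Cov T p) (β : Fin p → ℝ), ‖x‖ ≤ R → ‖β‖ ≤ R → ∀ γ : ℕ → Cov T p → ℝ,
      (∀ t, |cPlug γ β t x| ≤ L * ∑ j ∈ Finset.range (T + 1), |γ j x|) ∧
      ((∀ j ≤ T, 0 ≤ γ j x) → ∑ j ∈ Finset.range (T + 1), γ j x = 1 →
        κ ≤ cPlug γ β 0 x ∧ ∀ β', ‖β'‖ ≤ R → ∀ (γ' : ℕ → Cov T p → ℝ) (t : ℕ),
          |cPlug γ' β' t x - cPlug γ β t x| ≤
            L * (∑ j ∈ Finset.range (T + 1), |γ' j x - γ j x| + ‖β' - β‖)) := by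
  obtain ⟨L, κ, hL, hκ, hw⟩ := exists_wgt_bounds T p R
  have hsub : ∀ t, Finset.Icc t T ⊆ Finset.range (T + 1) := fun t j hj =>
    Finset.mem_range_succ_iff.2 (Finset.mem_Icc.1 hj).2
  have hch : ∀ t j, ((T - t).choose (j - t) : ℝ) ≤ 2 ^ T := fun t j => by
    have := ((T - t).choose_le_two_pow (j - t)).trans
      (Nat.pow_le_pow_right (by norm_num) (Nat.sub_le T t))
    exact_mod_cast this
  refine ⟨2 ^ T * L, κ, by positivity, hκ, fun x β hx hβ γ => ⟨fun t => ?_, fun h0 h1 => ⟨?_, ?_⟩⟩⟩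
  · rw [cPlug_eq, Finset.mul_sum]
    refine (Finset.abs_sum_le_sum_abs _ _).trans ((Finset.sum_le_sum fun j hj => ?_).trans
      (Finset.sum_le_sum_of_subset_of_nonneg (hsub t) fun j _ _ => by positivity))
    have hj' := (Finset.mem_Icc.1 hj).2
    rw [abs_mul, abs_of_nonneg (mul_nonneg (Nat.cast_nonneg _) (wgt_pos hj' x β).le), mul_comm]
    exact mul_le_mul_of_nonneg_right (mul_le_mul (hch t j) (hw j hj' x β hx hβ).2.1
      (wgt_pos hj' x β).le (by positivity)) (abs_nonneg _)
  · rw [cPlug_eq]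
    have : Finset.Icc 0 T = Finset.range (T + 1) := by ext; simp
    rw [this]
    calc κ = ∑ j ∈ Finset.range (T + 1), γ j x * κ := by rw [← Finset.sum_mul, h1, one_mul]
      _ ≤ _ := Finset.sum_le_sum fun j hj => by
        have hj' := Finset.mem_range_succ_iff.1 hj
        refine mul_le_mul_of_nonneg_left ?_ (h0 j hj')
        have h2 : (1 : ℝ) ≤ ((T - 0).choose (j - 0) : ℝ) := by
          exact_mod_cast Nat.choose_pos (by simpa using hj')
        nlinarith [(hw j hj' x β hx hβ).1]
  · intro β' hβ' γ' t
    rw [cPlug_eq, cPlug_eq, ← Finset.sum_sub_distrib, mul_add]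
    have hb : ‖β' - β‖ = ∑ j ∈ Finset.range (T + 1), γ j x * ‖β' - β‖ := by
      rw [← Finset.sum_mul, h1, one_mul]
    rw [hb, Finset.mul_sum, Finset.mul_sum, ← Finset.sum_add_distrib]
    refine (Finset.abs_sum_le_sum_abs _ _).trans ((Finset.sum_le_sum fun j hj => ?_).trans
      (Finset.sum_le_sum_of_subset_of_nonneg (hsub t) fun j hj _ => ?_))
    · have hj' := (Finset.mem_Icc.1 hj).2
      have e : γ' j x * (((T - t).choose (j - t) : ℝ) * wgt j x β') -
          γ j x * (((T - t).choose (j - t) : ℝ) * wgt j x β) =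
          ((T - t).choose (j - t) : ℝ) * wgt j x β' * (γ' j x - γ j x) +
          ((T - t).choose (j - t) : ℝ) * (wgt j x β' - wgt j x β) * γ j x := by ring
      rw [e]
      refine (abs_add_le _ _).trans (add_le_add ?_ ?_)
      · rw [abs_mul, abs_of_nonneg (mul_nonneg (Nat.cast_nonneg _) (wgt_pos hj' x β').le)]
        exact mul_le_mul_of_nonneg_right (mul_le_mul (hch t j) (hw j hj' x β' hx hβ').2.1
          (wgt_pos hj' x β').le (by positivity)) (abs_nonneg _)
      · rw [abs_mul, abs_mul, abs_of_nonneg (h0 j hj'), Nat.abs_cast]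
        have := mul_le_mul (hch t j) ((hw j hj' x β' hx hβ').2.2 β hβ) (abs_nonneg _)
          (by positivity)
        calc _ ≤ 2 ^ T * (L * ‖β' - β‖) * γ j x := mul_le_mul_of_nonneg_right this (h0 j hj')
          _ = _ := by ring
    · have := h0 j (Finset.mem_range_succ_iff.1 hj)
      positivity

lemma mTilde_zero {T p : ℕ} [NeZero T] (γ : ℕ → Cov T p → ℝ) (β : Fin p → ℝ) (x : Cov T p) :
    mTilde γ β x 0 = 1 := if_pos rfl

lemma exists_term_coeff_bounds {T p : ℕ} [NeZero T] (k : Fin p) (R : ℝ) : ∃ L, 0 ≤ L ∧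
    ∀ (x : Cov T p) (β : Fin p → ℝ), ‖x‖ ≤ R → ‖β‖ ≤ R →
      |slope k x β| ≤ L ∧ (∀ s ≤ T, |r k x s β| ≤ L) ∧ ∀ β', ‖β'‖ ≤ R →
        |slope k x β - slope k x β'| ≤ L * ‖β - β'‖ ∧
        ∀ s ≤ T, |r k x s β - r k x s β'| ≤ L * ‖β - β'‖ := by
  obtain ⟨L₁, hL₁, h₁⟩ := exists_bound_lipschitz (contDiff_slope (T := T) k) R
  choose! A hA0 hA using fun (s : ℕ) (hs : s ≤ T) =>
    exists_bound_lipschitz (contDiff_r hs k) R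
  have hS : 0 ≤ ∑ j ∈ Finset.range (T + 1), A j :=
    Finset.sum_nonneg fun j hj => hA0 j (Finset.mem_range_succ_iff.1 hj)
  have hle : ∀ j ≤ T, A j ≤ L₁ + ∑ j ∈ Finset.range (T + 1), A j := fun j hj => by
    have := Finset.single_le_sum (f := A) (fun i hi => hA0 i (Finset.mem_range_succ_iff.1 hi))
      (Finset.mem_range_succ_iff.2 hj)
    linarith
  refine ⟨L₁ + ∑ j ∈ Finset.range (T + 1), A j, by positivity, fun x β hx hβ =>
    ⟨(h₁ x β hx hβ).1.trans (by linarith), fun s hs => (hA s hs x β hx hβ).1.trans (hle s hs),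
      fun β' hβ' => ⟨((h₁ x β hx hβ).2 β' hβ').trans ?_, fun s hs =>
        ((hA s hs x β hx hβ).2 β' hβ').trans ?_⟩⟩⟩
  · exact mul_le_mul_of_nonneg_right (by linarith) (norm_nonneg _)
  · exact mul_le_mul_of_nonneg_right (hle s hs) (norm_nonneg _)

/-- A bound for the estimated terms, whatever the estimates. -/
lemma exists_abs_term_le {T p : ℕ} [NeZero T] (k : Fin p) (R : ℝ) : ∃ L, 0 ≤ L ∧
    ∀ (x : Cov T p) (β : Fin p → ℝ), ‖x‖ ≤ R → ‖β‖ ≤ R → ∀ (γ : ℕ → Cov T p → ℝ) (m : ℕ → ℝ),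
      m 0 = 1 → ∀ s ≤ T,
      |lowerTerm k x s β (cPlug γ β 0 x) m| ≤ L * (1 + ∑ j ∈ Finset.range (T + 1), |γ j x|) ∧
      |upperTerm k x s β (cPlug γ β 0 x) m| ≤ L * (1 + ∑ j ∈ Finset.range (T + 1), |γ j x|) := by
  obtain ⟨L₁, κ, hL₁, -, h₁⟩ := exists_cPlug_bounds T p R
  obtain ⟨L₂, hL₂, h₂⟩ := exists_term_coeff_bounds (T := T) k R
  refine ⟨L₂ + L₁ * L₂, by positivity, fun x β hx hβ γ m hm s hs => ?_⟩
  have key : ∀ q₁ q₂, q₁ ∈ Set.Icc (0 : ℝ) 1 → q₂ ∈ Set.Icc (0 : ℝ) 1 →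
      |boundTerm (r k x s β) (cPlug γ β 0 x) (slope k x β) q₁ q₂| ≤
        (L₂ + L₁ * L₂) * (1 + ∑ j ∈ Finset.range (T + 1), |γ j x|) := fun q₁ q₂ hq₁ hq₂ => by
    have hS : 0 ≤ ∑ j ∈ Finset.range (T + 1), |γ j x| := by positivity
    have := mul_le_mul ((h₁ x β hx hβ γ).1 0) (h₂ x β hx hβ).1 (abs_nonneg _) (by positivity)
    have h3 := (h₂ x β hx hβ).2.1 s hs
    have h4 : 0 ≤ L₁ * L₂ := by positivity
    refine (abs_boundTerm_le hq₁ hq₂).trans ?_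
    nlinarith
  rw [lowerTerm_eq, upperTerm_eq]
  exact ⟨key _ _ (qLower_mem_Icc T hm) (qUpper_mem_Icc T hm),
    key _ _ (qUpper_mem_Icc T hm) (qLower_mem_Icc T hm)⟩

/-- The estimated terms are uniformly close to the true ones, if the estimation errors are small
compared with the threshold. -/
theorem exists_term_close {T p : ℕ} [NeZero T] (k : Fin p) (R : ℝ) {η : ℝ} (hη : 0 < η) {ε : ℝ}
    (hε : 0 < ε) : ∃ δ > 0, ∀ (x : Cov T p) (β₀ β : Fin p → ℝ), ‖x‖ ≤ R → ‖β₀‖ ≤ R → ‖β‖ ≤ R →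
      ∀ γ₀ γ : ℕ → Cov T p → ℝ, (∀ j ≤ T, 0 ≤ γ₀ j x) →
      ∑ j ∈ Finset.range (T + 1), γ₀ j x = 1 → mTilde γ₀ β₀ x ∈ Strat T η →
      ∀ c, 0 < c → c < δ → ‖β - β₀‖ ≤ δ * c → (∀ j ≤ T, |γ j x - γ₀ j x| ≤ δ * c) → ∀ s ≤ T,
      |lowerTerm k x s β (cPlug γ β 0 x) (mHat c γ β x) -
        lowerTerm k x s β₀ (cPlug γ₀ β₀ 0 x) (mTilde γ₀ β₀ x)| ≤ ε ∧
      |upperTerm k x s β (cPlug γ β 0 x) (mHat c γ β x) -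
        upperTerm k x s β₀ (cPlug γ₀ β₀ 0 x) (mTilde γ₀ β₀ x)| ≤ ε := by
  obtain ⟨L₁, κ, hL₁, hκ, h₁⟩ := exists_cPlug_bounds T p R
  obtain ⟨L₂, hL₂, h₂⟩ := exists_term_coeff_bounds (T := T) k R
  set M := (L₁ + 1) * (L₂ + 1) with hM
  have hM1 : 0 < M := by positivity
  -- The extremal moments enter with a factor at most `M`, so this tolerance contributes ε/3 in all.
  obtain ⟨δ₀, hδ₀, hcorr⟩ := correct_uniform T hη (show 0 < ε / (6 * M) by positivity)
  set N : ℝ := L₁ * (T + 2) with hN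
  have hN0 : 0 ≤ N := by positivity
  set D : ℝ := 2 / κ + 2 * L₁ / κ ^ 2 with hD
  have hD0 : 0 < D := by positivity
  -- In order: c stays below 1; the threshold is admissible for `correct_uniform`; the estimate of
  -- c_0 stays above κ/2; the moment errors stay below δ₀ c; the estimate of c_0 is at most L₁ + 1;
  -- the remaining Lipschitz terms are small.
  obtain ⟨δ, hδ, hδ1, hδδ, hδN, hδD, hδN1, hδε⟩ : ∃ δ > 0, δ ≤ 1 ∧ δ ≤ δ₀ ∧ N * δ ≤ κ / 2 ∧
      N * D * δ ≤ δ₀ ∧ N * δ ≤ 1 ∧ (L₂ + N * L₂ + 4 * M * L₂ + N) * δ ≤ ε / 6 := by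
    have hev : ∀ a b : ℝ, 0 < b → ∀ᶠ δ in 𝓝[>] (0 : ℝ), a * δ ≤ b := fun a b hb => by
      have : Tendsto (fun δ : ℝ => a * δ) (𝓝[>] 0) (𝓝 0) := by
        have : Tendsto (fun δ : ℝ => a * δ) (𝓝 0) (𝓝 (a * 0)) := by
          exact (continuous_const.mul continuous_id).tendsto 0
        rw [mul_zero] at this
        exact this.mono_left nhdsWithin_le_nhds
      exact (this.eventually_lt_const hb).mono fun _ h => h.le
    obtain ⟨δ, h1, h2, h3, h4, h5, h5', h6⟩ := ((eventually_mem_nhdsWithin (a := (0 : ℝ))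
      (s := Set.Ioi 0)).and ((hev 1 1 one_pos).and ((hev 1 δ₀ hδ₀).and ((hev N (κ / 2)
      (by positivity)).and ((hev (N * D) δ₀ hδ₀).and ((hev N 1 one_pos).and (hev (L₂ + N * L₂ + 4 * M * L₂ + N) (ε / 6)
      (by positivity)))))))).exists
    exact ⟨δ, h1, by linarith, by linarith, h4, h5, h5', h6⟩
  refine ⟨δ, hδ, fun x β₀ β hx hβ₀ hβ γ₀ γ hγ0 hγ1 hstrat c hc hcδ hβδ hγδ s hs => ?_⟩
  have hc1 : c < 1 := hcδ.trans_le hδ1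
  have hδc : δ * c ≤ δ := by nlinarith
  obtain ⟨hlow, hdiff⟩ := (h₁ x β₀ hx hβ₀ γ₀).2 hγ0 hγ1
  have hsumabs : ∑ j ∈ Finset.range (T + 1), |γ₀ j x| = 1 := by
    rw [← hγ1]
    exact Finset.sum_congr rfl fun j hj => abs_of_nonneg (hγ0 j (Finset.mem_range_succ_iff.1 hj))
  have hup : ∀ t, |cPlug γ₀ β₀ t x| ≤ L₁ := fun t => by
    have := (h₁ x β₀ hx hβ₀ γ₀).1 t
    rwa [hsumabs, mul_one] at this
  have hcd : ∀ t, |cPlug γ β t x - cPlug γ₀ β₀ t x| ≤ N * (δ * c) := fun t => by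
    refine (hdiff β hβ γ t).trans ?_
    have : ∑ j ∈ Finset.range (T + 1), |γ j x - γ₀ j x| ≤ (T + 1) * (δ * c) := by
      refine (Finset.sum_le_card_nsmul _ _ _ fun j hj =>
        hγδ j (Finset.mem_range_succ_iff.1 hj)).trans_eq ?_
      simp
    calc _ ≤ L₁ * ((T + 1) * (δ * c) + δ * c) := mul_le_mul_of_nonneg_left (by linarith) hL₁
      _ = N * (δ * c) := by rw [hN]; ring
  have hNc : N * (δ * c) ≤ κ / 2 := (mul_le_mul_of_nonneg_left hδc hN0).trans hδN
  have hlow' : κ / 2 ≤ cPlug γ β 0 x := by have := (abs_le.1 (hcd 0)).1; linarith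
  -- Errors of order δ c in the numerator and in the denominator, with denominators at least κ/2 and
  -- κ, give the factor D = 2/κ + 2L₁/κ².
  have hmt : ∀ t ≤ T, |mTilde γ β x t - mTilde γ₀ β₀ x t| ≤ δ₀ * c := fun t _ => by
    unfold mTilde
    split_ifs with h0
    · simp; positivity
    have e : cPlug γ β t x / cPlug γ β 0 x - cPlug γ₀ β₀ t x / cPlug γ₀ β₀ 0 x =
        (cPlug γ β t x - cPlug γ₀ β₀ t x) / cPlug γ β 0 x -
        cPlug γ₀ β₀ t x * (cPlug γ β 0 x - cPlug γ₀ β₀ 0 x) /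
          (cPlug γ β 0 x * cPlug γ₀ β₀ 0 x) := by
      have h3 : cPlug γ β 0 x ≠ 0 := by linarith
      have h4 : cPlug γ₀ β₀ 0 x ≠ 0 := by linarith
      field_simp; ring
    have hpos : 0 < cPlug γ β 0 x := by linarith
    have hpos₀ : 0 < cPlug γ₀ β₀ 0 x := by linarith
    calc _ ≤ N * (δ * c) / (κ / 2) + L₁ * (N * (δ * c)) / (κ / 2 * κ) := by
          rw [e]
          refine (abs_sub _ _).trans (add_le_add ?_ ?_)
          · rw [abs_div, abs_of_pos hpos]
            exact div_le_div₀ (by positivity) (hcd t) (by positivity) hlow'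
          · rw [abs_div, abs_mul, abs_of_pos (mul_pos hpos hpos₀)]
            exact div_le_div₀ (by positivity) (mul_le_mul (hup t) (hcd 0) (abs_nonneg _) hL₁)
              (by positivity) (mul_le_mul hlow' hlow hκ.le hpos.le)
      _ = N * D * δ * c := by rw [hD]; field_simp
      _ ≤ δ₀ * c := mul_le_mul_of_nonneg_right hδD hc.le
  have hq := hcorr _ hstrat c hc (hcδ.trans_le hδδ) _ (mTilde_zero γ β x) hmt
  have hm1 : mHat c γ β x 0 = 1 := correct_zero T c (mTilde_zero γ β x)
  have hcabs : |cPlug γ β 0 x| ≤ L₁ + N * (δ * c) := by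
    have := abs_add_le (cPlug γ β 0 x - cPlug γ₀ β₀ 0 x) (cPlug γ₀ β₀ 0 x)
    rw [sub_add_cancel] at this
    linarith [hcd 0, hup 0]
  have hNδ : N * (δ * c) ≤ N * δ := mul_le_mul_of_nonneg_left hδc hN0
  have hb' : ‖β - β₀‖ ≤ δ := hβδ.trans hδc
  have key : ∀ q₁ q₁' q₂ q₂', q₁' ∈ Set.Icc (0 : ℝ) 1 → q₂' ∈ Set.Icc (0 : ℝ) 1 →
      |q₁ - q₁'| ≤ ε / (6 * M) → |q₂ - q₂'| ≤ ε / (6 * M) →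
      |boundTerm (r k x s β) (cPlug γ β 0 x) (slope k x β) q₁ q₂ -
        boundTerm (r k x s β₀) (cPlug γ₀ β₀ 0 x) (slope k x β₀) q₁' q₂'| ≤ ε := by
    intro q₁ q₁' q₂ q₂' hq₁ hq₂ hd₁ hd₂
    have hb : L₂ * ‖β - β₀‖ ≤ L₂ * δ := mul_le_mul_of_nonneg_left hb' hL₂
    refine (abs_boundTerm_sub_le_of_le hL₁ hL₂ (by positivity) hq₁ hq₂
      ((((h₂ x β hx hβ).2.2 β₀ hβ₀).2 s hs).trans hb) ((hcd 0).trans hNδ)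
      (hcabs.trans (by linarith)) (h₂ x β hx hβ).1 (h₂ x β₀ hx hβ₀).1
      (((h₂ x β hx hβ).2.2 β₀ hβ₀).1.trans hb) hd₁ hd₂).trans ?_
    have t5 : (L₁ + 1) * ((L₂ + 1) * (2 * (ε / (6 * M)))) = ε / 3 := by
      rw [hM]; field_simp; norm_num
    have t6 : (L₁ + 1) * (2 * (L₂ * δ)) ≤ 2 * (M * L₂ * δ) := by
      have : L₁ + 1 ≤ M := by rw [hM]; nlinarith
      have := mul_le_mul_of_nonneg_right this (show 0 ≤ L₂ * δ by positivity)
      linarith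
    have t7 : 0 ≤ M * L₂ * δ := by positivity
    have t8 : 0 ≤ N * δ := by positivity
    rw [mul_add (L₁ + 1), t5]
    linarith
  have hz := mTilde_zero γ₀ β₀ x
  rw [lowerTerm_eq, lowerTerm_eq, upperTerm_eq, upperTerm_eq]
  exact ⟨key _ _ _ _ (qLower_mem_Icc T hz) (qUpper_mem_Icc T hz) hq.1 hq.2,
    key _ _ _ _ (qUpper_mem_Icc T hz) (qLower_mem_Icc T hz) hq.2 hq.1⟩

end FELogit
end

noncomputable section
namespace FELogit

/-! ### Deviation inequalities for i.i.d. samples -/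

/-- The variables `Z_i` are i.i.d. with law `μ`. -/
structure IsIID {Ω 𝒵 : Type*} [MeasurableSpace Ω] [MeasurableSpace 𝒵] (P : Measure Ω)
    (Z : ℕ → Ω → 𝒵) (μ : Measure 𝒵) : Prop where
  measurable : ∀ i, Measurable (Z i)
  iIndep : iIndepFun Z P
  map_eq : ∀ i, P.map (Z i) = μ

section

variable {Ω 𝒵 : Type*} [MeasurableSpace Ω] [MeasurableSpace 𝒵] {P : Measure Ω}
  [IsProbabilityMeasure P] {Z : ℕ → Ω → 𝒵} {μ : Measure 𝒵}

lemma IsIID.isProbabilityMeasure (h : IsIID P Z μ) : IsProbabilityMeasure μ := by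
  rw [← h.map_eq 0]; exact Measure.isProbabilityMeasure_map (h.measurable 0).aemeasurable

/-- Sample averages of bounded functions concentrate. -/
theorem IsIID.mean_dev (h : IsIID P Z μ) {H : 𝒵 → ℝ} (hH : AEMeasurable H μ) {B : ℝ}
    (hB : ∀ᵐ z ∂μ, |H z| ≤ B) {n : ℕ} (hn : 0 < n) {τ : ℝ} (hτ : 0 < τ) :
    P.real {ω | τ < |(n : ℝ)⁻¹ * ∑ i ∈ Finset.range n, H (Z i ω) - ∫ z, H z ∂μ|} ≤
      B ^ 2 / (n * τ ^ 2) := by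
  have hmap : ∀ i, AEMeasurable H (P.map (Z i)) := fun i => by rw [h.map_eq]; exact hH
  have hYm : ∀ i, AEMeasurable (fun ω => H (Z i ω)) P := fun i =>
    (hmap i).comp_measurable (h.measurable i)
  have hYb : ∀ i, ∀ᵐ ω ∂P, |H (Z i ω)| ≤ B := fun i =>
    ae_of_ae_map (h.measurable i).aemeasurable (by rw [h.map_eq]; exact hB)
  have hmem : ∀ i, MemLp (fun ω => H (Z i ω)) 2 P := fun i =>
    MemLp.of_bound (hYm i).aestronglyMeasurable B (hYb i)
  have hmean : ∀ i, ∫ ω, H (Z i ω) ∂P = ∫ z, H z ∂μ := fun i => by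
    rw [← h.map_eq i, integral_map (h.measurable i).aemeasurable (hmap i).aestronglyMeasurable]
  set S : Ω → ℝ := fun ω => ∑ i ∈ Finset.range n, H (Z i ω) with hS
  have hSm : MemLp S 2 P := memLp_finsetSum _ fun i _ => hmem i
  have hSE : ∫ ω, S ω ∂P = n * ∫ z, H z ∂μ := by
    rw [hS, integral_finsetSum _ fun i _ => (hmem i).integrable one_le_two]
    simp [hmean]
  have hvar : variance S P ≤ n * B ^ 2 := by
    have e : S = ∑ i ∈ Finset.range n, fun ω => H (Z i ω) := by
      ext ω; simp [hS]
    rw [e, IndepFun.variance_sum (fun i _ => hmem i) fun i _ j _ hij => ?_]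
    · calc _ ≤ ∑ i ∈ Finset.range n, B ^ 2 := Finset.sum_le_sum fun i _ => by
            refine (variance_le_expectation_sq (hYm i).aestronglyMeasurable).trans ?_
            have : ∫ ω, ((fun ω => H (Z i ω)) ^ 2) ω ∂P ≤ ∫ _, B ^ 2 ∂P := by
              refine integral_mono_ae (hmem i).integrable_sq (integrable_const _) ?_
              filter_upwards [hYb i] with ω hω
              exact sq_le_sq' (abs_le.1 hω).1 (abs_le.1 hω).2
            simpa using this
        _ = n * B ^ 2 := by simp
    · exact (h.iIndep.indepFun hij).comp₀ (h.measurable i).aemeasurable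
        (h.measurable j).aemeasurable (hmap i) (hmap j)
  have hn' : (0 : ℝ) < n := by exact_mod_cast hn
  have hcheb := meas_ge_le_variance_div_sq hSm (c := n * τ) (by positivity)
  have hsub : {ω | τ < |(n : ℝ)⁻¹ * S ω - ∫ z, H z ∂μ|} ⊆
      {ω | n * τ ≤ |S ω - ∫ ω, S ω ∂P|} := fun ω (hω : τ < _) => by
    have e : S ω - ∫ ω, S ω ∂P = n * ((n : ℝ)⁻¹ * S ω - ∫ z, H z ∂μ) := by
      rw [hSE]; field_simp
    change n * τ ≤ |S ω - ∫ ω, S ω ∂P|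
    rw [e, abs_mul, abs_of_pos hn']
    exact mul_le_mul_of_nonneg_left hω.le hn'.le
  calc _ ≤ P.real {ω | n * τ ≤ |S ω - ∫ ω, S ω ∂P|} := measureReal_mono hsub
    _ ≤ variance S P / (n * τ) ^ 2 := by
        rw [measureReal_def]
        exact ENNReal.toReal_le_of_le_ofReal (div_nonneg (variance_nonneg _ _) (by positivity)) hcheb
    _ ≤ n * B ^ 2 / (n * τ) ^ 2 := by gcongr
    _ = B ^ 2 / (n * τ ^ 2) := by field_simp

/-- Averages of a bounded kernel over the sample, at a sample point, concentrate. -/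
theorem IsIID.pair_dev (h : IsIID P Z μ) {G : 𝒵 × 𝒵 → ℝ} (hG : Measurable G) {B V : ℝ}
    (hB : ∀ z, |G z| ≤ B) (hV : ∀ z, ∫ w, G (z, w) ^ 2 ∂μ ≤ V) (hV0 : 0 ≤ V) {n i : ℕ} {N τ : ℝ}
    (hN : 0 < N) (hτ : 0 < τ) :
    P.real {ω | τ + 2 * B / N < |N⁻¹ * ∑ j ∈ Finset.range n,
      (G (Z i ω, Z j ω) - ∫ w, G (Z i ω, w) ∂μ)|} ≤ n * V / (N * τ) ^ 2 := by
  have := h.isProbabilityMeasure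
  have hB0 : 0 ≤ B := by
    obtain ⟨ω⟩ : Nonempty Ω := P.nonempty_of_neZero
    exact (abs_nonneg _).trans (hB (Z 0 ω, Z 0 ω))
  set m : 𝒵 → ℝ := fun z => ∫ w, G (z, w) ∂μ with hm
  have hmm : Measurable m := (hG.stronglyMeasurable.integral_prod_right').measurable
  have hGi : ∀ z, Integrable (fun w => G (z, w)) μ := fun z =>
    Integrable.of_bound (hG.comp (measurable_const.prodMk measurable_id)).aestronglyMeasurable B
      (ae_of_all _ fun w => hB _)
  have hmB : ∀ z, |m z| ≤ B := fun z => by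
    have := norm_integral_le_of_norm_le_const (μ := μ) (f := fun w => G (z, w)) (C := B)
      (ae_of_all _ fun w => hB _)
    simpa using this
  set H : 𝒵 × 𝒵 → ℝ := fun z => G z - m z.1 with hH
  have hHm : Measurable H := hG.sub (hmm.comp measurable_fst)
  have hHB : ∀ z, |H z| ≤ 2 * B := fun z => by
    refine (abs_sub _ _).trans ?_
    linarith [hB z, hmB z.1]
  have hH0 : ∀ z, ∫ w, H (z, w) ∂μ = 0 := fun z => by
    simp only [hH]
    rw [integral_sub (hGi z) (integrable_const _)]
    simp [hm]
  have hHV : ∀ z, ∫ w, H (z, w) ^ 2 ∂μ ≤ V := fun z => by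
    have e : ∀ w, H (z, w) ^ 2 = G (z, w) ^ 2 - 2 * m z * G (z, w) + m z ^ 2 := fun w => by
      simp only [hH]; ring
    have hi2 : Integrable (fun w => G (z, w) ^ 2) μ := by
      refine Integrable.of_bound ((hG.comp
        (measurable_const.prodMk measurable_id)).pow_const 2).aestronglyMeasurable (B ^ 2)
        (ae_of_all _ fun w => ?_)
      rw [Real.norm_eq_abs, abs_pow]
      exact pow_le_pow_left₀ (abs_nonneg _) (hB _) 2
    have hi3 : Integrable (fun w => G (z, w) ^ 2 - 2 * m z * G (z, w)) μ :=
      hi2.sub ((hGi z).const_mul _)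
    simp_rw [e]
    rw [integral_add hi3 (integrable_const _),
      integral_sub hi2 ((hGi z).const_mul _), integral_const_mul]
    have := hV z
    simp only [integral_const, probReal_univ, one_smul]
    change _ - 2 * m z * m z + _ ≤ _
    nlinarith [sq_nonneg (m z)]
  -- The term j = i pairs an observation with itself and is not centred; it is bounded by 2B, which
  -- accounts for the summand 2B/N in the threshold.
  set s := (Finset.range n).erase i with hs
  have hYi : ∀ j k, Integrable (fun ω => H (Z i ω, Z j ω) * H (Z i ω, Z k ω)) P := fun j k => by
    have hij : ∀ j, Measurable fun ω => H (Z i ω, Z j ω) := fun j =>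
      hHm.comp ((h.measurable i).prodMk (h.measurable j))
    refine Integrable.of_bound ((hij j).mul (hij k)).aestronglyMeasurable (2 * B * (2 * B))
      (ae_of_all _ fun ω => ?_)
    rw [Real.norm_eq_abs, abs_mul]
    exact mul_le_mul (hHB _) (hHB _) (abs_nonneg _) (by positivity)
  have hpair : ∀ j, j ≠ i → P.map (fun ω => (Z i ω, Z j ω)) = μ.prod μ := fun j hj => by
    rw [(indepFun_iff_map_prod_eq_prod_map_map (h.measurable i).aemeasurable
      (h.measurable j).aemeasurable).1 (h.iIndep.indepFun hj.symm), h.map_eq, h.map_eq]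
  have hdiag : ∀ j, j ≠ i → ∫ ω, H (Z i ω, Z j ω) * H (Z i ω, Z j ω) ∂P ≤ V := fun j hj => by
    have e : ∫ ω, H (Z i ω, Z j ω) * H (Z i ω, Z j ω) ∂P = ∫ z, H z ^ 2 ∂(μ.prod μ) := by
      rw [← hpair j hj, integral_map ((h.measurable i).prodMk (h.measurable j)).aemeasurable
        (hHm.pow_const 2).aestronglyMeasurable]
      exact integral_congr_ae (ae_of_all _ fun ω => (sq _).symm)
    have hi : Integrable (fun z => H z ^ 2) (μ.prod μ) := by
      refine Integrable.of_bound (hHm.pow_const 2).aestronglyMeasurable ((2 * B) ^ 2)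
        (ae_of_all _ fun z => ?_)
      rw [Real.norm_eq_abs, abs_pow]
      exact pow_le_pow_left₀ (abs_nonneg _) (hHB _) 2
    rw [e, integral_prod _ hi]
    refine (integral_mono hi.integral_prod_left (integrable_const V) fun z => hHV z).trans ?_
    simp
  -- Given Z_i and Z_j, the variable Z_k is independent and the second factor has mean zero, so only
  -- the diagonal of the double sum survives.
  have hoff : ∀ j k, j ≠ i → k ≠ i → j ≠ k →
      ∫ ω, H (Z i ω, Z j ω) * H (Z i ω, Z k ω) ∂P = 0 := fun j k hj hk hjk => by
    have hind : IndepFun (fun ω => (Z i ω, Z j ω)) (Z k) P :=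
      h.iIndep.indepFun_prodMk h.measurable i j k hk.symm hjk
    have hij := (h.measurable i).prodMk (h.measurable j)
    have hlaw : P.map (fun ω => ((Z i ω, Z j ω), Z k ω)) = (μ.prod μ).prod μ := by
      rw [(indepFun_iff_map_prod_eq_prod_map_map hij.aemeasurable
        (h.measurable k).aemeasurable).1 hind, hpair j hj, h.map_eq]
    set F : (𝒵 × 𝒵) × 𝒵 → ℝ := fun z => H z.1 * H (z.1.1, z.2) with hF
    have hFm : Measurable F := (hHm.comp measurable_fst).mul
      (hHm.comp ((measurable_fst.comp measurable_fst).prodMk measurable_snd))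
    have hFi : Integrable F ((μ.prod μ).prod μ) := by
      refine Integrable.of_bound hFm.aestronglyMeasurable (2 * B * (2 * B))
        (ae_of_all _ fun z => ?_)
      rw [Real.norm_eq_abs, hF, abs_mul]
      exact mul_le_mul (hHB _) (hHB _) (abs_nonneg _) (by positivity)
    calc ∫ ω, H (Z i ω, Z j ω) * H (Z i ω, Z k ω) ∂P = ∫ z, F z ∂((μ.prod μ).prod μ) := by
          rw [← hlaw, integral_map (hij.prodMk (h.measurable k)).aemeasurable
            hFm.aestronglyMeasurable]
      _ = 0 := by
          rw [integral_prod _ hFi]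
          simp only [hF, integral_const_mul, hH0, mul_zero, integral_zero]
  set Y : Ω → ℝ := fun ω => ∑ j ∈ s, H (Z i ω, Z j ω) with hY
  have hYsq : ∀ ω, Y ω ^ 2 = ∑ j ∈ s, ∑ k ∈ s, H (Z i ω, Z j ω) * H (Z i ω, Z k ω) := fun ω => by
    rw [sq, hY, Finset.sum_mul_sum]
  have hYint : Integrable (fun ω => Y ω ^ 2) P := by
    simp_rw [hYsq]
    exact integrable_finsetSum _ fun j _ => integrable_finsetSum _ fun k _ => hYi j k
  have hYE : ∫ ω, Y ω ^ 2 ∂P ≤ n * V := by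
    simp_rw [hYsq]
    rw [integral_finsetSum _ fun j _ => integrable_finsetSum _ fun k _ => hYi j k]
    have hne : ∀ j ∈ s, j ≠ i := fun j hj => Finset.ne_of_mem_erase hj
    calc _ = ∑ j ∈ s, ∫ ω, H (Z i ω, Z j ω) * H (Z i ω, Z j ω) ∂P :=
          Finset.sum_congr rfl fun j hj => by
            rw [integral_finsetSum _ fun k _ => hYi j k]
            exact Finset.sum_eq_single_of_mem j hj fun k hk hkj =>
              hoff j k (hne j hj) (hne k hk) hkj.symm
      _ ≤ ∑ j ∈ s, V := Finset.sum_le_sum fun j hj => hdiag j (hne j hj)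
      _ = s.card * V := by simp
      _ ≤ n * V := by
          refine mul_le_mul_of_nonneg_right ?_ hV0
          exact_mod_cast (Finset.card_le_card (Finset.erase_subset _ _)).trans_eq
            (Finset.card_range n)
  have hsub : {ω | τ + 2 * B / N < |N⁻¹ * ∑ j ∈ Finset.range n,
      (G (Z i ω, Z j ω) - ∫ w, G (Z i ω, w) ∂μ)|} ⊆ {ω | (N * τ) ^ 2 ≤ Y ω ^ 2} := by
    intro ω hω
    have hle : |∑ j ∈ Finset.range n, H (Z i ω, Z j ω)| ≤ |Y ω| + 2 * B := by
      by_cases hi : i ∈ Finset.range n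
      · rw [← Finset.add_sum_erase _ _ hi]
        refine (abs_add_le _ _).trans ?_
        linarith [hHB (Z i ω, Z i ω)]
      · have : s = Finset.range n := Finset.erase_eq_of_notMem hi
        rw [← this]
        linarith [le_refl |Y ω|]
    have hω' : τ + 2 * B / N < N⁻¹ * |∑ j ∈ Finset.range n, H (Z i ω, Z j ω)| := by
      have : τ + 2 * B / N < |N⁻¹ * ∑ j ∈ Finset.range n, H (Z i ω, Z j ω)| := hω
      rwa [abs_mul, abs_of_pos (inv_pos.2 hN)] at this
    change (N * τ) ^ 2 ≤ Y ω ^ 2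
    rw [← sq_abs (Y ω)]
    refine pow_le_pow_left₀ (by positivity) ?_ 2
    have h1 : N * (τ + 2 * B / N) < |∑ j ∈ Finset.range n, H (Z i ω, Z j ω)| :=
      (lt_inv_mul_iff₀ hN).1 hω'
    have h2 : N * (τ + 2 * B / N) = N * τ + 2 * B := by field_simp
    linarith
  calc _ ≤ P.real {ω | (N * τ) ^ 2 ≤ Y ω ^ 2} := measureReal_mono hsub
    _ ≤ (∫ ω, Y ω ^ 2 ∂P) / (N * τ) ^ 2 := by
        rw [le_div_iff₀ (by positivity), mul_comm]
        exact mul_meas_ge_le_integral_of_nonneg (ae_of_all _ fun ω => sq_nonneg (Y ω)) hYint _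
    _ ≤ n * V / (N * τ) ^ 2 := by gcongr

end

end FELogit
end

noncomputable section
namespace FELogit

/-! ### Conditional probabilities -/

lemma measurable_gamma0 {T p : ℕ} (Q : Measure (Cov T p × ℕ)) [IsFiniteMeasure Q] (j : ℕ) :
    Measurable (gamma0 Q j) :=
  (Kernel.measurable_coe _ (measurableSet_singleton j)).ennreal_toReal

lemma gamma0_nonneg {T p : ℕ} (Q : Measure (Cov T p × ℕ)) [IsFiniteMeasure Q] (j : ℕ)
    (x : Cov T p) : 0 ≤ gamma0 Q j x := measureReal_nonneg

lemma gamma0_le_one {T p : ℕ} (Q : Measure (Cov T p × ℕ)) [IsFiniteMeasure Q] (j : ℕ)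
    (x : Cov T p) : gamma0 Q j x ≤ 1 := measureReal_le_one

lemma ae_condKernel_le {T p : ℕ} {Q : Measure (Cov T p × ℕ)} [IsFiniteMeasure Q]
    (hQ : ∀ᵐ z ∂Q, z.2 ≤ T) : ∀ᵐ x ∂Q.fst, ∀ᵐ s ∂(Q.condKernel x), s ≤ T := by
  rw [← Q.disintegrate Q.condKernel] at hQ
  exact Measure.ae_ae_of_ae_compProd hQ

lemma integral_condKernel_eq_sum {T p : ℕ} {Q : Measure (Cov T p × ℕ)} [IsFiniteMeasure Q]
    {x : Cov T p} (hx : ∀ᵐ s ∂(Q.condKernel x), s ≤ T) (f : ℕ → ℝ) :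
    ∫ s, f s ∂(Q.condKernel x) = ∑ j ∈ Finset.range (T + 1), gamma0 Q j x * f j := by
  have h1 : (Q.condKernel x).restrict (Finset.range (T + 1) : Finset ℕ) = Q.condKernel x :=
    Measure.restrict_eq_self_of_ae_mem (hx.mono fun s hs => by simpa [Nat.lt_succ_iff] using hs)
  rw [← h1, setIntegral_finset]
  · rfl
  · exact IntegrableOn.finset

lemma sum_gamma0 {T p : ℕ} {Q : Measure (Cov T p × ℕ)} [IsFiniteMeasure Q]
    {x : Cov T p} (hx : ∀ᵐ s ∂(Q.condKernel x), s ≤ T) :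
    ∑ j ∈ Finset.range (T + 1), gamma0 Q j x = 1 := by
  have := integral_condKernel_eq_sum hx fun _ => 1
  simpa using this.symm

lemma cFun_eq_cPlug {T p : ℕ} [NeZero T] {Q : Measure (Cov T p × ℕ)} [IsFiniteMeasure Q]
    {x : Cov T p} (hx : ∀ᵐ s ∂(Q.condKernel x), s ≤ T) (β : Fin p → ℝ) (t : ℕ) :
    cFun Q β t x = cPlug (gamma0 Q) β t x := by
  rw [cFun, integral_condKernel_eq_sum hx, cPlug_eq]
  have hsub : Finset.Icc t T ⊆ Finset.range (T + 1) := fun j hj =>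
    Finset.mem_range_succ_iff.2 (Finset.mem_Icc.1 hj).2
  rw [← Finset.sum_subset hsub fun j hj hj' => ?_]
  · refine Finset.sum_congr rfl fun j hj => ?_
    rw [if_pos (Finset.mem_Icc.1 hj).1, wgt, mul_div_assoc]
  · rw [if_neg, mul_zero]
    intro h
    exact hj' (Finset.mem_Icc.2 ⟨h, Finset.mem_range_succ_iff.1 hj⟩)

lemma cPlug_gamma0_pos {T p : ℕ} [NeZero T] {Q : Measure (Cov T p × ℕ)} [IsFiniteMeasure Q]
    {x : Cov T p} (hx : ∀ᵐ s ∂(Q.condKernel x), s ≤ T) (β : Fin p → ℝ) :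
    0 < cPlug (gamma0 Q) β 0 x := by
  obtain ⟨L, κ, -, hκ, h⟩ := exists_cPlug_bounds T p (max ‖x‖ ‖β‖)
  exact hκ.trans_le ((h x β (le_max_left _ _) (le_max_right _ _) (gamma0 Q)).2
    (fun j _ => gamma0_nonneg Q j x) (sum_gamma0 hx)).1

lemma mFun_eq_mTilde {T p : ℕ} [NeZero T] {Q : Measure (Cov T p × ℕ)} [IsFiniteMeasure Q]
    {x : Cov T p} (hx : ∀ᵐ s ∂(Q.condKernel x), s ≤ T) (β : Fin p → ℝ) :
    mFun Q β x = mTilde (gamma0 Q) β x := by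
  ext t
  rw [mFun, mTilde, cFun_eq_cPlug hx, cFun_eq_cPlug hx]
  split_ifs with h
  · rw [h, div_self (cPlug_gamma0_pos hx β).ne']
  · rfl

lemma measurable_cPlug {T p : ℕ} [NeZero T] {γ : ℕ → Cov T p → ℝ} (hγ : ∀ j, Measurable (γ j))
    (β : Fin p → ℝ) (t : ℕ) : Measurable fun x => cPlug γ β t x := by
  simp only [cPlug_eq]
  refine Finset.measurable_sum _ fun j hj => (hγ j).mul ?_
  have : Continuous fun x : Cov T p => wgt j x β :=
    (contDiff_wgt (p := p) (Finset.mem_Icc.1 hj).2).continuous.comp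
      (continuous_id.prodMk continuous_const)
  exact this.measurable.const_mul _

lemma measurable_mTilde {T p : ℕ} [NeZero T] {γ : ℕ → Cov T p → ℝ} (hγ : ∀ j, Measurable (γ j))
    (β : Fin p → ℝ) : Measurable fun x => mTilde γ β x := by
  refine measurable_pi_lambda _ fun t => ?_
  unfold mTilde
  split_ifs
  · exact measurable_const
  · exact (measurable_cPlug hγ β t).div (measurable_cPlug hγ β 0)

/-- `u^t W`, where `u = e^v / (1 + e^v)`, `v = x_T'β + a`, and `W = (1 + e^v)^T / ∏ (1 + e^{..})`. -/
lemma sum_sumProb_wgt {T p : ℕ} [NeZero T] (β : Fin p → ℝ) (x : Cov T p) (a : ℝ) {t : ℕ}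
    (ht : t ≤ T) :
    ∑ j ∈ Finset.Icc t T, sumProb β j x a * (((T - t).choose (j - t) : ℝ) * wgt j x β) =
      (Real.exp (x (lastPeriod T) ⬝ᵥ β + a) / (1 + Real.exp (x (lastPeriod T) ⬝ᵥ β + a))) ^ t *
        ((1 + Real.exp (x (lastPeriod T) ⬝ᵥ β + a)) ^ T / normFactor β x a) := by
  set v := x (lastPeriod T) ⬝ᵥ β + a with hv
  -- The normalising sum C_j cancels between the probability of S = j and its weight; what remains
  -- is a binomial expansion of (1 + e^v)^(T - t).
  have h1 : ∀ j ∈ Finset.Icc t T,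
      sumProb β j x a * (((T - t).choose (j - t) : ℝ) * wgt j x β) =
      ((T - t).choose (j - t) : ℝ) * Real.exp v ^ j / normFactor β x a := fun j hj => by
    have hC := (C_pos (Finset.mem_Icc.1 hj).2 x β).ne'
    have e : Real.exp v ^ j = Real.exp (j * a) * Real.exp (j * (x (lastPeriod T) ⬝ᵥ β)) := by
      rw [← Real.exp_nat_mul, ← Real.exp_add]; congr 1; rw [hv]; ring
    rw [sumProb_eq, wgt, e]
    field_simp
  rw [Finset.sum_congr rfl h1, ← Finset.sum_div]
  have h2 : ∑ j ∈ Finset.Icc t T, ((T - t).choose (j - t) : ℝ) * Real.exp v ^ j =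
      Real.exp v ^ t * (1 + Real.exp v) ^ (T - t) := by
    rw [← Finset.Ico_add_one_right_eq_Icc, Finset.sum_Ico_eq_sum_range, add_comm 1 (Real.exp v),
      add_pow, Finset.mul_sum, Nat.sub_add_comm ht]
    refine Finset.sum_congr rfl fun j _ => ?_
    rw [Nat.add_sub_cancel_left, pow_add]; ring
  have hpos : 0 < 1 + Real.exp v := by positivity
  rw [h2, div_pow]
  have h3 : (1 + Real.exp v) ^ T = (1 + Real.exp v) ^ t * (1 + Real.exp v) ^ (T - t) := by
    rw [← pow_add]; congr 1; omega
  have h4 : ∀ A B D N : ℝ, B ≠ 0 → A * D / N = A / B * (B * D / N) := fun A B D N hB => by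
    field_simp
  rw [h3]
  exact h4 _ _ _ _ (pow_pos hpos t).ne'

lemma measurable_sumProb {T p : ℕ} (β : Fin p → ℝ) (s : ℕ) :
    Measurable fun z : Cov T p × ℝ => sumProb β s z.1 z.2 := by
  unfold sumProb
  refine Finset.measurable_sum _ fun d _ => ?_
  have hsw : Measurable fun z : Cov T p × ℝ => (z.2, z.1) := measurable_snd.prodMk measurable_fst
  have := (measurable_seqProb β d).comp hsw
  exact this

lemma sumProb_nonneg {T p : ℕ} (β : Fin p → ℝ) (s : ℕ) (x : Cov T p) (a : ℝ) :
    0 ≤ sumProb β s x a := Finset.sum_nonneg fun _ _ => seqProb_nonneg _ _ _ _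

lemma sumProb_le {T p : ℕ} (β : Fin p → ℝ) (s : ℕ) (x : Cov T p) (a : ℝ) :
    sumProb β s x a ≤ (level T s).card := by
  unfold sumProb
  refine (Finset.sum_le_card_nsmul _ _ 1 fun _ _ => seqProb_le_one _ _ _ _).trans_eq ?_
  simp

lemma integrable_sumProb {T p : ℕ} (β : Fin p → ℝ) (s : ℕ) (x : Cov T p) (κ : Measure ℝ)
    [IsFiniteMeasure κ] : Integrable (fun a => sumProb β s x a) κ := by
  refine Integrable.of_bound ((measurable_sumProb β s).comp
    (measurable_const.prodMk measurable_id)).aestronglyMeasurable ((level T s).card : ℝ)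
    (ae_of_all _ fun a => ?_)
  rw [Real.norm_eq_abs, abs_of_nonneg (sumProb_nonneg _ _ _ _)]
  exact sumProb_le _ _ _ _

/-- If the conditional probabilities of `S` come from a distribution of the effect, then the
vector `m` belongs to the moment space. -/
lemma isMom_of_mixture {T p : ℕ} [NeZero T] {β : Fin p → ℝ} {x : Cov T p} {κ : Measure ℝ}
    [IsProbabilityMeasure κ] {γ : ℕ → Cov T p → ℝ}
    (hγ : ∀ j ≤ T, γ j x = ∫ a, sumProb β j x a ∂κ) (hpos : 0 < cPlug γ β 0 x) :
    IsMom T (mTilde γ β x) := by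
  set v : ℝ → ℝ := fun a => x (lastPeriod T) ⬝ᵥ β + a with hv
  -- The representing measure is the law of u under the mixing distribution reweighted by W / c_0, a
  -- density of total mass 1 because c_0 is the mean of W.
  set W : ℝ → ℝ := fun a => (1 + Real.exp (v a)) ^ T / normFactor β x a with hW
  have hu : ∀ a, Real.exp (v a) / (1 + Real.exp (v a)) ∈ unitInterval := fun a =>
    ⟨by positivity, (div_le_one (by positivity)).2 (by linarith)⟩
  set u : ℝ → unitInterval := fun a => ⟨Real.exp (v a) / (1 + Real.exp (v a)), hu a⟩ with hud
  have hvm : Measurable v := measurable_const.add measurable_id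
  have hum : Measurable u := (hvm.exp.div (hvm.exp.const_add 1)).subtype_mk
  have hc : ∀ t ≤ T, cPlug γ β t x = ∫ a, (u a : ℝ) ^ t * W a ∂κ := fun t ht => by
    rw [cPlug_eq]
    have : ∀ a, (u a : ℝ) ^ t * W a = ∑ j ∈ Finset.Icc t T,
        sumProb β j x a * (((T - t).choose (j - t) : ℝ) * wgt j x β) := fun a =>
      (sum_sumProb_wgt β x a ht).symm
    simp_rw [this]
    rw [integral_finsetSum _ fun j _ => (integrable_sumProb β j x κ).mul_const _]
    refine Finset.sum_congr rfl fun j hj => ?_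
    rw [integral_mul_const, hγ j (Finset.mem_Icc.1 hj).2]
  have hWm : Measurable W := by
    have : W = fun a => ∑ j ∈ Finset.Icc 0 T,
        sumProb β j x a * (((T - 0).choose (j - 0) : ℝ) * wgt j x β) := by
      ext a
      rw [sum_sumProb_wgt β x a (Nat.zero_le T)]
      simp [hW, hv]
    rw [this]
    exact Finset.measurable_sum _ fun j _ => ((measurable_sumProb β j).comp
      (measurable_const.prodMk measurable_id)).mul_const _
  have hW0 : ∀ a, 0 ≤ W a := fun a => div_nonneg (by positivity) (normFactor_pos β x a).le
  set c := cPlug γ β 0 x with hcd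
  set D : ℝ → NNReal := fun a => Real.toNNReal (W a / c) with hD
  have hDm : Measurable D := (hWm.div_const c).real_toNNReal
  have hint : ∀ f : ℝ → ℝ, ∫ a, f a ∂(κ.withDensity fun a => (D a : ENNReal)) =
      (∫ a, f a * W a ∂κ) / c := fun f => by
    rw [integral_withDensity_eq_integral_smul hDm, ← integral_div]
    refine integral_congr_ae (ae_of_all _ fun a => ?_)
    simp only [hD, NNReal.smul_def, smul_eq_mul, Real.coe_toNNReal _ (div_nonneg (hW0 a) hpos.le)]
    ring
  -- If W were not integrable, its integral would be 0 by convention, contradicting the positivity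
  -- of c_0.
  have hWi : Integrable W κ := by
    have h0 := hc 0 (Nat.zero_le T)
    simp only [pow_zero, one_mul] at h0
    by_contra h
    rw [integral_undef h] at h0
    exact hpos.ne' h0
  have hmass : IsProbabilityMeasure (κ.withDensity fun a => (D a : ENNReal)) := by
    constructor
    rw [withDensity_apply _ MeasurableSet.univ, Measure.restrict_univ]
    have e : ∫⁻ a, (D a : ENNReal) ∂κ = ENNReal.ofReal (∫ a, W a / c ∂κ) := by
      rw [ofReal_integral_eq_lintegral_ofReal (hWi.div_const c)
        (ae_of_all _ fun a => div_nonneg (hW0 a) hpos.le)]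
      rfl
    have h0 := hc 0 (Nat.zero_le T)
    simp only [pow_zero, one_mul] at h0
    rw [e, integral_div, ← h0, div_self hpos.ne', ENNReal.ofReal_one]
  refine ⟨(κ.withDensity fun a => (D a : ENNReal)).map u,
    Measure.isProbabilityMeasure_map hum.aemeasurable, fun s hs => ?_⟩
  unfold mom
  rw [integral_map hum.aemeasurable (by fun_prop), hint, mTilde]
  split_ifs with h0
  · subst h0
    have h0 := hc 0 (Nat.zero_le T)
    rw [← h0, div_self hpos.ne']
  · rw [hc s hs]

section Model

variable {Ω : Type*} [MeasurableSpace Ω] {P : Measure Ω} {T p : ℕ}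
  {X : Ω → Cov T p} {α : Ω → ℝ} {ε : Ω → Fin T → ℝ} {β : Fin p → ℝ}

lemma IsModel.measurable_dvec (h : IsModel P X α ε) (β : Fin p → ℝ) :
    Measurable fun ω => dvec β (X ω) (α ω) (ε ω) :=
  (FELogit.measurable_dvec β).comp (h.measurable_ε.prodMk (h.measurable_α.prodMk h.measurable_X))

/-- The conditional probabilities of `S` given `X` are mixtures. -/
theorem IsModel.gamma0_ae_eq [IsProbabilityMeasure P] (h : IsModel P X α ε) {S : Ω → ℕ} (hSm : Measurable S)
    (hS : ∀ ω, S ω = ∑ t, (dvec β (X ω) (α ω) (ε ω) t : ℕ)) (s : ℕ) :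
    ∀ᵐ x ∂(P.map X), gamma0 (P.map fun ω => (X ω, S ω)) s x =
      ∫ a, sumProb β s x a ∂((P.map fun ω => (X ω, α ω)).condKernel x) := by
  have hXS := h.measurable_X.prodMk hSm
  have hXα := h.measurable_X.prodMk h.measurable_α
  set Q := P.map fun ω => (X ω, S ω) with hQ
  set ρ := P.map fun ω => (X ω, α ω) with hρ
  have hQf : Q.fst = P.map X := by rw [hQ, Measure.fst_map_prodMk hSm]
  have hρf : ρ.fst = P.map X := by rw [hρ, Measure.fst_map_prodMk h.measurable_α]
  have : IsProbabilityMeasure Q := Measure.isProbabilityMeasure_map hXS.aemeasurable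
  have : IsProbabilityMeasure ρ := Measure.isProbabilityMeasure_map hXα.aemeasurable
  have : IsProbabilityMeasure (P.map X) :=
    Measure.isProbabilityMeasure_map h.measurable_X.aemeasurable
  have hf1 : Integrable (fun z : Cov T p × ℕ => if z.2 = s then (1 : ℝ) else 0) Q := by
    refine Integrable.of_bound (Measurable.ite (measurable_snd (measurableSet_singleton s))
      measurable_const measurable_const).aestronglyMeasurable 1 (ae_of_all _ fun z => ?_)
    split_ifs <;> simp
  have hf2 : Integrable (fun z : Cov T p × ℝ => sumProb β s z.1 z.2) ρ := by
    refine Integrable.of_bound (measurable_sumProb β s).aestronglyMeasurable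
      ((level T s).card : ℝ) (ae_of_all _ fun z => ?_)
    rw [Real.norm_eq_abs, abs_of_nonneg (sumProb_nonneg _ _ _ _)]
    exact sumProb_le _ _ _ _
  have hg : ∀ x, gamma0 Q s x = ∫ b, (if b = s then (1 : ℝ) else 0) ∂(Q.condKernel x) := fun x => by
    have : (fun b : ℕ => if b = s then (1 : ℝ) else 0) = ({s} : Set ℕ).indicator fun _ => 1 := by
      ext b; simp [Set.indicator]
    rw [this, integral_indicator_const _ (measurableSet_singleton s), smul_eq_mul, mul_one]
    rfl
  -- Both functions of x are determined almost everywhere by their integrals over measurable sets A.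
  -- The two integrals agree because the model replaces the indicator of S = s by its conditional
  -- probability given (X, α).
  refine Integrable.ae_eq_of_forall_setIntegral_eq _ _ ?_ ?_ fun A hA _ => ?_
  · exact Integrable.of_bound (measurable_gamma0 Q s).aestronglyMeasurable 1
      (ae_of_all _ fun x => by
        rw [Real.norm_eq_abs, abs_of_nonneg (gamma0_nonneg _ _ _)]; exact gamma0_le_one _ _ _)
  · have := hf2.integral_condKernel
    rwa [hρf] at this
  have e1 := Measure.setIntegral_condKernel_univ_right (ρ := Q) hA hf1.integrableOn
  have e2 := Measure.setIntegral_condKernel_univ_right (ρ := ρ) hA hf2.integrableOn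
  rw [hQf] at e1
  rw [hρf] at e2
  refine (integral_congr_ae (ae_of_all _ fun x => hg x)).trans (e1.trans (Eq.trans ?_ e2.symm))
  rw [← integral_indicator (hA.prod MeasurableSet.univ),
    ← integral_indicator (hA.prod MeasurableSet.univ), hQ, hρ,
    integral_map hXS.aemeasurable (by
      rw [← hQ]; exact (hf1.indicator (hA.prod MeasurableSet.univ)).aestronglyMeasurable),
    integral_map hXα.aemeasurable (by
      rw [← hρ]; exact (hf2.indicator (hA.prod MeasurableSet.univ)).aestronglyMeasurable)]
  have key := h.integral_outcome β
    (fun d z => (if ∑ t, (d t : ℕ) = s then (1 : ℝ) else 0) * A.indicator (fun _ => 1) z.2)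
    (fun d => ((measurable_const.indicator hA).comp measurable_snd).const_mul _) (B := 1)
    (fun d z => by
      by_cases hz : z.2 ∈ A <;> split_ifs <;> simp [hz])
  convert key using 1
  · refine integral_congr_ae (ae_of_all _ fun ω => ?_)
    by_cases hx : X ω ∈ A <;> simp [Set.indicator, hx, hS]
  · refine integral_congr_ae (ae_of_all _ fun ω => ?_)
    by_cases hx : X ω ∈ A <;>
      simp [Set.indicator, hx, sumProb, level, Finset.sum_filter]

end Model

end FELogit
end

noncomputable section
namespace FELogit

/-! ### Kernel averages -/

section Kernel

open Module

variable {E : Type*} [NormedAddCommGroup E] [NormedSpace ℝ E] [MeasurableSpace E]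
  [FiniteDimensional ℝ E]

lemma integrable_of_bounded_support {μ : Measure E} [μ.IsAddHaarMeasure] {q : E → ℝ} (hq : Measurable q) {B R : ℝ} (hB : ∀ u, |q u| ≤ B)
    (hR : ∀ u, R < ‖u‖ → q u = 0) : Integrable q μ := by
  have h1 : IntegrableOn q (Metric.closedBall 0 R) μ :=
    Measure.integrableOn_of_bounded (M := B) (isCompact_closedBall _ _).measure_lt_top.ne
      hq.aestronglyMeasurable (ae_of_all _ hB)
  refine (integrableOn_iff_integrable_of_support_subset fun u hu => ?_).1 h1
  rw [mem_closedBall_zero_iff]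
  by_contra hc
  exact hu (hR u (not_le.1 hc))

variable [BorelSpace E] (μ : Measure E) [μ.IsAddHaarMeasure]

lemma integral_rescale (g F : E → ℝ) (x : E) {h : ℝ} (hh : 0 < h) :
    ∫ y, g (h⁻¹ • (y - x)) * F y ∂μ = h ^ finrank ℝ E * ∫ u, g u * F (x + h • u) ∂μ := by
  have h1 := Measure.integral_comp_smul μ (fun z => g (h⁻¹ • z) * F (x + z)) h
  have h2 : ∀ u : E, h⁻¹ • h • u = u := fun u => by rw [smul_smul, inv_mul_cancel₀ hh.ne', one_smul]
  simp only [h2] at h1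
  rw [h1, abs_of_pos (by positivity), smul_eq_mul, ← mul_assoc, mul_inv_cancel₀ (by positivity),
    one_mul, ← integral_sub_right_eq_self (fun z => g (h⁻¹ • z) * F (x + z)) x]
  simp

variable {μ}

/-- Lebesgue differentiation for kernel averages. -/
theorem ae_tendsto_kernel_average {F g : E → ℝ} (hF : Measurable F) {M : ℝ} (hM : ∀ x, |F x| ≤ M)
    (hg : Measurable g) {B R : ℝ} (hR0 : 0 < R) (hB : ∀ u, |g u| ≤ B) (hR : ∀ u, R < ‖u‖ → g u = 0)
    {h : ℕ → ℝ} (hpos : ∀ n, 0 < h n) (hlim : Tendsto h atTop (𝓝 0)) :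
    ∀ᵐ x ∂μ, Tendsto (fun n => ∫ u, g u * F (x + h n • u) ∂μ) atTop (𝓝 (F x * ∫ u, g u ∂μ)) := by
  have hloc : LocallyIntegrable F μ := fun x => by
    refine ⟨Metric.closedBall x 1, Metric.closedBall_mem_nhds x one_pos, ?_⟩
    exact Measure.integrableOn_of_bounded (M := M) (isCompact_closedBall _ _).measure_lt_top.ne
      hF.aestronglyMeasurable (ae_of_all _ hM)
  -- Lebesgue points make continuity of `F` unnecessary; the density of the covariates may jump at
  -- the edge of its support.
  filter_upwards [IsUnifLocDoublingMeasure.ae_tendsto_average_norm_sub μ hloc 1] with x hx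
  have hB0 : 0 ≤ B := (abs_nonneg _).trans (hB 0)
  have hδ : Tendsto (fun n => h n * R) atTop (𝓝[>] 0) := by
    refine tendsto_nhdsWithin_iff.2 ⟨by simpa using hlim.mul_const R, Eventually.of_forall fun n =>
      mul_pos (hpos n) hR0⟩
  have hav := hx (fun _ : ℕ => x) (fun n => h n * R) hδ (Eventually.of_forall fun n => by
    rw [one_mul]; exact Metric.mem_closedBall_self (mul_pos (hpos n) hR0).le)
  set v := μ.real (Metric.ball (0 : E) 1) with hv
  have hgi : Integrable g μ := integrable_of_bounded_support hg hB hR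
  have hshift : ∀ n, Measurable fun u => F (x + h n • u) := fun n =>
    hF.comp ((measurable_const_smul (h n)).const_add x)
  have hψm : Measurable ((Metric.closedBall (0 : E) R).indicator fun _ => (1 : ℝ)) :=
    measurable_const.indicator measurableSet_closedBall
  -- The kernel is dominated by B times the indicator of the ball of radius R, so the deviation is
  -- at most a constant times the mean oscillation of `F` on the ball of radius h R around x.
  have hbound : ∀ n, |∫ u, g u * F (x + h n • u) ∂μ - F x * ∫ u, g u ∂μ| ≤
      B * (R ^ finrank ℝ E * v) * ⨍ y in Metric.closedBall x (h n * R), ‖F y - F x‖ ∂μ := fun n => by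
    have hi1 : Integrable (fun u => g u * F (x + h n • u)) μ := by
      refine integrable_of_bounded_support (hg.mul (hshift n)) (B := B * M) (R := R)
        (fun u => ?_) fun u hu => by simp only [hR u hu, zero_mul]
      rw [abs_mul]
      exact mul_le_mul (hB u) (hM _) (abs_nonneg _) hB0
    have e1 : ∫ u, g u * F (x + h n • u) ∂μ - F x * ∫ u, g u ∂μ =
        ∫ u, g u * (F (x + h n • u) - F x) ∂μ := by
      rw [← integral_const_mul, ← integral_sub hi1 (hgi.const_mul _)]
      exact integral_congr_ae (ae_of_all _ fun u => by ring)
    have e2 : ∫ u, (Metric.closedBall (0 : E) R).indicator (fun _ => (1 : ℝ)) u *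
        |F (x + h n • u) - F x| ∂μ =
        R ^ finrank ℝ E * v * ⨍ y in Metric.closedBall x (h n * R), ‖F y - F x‖ ∂μ := by
      have h1 := integral_rescale μ ((Metric.closedBall (0 : E) R).indicator fun _ => (1 : ℝ))
        (fun y => |F y - F x|) x (hpos n)
      have h2 : ∀ y, (Metric.closedBall (0 : E) R).indicator (fun _ => (1 : ℝ))
          ((h n)⁻¹ • (y - x)) * |F y - F x| =
          (Metric.closedBall x (h n * R)).indicator (fun y => |F y - F x|) y := fun y => by
        have : (h n)⁻¹ • (y - x) ∈ Metric.closedBall (0 : E) R ↔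
            y ∈ Metric.closedBall x (h n * R) := by
          rw [mem_closedBall_zero_iff, mem_closedBall_iff_norm, norm_smul, norm_inv,
            Real.norm_eq_abs, abs_of_pos (hpos n), inv_mul_le_iff₀ (hpos n)]
        by_cases hy : y ∈ Metric.closedBall x (h n * R)
        · rw [Set.indicator_of_mem (this.2 hy), Set.indicator_of_mem hy, one_mul]
        · rw [Set.indicator_of_notMem fun hc => hy (this.1 hc), Set.indicator_of_notMem hy,
            zero_mul]
      simp_rw [h2] at h1
      rw [integral_indicator measurableSet_closedBall] at h1
      rw [setAverage_eq, Measure.addHaar_real_closedBall μ x (mul_pos (hpos n) hR0).le, smul_eq_mul,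
        ← hv]
      simp only [Real.norm_eq_abs]
      rw [h1, mul_pow]
      have hvpos : 0 < v := by
        rw [hv, measureReal_def]
        exact ENNReal.toReal_pos (Metric.measure_ball_pos μ _ one_pos).ne' measure_ball_lt_top.ne
      have := hpos n
      field_simp
    rw [e1, mul_assoc, ← e2, ← integral_const_mul, ← Real.norm_eq_abs]
    refine norm_integral_le_of_norm_le ?_ (ae_of_all _ fun u => ?_)
    · refine (integrable_of_bounded_support (hψm.mul ((hshift n).sub_const _).abs)
        (B := 1 * (M + M)) (R := R) (fun u => ?_) fun u hu => ?_).const_mul B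
      · rw [Pi.mul_apply, abs_mul, abs_abs]
        refine mul_le_mul ?_ ((abs_sub _ _).trans (add_le_add (hM _) (hM _))) (abs_nonneg _)
          zero_le_one
        by_cases hu : u ∈ Metric.closedBall (0 : E) R <;> simp [hu]
      · rw [Pi.mul_apply, Set.indicator_of_notMem (by
          rw [mem_closedBall_zero_iff]; exact not_le.2 hu), zero_mul]
    · rw [Real.norm_eq_abs, abs_mul]
      by_cases hu : R < ‖u‖
      · rw [hR u hu, abs_zero, zero_mul]
        refine mul_nonneg hB0 (mul_nonneg (Set.indicator_nonneg (fun _ _ => zero_le_one) _)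
          (abs_nonneg _))
      · rw [Set.indicator_of_mem (by rw [mem_closedBall_zero_iff]; exact not_lt.1 hu), one_mul]
        exact mul_le_mul_of_nonneg_right (hB u) (abs_nonneg _)
  rw [tendsto_iff_dist_tendsto_zero]
  simp only [Real.dist_eq]
  refine squeeze_zero (fun n => abs_nonneg _) hbound ?_
  simpa using hav.const_mul (B * (R ^ finrank ℝ E * v))

end Kernel

/-! ### The density of the covariates -/

/-- `F` is a bounded density of `ν`, and is at least `b` on a set of full measure. -/
structure IsBoundedDensity {T p : ℕ} (ν : Measure (Cov T p)) (F : Cov T p → ℝ) (b M : ℝ) :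
    Prop where
  measurable : Measurable F
  nonneg : ∀ x, 0 ≤ F x
  le : ∀ x, F x ≤ M
  pos : 0 < b
  ge : ∀ᵐ x ∂ν, b ≤ F x
  eq : ν = volume.withDensity fun x => ENNReal.ofReal (F x)

/-- Extended by zero outside the support, the density is still measurable, bounded, and bounded
below almost surely. The kernel arguments rely on these properties alone, so the shape of the
support is irrelevant. -/
lemma HasRegularDensity.exists_isBoundedDensity {T p : ℕ} {ν : Measure (Cov T p)}
    (h : HasRegularDensity ν) (hs : IsCompact ν.support) :
    ∃ F b M, IsBoundedDensity ν F b M := by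
  obtain ⟨f, hf, ⟨b, hb, hbf⟩, hν⟩ := h
  obtain ⟨M, hM⟩ := hs.exists_bound_of_continuousOn hf.continuous.continuousOn
  refine ⟨ν.support.indicator f, b, |M|, ?_, fun x => ?_, fun x => ?_, hb, ?_, hν⟩
  · exact hf.continuous.measurable.indicator Measure.isClosed_support.measurableSet
  · exact Set.indicator_nonneg (fun x hx => hb.le.trans (hbf x hx)) x
  · refine Set.indicator_le' (fun x hx => ?_) (fun _ _ => abs_nonneg M) x
    exact (le_abs_self _).trans ((hM x hx).trans (le_abs_self M))
  · filter_upwards [Measure.support_mem_ae (μ := ν)] with x hx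
    rw [Set.indicator_of_mem hx]
    exact hbf x hx

variable {T p : ℕ} {ν : Measure (Cov T p)} {F : Cov T p → ℝ} {b M : ℝ}

lemma IsBoundedDensity.absolutelyContinuous (h : IsBoundedDensity ν F b M) : ν ≪ volume := by
  rw [h.eq]; exact withDensity_absolutelyContinuous _ _

lemma IsBoundedDensity.integral_eq (h : IsBoundedDensity ν F b M) (φ : Cov T p → ℝ) :
    ∫ x, φ x ∂ν = ∫ x, φ x * F x := by
  have : (fun x => ENNReal.ofReal (F x)) = fun x => ((F x).toNNReal : ENNReal) := rfl
  rw [h.eq, this, integral_withDensity_eq_integral_smul h.measurable.real_toNNReal]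
  refine integral_congr_ae (ae_of_all _ fun x => ?_)
  simp only [NNReal.smul_def, smul_eq_mul, Real.coe_toNNReal _ (h.nonneg x)]
  ring

lemma finrank_cov (T p : ℕ) : Module.finrank ℝ (Cov T p) = p * T := by
  simp [Cov, Module.finrank_pi_fintype, mul_comm]

lemma IsBoundedDensity.integral_kernel (hF : IsBoundedDensity ν F b M) (g : Cov T p → ℝ)
    (x : Cov T p) {h : ℝ} (hh : 0 < h) :
    ∫ y, g (h⁻¹ • (y - x)) ∂ν = h ^ (p * T) * ∫ u, g u * F (x + h • u) := by
  rw [hF.integral_eq, integral_rescale volume g F x hh, finrank_cov]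

lemma IsBoundedDensity.integral_kernel_sq_le (hF : IsBoundedDensity ν F b M) {g : Cov T p → ℝ}
    (hg : Measurable g) {B R : ℝ} (hB : ∀ u, |g u| ≤ B) (hR : ∀ u, R < ‖u‖ → g u = 0)
    (x : Cov T p) {h : ℝ} (hh : 0 < h) :
    ∫ y, g (h⁻¹ • (y - x)) ^ 2 ∂ν ≤ h ^ (p * T) * (M * ∫ u, g u ^ 2) := by
  rw [hF.integral_kernel (fun u => g u ^ 2) x hh]
  refine mul_le_mul_of_nonneg_left ?_ (by positivity)
  have hB' : ∀ u, |g u ^ 2| ≤ B ^ 2 := fun u => by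
    rw [abs_pow]; exact pow_le_pow_left₀ (abs_nonneg _) (hB u) 2
  have hi := integrable_of_bounded_support (μ := volume) (hg.pow_const 2) hB'
    fun u hu => by rw [hR u hu]; ring
  have hm : Measurable fun u => F (x + h • u) :=
    hF.measurable.comp ((measurable_const_smul h).const_add x)
  rw [← integral_const_mul]
  refine integral_mono ?_ (hi.const_mul M) fun u => ?_
  · refine integrable_of_bounded_support ((hg.pow_const 2).mul hm) (B := B ^ 2 * M) (R := R)
      (fun u => ?_) fun u hu => by simp only [hR u hu]; ring
    rw [abs_mul, abs_of_nonneg (hF.nonneg _)]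
    exact mul_le_mul (hB' u) (hF.le _) (hF.nonneg _) (by positivity)
  · rw [mul_comm M]
    exact mul_le_mul_of_nonneg_left (hF.le _) (sq_nonneg _)

end FELogit
end

noncomputable section
namespace FELogit

/-! ### Consistency of the local polynomial estimator -/

/-- The error of a local polynomial estimate, when the empirical moments of the kernel are close to
their limits. -/
theorem exists_localPoly_close {T p : ℕ} {K : Cov T p → ℝ} (hK : IsKernel K) (ℓ : ℕ) {b M : ℝ}
    (hb : 0 < b) {g : Cov T p → ℝ} (hg : ContDiff ℝ (ℓ + 1 : ℕ) g) (R₀ : ℝ) :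
    ∃ A η, 0 ≤ A ∧ 0 < η ∧ ∀ (n : ℕ) (x : ℕ → Cov T p) (s : ℕ → ℕ) (j : ℕ) (h : ℝ) (x₀ : Cov T p)
      (ĝ F₀ N τ : ℝ), 0 < h → IsLocalPolyEstimate K h ℓ n x s j x₀ ĝ → 0 < N → b ≤ F₀ → F₀ ≤ M →
      (∀ i < n, ‖x i‖ ≤ R₀) → ‖x₀‖ ≤ R₀ →
      (∀ d d' : MultiIndex T p ℓ, |N⁻¹ * ∑ i ∈ Finset.range n, K (h⁻¹ • (x i - x₀)) *
        (monomial (h⁻¹ • (x i - x₀)) d * monomial (h⁻¹ • (x i - x₀)) d') -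
          F₀ * kernelMoment K d d'| ≤ η) →
      (∀ d : MultiIndex T p ℓ, |N⁻¹ * ∑ i ∈ Finset.range n, K (h⁻¹ • (x i - x₀)) *
        (monomial (h⁻¹ • (x i - x₀)) d * ((if s i = j then 1 else 0) - g (x i)))| ≤ τ) →
      h ^ (ℓ + 1) ≤ τ → |ĝ - g x₀| ≤ A * τ := by
  obtain ⟨B, R, r, -, -, hR, -, -, -, hKR, -⟩ := hK.exists_bounds
  obtain ⟨κ, hκ, hquad⟩ := hK.exists_kernelMoment_pos ℓ
  obtain ⟨C, hC, htay⟩ := exists_taylor hg R₀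
  set q := Fintype.card (MultiIndex T p ℓ) with hq
  set z := MultiIndex.zero T p ℓ with hz
  -- Small enough that an entrywise error `η` in the design matrix leaves at least half of its
  -- curvature b κ.
  set η := b * κ / (2 * (q + 1)) with hη
  have hη0 : 0 < η := by positivity
  set D := R ^ ℓ * (C * R ^ (ℓ + 1)) * (|M| * |kernelMoment K z z| + η) with hD
  have hD0 : 0 ≤ D := by positivity
  refine ⟨2 * q * (1 + D) / (b * κ / 2), η, by positivity, hη0, ?_⟩
  intro n x s j h x₀ ĝ F₀ N τ hh hĝ hN hbF hFM hx hx₀ hdes hnoise hτ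
  have hτ0 : 0 ≤ τ := le_trans (by positivity) hτ
  obtain ⟨a₀, ha₀, ha⟩ := htay x₀ (by simpa using hx₀)
  have hNi : 0 < N⁻¹ := inv_pos.2 hN
  -- The Taylor remainder is at most C (R h)^(ℓ+1) where the kernel is nonzero, and the total kernel
  -- weight is controlled by the entry of the design matrix at the zero multi-index.
  have hb' : ∀ d : MultiIndex T p ℓ, |N⁻¹ * ∑ i ∈ Finset.range n, K (h⁻¹ • (x i - x₀)) *
      (monomial (h⁻¹ • (x i - x₀)) d * (g (x i) - polyVal a₀ (x i - x₀)))| ≤ D * τ := fun d => by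
    have h1 : ∀ i ∈ Finset.range n, |K (h⁻¹ • (x i - x₀)) *
        (monomial (h⁻¹ • (x i - x₀)) d * (g (x i) - polyVal a₀ (x i - x₀)))| ≤
        R ^ ℓ * (C * R ^ (ℓ + 1)) * h ^ (ℓ + 1) * (K (h⁻¹ • (x i - x₀)) *
          (monomial (h⁻¹ • (x i - x₀)) z * monomial (h⁻¹ • (x i - x₀)) z)) := fun i hi => by
      rw [monomial_mi_zero, mul_one, mul_one, abs_mul, abs_of_nonneg (hK.nonneg _), mul_comm]
      by_cases hu : R < ‖h⁻¹ • (x i - x₀)‖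
      · rw [hKR _ hu]; simp
      · rw [not_lt] at hu
        refine mul_le_mul_of_nonneg_right ?_ (hK.nonneg _)
        have hd : ‖x i - x₀‖ ≤ R * h := by
          rwa [norm_smul, norm_inv, Real.norm_eq_abs, abs_of_pos hh, inv_mul_le_iff₀ hh,
            mul_comm] at hu
        have hi' := ha (x i) (by simpa using hx i (Finset.mem_range.1 hi))
        rw [abs_mul, mul_assoc]
        refine mul_le_mul (abs_monomial_le hR hu d) (hi'.trans ?_) (abs_nonneg _) (by positivity)
        calc C * ‖x i - x₀‖ ^ (ℓ + 1) ≤ C * (R * h) ^ (ℓ + 1) := by gcongr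
          _ = _ := by rw [mul_pow]; ring
    have h2 : N⁻¹ * ∑ i ∈ Finset.range n, K (h⁻¹ • (x i - x₀)) *
        (monomial (h⁻¹ • (x i - x₀)) z * monomial (h⁻¹ • (x i - x₀)) z) ≤
        |M| * |kernelMoment K z z| + η := by
      have h3 := (abs_le.1 (hdes z z)).2
      have h4 : F₀ * kernelMoment K z z ≤ |M| * |kernelMoment K z z| :=
        mul_le_mul (hFM.trans (le_abs_self M)) (le_abs_self _) (by
          rw [kernelMoment]
          refine integral_nonneg fun u => mul_nonneg (hK.nonneg u) ?_
          rw [hz, monomial_mi_zero]; norm_num) (abs_nonneg _)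
      linarith
    rw [abs_mul, abs_of_pos hNi]
    calc _ ≤ N⁻¹ * (R ^ ℓ * (C * R ^ (ℓ + 1)) * h ^ (ℓ + 1) *
          ∑ i ∈ Finset.range n, K (h⁻¹ • (x i - x₀)) *
          (monomial (h⁻¹ • (x i - x₀)) z * monomial (h⁻¹ • (x i - x₀)) z)) := by
          refine mul_le_mul_of_nonneg_left ?_ hNi.le
          rw [Finset.mul_sum]
          exact (Finset.abs_sum_le_sum_abs _ _).trans (Finset.sum_le_sum h1)
      _ = R ^ ℓ * (C * R ^ (ℓ + 1)) * h ^ (ℓ + 1) *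
          (N⁻¹ * ∑ i ∈ Finset.range n, K (h⁻¹ • (x i - x₀)) *
          (monomial (h⁻¹ • (x i - x₀)) z * monomial (h⁻¹ • (x i - x₀)) z)) := by ring
      _ ≤ R ^ ℓ * (C * R ^ (ℓ + 1)) * τ * (|M| * |kernelMoment K z z| + η) :=
          mul_le_mul (mul_le_mul_of_nonneg_left hτ (by positivity)) h2
            (mul_nonneg hNi.le (Finset.sum_nonneg fun i _ => mul_nonneg (hK.nonneg _) (by
              rw [hz, monomial_mi_zero]; norm_num))) (by positivity)
      _ = D * τ := by rw [hD]; ring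
  have hquad' : ∀ e : MultiIndex T p ℓ → ℝ, b * κ * ∑ i, e i ^ 2 ≤
      ∑ i, ∑ j, e i * e j * (F₀ * kernelMoment K i j) := fun e => by
    have e1 : ∑ i, ∑ j, e i * e j * (F₀ * kernelMoment K i j) =
        F₀ * ∑ i, ∑ j, e i * e j * kernelMoment K i j := by
      simp only [Finset.mul_sum]
      exact Finset.sum_congr rfl fun i _ => Finset.sum_congr rfl fun j _ => by ring
    rw [e1]
    have h0 : 0 ≤ κ * ∑ i, e i ^ 2 := by positivity
    have h1 := mul_le_mul hbF (hquad e) h0 (hb.le.trans hbF)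
    linarith
  have hdesign : ∀ e : MultiIndex T p ℓ → ℝ, b * κ / 2 * ∑ d, e d ^ 2 ≤
      N⁻¹ * ∑ i ∈ Finset.range n, K (h⁻¹ • (x i - x₀)) * polyVal e (h⁻¹ • (x i - x₀)) ^ 2 :=
    fun e => by
    have h1 := quadForm_perturb hquad' hdes e
    have h2 : b * κ / 2 ≤ b * κ - η * q := by
      have : η * (q + 1) = b * κ / 2 := by rw [hη]; field_simp
      linarith
    refine (mul_le_mul_of_nonneg_right h2 (by positivity)).trans (h1.trans_eq ?_)
    simp only [polyVal, sq, Finset.sum_mul_sum]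
    simp only [Finset.mul_sum]
    rw [Finset.sum_comm' (t' := Finset.univ) (s' := fun _ => Finset.range n) (by simp)]
    refine Finset.sum_congr rfl fun d _ => ?_
    rw [Finset.sum_comm]
    refine Finset.sum_congr rfl fun i _ => Finset.sum_congr rfl fun d' _ => by ring
  have hle1 : τ ≤ (1 + D) * τ := by nlinarith
  have hle2 : D * τ ≤ (1 + D) * τ := by nlinarith
  have := abs_localPoly_sub_le hh hĝ (by positivity) hdesign
    (fun d => (hnoise d).trans hle1) (fun d => (hb' d).trans hle2)
  rw [ha₀] at this
  refine this.trans_eq ?_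
  ring

/-- The conditions on the bandwidth and on the threshold. -/
structure IsTuning (d ℓ : ℕ) (h c : ℕ → ℝ) : Prop where
  pos : ∀ n, 0 < h n
  lim : Tendsto h atTop (𝓝 0)
  cpos : ∀ n, 0 < c n
  clim : Tendsto c atTop (𝓝 0)
  noise : Tendsto (fun n : ℕ => (n * h n ^ d * c n ^ 2)⁻¹) atTop (𝓝 0)
  bias : Tendsto (fun n => h n ^ (ℓ + 1) / c n) atTop (𝓝 0)

/-- Since ln n ≥ 1 for n ≥ 3, the rate condition gives n h^d c² → ∞. This is all that Chebyshev's
inequality needs, deviations being controlled at one sample point at a time. -/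
lemma isTuning_of_rate {T p ℓ : ℕ} {h c : ℕ → ℝ} (hpos : ∀ n, 0 < h n)
    (hlim : Tendsto h atTop (𝓝 0)) (cpos : ∀ n, 0 < c n) (clim : Tendsto c atTop (𝓝 0))
    (hc : Tendsto (fun n : ℕ => rate T p ℓ n (h n) / c n) atTop (𝓝 0)) :
    IsTuning (p * T) ℓ h c := by
  refine ⟨hpos, hlim, cpos, clim, ?_, ?_⟩
  · have h1 : Tendsto (fun n : ℕ => (rate T p ℓ n (h n) / c n) ^ 2) atTop (𝓝 0) := by
      simpa using hc.pow 2
    refine squeeze_zero' (Eventually.of_forall fun n => ?_) ?_ h1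
    · have := hpos n; positivity
    filter_upwards [eventually_ge_atTop 3] with n hn
    have hn0 : (0 : ℝ) < n := by exact_mod_cast (by omega : 0 < n)
    have hh := hpos n
    have hcn := cpos n
    have hlog : 1 ≤ Real.log n := by
      rw [Real.le_log_iff_exp_le hn0]
      have : (3 : ℝ) ≤ n := by exact_mod_cast hn
      linarith [Real.exp_one_lt_d9]
    have h2 : √(Real.log n / (n * h n ^ (p * T))) ≤ rate T p ℓ n (h n) := by
      unfold rate
      linarith [pow_pos hh (ℓ + 1)]
    have h3 : Real.log n / (n * h n ^ (p * T)) ≤ rate T p ℓ n (h n) ^ 2 := by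
      rw [← Real.sq_sqrt (show 0 ≤ Real.log n / (n * h n ^ (p * T)) by positivity)]
      exact pow_le_pow_left₀ (Real.sqrt_nonneg _) h2 2
    rw [div_pow]
    calc (n * h n ^ (p * T) * c n ^ 2)⁻¹ = 1 / (n * h n ^ (p * T)) / c n ^ 2 := by field_simp
      _ ≤ Real.log n / (n * h n ^ (p * T)) / c n ^ 2 := by gcongr
      _ ≤ _ := by gcongr
  · refine squeeze_zero (fun n => ?_) (fun n => ?_) hc
    · have := hpos n; have := cpos n; positivity
    · have hcn := cpos n
      unfold rate
      gcongr
      linarith [Real.sqrt_nonneg (Real.log n / (n * h n ^ (p * T)))]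

section

variable {d ℓ : ℕ} {h c : ℕ → ℝ}

lemma IsTuning.eventually_noise_le (H : IsTuning d ℓ h c) (A : ℝ) {e : ℝ} (he : 0 < e) :
    ∀ᶠ n : ℕ in atTop, A / (n * h n ^ d * c n ^ 2) ≤ e := by
  have h1 := H.noise.const_mul A
  rw [mul_zero] at h1
  filter_upwards [h1.eventually_lt_const he] with n hn
  rw [div_eq_mul_inv]; exact hn.le

lemma IsTuning.eventually_c_le (H : IsTuning d ℓ h c) {e : ℝ} (he : 0 < e) : ∀ᶠ n in atTop, c n ≤ e :=
  (H.clim.eventually_lt_const he).mono fun _ h => h.le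

lemma IsTuning.eventually_diag_le (H : IsTuning d ℓ h c) (A : ℝ) {δ : ℝ} (hδ : 0 < δ) :
    ∀ᶠ n : ℕ in atTop, A / (n * h n ^ d) ≤ δ * c n := by
  filter_upwards [H.eventually_noise_le A hδ, H.eventually_c_le one_pos,
    eventually_gt_atTop 0] with n hn hc1 hn0
  have hn0' : (0 : ℝ) < n := by exact_mod_cast hn0
  have hc := H.cpos n
  have hh := H.pos n
  calc A / (n * h n ^ d) = A / (n * h n ^ d * c n ^ 2) * (c n * c n) := by field_simp
    _ ≤ δ * (1 * c n) := by gcongr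
    _ = δ * c n := by ring

lemma IsTuning.eventually_bias_le (H : IsTuning d ℓ h c) {δ : ℝ} (hδ : 0 < δ) :
    ∀ᶠ n in atTop, h n ^ (ℓ + 1) ≤ δ * c n := by
  filter_upwards [H.bias.eventually_lt_const hδ] with n hn
  exact ((div_lt_iff₀ (H.cpos n)).1 hn).le

lemma IsTuning.eventually_parametric_le (H : IsTuning d ℓ h c) {A : ℝ} (hA : 0 ≤ A) {e : ℝ} (he : 0 < e) :
    ∀ᶠ n : ℕ in atTop, A / (n * c n ^ 2) ≤ e := by
  filter_upwards [H.eventually_noise_le A he, H.lim.eventually_lt_const one_pos,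
    eventually_gt_atTop 0] with n hn hh1 hn0
  have hn0' : (0 : ℝ) < n := by exact_mod_cast hn0
  have hc := H.cpos n
  have hh := H.pos n
  refine le_trans ?_ hn
  have : h n ^ d ≤ 1 := pow_le_one₀ hh.le hh1.le
  refine div_le_div_of_nonneg_left hA (by positivity) ?_
  gcongr
  nlinarith

end

end FELogit
end

/-! ### Events of uniformly small probability, and kernel averages at the sample points -/

noncomputable section
namespace FELogit

/-- The probability of `B n i` tends to `0`, uniformly in `i`. -/
def Negligible {Ω : Type*} [MeasurableSpace Ω] (P : Measure Ω) (B : ℕ → ℕ → Set Ω) : Prop :=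
  ∀ e > 0, ∀ᶠ n in atTop, ∀ i, P.real (B n i) ≤ e

section

variable {Ω : Type*} [MeasurableSpace Ω] {P : Measure Ω}

lemma Negligible.mono [IsProbabilityMeasure P] {B B' : ℕ → ℕ → Set Ω} (h : Negligible P B)
    (hB : ∀ᶠ n in atTop, ∀ i, B' n i ⊆ B n i) : Negligible P B' := fun e he => by
  filter_upwards [h e he, hB] with n h1 h2 i
  exact (measureReal_mono (h2 i)).trans (h1 i)

lemma Negligible.iUnion {ι : Type*} [Fintype ι] {B : ι → ℕ → ℕ → Set Ω}
    (h : ∀ a, Negligible P (B a)) : Negligible P fun n i => ⋃ a, B a n i := fun e he => by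
  have h1 : ∀ᶠ n in atTop, ∀ a i, P.real (B a n i) ≤ e / (Fintype.card ι + 1) :=
    eventually_all.2 fun a => h a _ (by positivity)
  filter_upwards [h1] with n hn i
  refine (measureReal_iUnion_fintype_le _).trans
    ((Finset.sum_le_card_nsmul _ _ _ fun a _ => hn a i).trans ?_)
  rw [nsmul_eq_mul, Finset.card_univ, mul_div_assoc', div_le_iff₀ (by positivity)]
  nlinarith

lemma Negligible.union {B B' : ℕ → ℕ → Set Ω} (h : Negligible P B) (h' : Negligible P B') :
    Negligible P fun n i => B n i ∪ B' n i := fun e he => by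
  filter_upwards [h (e / 2) (by positivity), h' (e / 2) (by positivity)] with n h1 h2 i
  linarith [measureReal_union_le (μ := P) (B n i) (B' n i), h1 i, h2 i]

variable [IsProbabilityMeasure P] {T p : ℕ} {𝒟 : Type*} [MeasurableSpace 𝒟] {Z : ℕ → Ω → Cov T p × 𝒟}
  {μ : Measure (Cov T p × 𝒟)} {F : Cov T p → ℝ} {b M : ℝ}

lemma measurable_rescale (h : ℝ) :
    Measurable fun z : (Cov T p × 𝒟) × (Cov T p × 𝒟) => h⁻¹ • (z.2.1 - z.1.1) :=
  (measurable_const_smul h⁻¹).comp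
    ((measurable_fst.comp measurable_snd).sub (measurable_fst.comp measurable_fst))

/-- The second moment of a kernel term is of order h^(pT), by rescaling against a bounded density.
After division by n h^(pT), the variance is of order 1/(n h^(pT)). -/
lemma IsIID.kernel_dev (hZ : IsIID P Z μ) (hF : IsBoundedDensity μ.fst F b M) {g : Cov T p → ℝ}
    (hg : Measurable g) {B R : ℝ} (hB : ∀ u, |g u| ≤ B) (hR : ∀ u, R < ‖u‖ → g u = 0)
    {ξ : Cov T p × 𝒟 → ℝ} (hξ : Measurable ξ) (hξ1 : ∀ z, |ξ z| ≤ 1) {n : ℕ} (hn : 0 < n) (i : ℕ)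
    {h τ : ℝ} (hh : 0 < h) (hτ : 0 < τ) :
    P.real {ω | τ + 2 * B / (n * h ^ (p * T)) < |(n * h ^ (p * T))⁻¹ * ∑ j ∈ Finset.range n,
      (g (h⁻¹ • ((Z j ω).1 - (Z i ω).1)) * ξ (Z j ω) -
        ∫ w, g (h⁻¹ • (w.1 - (Z i ω).1)) * ξ w ∂μ)|} ≤
      M * (∫ u, g u ^ 2) / (n * h ^ (p * T) * τ ^ 2) := by
  have := hZ.isProbabilityMeasure
  have hn' : (0 : ℝ) < n := by exact_mod_cast hn
  have hM : 0 ≤ M := (hF.nonneg 0).trans (hF.le 0)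
  have hI : 0 ≤ ∫ u, g u ^ 2 := integral_nonneg fun u => sq_nonneg _
  have hV : ∀ z : Cov T p × 𝒟, ∫ w, (g (h⁻¹ • (w.1 - z.1)) * ξ w) ^ 2 ∂μ ≤
      h ^ (p * T) * (M * ∫ u, g u ^ 2) := fun z => by
    refine le_trans ?_ (hF.integral_kernel_sq_le hg hB hR z.1 hh)
    have hm : Measurable fun y => g (h⁻¹ • (y - z.1)) :=
      hg.comp ((measurable_const_smul _).comp (measurable_id.sub_const _))
    have hb2 : ∀ y, ‖g (h⁻¹ • (y - z.1)) ^ 2‖ ≤ B ^ 2 := fun y => by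
      rw [Real.norm_eq_abs, abs_pow]; exact pow_le_pow_left₀ (abs_nonneg _) (hB _) 2
    have hle : ∀ w : Cov T p × 𝒟,
        (g (h⁻¹ • (w.1 - z.1)) * ξ w) ^ 2 ≤ g (h⁻¹ • (w.1 - z.1)) ^ 2 := fun w => by
      rw [mul_pow]
      have : ξ w ^ 2 ≤ 1 := by
        rw [← sq_abs]; exact pow_le_one₀ (abs_nonneg _) (hξ1 w)
      nlinarith [sq_nonneg (g (h⁻¹ • (w.1 - z.1)))]
    rw [Measure.fst, integral_map measurable_fst.aemeasurable (hm.pow_const 2).aestronglyMeasurable]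
    have hi : Integrable (fun w : Cov T p × 𝒟 => g (h⁻¹ • (w.1 - z.1)) ^ 2) μ :=
      Integrable.of_bound ((hm.comp measurable_fst).pow_const 2).aestronglyMeasurable (B ^ 2)
        (ae_of_all _ fun w => hb2 _)
    refine integral_mono (hi.mono' (((hm.comp measurable_fst).mul hξ).pow_const
      2).aestronglyMeasurable (ae_of_all _ fun w => ?_)) hi hle
    rw [Real.norm_eq_abs, abs_of_nonneg (sq_nonneg _)]
    exact hle w
  refine (hZ.pair_dev (G := fun z => g (h⁻¹ • (z.2.1 - z.1.1)) * ξ z.2)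
    ((hg.comp (measurable_rescale h)).mul (hξ.comp measurable_snd)) (B := B) (fun z => ?_) hV
    (by positivity) (n := n) (i := i) (N := n * h ^ (p * T)) (by positivity) hτ).trans_eq ?_
  · rw [abs_mul]
    exact (mul_le_mul (hB _) (hξ1 _) (abs_nonneg _) ((abs_nonneg _).trans (hB 0))).trans_eq
      (mul_one B)
  · field_simp

/-- Centred kernel averages are small compared with the threshold. -/
lemma IsIID.negligible_kernel_dev (hZ : IsIID P Z μ) (hF : IsBoundedDensity μ.fst F b M)
    {ℓ : ℕ} {h c : ℕ → ℝ} (H : IsTuning (p * T) ℓ h c) {g : Cov T p → ℝ}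
    (hg : Measurable g) {B R : ℝ} (hB : ∀ u, |g u| ≤ B) (hR : ∀ u, R < ‖u‖ → g u = 0)
    {ξ : Cov T p × 𝒟 → ℝ} (hξ : Measurable ξ) (hξ1 : ∀ z, |ξ z| ≤ 1) {δ : ℝ} (hδ : 0 < δ) :
    Negligible P fun n i => {ω | δ * c n < |(n * h n ^ (p * T))⁻¹ * ∑ j ∈ Finset.range n,
      (g ((h n)⁻¹ • ((Z j ω).1 - (Z i ω).1)) * ξ (Z j ω) -
        ∫ w, g ((h n)⁻¹ • (w.1 - (Z i ω).1)) * ξ w ∂μ)|} := fun e he => by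
  filter_upwards [H.eventually_noise_le (M * (∫ u, g u ^ 2) / (δ / 2) ^ 2) he,
    H.eventually_diag_le (2 * B) (half_pos hδ), eventually_gt_atTop 0] with n h1 h2 hn i
  have hc := H.cpos n
  have hh := H.pos n
  refine le_trans (measureReal_mono fun ω (hω : δ * c n < _) => ?_)
    ((hZ.kernel_dev hF hg hB hR hξ hξ1 hn i hh (τ := δ / 2 * c n) (by positivity)).trans ?_)
  · exact lt_of_le_of_lt (by linarith) hω
  · refine le_trans (le_of_eq ?_) h1
    rw [mul_pow, div_div]
    ring

/-- Kernel averages at the sample points are close to their limits. -/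
lemma IsIID.negligible_kernel_sub (hZ : IsIID P Z μ) (hF : IsBoundedDensity μ.fst F b M)
    {ℓ : ℕ} {h c : ℕ → ℝ} (H : IsTuning (p * T) ℓ h c) {g : Cov T p → ℝ}
    (hg : Measurable g) {B R : ℝ} (hR0 : 0 < R) (hB : ∀ u, |g u| ≤ B)
    (hR : ∀ u, R < ‖u‖ → g u = 0) {δ : ℝ} (hδ : 0 < δ) :
    Negligible P fun n i => {ω | δ < |(n * h n ^ (p * T))⁻¹ * ∑ j ∈ Finset.range n,
      g ((h n)⁻¹ • ((Z j ω).1 - (Z i ω).1)) - F (Z i ω).1 * ∫ u, g u|} := by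
  have := hZ.isProbabilityMeasure
  set a : ℕ → Cov T p → ℝ := fun n x => ∫ u, g u * F (x + h n • u) with ha
  set I := ∫ u, g u with hI
  have ham : ∀ n, Measurable (a n) := fun n => by
    have : Measurable fun z : Cov T p × Cov T p => g z.2 * F (z.1 + h n • z.2) :=
      (hg.comp measurable_snd).mul
        (hF.measurable.comp (measurable_fst.add ((measurable_const_smul (h n)).comp measurable_snd)))
    exact this.stronglyMeasurable.integral_prod_right'.measurable
  -- Almost sure convergence gives convergence in measure under the law of the covariates; all X_i
  -- share that law, so the resulting bound is uniform in i.
  have hconv : ∀ᵐ x ∂μ.fst, Tendsto (fun n => a n x) atTop (𝓝 (F x * I)) :=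
    hF.absolutelyContinuous.ae_le (ae_tendsto_kernel_average hF.measurable (M := M) (fun x => by
      rw [abs_of_nonneg (hF.nonneg x)]; exact hF.le x) hg hR0 hB hR H.pos H.lim)
  have hmeas := tendstoInMeasure_of_tendsto_ae (fun n => (ham n).aestronglyMeasurable) hconv
  rw [tendstoInMeasure_iff_measureReal_norm] at hmeas
  have hbias : Negligible P fun n i => {ω | δ / 2 < |a n (Z i ω).1 - F (Z i ω).1 * I|} :=
    fun e he => by
    filter_upwards [(hmeas (δ / 2) (half_pos hδ)).eventually_lt_const he] with n hn i
    refine le_trans (le_trans (le_of_eq (b := μ.fst.real {x | δ / 2 < |a n x - F x * I|}) ?_)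
      (measureReal_mono fun x (hx : δ / 2 < _) => ?_)) hn.le
    · have hm : MeasurableSet {x | δ / 2 < |a n x - F x * I|} :=
        measurableSet_lt measurable_const ((ham n).sub (hF.measurable.mul_const I)).abs
      rw [Measure.fst, map_measureReal_apply measurable_fst hm, ← hZ.map_eq i,
        map_measureReal_apply (hZ.measurable i) (measurable_fst hm)]
      rfl
    · exact hx.le
  have hdev := hZ.negligible_kernel_dev hF H hg hB hR (ξ := fun _ => 1) measurable_const (by simp)
    (half_pos hδ)
  refine (hdev.union hbias).mono ?_
  filter_upwards [H.eventually_c_le one_pos, eventually_gt_atTop 0] with n hc hn i ω hω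
  by_contra hcon
  simp only [Set.mem_union, Set.mem_ofPred_eq, not_or, not_lt] at hcon
  obtain ⟨h1, h2⟩ := hcon
  have hh := H.pos n
  have hn' : (0 : ℝ) < n := by exact_mod_cast hn
  have hω' : δ < |(n * h n ^ (p * T))⁻¹ * ∑ j ∈ Finset.range n,
      g ((h n)⁻¹ • ((Z j ω).1 - (Z i ω).1)) - F (Z i ω).1 * I| := hω
  have hmean : ∫ w : Cov T p × 𝒟, g ((h n)⁻¹ • (w.1 - (Z i ω).1)) * 1 ∂μ =
      h n ^ (p * T) * a n (Z i ω).1 := by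
    have hm : Measurable fun y => g ((h n)⁻¹ • (y - (Z i ω).1)) :=
      hg.comp ((measurable_const_smul _).comp (measurable_id.sub_const _))
    rw [ha, ← hF.integral_kernel g _ hh, Measure.fst,
      integral_map measurable_fst.aemeasurable hm.aestronglyMeasurable]
    simp
  rw [Finset.sum_sub_distrib, hmean, Finset.sum_const, Finset.card_range, nsmul_eq_mul, mul_sub,
    show ((n : ℝ) * h n ^ (p * T))⁻¹ * (n * (h n ^ (p * T) * a n (Z i ω).1)) = a n (Z i ω).1 by
      field_simp] at h1
  simp only [mul_one] at h1
  have h3 : δ / 2 * c n ≤ δ / 2 := by nlinarith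
  have := abs_sub_le ((n * h n ^ (p * T))⁻¹ * ∑ j ∈ Finset.range n,
      g ((h n)⁻¹ • ((Z j ω).1 - (Z i ω).1))) (a n (Z i ω).1) (F (Z i ω).1 * I)
  linarith

end

end FELogit
end

/-! ### Local polynomial estimates at the sample points -/

noncomputable section
namespace FELogit

section

variable {Ω : Type*} [MeasurableSpace Ω] {P : Measure Ω} [IsProbabilityMeasure P] {T p : ℕ}
  {𝒟 : Type*} [MeasurableSpace 𝒟] {Z : ℕ → Ω → Cov T p × 𝒟}
  {μ : Measure (Cov T p × 𝒟)} {F : Cov T p → ℝ} {b M : ℝ}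

/-- Disintegrating `Q` along its first coordinate, the inner integral vanishes at each x, because
`gamma0` is read off the same conditional kernel. This centres the regression noise. -/
lemma integral_mul_sub_gamma0 {Q : Measure (Cov T p × ℕ)} [IsProbabilityMeasure Q]
    {φ : Cov T p → ℝ} (hφ : Measurable φ) {B : ℝ} (hB : ∀ x, |φ x| ≤ B) (j : ℕ) :
    ∫ z, φ z.1 * ((if z.2 = j then 1 else 0) - gamma0 Q j z.1) ∂Q = 0 := by
  have hind : Measurable fun s : ℕ => if s = j then (1 : ℝ) else 0 := measurable_of_countable _
  have hm : Measurable fun z : Cov T p × ℕ =>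
      φ z.1 * ((if z.2 = j then 1 else 0) - gamma0 Q j z.1) :=
    (hφ.comp measurable_fst).mul
      ((hind.comp measurable_snd).sub ((measurable_gamma0 Q j).comp measurable_fst))
  have hle : ∀ (s : ℕ) (x : Cov T p), |(if s = j then 1 else 0) - gamma0 Q j x| ≤ 1 := fun s x => by
    have h0 := gamma0_nonneg Q j x
    have h1 := gamma0_le_one Q j x
    rw [abs_le]
    split_ifs <;> constructor <;> linarith
  have hi : Integrable (fun z : Cov T p × ℕ =>
      φ z.1 * ((if z.2 = j then 1 else 0) - gamma0 Q j z.1)) Q := by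
    refine Integrable.of_bound hm.aestronglyMeasurable (B * 1) (ae_of_all _ fun z => ?_)
    rw [Real.norm_eq_abs, abs_mul]
    exact mul_le_mul (hB _) (hle _ _) (abs_nonneg _) ((abs_nonneg _).trans (hB z.1))
  rw [← Measure.integral_condKernel hi]
  refine integral_eq_zero_of_ae (ae_of_all _ fun x => ?_)
  have h1 : ∫ s, (if s = j then (1 : ℝ) else 0) ∂(Q.condKernel x) = gamma0 Q j x := by
    have : (fun b : ℕ => if b = j then (1 : ℝ) else 0) = ({j} : Set ℕ).indicator fun _ => 1 := by
      ext b; simp [Set.indicator]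
    rw [this, integral_indicator_const _ (measurableSet_singleton j), smul_eq_mul, mul_one]
    rfl
  have h2 : Integrable (fun s : ℕ => if s = j then (1 : ℝ) else 0) (Q.condKernel x) :=
    Integrable.of_bound hind.aestronglyMeasurable 1 (ae_of_all _ fun s => by split_ifs <;> simp)
  simp only [Pi.zero_apply]
  rw [integral_const_mul, integral_sub h2 (integrable_const _), h1]
  simp

/-- The local polynomial estimates are close to the conditional probabilities at the sample points,
on the scale of the threshold. -/
theorem IsIID.exists_gamma_bad (hZ : IsIID P Z μ) (hF : IsBoundedDensity μ.fst F b M)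
    {ℓ : ℕ} {h c : ℕ → ℝ} (H : IsTuning (p * T) ℓ h c) {K : Cov T p → ℝ} (hK : IsKernel K)
    {σ : 𝒟 → ℕ} (hσ : Measurable σ) {Q : Measure (Cov T p × ℕ)} [IsProbabilityMeasure Q]
    (hQ : Q = μ.map fun z => (z.1, σ z.2)) {R₀ : ℝ} (hR₀ : ∀ᵐ x ∂μ.fst, ‖x‖ ≤ R₀) {j : ℕ}
    {g : Cov T p → ℝ} (hg : ContDiff ℝ (ℓ + 1 : ℕ) g) (hgγ : ∀ᵐ x ∂μ.fst, gamma0 Q j x = g x)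
    {δ : ℝ} (hδ : 0 < δ) : ∃ Bad : ℕ → ℕ → Set Ω, Negligible P Bad ∧
      ∀ᶠ n in atTop, ∀ᵐ ω ∂P, ∀ i, ω ∉ Bad n i → ∀ ĝ,
        IsLocalPolyEstimate K (h n) ℓ n (fun i => (Z i ω).1) (fun i => σ (Z i ω).2) j (Z i ω).1 ĝ →
        |ĝ - gamma0 Q j (Z i ω).1| ≤ δ * c n := by
  have := hZ.isProbabilityMeasure
  obtain ⟨B, R, -, -, hB, hR, -, -, hKB, hKR, -⟩ := hK.exists_bounds
  obtain ⟨A, η, hA, hη, hclose⟩ := exists_localPoly_close hK ℓ (M := M) hF.pos hg R₀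
  set δ' := δ / (A + 1) with hδ'
  have hδ'0 : 0 < δ' := by positivity
  have hKabs : ∀ u, |K u| ≤ B := fun u => by rw [abs_of_nonneg (hK.nonneg u)]; exact hKB u
  have hφ : ∀ φ : Cov T p → ℝ, (∀ u, ‖u‖ ≤ R → |φ u| ≤ R ^ ℓ * R ^ ℓ) →
      ∀ u, |K u * φ u| ≤ B * (R ^ ℓ * R ^ ℓ) := fun φ hφ u => by
    by_cases hu : R < ‖u‖
    · rw [hKR u hu, zero_mul, abs_zero]; positivity
    · rw [abs_mul]
      exact mul_le_mul (hKabs u) (hφ u (not_lt.1 hu)) (abs_nonneg _) hB.le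
  have hzero : ∀ φ : Cov T p → ℝ, ∀ u, R < ‖u‖ → K u * φ u = 0 := fun φ u hu => by
    rw [hKR u hu, zero_mul]
  have hR1 : 1 ≤ R ^ ℓ := one_le_pow₀ hR
  set ξ : Cov T p × 𝒟 → ℝ := fun z => (if σ z.2 = j then 1 else 0) - gamma0 Q j z.1 with hξ
  have hξm : Measurable ξ := by
    have hind : Measurable fun s : ℕ => if s = j then (1 : ℝ) else 0 := measurable_of_countable _
    exact ((hind.comp hσ).comp measurable_snd).sub ((measurable_gamma0 Q j).comp measurable_fst)
  have hξ1 : ∀ z, |ξ z| ≤ 1 := fun z => by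
    have h0 := gamma0_nonneg Q j z.1
    have h1 := gamma0_le_one Q j z.1
    rw [abs_le]
    simp only [hξ]
    split_ifs <;> constructor <;> linarith
  set B₁ : MultiIndex T p ℓ → MultiIndex T p ℓ → ℕ → ℕ → Set Ω := fun d d' n i =>
    {ω | η < |(n * h n ^ (p * T))⁻¹ * ∑ k ∈ Finset.range n,
      K ((h n)⁻¹ • ((Z k ω).1 - (Z i ω).1)) *
        (monomial ((h n)⁻¹ • ((Z k ω).1 - (Z i ω).1)) d *
          monomial ((h n)⁻¹ • ((Z k ω).1 - (Z i ω).1)) d') -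
        F (Z i ω).1 * kernelMoment K d d'|} with hB₁
  set B₂ : MultiIndex T p ℓ → ℕ → ℕ → Set Ω := fun d n i =>
    {ω | δ' * c n < |(n * h n ^ (p * T))⁻¹ * ∑ k ∈ Finset.range n,
      (K ((h n)⁻¹ • ((Z k ω).1 - (Z i ω).1)) * monomial ((h n)⁻¹ • ((Z k ω).1 - (Z i ω).1)) d *
        ξ (Z k ω) - ∫ w, K ((h n)⁻¹ • (w.1 - (Z i ω).1)) *
          monomial ((h n)⁻¹ • (w.1 - (Z i ω).1)) d * ξ w ∂μ)|} with hB₂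
  have h1 : ∀ d d', Negligible P (B₁ d d') := fun d d' => by
    have hc : Continuous fun u => K u * (monomial u d * monomial u d') :=
      hK.continuous.mul ((continuous_monomial d).mul (continuous_monomial d'))
    exact hZ.negligible_kernel_sub hF H hc.measurable (zero_lt_one.trans_le hR)
      (hφ _ fun u hu => by
        rw [abs_mul]
        exact mul_le_mul (abs_monomial_le hR hu d) (abs_monomial_le hR hu d') (abs_nonneg _)
          (by positivity)) (hzero _) hη
  have h2 : ∀ d, Negligible P (B₂ d) := fun d => by
    have hc : Continuous fun u => K u * monomial u d := hK.continuous.mul (continuous_monomial d)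
    exact hZ.negligible_kernel_dev hF H hc.measurable (hφ _ fun u hu =>
      (abs_monomial_le hR hu d).trans (le_mul_of_one_le_left (by positivity) hR1)) (hzero _)
      hξm hξ1 hδ'0
  refine ⟨fun n i => (⋃ d, ⋃ d', B₁ d d' n i) ∪ ⋃ d, B₂ d n i,
    (Negligible.iUnion fun d => Negligible.iUnion fun d' => h1 d d').union
      (Negligible.iUnion h2), ?_⟩
  have hae : ∀ᵐ ω ∂P, ∀ i, ‖(Z i ω).1‖ ≤ R₀ ∧ gamma0 Q j (Z i ω).1 = g (Z i ω).1 ∧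
      b ≤ F (Z i ω).1 := by
    refine ae_all_iff.2 fun i => ?_
    have h3 : ∀ᵐ x ∂μ.fst, ‖x‖ ≤ R₀ ∧ gamma0 Q j x = g x ∧ b ≤ F x := by
      filter_upwards [hR₀, hgγ, hF.ge] with x a1 a2 a3 using ⟨a1, a2, a3⟩
    have h4 := ae_of_ae_map measurable_fst.aemeasurable h3
    rw [← hZ.map_eq i] at h4
    exact ae_of_ae_map (hZ.measurable i).aemeasurable h4
  filter_upwards [H.eventually_bias_le hδ'0, eventually_gt_atTop 0] with n hbias hn
  filter_upwards [hae] with ω hω i hi ĝ hĝ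
  have hn' : (0 : ℝ) < n := by exact_mod_cast hn
  have hh := H.pos n
  simp only [Set.mem_union, Set.mem_iUnion, not_or, not_exists, hB₁, hB₂, Set.mem_ofPred_eq,
    not_lt] at hi
  have hnoise : ∀ d : MultiIndex T p ℓ, |((n : ℝ) * h n ^ (p * T))⁻¹ * ∑ k ∈ Finset.range n,
      K ((h n)⁻¹ • ((Z k ω).1 - (Z i ω).1)) *
        (monomial ((h n)⁻¹ • ((Z k ω).1 - (Z i ω).1)) d *
          ((if σ (Z k ω).2 = j then 1 else 0) - g (Z k ω).1))| ≤ δ' * c n := fun d => by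
    refine le_trans (le_of_eq ?_) (hi.2 d)
    congr 2
    refine Finset.sum_congr rfl fun k _ => ?_
    -- The noise has mean zero given the covariates, so the centring term in `B₂` is absent.
    have hz : ∫ w : Cov T p × 𝒟, K ((h n)⁻¹ • (w.1 - (Z i ω).1)) *
        monomial ((h n)⁻¹ • (w.1 - (Z i ω).1)) d * ξ w ∂μ = 0 := by
      have hc : Continuous fun x : Cov T p => K ((h n)⁻¹ • (x - (Z i ω).1)) *
          monomial ((h n)⁻¹ • (x - (Z i ω).1)) d :=
        (hK.continuous.mul (continuous_monomial d)).comp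
          (show Continuous fun x : Cov T p => (h n)⁻¹ • (x - (Z i ω).1) by fun_prop)
      have hm2 : Measurable fun z : Cov T p × 𝒟 => (z.1, σ z.2) :=
        measurable_fst.prodMk (hσ.comp measurable_snd)
      have h5 := integral_mul_sub_gamma0 (Q := Q) hc.measurable (B := B * (R ^ ℓ * R ^ ℓ))
        (fun x => hφ (fun u => monomial u d) (fun u hu =>
          (abs_monomial_le hR hu d).trans (le_mul_of_one_le_left (by positivity) hR1)) _) j
      have hind : Measurable fun s : ℕ => if s = j then (1 : ℝ) else 0 := measurable_of_countable _
      have hfm : Measurable fun z : Cov T p × ℕ => K ((h n)⁻¹ • (z.1 - (Z i ω).1)) *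
          monomial ((h n)⁻¹ • (z.1 - (Z i ω).1)) d *
          ((if z.2 = j then 1 else 0) - gamma0 Q j z.1) :=
        (hc.measurable.comp measurable_fst).mul
          ((hind.comp measurable_snd).sub ((measurable_gamma0 Q j).comp measurable_fst))
      have h6 : ∫ z, K ((h n)⁻¹ • (z.1 - (Z i ω).1)) *
          monomial ((h n)⁻¹ • (z.1 - (Z i ω).1)) d *
          ((if z.2 = j then 1 else 0) - gamma0 Q j z.1) ∂(μ.map fun z => (z.1, σ z.2)) = 0 := by
        rw [← hQ]; exact h5
      rw [integral_map hm2.aemeasurable hfm.aestronglyMeasurable] at h6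
      exact h6
    -- Almost surely the conditional probability agrees with its smooth version at all sample points
    -- simultaneously, so the two may be exchanged inside the average.
    rw [hz, sub_zero, ← (hω k).2.1]
    simp only [hξ]
    ring
  have := hclose n (fun i => (Z i ω).1) (fun i => σ (Z i ω).2) j (h n) (Z i ω).1 ĝ (F (Z i ω).1)
    (n * h n ^ (p * T)) (δ' * c n) hh hĝ (by positivity) (hω i).2.2 (hF.le _)
    (fun k _ => (hω k).1) (hω i).1 (fun d d' => hi.1 d d') hnoise hbias
  rw [(hω i).2.1]
  refine this.trans ?_
  have hc := H.cpos n
  have e : δ = δ' * (A + 1) := by rw [hδ']; field_simp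
  rw [e]
  have : 0 < δ' * c n := by positivity
  nlinarith

end

end FELogit
end

noncomputable section
namespace FELogit

/-! ### Consistency of the conditional maximum likelihood estimator -/

lemma continuous_score {T p : ℕ} (d : Fin T → Fin 2) (β : Fin p → ℝ) (k : Fin p) :
    Continuous fun x : Cov T p => score d x β k := by
  have hdot : ∀ t : Fin T, Continuous fun x : Cov T p => x t ⬝ᵥ β := fun t => by
    unfold dotProduct; fun_prop
  have hlin : ∀ d : Fin T → Fin 2, Continuous fun x : Cov T p => lin d x β := fun d => by
    unfold lin
    exact continuous_finsetSum _ fun t _ => continuous_const.mul (hdot t)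
  have hC : Continuous fun x : Cov T p => C (∑ t, (d t : ℕ)) x β := by
    simp only [C_eq]
    exact continuous_finsetSum _ fun d _ => (hlin d).rexp
  have hsum : ∀ d : Fin T → Fin 2, Continuous fun x : Cov T p => ∑ t, ((d t : ℕ) : ℝ) * x t k :=
    fun d => by fun_prop
  unfold score condMean
  exact (hsum d).sub ((continuous_finsetSum _ fun d _ => (hlin d).rexp.mul (hsum d)).div hC
    fun x => (C_pos (sum_le_of_fin2 d) x β).ne')

lemma exists_bound_on_ball {T p : ℕ} {G : (Fin T → Fin 2) → Cov T p → ℝ}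
    (hG : ∀ d, Continuous (G d)) (R : ℝ) : ∃ B, ∀ d x, ‖x‖ ≤ R → |G d x| ≤ B := by
  choose B hB using fun d => (isCompact_closedBall (0 : Cov T p) R).exists_bound_of_continuousOn
    (hG d).continuousOn
  refine ⟨∑ d, |B d|, fun d x hx => ?_⟩
  refine ((hB d x (by simpa using hx)).trans (le_abs_self _)).trans ?_
  exact Finset.single_le_sum (f := fun d => |B d|) (fun d _ => abs_nonneg _) (Finset.mem_univ d)

lemma measurable_uncurry_fin {T p : ℕ} {G : (Fin T → Fin 2) → Cov T p → ℝ}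
    (hG : ∀ d, Continuous (G d)) :
    Measurable fun z : Cov T p × (Fin T → Fin 2) => G z.2 z.1 :=
  measurable_from_prod_countable_left fun d => (hG d).measurable

/-- The exceptional set is a proper linear subspace, hence a Lebesgue null set. -/
lemma ae_dotProduct_ne_zero {T p : ℕ} {t₀ t₁ : Fin T} (ht : t₀ ≠ t₁) {e : Fin p → ℝ}
    (he : e ≠ 0) : ∀ᵐ x : Cov T p, (x t₀ - x t₁) ⬝ᵥ e ≠ 0 := by
  let f : Cov T p →ₗ[ℝ] ℝ :=
    { toFun := fun x => (x t₀ - x t₁) ⬝ᵥ e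
      map_add' := fun x y => by simp [sub_dotProduct, add_dotProduct]; ring
      map_smul' := fun a x => by simp [sub_dotProduct, mul_sub] }
  have hf : LinearMap.ker f ≠ ⊤ := fun htop => he (dotProduct_self_eq_zero.1 (by
    have h1 : f (Function.update 0 t₀ e) = 0 :=
      LinearMap.mem_ker.1 (htop ▸ Submodule.mem_top)
    have h2 : f (Function.update 0 t₀ e) =
      ((Function.update 0 t₀ e : Cov T p) t₀ - (Function.update 0 t₀ e : Cov T p) t₁) ⬝ᵥ e := rfl
    rw [h2, Function.update_self, Function.update_of_ne ht.symm] at h1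
    simpa using h1))
  have hnull := Measure.addHaar_submodule volume _ hf
  rw [ae_iff]
  refine measure_mono_null (fun x hx => ?_) hnull
  exact LinearMap.mem_ker.2 (not_not.1 hx)

section

variable {Ω : Type*} [MeasurableSpace Ω] {P : Measure Ω} [IsProbabilityMeasure P] {T p : ℕ}
  {X : Ω → Cov T p} {α : Ω → ℝ} {ε : Ω → Fin T → ℝ} {β : Fin p → ℝ}
  {μ : Measure (Cov T p × (Fin T → Fin 2))}

lemma IsModel.integral_law (h : IsModel P X α ε)
    (hμ : μ = P.map fun ω => (X ω, dvec β (X ω) (α ω) (ε ω)))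
    {G : (Fin T → Fin 2) → Cov T p → ℝ} (hG : ∀ d, Continuous (G d)) {R : ℝ}
    (hR : ∀ᵐ ω ∂P, ‖X ω‖ ≤ R) :
    ∫ z, G z.2 z.1 ∂μ = ∫ ω, ∑ d, seqProb β d (X ω) (α ω) * G d (X ω) ∂P := by
  obtain ⟨B, hB⟩ := exists_bound_on_ball hG R
  have hball : MeasurableSet (Metric.closedBall (0 : Cov T p) R) := measurableSet_closedBall
  -- `IsModel.integral_outcome` requires globally bounded functions; truncating to the ball changes
  -- nothing almost surely.
  have key := h.integral_outcome β
    (fun d z => (Metric.closedBall (0 : Cov T p) R).indicator (G d) z.2)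
    (fun d => ((hG d).measurable.indicator hball).comp measurable_snd) (B := |B|) (fun d z => by
      by_cases hz : z.2 ∈ Metric.closedBall (0 : Cov T p) R
      · rw [Set.indicator_of_mem hz]
        exact (hB d _ (by simpa using hz)).trans (le_abs_self B)
      · rw [Set.indicator_of_notMem hz, abs_zero]; exact abs_nonneg _)
  have hmem : ∀ᵐ ω ∂P, X ω ∈ Metric.closedBall (0 : Cov T p) R :=
    hR.mono fun ω hω => by simpa using hω
  rw [hμ, integral_map (h.measurable_X.prodMk (h.measurable_dvec β)).aemeasurable
    (measurable_uncurry_fin hG).aestronglyMeasurable]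
  refine Eq.trans (integral_congr_ae ?_) (key.trans (integral_congr_ae ?_))
  · filter_upwards [hmem] with ω hω
    rw [Set.indicator_of_mem hω]
  · filter_upwards [hmem] with ω hω
    exact Finset.sum_congr rfl fun d _ => by rw [Set.indicator_of_mem hω]

lemma IsModel.integral_score (h : IsModel P X α ε)
    (hμ : μ = P.map fun ω => (X ω, dvec β (X ω) (α ω) (ε ω))) {R : ℝ}
    (hR : ∀ᵐ ω ∂P, ‖X ω‖ ≤ R) (k : Fin p) : ∫ z, score z.2 z.1 β k ∂μ = 0 := by
  rw [h.integral_law hμ (G := fun d x => score d x β k) (fun d => continuous_score d β k) hR]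
  simp [sum_seqProb_score]

/-- The outcomes with `S = 1` have a nondegenerate second moment. -/
lemma IsModel.exists_information_pos (h : IsModel P X α ε)
    (hμ : μ = P.map fun ω => (X ω, dvec β (X ω) (α ω) (ε ω))) {R : ℝ}
    (hR : ∀ᵐ ω ∂P, ‖X ω‖ ≤ R) (hac : P.map X ≪ volume) {t₀ t₁ : Fin T} (ht : t₀ ≠ t₁) :
    ∃ κ > 0, ∀ e : Fin p → ℝ, κ * ∑ k, e k ^ 2 ≤ ∑ k, ∑ l, e k * e l *
      ∫ z, (if ∑ t, (z.2 t : ℕ) = 1 then (z.1 t₀ - z.1 t₁) k * (z.1 t₀ - z.1 t₁) l else 0) ∂μ := by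
  have hprob : IsProbabilityMeasure μ := by
    rw [hμ]
    exact Measure.isProbabilityMeasure_map
      (h.measurable_X.prodMk (h.measurable_dvec β)).aemeasurable
  have hXμ : ∀ᵐ z ∂μ, ‖z.1‖ ≤ R := by
    rw [hμ, ae_map_iff (h.measurable_X.prodMk (h.measurable_dvec β)).aemeasurable
      (measurableSet_le measurable_fst.norm measurable_const)]
    exact hR
  have hint : ∀ G : (Fin T → Fin 2) → Cov T p → ℝ, (∀ d, Continuous (G d)) →
      Integrable (fun z => G z.2 z.1) μ := fun G hG => by
    obtain ⟨B, hB⟩ := exists_bound_on_ball hG R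
    exact Integrable.of_bound (measurable_uncurry_fin hG).aestronglyMeasurable B
      (hXμ.mono fun z hz => hB z.2 z.1 hz)
  have hcont : ∀ f : Cov T p → ℝ, Continuous f → ∀ d : Fin T → Fin 2,
      Continuous fun x => if ∑ t, (d t : ℕ) = 1 then f x else 0 := fun f hf d => by
    split_ifs
    exacts [hf, continuous_const]
  have hkl : ∀ k l, Continuous fun x : Cov T p => (x t₀ - x t₁) k * (x t₀ - x t₁) l :=
    fun k l => by
      simp only [Pi.sub_apply]; fun_prop
  refine exists_pos_quadForm _ fun e he => ?_
  set φ : Cov T p → ℝ := fun x => ((x t₀ - x t₁) ⬝ᵥ e) ^ 2 with hφ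
  have hφc : Continuous φ := by
    simp only [hφ, dotProduct, Pi.sub_apply]; fun_prop
  have hquad : ∑ k, ∑ l, e k * e l *
      ∫ z, (if ∑ t, (z.2 t : ℕ) = 1 then (z.1 t₀ - z.1 t₁) k * (z.1 t₀ - z.1 t₁) l else 0) ∂μ =
      ∫ z, (if ∑ t, (z.2 t : ℕ) = 1 then φ z.1 else 0) ∂μ := by
    have hi : ∀ k l, Integrable (fun z : Cov T p × (Fin T → Fin 2) => e k * e l *
        (if ∑ t, (z.2 t : ℕ) = 1 then (z.1 t₀ - z.1 t₁) k * (z.1 t₀ - z.1 t₁) l else 0)) μ :=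
      fun k l => (hint _ (hcont _ (hkl k l))).const_mul _
    simp only [← integral_const_mul]
    simp_rw [← integral_finsetSum _ fun l _ => hi _ l]
    rw [← integral_finsetSum _ fun k _ => integrable_finsetSum _ fun l _ => hi k l]
    congr 1; ext z
    split_ifs
    · simp only [hφ, dotProduct, sq, Finset.sum_mul_sum]
      exact Finset.sum_congr rfl fun k _ => Finset.sum_congr rfl fun l _ => by ring
    · simp
  rw [hquad, h.integral_law hμ (G := fun d x => if ∑ t, (d t : ℕ) = 1 then φ x else 0)
    (hcont φ hφc) hR]
  have hsum : ∀ ω, ∑ d, seqProb β d (X ω) (α ω) * (if ∑ t, (d t : ℕ) = 1 then φ (X ω) else 0) =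
      sumProb β 1 (X ω) (α ω) * φ (X ω) := fun ω => by
    simp only [sumProb, level, Finset.sum_filter, Finset.sum_mul, mul_ite, mul_zero, ite_mul,
      zero_mul]
  simp_rw [hsum]
  have hT : 1 ≤ T := Nat.one_le_iff_ne_zero.2 fun hT0 => by subst hT0; exact t₀.elim0
  have hnn : ∀ ω, 0 ≤ sumProb β 1 (X ω) (α ω) * φ (X ω) := fun ω =>
    mul_nonneg (sumProb_nonneg _ _ _ _) (sq_nonneg _)
  refine lt_of_le_of_ne (integral_nonneg hnn) fun h0 => ?_
  obtain ⟨B, hB⟩ := exists_bound_on_ball (G := fun _ => φ) (fun _ => hφc) R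
  have hi : Integrable (fun ω => sumProb β 1 (X ω) (α ω) * φ (X ω)) P := by
    have hm0 := (measurable_sumProb β 1).comp (h.measurable_X.prodMk h.measurable_α)
    have hm : Measurable fun ω => sumProb β 1 (X ω) (α ω) := hm0
    have hm2 : Measurable fun ω => φ (X ω) := hφc.measurable.comp h.measurable_X
    have hm3 : Measurable fun ω => sumProb β 1 (X ω) (α ω) * φ (X ω) := hm.mul hm2
    refine Integrable.of_bound hm3.aestronglyMeasurable ((level T 1).card * B) ?_
    filter_upwards [hR] with ω hω
    rw [Real.norm_eq_abs, abs_mul, abs_of_nonneg (sumProb_nonneg _ _ _ _)]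
    exact mul_le_mul (sumProb_le _ _ _ _) (hB 0 _ hω) (abs_nonneg _) (by positivity)
  -- The probability of S = 1 is positive for every value of (x, α). A zero integral would thus put
  -- X almost surely in the hyperplane (x_{t₀} - x_{t₁})'e = 0, which absolute continuity excludes.
  have hzero := (integral_eq_zero_iff_of_nonneg hnn hi).1 h0.symm
  have hall : ∀ᵐ ω ∂P, (X ω t₀ - X ω t₁) ⬝ᵥ e = 0 := by
    filter_upwards [hzero] with ω hω
    have h1 : sumProb β 1 (X ω) (α ω) * φ (X ω) = 0 := hω
    exact pow_eq_zero_iff two_ne_zero |>.1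
      ((mul_eq_zero.1 h1).resolve_left (sumProb_pos hT _ _ _).ne')
  have hnull : ∀ᵐ ω ∂P, (X ω t₀ - X ω t₁) ⬝ᵥ e ≠ 0 :=
    ae_of_ae_map h.measurable_X.aemeasurable (hac.ae_le (ae_dotProduct_ne_zero ht he))
  obtain ⟨ω, h1, h2⟩ := (hall.and hnull).exists
  exact h2 h1

/-- The conditional maximum likelihood estimates are consistent on the scale of the threshold. -/
theorem IsModel.exists_beta_bad (h : IsModel P X α ε)
    (hμ : μ = P.map fun ω => (X ω, dvec β (X ω) (α ω) (ε ω)))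
    {Z : ℕ → Ω → Cov T p × (Fin T → Fin 2)} (hZ : IsIID P Z μ) {R : ℝ}
    (hR : ∀ᵐ x ∂(P.map X), ‖x‖ ≤ R) (hac : P.map X ≪ volume) (hT : 2 ≤ T) {d ℓ : ℕ} {hn c : ℕ → ℝ}
    (H : IsTuning d ℓ hn c) {Θ : Set (Fin p → ℝ)} (hΘ : ∀ b ∈ Θ, ‖b‖ ≤ R) (hβ : β ∈ Θ) {δ : ℝ}
    (hδ : 0 < δ) : ∃ Bad : ℕ → ℕ → Set Ω, Negligible P Bad ∧
      ∀ᶠ n in atTop, ∀ᵐ ω ∂P, ω ∉ Bad n 0 → ∀ b,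
        IsCMLE Θ n (fun i => (Z i ω).1) (fun i t => ((Z i ω).2 t : ℕ)) b →
        ‖b - β‖ ≤ δ * c n := by
  have hRω : ∀ᵐ ω ∂P, ‖X ω‖ ≤ R := ae_of_ae_map h.measurable_X.aemeasurable hR
  set t₀ : Fin T := ⟨0, by omega⟩ with ht₀
  set t₁ : Fin T := ⟨1, by omega⟩ with ht₁
  have ht : t₀ ≠ t₁ := by simp [ht₀, ht₁]
  obtain ⟨κ, hκ, hquad⟩ := h.exists_information_pos hμ hRω hac ht
  obtain ⟨A, hA, hbound⟩ := exists_cmle_bound (p := p) ht R (half_pos hκ)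
  have hXμ : ∀ᵐ z ∂μ, ‖z.1‖ ≤ R := by
    rw [hμ, ae_map_iff (h.measurable_X.prodMk (h.measurable_dvec β)).aemeasurable
      (measurableSet_le measurable_fst.norm measurable_const)]
    exact hRω
  set δ' := δ / (A + 1) with hδ'
  have hδ'0 : 0 < δ' := by positivity
  -- Entrywise errors below this level leave half of the curvature of the information matrix, the
  -- constant passed to `exists_cmle_bound`. The score, in contrast, must be small on the scale of
  -- c_n.
  set η := κ / (2 * (p + 1)) with hη
  have hη0 : 0 < η := by positivity
  set G : Fin p → Fin p → (Fin T → Fin 2) → Cov T p → ℝ := fun k l d x =>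
    if ∑ t, (d t : ℕ) = 1 then (x t₀ - x t₁) k * (x t₀ - x t₁) l else 0 with hG
  have hGc : ∀ k l d, Continuous (G k l d) := fun k l d => by
    simp only [hG, Pi.sub_apply]
    split_ifs
    · fun_prop
    · exact continuous_const
  set B₁ : Fin p → ℕ → ℕ → Set Ω := fun k n _ => {ω | δ' * c n <
    |(n : ℝ)⁻¹ * ∑ i ∈ Finset.range n, score (Z i ω).2 (Z i ω).1 β k -
      ∫ z, score z.2 z.1 β k ∂μ|} with hB₁
  set B₂ : Fin p → Fin p → ℕ → ℕ → Set Ω := fun k l n _ => {ω | η <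
    |(n : ℝ)⁻¹ * ∑ i ∈ Finset.range n, G k l (Z i ω).2 (Z i ω).1 -
      ∫ z, G k l z.2 z.1 ∂μ|} with hB₂
  have h1 : ∀ k, Negligible P (B₁ k) := fun k e he => by
    obtain ⟨B, hB⟩ := exists_bound_on_ball (fun d => continuous_score (T := T) d β k) R
    filter_upwards [H.eventually_parametric_le (A := B ^ 2 / δ' ^ 2) (by positivity) he,
      eventually_gt_atTop 0] with n hn1 hn0 i
    have hc := H.cpos n
    refine (hZ.mean_dev (H := fun z => score z.2 z.1 β k)
      (measurable_uncurry_fin fun d => continuous_score d β k).aemeasurable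
      (hXμ.mono fun z hz => hB z.2 z.1 hz) hn0 (τ := δ' * c n) (by positivity)).trans
      (le_trans (le_of_eq ?_) hn1)
    field_simp
  have h2 : ∀ k l, Negligible P (B₂ k l) := fun k l e he => by
    obtain ⟨B, hB⟩ := exists_bound_on_ball (hGc k l) R
    filter_upwards [H.eventually_parametric_le (A := B ^ 2 / η ^ 2) (by positivity) he,
      H.eventually_c_le one_pos, eventually_gt_atTop 0] with n hn1 hc1 hn0 i
    have hc := H.cpos n
    have hn0' : (0 : ℝ) < n := by exact_mod_cast hn0
    refine (hZ.mean_dev (H := fun z => G k l z.2 z.1)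
      (measurable_uncurry_fin (hGc k l)).aemeasurable
      (hXμ.mono fun z hz => hB z.2 z.1 hz) hn0 hη0).trans (le_trans ?_ hn1)
    rw [div_div]
    refine div_le_div_of_nonneg_left (sq_nonneg B) (by positivity) ?_
    have : c n ^ 2 ≤ 1 := pow_le_one₀ hc.le hc1
    calc η ^ 2 * (n * c n ^ 2) = n * η ^ 2 * c n ^ 2 := by ring
      _ ≤ n * η ^ 2 * 1 := by gcongr
      _ = n * η ^ 2 := mul_one _
  refine ⟨fun n i => (⋃ k, B₁ k n i) ∪ ⋃ k, ⋃ l, B₂ k l n i,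
    (Negligible.iUnion h1).union (Negligible.iUnion fun k => Negligible.iUnion fun l => h2 k l),
    Eventually.of_forall fun n => ?_⟩
  have hae : ∀ᵐ ω ∂P, ∀ i, ‖(Z i ω).1‖ ≤ R := ae_all_iff.2 fun i => by
    rw [← hZ.map_eq i] at hXμ
    exact ae_of_ae_map (hZ.measurable i).aemeasurable hXμ
  filter_upwards [hae] with ω hω hbad b hb
  simp only [Set.mem_union, Set.mem_iUnion, not_or, not_exists, hB₁, hB₂, Set.mem_ofPred_eq,
    not_lt] at hbad
  have hc := H.cpos n
  have hfin := hbound Θ n (fun i => (Z i ω).1) (fun i => (Z i ω).2) β b hΘ hβ (fun i _ => hω i) hb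
    (fun e => ?_) (δ' * c n) fun k => ?_
  · refine hfin.trans ?_
    have e : δ = δ' * (A + 1) := by rw [hδ']; field_simp
    rw [e]
    have : 0 < δ' * c n := by positivity
    nlinarith
  · have h3 := quadForm_perturb hquad (fun k l => hbad.2 k l) e
    refine le_trans (mul_le_mul_of_nonneg_right ?_ (by positivity)) h3
    have : η * (p + 1) = κ / 2 := by rw [hη]; field_simp
    rw [Fintype.card_fin]
    linarith
  · have h4 := hbad.1 k
    rwa [h.integral_score hμ hRω, sub_zero] at h4

end

end FELogit
end

noncomputable section
namespace FELogit

/-! ### Averages of estimated terms -/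

section

variable {Ω : Type*} [MeasurableSpace Ω] {P : Measure Ω} [IsProbabilityMeasure P]

lemma measureReal_mono_of_ae {s t : Set Ω} (h : ∀ᵐ ω ∂P, ω ∈ s → ω ∈ t) :
    P.real s ≤ P.real t :=
  ENNReal.toReal_mono (measure_ne_top _ _) (measure_mono_ae h)

/-- Markov's inequality for the number of events that occur. -/
lemma measureReal_frequency_le {B : ℕ → Set Ω} {e s : ℝ} (he : ∀ i, P.real (B i) ≤ e) (hs : 0 < s)
    {n : ℕ} (hn : 0 < n) :
    P.real {ω | s < (n : ℝ)⁻¹ * ∑ i ∈ Finset.range n, (B i).indicator 1 ω} ≤ e / s := by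
  have hn' : (0 : ℝ) < n := by exact_mod_cast hn
  -- The events need not be measurable; their measurable hulls have the same probability.
  set B' : ℕ → Set Ω := fun i => toMeasurable P (B i) with hB'
  have hm : ∀ i, MeasurableSet (B' i) := fun i => measurableSet_toMeasurable P (B i)
  set f : Ω → ℝ := fun ω => (n : ℝ)⁻¹ * ∑ i ∈ Finset.range n, (B' i).indicator 1 ω with hf
  have hi : ∀ i, Integrable ((B' i).indicator (1 : Ω → ℝ)) P := fun i =>
    (integrable_const (1 : ℝ)).indicator (hm i)
  have hfi : Integrable f P := (integrable_finsetSum _ fun i _ => hi i).const_mul _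
  have hf0 : ∀ ω, 0 ≤ f ω := fun ω => mul_nonneg (inv_pos.2 hn').le
    (Finset.sum_nonneg fun i _ => Set.indicator_nonneg (fun _ _ => zero_le_one) _)
  have hsub : {ω | s < (n : ℝ)⁻¹ * ∑ i ∈ Finset.range n, (B i).indicator 1 ω} ⊆ {ω | s ≤ f ω} :=
    fun ω (hω : s < _) => by
      refine hω.le.trans (mul_le_mul_of_nonneg_left (Finset.sum_le_sum fun i _ => ?_)
        (inv_pos.2 hn').le)
      exact Set.indicator_le_indicator_of_subset (subset_toMeasurable P (B i))
        (fun _ => zero_le_one) ω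
  have hint : ∫ ω, f ω ∂P ≤ e := by
    simp only [hf]
    rw [integral_const_mul, integral_finsetSum _ fun i _ => hi i]
    have : ∀ i ∈ Finset.range n, ∫ ω, (B' i).indicator (1 : Ω → ℝ) ω ∂P ≤ e := fun i _ => by
      rw [integral_indicator_one (hm i), measureReal_def, measure_toMeasurable]
      exact he i
    calc _ ≤ (n : ℝ)⁻¹ * ∑ i ∈ Finset.range n, e :=
          mul_le_mul_of_nonneg_left (Finset.sum_le_sum this) (inv_pos.2 hn').le
      _ = e := by simp; field_simp
  rw [le_div_iff₀ hs, mul_comm]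
  exact (mul_le_mul_of_nonneg_left (measureReal_mono hsub) hs.le).trans
    ((mul_meas_ge_le_integral_of_nonneg (ae_of_all _ hf0) hfi s).trans hint)

/-- The difference of two averages whose terms are close except on a few indices. -/
lemma abs_average_sub_le {n : ℕ} (hn : 0 < n) {a l w b : ℕ → ℝ} {e C B A s : ℝ} (hC : 0 ≤ C)
    (hB : 0 ≤ B) (hA : 0 ≤ A) (he : 0 ≤ e)
    (hb : ∀ i, b i = 0 ∨ b i = 1) (hgood : ∀ i < n, b i = 0 → |a i - l i| ≤ e)
    (ha : ∀ i < n, |a i| ≤ C * (1 + w i)) (hl : ∀ i < n, |l i| ≤ B)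
    (hw : ∑ i ∈ Finset.range n, w i ^ 2 ≤ A * n) (hs : (n : ℝ)⁻¹ * ∑ i ∈ Finset.range n, b i ≤ s) :
    |(n : ℝ)⁻¹ * ∑ i ∈ Finset.range n, a i - (n : ℝ)⁻¹ * ∑ i ∈ Finset.range n, l i| ≤
      e + ((C + B) * s + C * √(A * s)) := by
  have hn' : (0 : ℝ) < n := by exact_mod_cast hn
  have hb0 : ∀ i, 0 ≤ b i := fun i => by rcases hb i with h | h <;> simp [h]
  have hbsq : ∀ i, b i ^ 2 = b i := fun i => by rcases hb i with h | h <;> simp [h]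
  have hterm : ∀ i ∈ Finset.range n, |a i - l i| ≤ e + ((C + B) * b i + C * (b i * w i)) :=
    fun i hi => by
      have hi' := Finset.mem_range.1 hi
      rcases hb i with h | h
      · simpa [h] using hgood i hi' h
      · rw [h]
        have := abs_sub (a i) (l i)
        linarith [ha i hi', hl i hi']
  have hsn : ∑ i ∈ Finset.range n, b i ≤ s * n := by
    rw [inv_mul_le_iff₀ hn'] at hs; linarith
  have hs0 : 0 ≤ s := by
    refine le_trans ?_ hs
    exact mul_nonneg (inv_pos.2 hn').le (Finset.sum_nonneg fun i _ => hb0 i)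
  -- Cauchy–Schwarz: few bad indices together with a bounded mean square of `w` make the bad
  -- contribution small, although no individual `w i` is bounded.
  have hcs : ∑ i ∈ Finset.range n, b i * w i ≤ n * √(A * s) := by
    have h1 : (∑ i ∈ Finset.range n, b i * w i) ^ 2 ≤ (n * √(A * s)) ^ 2 := by
      calc _ ≤ (∑ i ∈ Finset.range n, b i ^ 2) * ∑ i ∈ Finset.range n, w i ^ 2 :=
            Finset.sum_mul_sq_le_sq_mul_sq _ _ _
        _ ≤ (s * n) * (A * n) := by
            simp only [hbsq]
            exact mul_le_mul hsn hw (Finset.sum_nonneg fun i _ => sq_nonneg _) (by positivity)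
        _ = (n * √(A * s)) ^ 2 := by
            rw [mul_pow, Real.sq_sqrt (by positivity)]; ring
    exact (abs_le_of_sq_le_sq' h1 (by positivity)).2
  rw [← mul_sub, ← Finset.sum_sub_distrib, abs_mul, abs_of_pos (inv_pos.2 hn'), inv_mul_le_iff₀ hn']
  refine (Finset.abs_sum_le_sum_abs _ _).trans ((Finset.sum_le_sum hterm).trans ?_)
  rw [Finset.sum_add_distrib, Finset.sum_add_distrib, ← Finset.mul_sum, ← Finset.mul_sum]
  simp only [Finset.sum_const, Finset.card_range, nsmul_eq_mul]
  have h1 := mul_le_mul_of_nonneg_left hsn (add_nonneg hC hB)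
  have h2 := mul_le_mul_of_nonneg_left hcs hC
  linarith

/-- The average of the estimated terms converges to the mean of the true ones, if the estimated
terms are close to the true ones except on events of small probability. -/
theorem IsIID.tendsto_average {𝒵 : Type*} [MeasurableSpace 𝒵] {Z : ℕ → Ω → 𝒵} {μ : Measure 𝒵}
    (hZ : IsIID P Z μ) {L : 𝒵 → ℝ} (hL : AEMeasurable L μ) {B : ℝ} (hB : ∀ᵐ z ∂μ, |L z| ≤ B)
    {est w : ℕ → Ω → ℕ → ℝ} {C A : ℝ} (hC : 0 ≤ C) (hA : 0 ≤ A)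
    (hest : ∀ n, ∀ᵐ ω ∂P, ∀ i < n, |est n ω i| ≤ C * (1 + w n ω i))
    (hw : ∀ n ω, ∑ i ∈ Finset.range n, w n ω i ^ 2 ≤ A * n)
    (hclose : ∀ e > 0, ∃ (E : ℕ → Set Ω) (Bad : ℕ → ℕ → Set Ω), (∀ᶠ n in atTop, P.real (E n) ≤ e) ∧
      (∀ᶠ n in atTop, ∀ i, P.real (Bad n i) ≤ e) ∧
      ∀ᶠ n in atTop, ∀ᵐ ω ∂P, ω ∉ E n → ∀ i < n, ω ∉ Bad n i → |est n ω i - L (Z i ω)| ≤ e)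
    {e : ℝ} (he : 0 < e) : ∀ᶠ n : ℕ in atTop,
      P.real {ω | e < |(n : ℝ)⁻¹ * ∑ i ∈ Finset.range n, est n ω i - ∫ z, L z ∂μ|} ≤ e := by
  have := hZ.isProbabilityMeasure
  have hB0 : 0 ≤ B := by
    obtain ⟨z, hz⟩ := hB.exists
    exact (abs_nonneg _).trans hz
  -- `s` is the admissible fraction of bad indices.
  obtain ⟨s, hs0, hs⟩ : ∃ s > 0, (C + B) * s + C * √(A * s) ≤ e / 4 := by
    have hcont : Continuous fun s : ℝ => (C + B) * s + C * √(A * s) := by fun_prop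
    have h0 : Tendsto (fun s : ℝ => (C + B) * s + C * √(A * s)) (𝓝[>] 0) (𝓝 0) := by
      have := hcont.tendsto 0
      simp only [mul_zero, Real.sqrt_zero, add_zero] at this
      exact this.mono_left nhdsWithin_le_nhds
    obtain ⟨s, h1, h2⟩ := ((h0.eventually_lt_const (show (0 : ℝ) < e / 4 by positivity)).and
      (eventually_mem_nhdsWithin (a := (0 : ℝ)) (s := Set.Ioi 0))).exists
    exact ⟨s, h2, h1.le⟩
  -- The second term makes Markov's bound e₁ / s at most e / 4. Three exceptional events of
  -- probability at most e / 4 remain: `E n`, too many bad indices, and a deviation of the true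
  -- average.
  set e₁ := min (e / 4) (s * (e / 4)) with he₁
  have he₁0 : 0 < e₁ := by positivity
  obtain ⟨E, Bad, hE, hBad, hgood⟩ := hclose e₁ he₁0
  have hLLN : ∀ᶠ n : ℕ in atTop, B ^ 2 / (n * (e / 4) ^ 2) ≤ e / 4 := by
    have h1 : Tendsto (fun n : ℕ => B ^ 2 / (e / 4) ^ 2 / (n : ℝ)) atTop (𝓝 0) :=
      tendsto_const_div_atTop_nhds_zero_nat _
    filter_upwards [h1.eventually_lt_const (show (0 : ℝ) < e / 4 by positivity)] with n hn
    rw [mul_comm, ← div_div]; exact hn.le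
  have hBω : ∀ᵐ ω ∂P, ∀ i, |L (Z i ω)| ≤ B := ae_all_iff.2 fun i => by
    rw [← hZ.map_eq i] at hB
    exact ae_of_ae_map (hZ.measurable i).aemeasurable hB
  filter_upwards [hE, hBad, hgood, hLLN, eventually_gt_atTop 0] with n h1 h2 h3 h4 hn
  have hfreq := measureReal_frequency_le h2 hs0 hn
  have hmean := hZ.mean_dev hL hB hn (show 0 < e / 4 by positivity)
  have hsub : P.real {ω | e < |(n : ℝ)⁻¹ * ∑ i ∈ Finset.range n, est n ω i - ∫ z, L z ∂μ|} ≤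
      P.real (E n ∪ ({ω | s < (n : ℝ)⁻¹ * ∑ i ∈ Finset.range n, (Bad n i).indicator 1 ω} ∪
        {ω | e / 4 < |(n : ℝ)⁻¹ * ∑ i ∈ Finset.range n, L (Z i ω) - ∫ z, L z ∂μ|})) := by
    refine measureReal_mono_of_ae ?_
    filter_upwards [h3, hest n, hBω] with ω g1 g2 g3 hω
    by_contra hcon
    simp only [Set.mem_union, Set.mem_ofPred_eq, not_or, not_lt] at hcon hω
    obtain ⟨c1, c2, c3⟩ := hcon
    have hd := abs_average_sub_le hn (a := est n ω) (l := fun i => L (Z i ω)) (w := w n ω)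
      (b := fun i => (Bad n i).indicator 1 ω) hC hB0 hA he₁0.le
      (fun i => by by_cases hi : ω ∈ Bad n i <;> simp [hi])
      (fun i hi hb => g1 c1 i hi fun hmem => by simp [hmem] at hb) g2 (fun i _ => g3 i) (hw n ω) c2
    have htri := abs_sub_le ((n : ℝ)⁻¹ * ∑ i ∈ Finset.range n, est n ω i)
      ((n : ℝ)⁻¹ * ∑ i ∈ Finset.range n, L (Z i ω)) (∫ z, L z ∂μ)
    have : e₁ ≤ e / 4 := min_le_left _ _
    linarith
  have hu1 := measureReal_union_le (μ := P) (E n)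
    ({ω | s < (n : ℝ)⁻¹ * ∑ i ∈ Finset.range n, (Bad n i).indicator 1 ω} ∪
        {ω | e / 4 < |(n : ℝ)⁻¹ * ∑ i ∈ Finset.range n, L (Z i ω) - ∫ z, L z ∂μ|})
  have hu2 := measureReal_union_le (μ := P)
    {ω | s < (n : ℝ)⁻¹ * ∑ i ∈ Finset.range n, (Bad n i).indicator 1 ω}
    {ω | e / 4 < |(n : ℝ)⁻¹ * ∑ i ∈ Finset.range n, L (Z i ω) - ∫ z, L z ∂μ|}
  have h5 : e₁ / s ≤ e / 4 := by
    rw [div_le_iff₀ hs0, mul_comm]; exact min_le_right _ _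
  have h6 : e₁ ≤ e / 4 := min_le_left _ _
  linarith

end

end FELogit
end

noncomputable section
namespace FELogit

/-! ### The terms of the bounds at the true parameters -/

lemma measurable_r {T p : ℕ} [NeZero T] (k : Fin p) (β : Fin p → ℝ) :
    Measurable fun z : Cov T p × ℕ => r k z.1 z.2 β := by
  refine measurable_from_prod_countable_left fun s => ?_
  have hpair : Continuous fun x : Cov T p => (x, β) := continuous_id.prodMk continuous_const
  have hlam : ∀ t, Measurable fun x : Cov T p => lam t x β := fun t =>
    ((contDiff_lam t).continuous.comp hpair).measurable
  have hC : Measurable fun x : Cov T p => C s x β :=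
    ((contDiff_C s).continuous.comp hpair).measurable
  simp only [r_eq, wgt]
  refine (Finset.measurable_sum _ fun t _ => ?_).const_mul _
  exact ((hlam t).mul (((measurable_dotProduct_cov _ β).const_mul _).exp.div hC)).const_mul _

lemma measurable_slope {T p : ℕ} [NeZero T] (k : Fin p) (β : Fin p → ℝ) :
    Measurable fun x : Cov T p => slope k x β :=
  ((contDiff_slope k).continuous.comp (continuous_id.prodMk continuous_const)).measurable

lemma ae_snd_le_of_map {T p : ℕ} {Ω : Type*} [MeasurableSpace Ω] {P : Measure Ω} {X : Ω → Cov T p}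
    {S : Ω → ℕ} (hX : Measurable X) (hS : Measurable S) (h : ∀ ω, S ω ≤ T) :
    ∀ᵐ z ∂(P.map fun ω => (X ω, S ω)), z.2 ≤ T := by
  rw [ae_map_iff (hX.prodMk hS).aemeasurable (measurableSet_le measurable_snd measurable_const)]
  exact ae_of_all _ h

/-- Most of the moment vectors have Hankel determinants that are zero or bounded away from zero. -/
lemma exists_strat_measure_le {T p : ℕ} {ν : Measure (Cov T p)} [IsProbabilityMeasure ν]
    {m : Cov T p → ℕ → ℝ} (hm : Measurable m) (hmom : ∀ᵐ x ∂ν, IsMom T (m x)) {e : ℝ} (he : 0 < e) :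
    ∃ η > 0, ν.real {x | m x ∉ Strat T η} ≤ e := by
  set N : ℕ → Set (Cov T p) := fun k => {x | m x ∉ Strat T (1 / ((k : ℝ) + 1))} with hN
  have hNm : ∀ k, MeasurableSet (N k) := fun k => (hm (measurableSet_strat T _)).compl
  -- Almost every vector belongs to all strata with small enough η, so the indicators of the
  -- complements tend to 0 almost surely, hence in measure.
  have hconv : ∀ᵐ x ∂ν, Tendsto (fun k => (N k).indicator (1 : Cov T p → ℝ) x) atTop (𝓝 0) := by
    filter_upwards [hmom] with x hx
    obtain ⟨η, hη, h⟩ := hx.exists_strat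
    refine tendsto_const_nhds.congr' ?_
    filter_upwards [(tendsto_one_div_add_atTop_nhds_zero_nat (𝕜 := ℝ)).eventually_lt_const hη]
      with k hk
    have hx' : x ∉ N k := fun (hmem : m x ∉ Strat T (1 / ((k : ℝ) + 1))) => hmem (h _ hk.le)
    rw [Set.indicator_of_notMem hx']
  have hmeas := tendstoInMeasure_of_tendsto_ae
    (fun k => (measurable_one.indicator (hNm k)).aestronglyMeasurable) hconv
  rw [tendstoInMeasure_iff_measureReal_norm] at hmeas
  obtain ⟨k, hk⟩ := ((hmeas 1 one_pos).eventually_lt_const he).exists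
  refine ⟨1 / ((k : ℝ) + 1), by positivity, (measureReal_mono fun x hx => ?_).trans hk.le⟩
  change 1 ≤ ‖(N k).indicator (1 : Cov T p → ℝ) x - 0‖
  rw [Set.indicator_of_mem (show x ∈ N k from hx)]
  simp

section

variable {T p : ℕ} [NeZero T] {Q : Measure (Cov T p × ℕ)} [IsProbabilityMeasure Q]

lemma aemeasurable_boundTerm (k : Fin p) (β : Fin p → ℝ)
    (hmom : ∀ᵐ x ∂Q.fst, IsMom T (mTilde (gamma0 Q) β x)) {q₁ q₂ : (ℕ → ℝ) → ℝ}
    (h₁ : Measurable ({m | IsMom T m}.indicator q₁))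
    (h₂ : Measurable ({m | IsMom T m}.indicator q₂)) :
    AEMeasurable (fun z : Cov T p × ℕ => boundTerm (r k z.1 z.2 β) (cPlug (gamma0 Q) β 0 z.1)
      (slope k z.1 β) (q₁ (mTilde (gamma0 Q) β z.1)) (q₂ (mTilde (gamma0 Q) β z.1))) Q := by
  have hm := measurable_mTilde (measurable_gamma0 Q) β
  have hq : ∀ {q : (ℕ → ℝ) → ℝ}, Measurable ({m | IsMom T m}.indicator q) →
      AEMeasurable (fun z : Cov T p × ℕ => q (mTilde (gamma0 Q) β z.1)) Q := fun {q} h => by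
    refine ⟨fun z => {m | IsMom T m}.indicator q (mTilde (gamma0 Q) β z.1),
      (h.comp hm).comp measurable_fst, ?_⟩
    filter_upwards [ae_of_ae_map measurable_fst.aemeasurable hmom] with z hz
    rw [Set.indicator_of_mem (show mTilde (gamma0 Q) β z.1 ∈ {m | IsMom T m} from hz)]
  have hs : Measurable fun z : Cov T p × ℕ => slope k z.1 β :=
    (measurable_slope k β).comp measurable_fst
  unfold boundTerm
  exact (measurable_r k β).aemeasurable.add
    (((measurable_cPlug (measurable_gamma0 Q) β 0).comp measurable_fst).aemeasurable.mul
      (((hs.max measurable_const).aemeasurable.mul (hq h₁)).sub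
        ((hs.neg.max measurable_const).aemeasurable.mul (hq h₂))))

/-- The terms of the bounds are integrable, and can be written with the plug-in formulas. -/
theorem terms_facts (k : Fin p) (β : Fin p → ℝ) (hS : ∀ᵐ z ∂Q, z.2 ≤ T) {R : ℝ}
    (hR : ∀ᵐ x ∂Q.fst, ‖x‖ ≤ R) (hβ : ‖β‖ ≤ R)
    (hmom : ∀ᵐ x ∂Q.fst, IsMom T (mTilde (gamma0 Q) β x)) :
    (AEMeasurable (fun z => lowerTerm k z.1 z.2 β (cPlug (gamma0 Q) β 0 z.1)
      (mTilde (gamma0 Q) β z.1)) Q ∧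
    AEMeasurable (fun z => upperTerm k z.1 z.2 β (cPlug (gamma0 Q) β 0 z.1)
      (mTilde (gamma0 Q) β z.1)) Q) ∧
    (∃ B, ∀ᵐ z ∂Q,
      |lowerTerm k z.1 z.2 β (cPlug (gamma0 Q) β 0 z.1) (mTilde (gamma0 Q) β z.1)| ≤ B ∧
      |upperTerm k z.1 z.2 β (cPlug (gamma0 Q) β 0 z.1) (mTilde (gamma0 Q) β z.1)| ≤ B) ∧
    ∀ᵐ z ∂Q, cFun Q β 0 z.1 = cPlug (gamma0 Q) β 0 z.1 ∧ mFun Q β z.1 = mTilde (gamma0 Q) β z.1 := by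
  have hker : ∀ᵐ z ∂Q, ∀ᵐ s ∂(Q.condKernel z.1), s ≤ T :=
    ae_of_ae_map measurable_fst.aemeasurable (ae_condKernel_le hS)
  refine ⟨⟨?_, ?_⟩, ?_, ?_⟩
  · simp only [lowerTerm_eq]
    exact aemeasurable_boundTerm k β hmom (measurable_qLower T) (measurable_qUpper T)
  · simp only [upperTerm_eq]
    exact aemeasurable_boundTerm k β hmom (measurable_qUpper T) (measurable_qLower T)
  · obtain ⟨L, hL, hLb⟩ := exists_abs_term_le (T := T) k R
    refine ⟨L * (1 + 1), ?_⟩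
    filter_upwards [hS, ae_of_ae_map measurable_fst.aemeasurable hR, hker] with z h1 h2 h3
    have := hLb z.1 β h2 hβ (gamma0 Q) _ (mTilde_zero (gamma0 Q) β z.1) z.2 h1
    rwa [Finset.sum_congr rfl fun j _ => abs_of_nonneg (gamma0_nonneg Q j z.1),
      sum_gamma0 h3] at this
  · filter_upwards [hker] with z hz
    exact ⟨cFun_eq_cPlug hz β 0, mFun_eq_mTilde hz β⟩

end

end FELogit
end

/-! ### Assembling the sample, and consistency of the estimated bounds -/

noncomputable section
namespace FELogit

section

variable {Ω : Type*} [MeasurableSpace Ω] {P : Measure Ω} {T p : ℕ}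

lemma IsIIDSample.isIID {X : ℕ → Ω → Cov T p} {α : ℕ → Ω → ℝ} {ε : ℕ → Ω → Fin T → ℝ}
    (h : IsIIDSample P X α ε) (hm : ∀ i, IsModel P (X i) (α i) (ε i)) (β : Fin p → ℝ) :
    IsIID P (fun i ω => (X i ω, dvec β (X i ω) (α i ω) (ε i ω)))
      (P.map fun ω => (X 0 ω, dvec β (X 0 ω) (α 0 ω) (ε 0 ω))) := by
  set f : Cov T p × ℝ × (Fin T → ℝ) → Cov T p × (Fin T → Fin 2) :=
    fun z => (z.1, dvec β z.1 z.2.1 z.2.2) with hf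
  have hfm : Measurable f := by
    refine measurable_fst.prodMk ?_
    have h1 : Measurable fun z : Cov T p × ℝ × (Fin T → ℝ) => (z.2.2, (z.2.1, z.1)) :=
      (measurable_snd.comp measurable_snd).prodMk
        ((measurable_fst.comp measurable_snd).prodMk measurable_fst)
    have h2 := (measurable_dvec β).comp h1
    exact h2
  exact ⟨fun i => (hm i).measurable_X.prodMk ((hm i).measurable_dvec β),
    h.iIndep.comp (fun _ => f) fun _ => hfm, fun i => ((h.identDistrib i).comp hfm).map_eq⟩

/-- A sum of absolute values of local polynomial estimates has a bounded mean square. -/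
lemma exists_sum_sq_sum_abs_le {K : Cov T p → ℝ} (hK : IsKernel K) (ℓ : ℕ) :
    ∃ A : ℝ, 0 ≤ A ∧ ∀ (n : ℕ) (x : ℕ → Cov T p) (s : ℕ → ℕ) (h : ℝ), 0 < h →
      ∀ γ : ℕ → Cov T p → ℝ, (∀ j ≤ T, ∀ x₀, IsLocalPolyEstimate K h ℓ n x s j x₀ (γ j x₀)) →
      ∑ i ∈ Finset.range n, (∑ j ∈ Finset.range (T + 1), |γ j (x i)|) ^ 2 ≤ A * n := by
  obtain ⟨A, hA, h⟩ := exists_sum_sq_localPoly_le hK ℓ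
  refine ⟨(T + 1) * ((T + 1) * A), by positivity, fun n x s b hb γ hγ => ?_⟩
  calc _ ≤ ∑ i ∈ Finset.range n, ((T + 1) * ∑ j ∈ Finset.range (T + 1), γ j (x i) ^ 2) :=
        Finset.sum_le_sum fun i _ => by
          have := sq_sum_le_card_mul_sum_sq (s := Finset.range (T + 1)) (f := fun j => |γ j (x i)|)
          simpa using this
    _ = (T + 1) * ∑ j ∈ Finset.range (T + 1), ∑ i ∈ Finset.range n, γ j (x i) ^ 2 := by
        rw [← Finset.mul_sum, Finset.sum_comm]
    _ ≤ (T + 1) * ∑ j ∈ Finset.range (T + 1), A * n := by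
        refine mul_le_mul_of_nonneg_left (Finset.sum_le_sum fun j hj => ?_) (by positivity)
        exact h n x s j b hb (fun i => γ j (x i)) fun i _ =>
          hγ j (Finset.mem_range_succ_iff.1 hj) (x i)
    _ = _ := by simp; ring

lemma tendstoInMeasure_prod_of_eventually [IsProbabilityMeasure P] {f g : ℕ → Ω → ℝ} {a b : ℝ}
    (hf : ∀ e > 0, ∀ᶠ n in atTop, P.real {ω | e < |f n ω - a|} ≤ e)
    (hg : ∀ e > 0, ∀ᶠ n in atTop, P.real {ω | e < |g n ω - b|} ≤ e) :
    TendstoInMeasure P (fun n ω => (f n ω, g n ω)) atTop fun _ => (a, b) := by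
  rw [tendstoInMeasure_iff_measureReal_dist]
  intro t ht
  refine tendsto_order.2 ⟨fun s hs => Eventually.of_forall fun n =>
    hs.trans_le measureReal_nonneg, fun s hs => ?_⟩
  set e := min (t / 2) (s / 3) with he
  have he0 : 0 < e := by positivity
  filter_upwards [hf e he0, hg e he0] with n h1 h2
  have h3 : e ≤ s / 3 := min_le_right _ _
  have h4 : e ≤ t / 2 := min_le_left _ _
  have hsub : {ω | t ≤ dist (f n ω, g n ω) (a, b)} ⊆
      {ω | e < |f n ω - a|} ∪ {ω | e < |g n ω - b|} := fun ω (hω : t ≤ dist _ _) => by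
    rw [Prod.dist_eq, Real.dist_eq, Real.dist_eq] at hω
    rcases le_max_iff.1 hω with h | h
    · exact Or.inl (show e < |f n ω - a| by linarith)
    · exact Or.inr (show e < |g n ω - b| by linarith)
  have := measureReal_union_le (μ := P) {ω | e < |f n ω - a|} {ω | e < |g n ω - b|}
  linarith [measureReal_mono (μ := P) hsub]

end

end FELogit
end

theorem mainTheorem7
    {Ω : Type*} [MeasurableSpace Ω] (P : Measure Ω) [IsProbabilityMeasure P]
    (T p : ℕ) [NeZero T] (hT : 2 ≤ T) (k : Fin p)
    (β₀ : Fin p → ℝ) (Θ : Set (Fin p → ℝ))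
    (X : ℕ → Ω → Cov T p) (α : ℕ → Ω → ℝ) (ε : ℕ → Ω → Fin T → ℝ)
    (Y : ℕ → Ω → Fin T → ℕ) (S : ℕ → Ω → ℕ)
    -- the model
    (hmodel : ∀ i, IsModel P (X i) (α i) (ε i))
    (hY : ∀ i ω t, Y i ω t = outcome β₀ (X i ω) (α i ω) (ε i ω) t)
    (hS : ∀ i ω, S i ω = ∑ t, Y i ω t)
    -- i.i.d. sampling, compactness
    (hiid : IsIIDSample P X α ε)
    (hsupp : IsCompact (P.map (X 0)).support)
    (hΘ : IsCompact Θ) (hβ₀ : β₀ ∈ Θ)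
    -- smoothness
    (hdens : HasRegularDensity (P.map (X 0)))
    (ℓ : ℕ) (hγ₀ : HasSmoothGamma (P.map fun ω => (X 0 ω, S 0 ω)) (ℓ + 2))
    -- kernel, bandwidth, threshold
    (K : Cov T p → ℝ) (hK : IsKernel K)
    (h : ℕ → ℝ) (hpos : ∀ n, 0 < h n) (hlim : Tendsto h atTop (𝓝 0))
    (hbw : Tendsto (fun n : ℕ => n * h n ^ (p * T) / Real.log n) atTop atTop)
    (c : ℕ → ℝ) (cpos : ∀ n, 0 < c n) (clim : Tendsto c atTop (𝓝 0))
    (hc : Tendsto (fun n : ℕ => rate T p ℓ n (h n) / c n) atTop (𝓝 0))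
    -- the first-step estimators: conditional maximum likelihood and local polynomials
    (βhat : ℕ → Ω → Fin p → ℝ)
    (hβhat : ∀ n ω, IsCMLE Θ n (fun i => X i ω) (fun i => Y i ω) (βhat n ω))
    (γhat : ℕ → Ω → ℕ → Cov T p → ℝ)
    (hγhat : ∀ n ω, ∀ j ≤ T, ∀ x,
      IsLocalPolyEstimate K (h n) ℓ n (fun i => X i ω) (fun i => S i ω) j x (γhat n ω j x)) :
    Integrable (fun z => lowerTerm k z.1 z.2 β₀
        (cFun (P.map fun ω => (X 0 ω, S 0 ω)) β₀ 0 z.1)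
        (mFun (P.map fun ω => (X 0 ω, S 0 ω)) β₀ z.1)) (P.map fun ω => (X 0 ω, S 0 ω)) ∧
    Integrable (fun z => upperTerm k z.1 z.2 β₀
        (cFun (P.map fun ω => (X 0 ω, S 0 ω)) β₀ 0 z.1)
        (mFun (P.map fun ω => (X 0 ω, S 0 ω)) β₀ z.1)) (P.map fun ω => (X 0 ω, S 0 ω)) ∧
    TendstoInMeasure P
      (fun (n : ℕ) (ω : Ω) =>
        (lowerEst k n (fun i => X i ω) (fun i => S i ω) (c n) (γhat n ω) (βhat n ω),
          upperEst k n (fun i => X i ω) (fun i => S i ω) (c n) (γhat n ω) (βhat n ω)))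
      atTop
      (fun _ =>
        (lowerBound k (P.map fun ω => (X 0 ω, S 0 ω)) β₀,
          upperBound k (P.map fun ω => (X 0 ω, S 0 ω)) β₀)) := by
  classical
  -- the sample of covariates and outcomes
  set D : ℕ → Ω → Fin T → Fin 2 := fun i ω => dvec β₀ (X i ω) (α i ω) (ε i ω) with hD
  set Z : ℕ → Ω → Cov T p × (Fin T → Fin 2) := fun i ω => (X i ω, D i ω) with hZdef
  set μ : Measure (Cov T p × (Fin T → Fin 2)) :=
    P.map fun ω => (X 0 ω, dvec β₀ (X 0 ω) (α 0 ω) (ε 0 ω)) with hμ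
  have hZ : IsIID P Z μ := hiid.isIID hmodel β₀
  have hμprob : IsProbabilityMeasure μ := hZ.isProbabilityMeasure
  set σ : (Fin T → Fin 2) → ℕ := fun d => ∑ t, (d t : ℕ) with hσ
  have hσm : Measurable σ := measurable_of_countable _
  have hYD : ∀ i ω t, Y i ω t = (D i ω t : ℕ) := fun i ω t => by
    rw [hY, outcome_eq_dvec]
  have hSD : ∀ i ω, S i ω = σ (D i ω) := fun i ω => by
    rw [hS]; exact Finset.sum_congr rfl fun t _ => hYD i ω t
  have hST : ∀ i ω, S i ω ≤ T := fun i ω => by rw [hSD]; exact sum_le_of_fin2 _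
  have hSm : Measurable (S 0) := by
    have : S 0 = fun ω => σ (D 0 ω) := funext fun ω => hSD 0 ω
    rw [this]
    exact hσm.comp ((hmodel 0).measurable_dvec β₀)
  have hX := (hmodel 0).measurable_X
  set Q := P.map fun ω => (X 0 ω, S 0 ω) with hQ
  have hQprob : IsProbabilityMeasure Q :=
    Measure.isProbabilityMeasure_map (hX.prodMk hSm).aemeasurable
  have hνprob : IsProbabilityMeasure (P.map (X 0)) := Measure.isProbabilityMeasure_map hX.aemeasurable
  have hpm : Measurable fun z : Cov T p × (Fin T → Fin 2) => (z.1, σ z.2) :=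
    measurable_fst.prodMk (hσm.comp measurable_snd)
  have hQμ : Q = μ.map fun z => (z.1, σ z.2) := by
    rw [hμ, Measure.map_map hpm (hX.prodMk ((hmodel 0).measurable_dvec β₀)), hQ]
    congr 1
    funext ω
    exact Prod.ext rfl (hSD 0 ω)
  have hμfst : μ.fst = P.map (X 0) := Measure.fst_map_prodMk ((hmodel 0).measurable_dvec β₀)
  have hQfst : Q.fst = P.map (X 0) := Measure.fst_map_prodMk hSm
  -- bounds
  obtain ⟨R₁, hR₁⟩ := hsupp.isBounded.exists_norm_le
  obtain ⟨R₂, hR₂⟩ := hΘ.isBounded.exists_norm_le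
  set R := max R₁ R₂ with hR
  have hΘR : ∀ b ∈ Θ, ‖b‖ ≤ R := fun b hb => (hR₂ b hb).trans (le_max_right _ _)
  have hνR : ∀ᵐ x ∂(P.map (X 0)), ‖x‖ ≤ R := by
    filter_upwards [Measure.support_mem_ae (μ := P.map (X 0))] with x hx
    exact (hR₁ x hx).trans (le_max_left _ _)
  obtain ⟨F, b, M, hF⟩ := hdens.exists_isBoundedDensity hsupp
  have hFμ : IsBoundedDensity μ.fst F b M := by rw [hμfst]; exact hF
  have H : IsTuning (p * T) ℓ h c := isTuning_of_rate hpos hlim cpos clim hc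
  -- the conditional probabilities
  have hQle : ∀ᵐ z ∂Q, z.2 ≤ T := ae_snd_le_of_map hX hSm (hST 0)
  have hker := ae_condKernel_le hQle
  -- The conditional law of `S` given `X` is a mixture over the conditional law of the effect, which
  -- is what places the true vector in the moment space.
  have hmom : ∀ᵐ x ∂Q.fst, IsMom T (mTilde (gamma0 Q) β₀ x) := by
    have h1 : ∀ᵐ x ∂Q.fst, ∀ s, gamma0 Q s x =
        ∫ a, sumProb β₀ s x a ∂((P.map fun ω => (X 0 ω, α 0 ω)).condKernel x) := by
      rw [hQfst]
      exact ae_all_iff.2 fun s => (hmodel 0).gamma0_ae_eq hSm (fun ω => hSD 0 ω) s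
    filter_upwards [h1, hker] with x hx hx'
    exact isMom_of_mixture (fun j _ => hx j) (cPlug_gamma0_pos hx' β₀)
  obtain ⟨⟨hlm, hum⟩, ⟨B, hB⟩, hterm⟩ :=
    terms_facts k β₀ hQle (hQfst ▸ hνR) (hΘR β₀ hβ₀) hmom
  set Lo : Cov T p × ℕ → ℝ := fun z =>
    lowerTerm k z.1 z.2 β₀ (cPlug (gamma0 Q) β₀ 0 z.1) (mTilde (gamma0 Q) β₀ z.1) with hLo
  set Up : Cov T p × ℕ → ℝ := fun z =>
    upperTerm k z.1 z.2 β₀ (cPlug (gamma0 Q) β₀ 0 z.1) (mTilde (gamma0 Q) β₀ z.1) with hUp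
  have hLoi : Integrable Lo Q :=
    Integrable.of_bound hlm.aestronglyMeasurable B (hB.mono fun z hz => hz.1)
  have hUpi : Integrable Up Q :=
    Integrable.of_bound hum.aestronglyMeasurable B (hB.mono fun z hz => hz.2)
  have hLoe : (fun z : Cov T p × ℕ =>
      lowerTerm k z.1 z.2 β₀ (cFun Q β₀ 0 z.1) (mFun Q β₀ z.1)) =ᵐ[Q] Lo := by
    filter_upwards [hterm] with z hz
    rw [hz.1, hz.2]
  have hUpe : (fun z : Cov T p × ℕ =>
      upperTerm k z.1 z.2 β₀ (cFun Q β₀ 0 z.1) (mFun Q β₀ z.1)) =ᵐ[Q] Up := by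
    filter_upwards [hterm] with z hz
    rw [hz.1, hz.2]
  refine ⟨hLoi.congr hLoe.symm, hUpi.congr hUpe.symm, ?_⟩
  have hlowE : lowerBound k Q β₀ = ∫ z, Lo (z.1, σ z.2) ∂μ := by
    rw [lowerBound, integral_congr_ae hLoe]
    have : ∫ z, Lo z ∂Q = ∫ z, Lo z ∂(μ.map fun z => (z.1, σ z.2)) := by rw [← hQμ]
    rw [this, integral_map hpm.aemeasurable (by rw [← hQμ]; exact hlm.aestronglyMeasurable)]
  have hupE : upperBound k Q β₀ = ∫ z, Up (z.1, σ z.2) ∂μ := by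
    rw [upperBound, integral_congr_ae hUpe]
    have : ∫ z, Up z ∂Q = ∫ z, Up z ∂(μ.map fun z => (z.1, σ z.2)) := by rw [← hQμ]
    rw [this, integral_map hpm.aemeasurable (by rw [← hQμ]; exact hum.aestronglyMeasurable)]
  have hLoμ : AEMeasurable (fun z : Cov T p × (Fin T → Fin 2) => Lo (z.1, σ z.2)) μ :=
    (hQμ ▸ hlm : AEMeasurable Lo (μ.map fun z => (z.1, σ z.2))).comp_measurable hpm
  have hUpμ : AEMeasurable (fun z : Cov T p × (Fin T → Fin 2) => Up (z.1, σ z.2)) μ :=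
    (hQμ ▸ hum : AEMeasurable Up (μ.map fun z => (z.1, σ z.2))).comp_measurable hpm
  have hBμ : ∀ᵐ z ∂μ, |Lo (z.1, σ z.2)| ≤ B ∧ |Up (z.1, σ z.2)| ≤ B := by
    have h1 : ∀ᵐ z ∂(μ.map fun z => (z.1, σ z.2)), |Lo z| ≤ B ∧ |Up z| ≤ B := by
      rw [← hQμ]; exact hB
    exact ae_of_ae_map hpm.aemeasurable h1
  -- almost sure properties of the sample
  have hsample : ∀ {p' : Cov T p → Prop}, (∀ᵐ x ∂(P.map (X 0)), p' x) →
      ∀ᵐ ω ∂P, ∀ i, p' (X i ω) := fun {p'} hp => ae_all_iff.2 fun i => by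
    rw [← hμfst, Measure.fst] at hp
    have h1 := ae_of_ae_map measurable_fst.aemeasurable hp
    rw [← hZ.map_eq i] at h1
    exact ae_of_ae_map (hZ.measurable i).aemeasurable h1
  have hXR := hsample hνR
  have hXker := hsample (hQfst ▸ hker)
  have hcmle : ∀ n ω, IsCMLE Θ n (fun i => (Z i ω).1) (fun i t => ((Z i ω).2 t : ℕ))
      (βhat n ω) := fun n ω => by
    have h1 : (fun i => Y i ω) = fun i t => ((Z i ω).2 t : ℕ) :=
      funext fun i => funext fun t => hYD i ω t
    rw [← h1]
    exact hβhat n ω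
  have hloc : ∀ n ω, ∀ j ≤ T, ∀ x, IsLocalPolyEstimate K (h n) ℓ n (fun i => (Z i ω).1)
      (fun i => σ (Z i ω).2) j x (γhat n ω j x) := fun n ω j hj x => by
    have h1 := hγhat n ω j hj x
    simp only [hSD] at h1
    exact h1
  -- the estimated terms are close to the true ones, up to small probability
  have hclose : ∀ e > 0, ∃ (E : ℕ → Set Ω) (Bad : ℕ → ℕ → Set Ω),
      (∀ᶠ n in atTop, P.real (E n) ≤ e) ∧ (∀ᶠ n in atTop, ∀ i, P.real (Bad n i) ≤ e) ∧
      ∀ᶠ n in atTop, ∀ᵐ ω ∂P, ω ∉ E n → ∀ i < n, ω ∉ Bad n i →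
        |lowerTerm k (X i ω) (S i ω) (βhat n ω) (cPlug (γhat n ω) (βhat n ω) 0 (X i ω))
          (mHat (c n) (γhat n ω) (βhat n ω) (X i ω)) - Lo (X i ω, S i ω)| ≤ e ∧
        |upperTerm k (X i ω) (S i ω) (βhat n ω) (cPlug (γhat n ω) (βhat n ω) 0 (X i ω))
          (mHat (c n) (γhat n ω) (βhat n ω) (X i ω)) - Up (X i ω, S i ω)| ≤ e := by
    intro e he
    -- The stratum is fixed before the sample size grows: half of the allowed probability pays for
    -- covariates outside `Strat T η`, the other half for failures of the local polynomial
    -- estimates.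
    obtain ⟨η, hη, hηe⟩ := exists_strat_measure_le
      (measurable_mTilde (measurable_gamma0 Q) β₀) hmom (half_pos he)
    obtain ⟨δ, hδ, hδc⟩ := exists_term_close (T := T) k R hη he
    obtain ⟨E, hE, hEβ⟩ := (hmodel 0).exists_beta_bad hμ hZ hνR hF.absolutelyContinuous hT H hΘR
      hβ₀ hδ
    have hγ : ∀ j : Fin (T + 1), ∃ Bad : ℕ → ℕ → Set Ω, Negligible P Bad ∧
        ∀ᶠ n in atTop, ∀ᵐ ω ∂P, ∀ i, ω ∉ Bad n i → ∀ ĝ,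
          IsLocalPolyEstimate K (h n) ℓ n (fun i => (Z i ω).1) (fun i => σ (Z i ω).2) j
            (Z i ω).1 ĝ → |ĝ - gamma0 Q j (Z i ω).1| ≤ δ * c n := fun j => by
      obtain ⟨g, hg, hgγ⟩ := hγ₀ j (Nat.lt_succ_iff.1 j.2)
      exact hZ.exists_gamma_bad hFμ H hK hσm hQμ (hμfst ▸ hνR)
        (hg.of_le (by exact_mod_cast Nat.le_succ (ℓ + 1))) (by rw [hμfst, ← hQfst]; exact hgγ) hδ
    choose Bγ hBγ hBγc using hγ
    set N : Set (Cov T p) := {x | mTilde (gamma0 Q) β₀ x ∉ Strat T η} with hN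
    have hNm : MeasurableSet N :=
      (measurable_mTilde (measurable_gamma0 Q) β₀ (measurableSet_strat T η)).compl
    have hNP : ∀ i, P.real {ω | X i ω ∈ N} ≤ e / 2 := fun i => by
      refine le_trans (le_of_eq ?_) hηe
      rw [hQfst, ← hμfst, Measure.fst, map_measureReal_apply measurable_fst hNm, ← hZ.map_eq i,
        map_measureReal_apply (hZ.measurable i) (measurable_fst hNm)]
      rfl
    -- The event on which β̂ fails is common to all indices. The failures of γ̂ and of the stratum
    -- condition depend on the index, and only their frequency is controlled.
    refine ⟨fun n => E n 0, fun n i => {ω | X i ω ∈ N} ∪ ⋃ j, Bγ j n i,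
      (hE e he).mono fun n hn => hn 0, ?_, ?_⟩
    · filter_upwards [Negligible.iUnion hBγ (e / 2) (half_pos he)] with n hn i
      linarith [measureReal_union_le (μ := P) {ω | X i ω ∈ N} (⋃ j, Bγ j n i), hn i, hNP i]
    · filter_upwards [hEβ, eventually_all.2 hBγc, clim.eventually_lt_const hδ] with n h1 h2 h3
      filter_upwards [h1, ae_all_iff.2 h2, hXR, hXker] with ω g1 g2 g3 g4 hωE i _ hωB
      simp only [Set.mem_union, Set.mem_iUnion, not_or, not_exists, Set.mem_ofPred_eq, hN,
        not_not] at hωB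
      exact hδc (X i ω) β₀ (βhat n ω) (g3 i) (hΘR _ hβ₀) (hΘR _ (hβhat n ω).1) (gamma0 Q)
        (γhat n ω) (fun j _ => gamma0_nonneg Q j _) (sum_gamma0 (g4 i)) hωB.1 (c n) (cpos n) h3
        (g1 hωE _ (hcmle n ω))
        (fun j hj => g2 ⟨j, Nat.lt_succ_iff.2 hj⟩ i (hωB.2 _) _ (hloc n ω j hj _))
        (S i ω) (hST i ω)
  obtain ⟨A, hA, hAb⟩ := exists_sum_sq_sum_abs_le (T := T) hK ℓ
  obtain ⟨Cb, hCb, hCbb⟩ := exists_abs_term_le (T := T) k R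
  -- On bad indices the estimated vector may be arbitrary, but its extremal moments still lie in
  -- [0,1]; the terms are then at most linear in the local polynomial estimates.
  have hcrude : ∀ n, ∀ᵐ ω ∂P, ∀ i < n,
      |lowerTerm k (X i ω) (S i ω) (βhat n ω) (cPlug (γhat n ω) (βhat n ω) 0 (X i ω))
          (mHat (c n) (γhat n ω) (βhat n ω) (X i ω))| ≤
        Cb * (1 + ∑ j ∈ Finset.range (T + 1), |γhat n ω j (X i ω)|) ∧
      |upperTerm k (X i ω) (S i ω) (βhat n ω) (cPlug (γhat n ω) (βhat n ω) 0 (X i ω))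
          (mHat (c n) (γhat n ω) (βhat n ω) (X i ω))| ≤
        Cb * (1 + ∑ j ∈ Finset.range (T + 1), |γhat n ω j (X i ω)|) := fun n => by
    filter_upwards [hXR] with ω hω i _
    exact hCbb (X i ω) (βhat n ω) (hω i) (hΘR _ (hβhat n ω).1) (γhat n ω) _
      (correct_zero T (c n) (mTilde_zero _ _ _)) (S i ω) (hST i ω)
  have hw : ∀ n ω, ∑ i ∈ Finset.range n,
      (∑ j ∈ Finset.range (T + 1), |γhat n ω j (X i ω)|) ^ 2 ≤ A * n := fun n ω =>
    hAb n (fun i => X i ω) (fun i => S i ω) (h n) (hpos n) (γhat n ω) (hγhat n ω)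
  have hLoS : ∀ i ω, Lo (X i ω, S i ω) = Lo ((Z i ω).1, σ (Z i ω).2) := fun i ω => by
    rw [hSD]
  have hUpS : ∀ i ω, Up (X i ω, S i ω) = Up ((Z i ω).1, σ (Z i ω).2) := fun i ω => by
    rw [hSD]
  rw [hlowE, hupE]
  refine tendstoInMeasure_prod_of_eventually (fun e he => ?_) fun e he => ?_
  · refine hZ.tendsto_average hLoμ (hBμ.mono fun z hz => hz.1) hCb hA
      (fun n => (hcrude n).mono fun ω hω i hi => (hω i hi).1) hw (fun e he => ?_) he
    obtain ⟨E, Bad, h1, h2, h3⟩ := hclose e he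
    refine ⟨E, Bad, h1, h2, h3.mono fun n hn => hn.mono fun ω hω hE i hi hBad => ?_⟩
    rw [← hLoS]
    exact (hω hE i hi hBad).1
  · refine hZ.tendsto_average hUpμ (hBμ.mono fun z hz => hz.2) hCb hA
      (fun n => (hcrude n).mono fun ω hω i hi => (hω i hi).2) hw (fun e he => ?_) he
    obtain ⟨E, Bad, h1, h2, h3⟩ := hclose e he
    refine ⟨E, Bad, h1, h2, h3.mono fun n hn => hn.mono fun ω hω hE i hi hBad => ?_⟩
    rw [← hUpS]
    exact (hω hE i hi hBad).2
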